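/- **Setting.** Let $j\in\{0,\dots,7\}$ and $1\le d\le 8$. For an index set $Y$ (the sites) let $\ell^2(Y)\otimes\mathbb C^n$ carry the entrywise complex conjugation; $\overline A$ and $A^t=(\overline A)^*$ denote the complex conjugate and the transpose of an operator. A fibre symmetry operator is a real unitary matrix $S$ with $S^2=\varepsilon\mathbf 1$, $\varepsilon=\pm1$. The class $j$ prescribes which of two commuting symmetry operators $S_{tr}$, $S_{ph}$ on $\mathbb C^N$ are present, and their signs $\varepsilon$: | $j$ | 0 | 1 | 2 | 3 | 4 | 5 | 6 | 7 | |---|---|---|---|---|---|---|---|---| | $S_{tr}^2$ | $+$ | $+$ | – | $-$ | $-$ | $-$ | – | $+$ | | $S_{ph}^2$ | – | $+$ | $+$ | $+$ | – | $-$ | $-$ | $-$ | A projection $P$ on $\ell^2(Y)\otimes\mathbb C^N$ has the symmetries of class $j$ if $S_{tr}^*\overline PS_{tr}=P$ and $S_{ph}^*\overline PS_{ph}=\mathbf 1-P$ for the symmetries that are present. For odd $j$ the chiral symmetry $R=S_{tr}S_{ph}$ is supposed to have two eigenspaces, for eigenvalues $\pm c$, of equal dimension, with orthonormal bases $V_\pm$.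 In the basis $(V_+,V_-)$ one has $2P-\mathbf 1=\binom{0\ \ U}{U^*\ 0}$, which defines a unitary $U$ on $\ell^2(Y)\otimes\mathbb C^{N/2}$. Let $d'=2^{\lfloor d/2\rfloor}$, let $\Gamma_1,\dots,\Gamma_d$ be the Clifford generators on $\mathbb C^{d'}=(\mathbb C^2)^{\otimes\lfloor d/2\rfloor}$ given by $\Gamma_{2i+1}=\sigma_3^{\otimes i}\otimes\sigma_1\otimes\mathbf 1$, $\Gamma_{2i+2}=\sigma_3^{\otimes i}\otimes\sigma_2\otimes\mathbf 1$ and, for odd $d$, $\Gamma_d=\sigma_3^{\otimes\lfloor d/2\rfloor}$, let $\Sigma=\imath^{\lfloor d/2\rfloor}\Gamma_2\Gamma_4\cdots\Gamma_{2\lfloor d/2\rfloor}$, $\Omega=(-\imath)^{\lfloor d/2\rfloor}\Gamma_1\cdots\Gamma_d$ and $\kappa=(-1)^{\lfloor d/2\rfloor}$. A projection $E$ on $\ell^2(Y)\otimes\mathbb C^{d'}$ has the symmetries of dimension $d$ if $\Sigma^*\overline E\Sigma=E$ (for $\kappa=1$), $\Sigma^*\overline E\Sigma=\mathbf 1-E$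 (for $\kappa=-1$) and, for even $d$, $\Omega^*E\Omega=\mathbf 1-E$. For even $d$ fix orthonormal bases $W_\pm$ of the eigenspaces of $\Omega$ for $\pm1$; in the basis $(W_+,W_-)$ one has $2E-\mathbf 1=\binom{0\ \ F}{F^*\ 0}$ with a unitary $F$. The operator of the index pairing of $P$ and $E$ is (tensor factors $\mathbf 1$ are suppressed) $$T=\begin{cases}PFP+\mathbf 1-P,& d\text{ even},\\ EUE+\mathbf 1-E,& d\text{ odd},\ j\text{ odd},\\ E(2P-\mathbf 1)E+\mathbf 1-E,& d\text{ odd},\ j\text{ even}.\end{cases}$$ Set $\mathrm{Ind}(T)=\dim\mathrm{Ker}\,T-\dim\mathrm{Ker}\,T^*$ and $\mathrm{Ind}_2(T)=\dim\mathrm{Ker}\,T\bmod 2$. A homotopy is a norm-continuous path of pairs $(P_t,E_t)$, $t\in[0,1]$, with the symmetries of class $j$ and of dimension $d$ and such that every $T_t$ is Fredholm. **Theorem.** Let $H=H^*$ be a bounded Hamiltonian on $\ell^2(\mathbb Z^d)\otimes\mathbb C^N$ of class $j$, that is $S_{tr}^*\overline HS_{tr}=H$ and $S_{ph}^*\overline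 HS_{ph}=-H$ for the symmetries that are present, with Fermi level $\mu\in\mathbb R$; if $S_{ph}$ is present, let $\mu=0$, and let $0$ not be an eigenvalue of $H$. Let $P=\chi(H\le\mu)$ be the Fermi projection, and let $E=\chi(D>0)+e_0\otimes\chi(\Gamma_1>0)$ be the Hardy projection of the Dirac operator $D=\sum_{i=1}^dX_i\otimes\Gamma_i$ on $\ell^2(\mathbb Z^d)\otimes\mathbb C^{d'}$, where $X_i$ are the position operators and $e_0$ is the projection onto the state at the origin. Suppose that $T$ is a Fredholm operator. Then $P$ has the symmetries of class $j$, $E$ has those of dimension $d$, and the entry $(j,d)$ of the table | | $d=1$ | $2$ | $3$ | $4$ | $5$ | $6$ | $7$ | $8$ | |---|---|---|---|---|---|---|---|---| | $j=0$ | | | | R-$2\mathbb Z$ | | R-$\mathbb Z_2$ | O-$\mathbb Z_2$ | $\mathbb Z$ | | $j=1$ | $\mathbb Z$ | | | | Q-$2\mathbb Z$ | | O-$\mathbb Z_2$ | O-$\mathbb Z_2$ | | $j=2$ | R-$\mathbb Z_2$ | $\mathbb Z$ | | | | O-$2\mathbb Z$ | | O-$\mathbb Z_2$ | | $j=3$ |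 R-$\mathbb Z_2$ | Q-$\mathbb Z_2$ | $\mathbb Z$ | | | | O-$2\mathbb Z$ | | | $j=4$ | | Q-$\mathbb Z_2$ | S-$\mathbb Z_2$ | $\mathbb Z$ | | | | Q-$2\mathbb Z$ | | $j=5$ | R-$2\mathbb Z$ | | S-$\mathbb Z_2$ | S-$\mathbb Z_2$ | $\mathbb Z$ | | | | | $j=6$ | | S-$2\mathbb Z$ | | S-$\mathbb Z_2$ | Q-$\mathbb Z_2$ | $\mathbb Z$ | | | | $j=7$ | | | S-$2\mathbb Z$ | | Q-$\mathbb Z_2$ | R-$\mathbb Z_2$ | $\mathbb Z$ | | gives the index theorem that holds for $T$: - $\mathbb Z$: $\mathrm{Ind}(T)\in\mathbb Z$ is constant along every homotopy that starts at $(P,E)$; - $2\mathbb Z$: moreover, $\mathrm{Ind}(T)$ is even; - $\mathbb Z_2$: $\mathrm{Ind}(T)=0$, and $\mathrm{Ind}_2(T)$ is constant along every homotopy that starts at $(P,E)$; - no entry: $\mathrm{Ind}(T)=0$ and, after finitely many sites have been added, with a pair $(P_0,E_0)$ over them whose operator $T_0$ is injective, there is a homotopy that starts at $(P\oplus P_0,E\oplus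 E_0)$ and ends at a pairing with $\mathrm{Ind}_2=0$. The letter is the symmetry relation of the projection that compresses in $T$, that is of $Q=P$ with respect to $S=S_{tr}$ or $S=S_{ph}$ for even $d$, and of $Q=E$ with respect to $S=\Sigma$ for odd $d$: R means $S^2=\mathbf 1$, $S^*\overline QS=Q$; Q means $S^2=-\mathbf 1$, $S^*\overline QS=Q$; O means $S^2=\mathbf 1$, $S^*\overline QS=\mathbf 1-Q$; S means $S^2=-\mathbf 1$, $S^*\overline QS=\mathbf 1-Q$. -/

import Mathlib

noncomputable section

namespace TopIns

open ContinuousLinearMap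

/-! ### The Hilbert spaces `ℓ²(ι)` with their complex conjugation -/

/-- The complex Hilbert space `ℓ²(ι)`. The space `ℓ²(Y) ⊗ ℂⁿ` is `ℓ²(Y × n)`. -/
abbrev L2 (ι : Type) : Type := lp (fun _ : ι => ℂ) 2

/-- Bounded operators on `ℓ²(ι)`. -/
abbrev BOp (ι : Type) : Type := L2 ι →L[ℂ] L2 ι

/-- The complex conjugate `Ā = 𝒞 A 𝒞`, where `𝒞` is the entrywise complex conjugation of `ℓ²(ι)`. -/
def conjOp {ι : Type} (A : BOp ι) : BOp ι :=
  (((starₗᵢ ℂ : L2 ι ≃ₗᵢ⋆[ℂ] L2 ι) : L2 ι →L⋆[ℂ] L2 ι).comp A).comp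
    ((starₗᵢ ℂ : L2 ι ≃ₗᵢ⋆[ℂ] L2 ι) : L2 ι →L⋆[ℂ] L2 ι)

theorem memlp_comp_embedding {ι κ : Type} (e : ι ↪ κ) (v : L2 κ) :
    Memℓp (fun i : ι => v (e i)) 2 := by
  have h := (lp.memℓp v).summable (by norm_num)
  exact memℓp_gen (h.comp_injective e.injective)

/-- Restriction `v ↦ v ∘ e` along an injection of index sets. -/
def restrictL {ι κ : Type} (e : ι ↪ κ) : L2 κ →L[ℂ] L2 ι :=
  LinearMap.mkContinuous
    { toFun := fun v => ⟨fun i => v (e i), memlp_comp_embedding e v⟩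
      map_add' := fun _ _ => rfl
      map_smul' := fun _ _ => rfl } 1 (by
    intro v
    rw [one_mul]
    have h2 : (0 : ℝ) < (2 : ENNReal).toReal := by norm_num
    refine lp.norm_le_of_tsum_le h2 (norm_nonneg _) ?_
    rw [lp.norm_rpow_eq_tsum h2]
    have hs := (lp.memℓp v).summable h2
    exact (hs.comp_injective e.injective).tsum_le_tsum_of_inj e e.injective
      (fun c _ => Real.rpow_nonneg (norm_nonneg _) _) (fun i => le_rfl) hs)

@[simp] theorem restrictL_apply {ι κ : Type} (e : ι ↪ κ) (v : L2 κ) (i : ι) :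
    restrictL e v i = v (e i) := rfl

/-- Extension by zero along an injection of index sets. -/
def extendL {ι κ : Type} (e : ι ↪ κ) : L2 ι →L[ℂ] L2 κ := adjoint (restrictL e)

/-- The fibre embedding `y ↦ (y, i)`. -/
def atFibre {Y n : Type} (i : n) : Y ↪ Y × n := ⟨fun y => (y, i), fun _ _ h => (Prod.ext_iff.1 h).1⟩

/-- The embedding `(y, i) ↦ ((y, a), i)`. -/
def atMid {Y n s : Type} (a : n) : Y × s ↪ (Y × n) × s :=
  ⟨fun p => ((p.1, a), p.2), fun p q h => by
    simp only [Prod.mk.injEq, and_true] at h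
    exact Prod.ext h.1 h.2⟩

/-- The operator `1 ⊗ M : ℓ²(Y) ⊗ ℂᵐ → ℓ²(Y) ⊗ ℂⁿ` of a matrix `M`. -/
def matOp {Y n m : Type} [Fintype n] [Fintype m] (M : Matrix n m ℂ) :
    L2 (Y × m) →L[ℂ] L2 (Y × n) :=
  ∑ i, ∑ k, M i k • (extendL (atFibre i) ∘L restrictL (atFibre k))

/-- `A ⊗ 1_s` on `ℓ²(Y) ⊗ ℂˢ`, for an operator `A` on `ℓ²(Y)`. -/
def amplRight {Y : Type} (s : Type) [Fintype s] (A : BOp Y) : BOp (Y × s) :=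
  ∑ i : s, extendL (atFibre i) ∘L A ∘L restrictL (atFibre i)

/-- `A ⊗ 1_n`, acting on `ℓ²(Y) ⊗ ℂⁿ ⊗ ℂˢ`, for an operator `A` on `ℓ²(Y) ⊗ ℂˢ`. -/
def amplMid {Y s : Type} (n : Type) [Fintype n] (A : BOp (Y × s)) : BOp ((Y × n) × s) :=
  ∑ a : n, extendL (atMid a) ∘L A ∘L restrictL (atMid a)

/-- The inclusion of fibres over `Y` into fibres over `Y ⊕ Y'`. -/
def inlSite {Y Y' n : Type} : Y × n ↪ (Y ⊕ Y') × n :=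
  ⟨fun p => (Sum.inl p.1, p.2), fun p q h => by
    simp only [Prod.mk.injEq, Sum.inl.injEq] at h
    exact Prod.ext h.1 h.2⟩

/-- The inclusion of fibres over `Y'` into fibres over `Y ⊕ Y'`. -/
def inrSite {Y Y' n : Type} : Y' × n ↪ (Y ⊕ Y') × n :=
  ⟨fun p => (Sum.inr p.1, p.2), fun p q h => by
    simp only [Prod.mk.injEq, Sum.inr.injEq] at h
    exact Prod.ext h.1 h.2⟩

/-- The direct sum `A ⊕ B` on `ℓ²(Y ⊕ Y') ⊗ ℂⁿ = (ℓ²(Y) ⊗ ℂⁿ) ⊕ (ℓ²(Y') ⊗ ℂⁿ)`. -/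
def dsumOp {Y Y' n : Type} (A : BOp (Y × n)) (B : BOp (Y' × n)) : BOp ((Y ⊕ Y') × n) :=
  extendL inlSite ∘L A ∘L restrictL inlSite + extendL inrSite ∘L B ∘L restrictL inrSite

/-! ### Symmetries -/

/-- A symmetry operator on the fibre: a real unitary `S` with `S² = ε 1`. -/
structure IsSymmetryOp {n : Type} [Fintype n] [DecidableEq n] (ε : ℤ) (S : Matrix n n ℂ) :
    Prop where
  real : S.map star = S
  unitary : S.conjTranspose * S = 1
  sq : S * S = (ε : ℂ) • (1 : Matrix n n ℂ)

/-- `S* Ā S`, for an operator `A` on `ℓ²(Y) ⊗ ℂⁿ` and a matrix `S` acting on the fibre. -/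
def twist {Y n : Type} [Fintype n] (S : Matrix n n ℂ) (A : BOp (Y × n)) : BOp (Y × n) :=
  adjoint (matOp S) ∘L conjOp A ∘L matOp S

/-- The sign `ε` of the time-reversal symmetry (`S_tr² = ε 1`) of class `j`, `0` if it is absent. -/
def trs : ℕ → ℤ
  | 0 => 1 | 1 => 1 | 2 => 0 | 3 => -1 | 4 => -1 | 5 => -1 | 6 => 0 | 7 => 1 | _ => 0

/-- The sign `ε` of the particle-hole symmetry (`S_ph² = ε 1`) of class `j`, `0` if it is
absent. -/
def phs : ℕ → ℤ
  | 0 => 0 | 1 => 1 | 2 => 1 | 3 => 1 | 4 => 0 | 5 => -1 | 6 => -1 | 7 => -1 | _ => 0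

/-- `S_tr` and `S_ph` are the symmetry operators of class `j`; they commute if both are present.
An absent symmetry puts no condition on the corresponding matrix. -/
structure IsFibreSymmetry {n : Type} [Fintype n] [DecidableEq n] (j : ℕ)
    (Str Sph : Matrix n n ℂ) : Prop where
  tr : trs j ≠ 0 → IsSymmetryOp (trs j) Str
  ph : phs j ≠ 0 → IsSymmetryOp (phs j) Sph
  comm : trs j ≠ 0 → phs j ≠ 0 → Str * Sph = Sph * Str

/-- `V₊` and `V₋` are orthonormal bases of the eigenspaces, of the same dimension, of the chiral
symmetry `R` for the eigenvalues `c` and `-c`: in the basis `(V₊, V₋)`, `R` is `c σ₃ ⊗ 1`. -/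
structure IsChiralFrame {n h : Type} [Fintype n] [DecidableEq n] [Fintype h] [DecidableEq h]
    (R : Matrix n n ℂ) (c : ℂ) (Vp Vm : Matrix n h ℂ) : Prop where
  isoP : Vp.conjTranspose * Vp = 1
  isoM : Vm.conjTranspose * Vm = 1
  complete : Vp * Vp.conjTranspose + Vm * Vm.conjTranspose = 1
  eigP : R * Vp = c • Vp
  eigM : R * Vm = -(c • Vm)

/-- The upper right entry of `2Q - 1` in the basis `(V₊, V₋)` of the fibre. If `Q` is a projection
and the chiral symmetry sends it to `1 - Q`, then `2Q - 1` is off-diagonal in that basis and this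
entry is a unitary. -/
def chiralBlock {Y n h : Type} [Fintype n] [Fintype h] (Vp Vm : Matrix n h ℂ)
    (Q : BOp (Y × n)) : BOp (Y × h) :=
  adjoint (matOp Vp) ∘L ((2 : ℂ) • Q - 1) ∘L matOp Vm

/-! ### Hamiltonians and Fermi projections -/

/-- The Fermi projection `χ(H ≤ μ)`: the orthogonal projection onto the kernel of the positive part
of `H - μ`. -/
def fermiProj {X : Type*} [NormedAddCommGroup X] [InnerProductSpace ℂ X] [CompleteSpace X]
    (H : X →L[ℂ] X) (μ : ℝ) : X →L[ℂ] X :=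
  ((H - (μ : ℂ) • (1 : X →L[ℂ] X))⁺).ker.starProjection

/-- `H` is a bounded Hamiltonian of class `j` with Fermi level `μ`. If there is a particle-hole
symmetry, the Fermi level is `0` and is not an eigenvalue of `H`. -/
structure IsHamiltonian {Y n : Type} [Fintype n] (j : ℕ) (Str Sph : Matrix n n ℂ)
    (H : BOp (Y × n)) (μ : ℝ) : Prop where
  selfAdjoint : IsSelfAdjoint H
  tr : trs j ≠ 0 → twist Str H = H
  ph : phs j ≠ 0 → twist Sph H = -H
  level : phs j ≠ 0 → μ = 0
  gap : phs j ≠ 0 → ∀ v, H v = 0 → v = 0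

/-- The projections on `ℓ²(Y) ⊗ ℂⁿ` with the symmetries of class `j`. -/
structure KClass {Y n : Type} [Fintype n] (j : ℕ) (Str Sph : Matrix n n ℂ) (P : BOp (Y × n)) :
    Prop where
  proj : IsStarProjection P
  tr : trs j ≠ 0 → twist Str P = P
  ph : phs j ≠ 0 → twist Sph P = 1 - P

/-! ### The Dirac operator -/

/-- The first Pauli matrix. -/
def pauli1 : Matrix (Fin 2) (Fin 2) ℂ := !![0, 1; 1, 0]

/-- The second Pauli matrix. -/
def pauli2 : Matrix (Fin 2) (Fin 2) ℂ := !![0, -Complex.I; Complex.I, 0]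

/-- The third Pauli matrix. -/
def pauli3 : Matrix (Fin 2) (Fin 2) ℂ := !![1, 0; 0, -1]

/-- The index set of the spinors `ℂ^{d'} = (ℂ²)^{⊗ ⌊d/2⌋}`. -/
abbrev Spin (d : ℕ) : Type := Fin (d / 2) → Fin 2

/-- The tensor product `a₀ ⊗ a₁ ⊗ ⋯` of `2 × 2` matrices. -/
def tensorMat {k : ℕ} (a : Fin k → Matrix (Fin 2) (Fin 2) ℂ) :
    Matrix (Fin k → Fin 2) (Fin k → Fin 2) ℂ :=
  Matrix.of fun x y => ∏ i, a i (x i) (y i)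

/-- The Clifford generators, counted from `0`: `gam d (2i)` is `σ₃^{⊗ i} ⊗ σ₁ ⊗ 1 ⊗ ⋯ ⊗ 1` and
`gam d (2i+1)` is `σ₃^{⊗ i} ⊗ σ₂ ⊗ 1 ⊗ ⋯ ⊗ 1`; for odd `d`, `gam d (d-1)` is `σ₃ ⊗ ⋯ ⊗ σ₃`. -/
def gam (d n : ℕ) : Matrix (Spin d) (Spin d) ℂ :=
  tensorMat fun i : Fin (d / 2) =>
    if i.1 < n / 2 then pauli3
    else if i.1 = n / 2 then (if Even n then pauli1 else pauli2) else 1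

/-- The symmetry `Σ = i^{⌊d/2⌋} Γ₂ Γ₄ ⋯`. -/
def diracSigma (d : ℕ) : Matrix (Spin d) (Spin d) ℂ :=
  Complex.I ^ (d / 2) • (List.ofFn fun i : Fin (d / 2) => gam d (2 * i.1 + 1)).prod

/-- The chiral symmetry `Ω = (-i)^{⌊d/2⌋} Γ₁ Γ₂ ⋯ Γ_d` (used for even `d`). -/
def diracOmega (d : ℕ) : Matrix (Spin d) (Spin d) ℂ :=
  (-Complex.I) ^ (d / 2) • (List.ofFn fun i : Fin d => gam d i.1).prod

/-- The Dirac operator `D = ∑ X_j ⊗ Γ_j` acts over the site `x` as the matrix `∑ x_j Γ_j`. -/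
def diracAt (d : ℕ) (x : Fin d → ℤ) : Matrix (Spin d) (Spin d) ℂ :=
  ∑ i : Fin d, (x i : ℂ) • gam d i.1

/-- The span of the eigenvectors of a matrix for its positive eigenvalues. -/
def posSpace {s : Type} [Fintype s] [DecidableEq s] (M : Matrix s s ℂ) : Submodule ℂ (s → ℂ) :=
  ⨆ r : {r : ℝ // 0 < r}, Module.End.eigenspace (Matrix.toLin' M) ((r.1 : ℝ) : ℂ)

/-- The component over the site `y` of a vector in `ℓ²(Y) ⊗ ℂˢ`. -/
def fibreAt {Y s : Type} (y : Y) : L2 (Y × s) →ₗ[ℂ] (s → ℂ) where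
  toFun v := fun i => v (y, i)
  map_add' _ _ := rfl
  map_smul' _ _ := rfl

/-- The range of the Hardy projection: the vectors whose component over each site `x ≠ 0` lies in
the positive spectral subspace of the Dirac operator, and whose component over the origin lies in
the positive spectral subspace of `Γ₁`. -/
def hardySpace (d : ℕ) : Submodule ℂ (L2 ((Fin d → ℤ) × Spin d)) :=
  ⨅ x : Fin d → ℤ, (posSpace (if x = 0 then gam d 0 else diracAt d x)).comap (fibreAt x)

theorem isClosed_hardySpace (d : ℕ) :
    IsClosed (hardySpace d : Set (L2 ((Fin d → ℤ) × Spin d))) := by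
  have h : (hardySpace d : Set (L2 ((Fin d → ℤ) × Spin d))) =
      ⋂ x : Fin d → ℤ, (fibreAt x : L2 ((Fin d → ℤ) × Spin d) → (Spin d → ℂ)) ⁻¹'
        (posSpace (if x = 0 then gam d 0 else diracAt d x) : Set (Spin d → ℂ)) := by
    ext v
    simp [hardySpace]
  rw [h]
  refine isClosed_iInter fun x => IsClosed.preimage ?_ (Submodule.closed_of_finiteDimensional _)
  refine continuous_pi fun i => ?_
  exact (lp.evalCLM ℂ (fun _ : (Fin d → ℤ) × Spin d => ℂ) 2 (x, i)).continuous

instance (d : ℕ) : CompleteSpace (hardySpace d) := (isClosed_hardySpace d).completeSpace_coe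

/-- The Hardy projection `E = χ(D > 0) + e₀ ⊗ χ(Γ₁ > 0)` on `ℓ²(ℤᵈ) ⊗ ℂ^{d'}`. -/
def hardyProj (d : ℕ) : BOp ((Fin d → ℤ) × Spin d) := (hardySpace d).starProjection

/-- The sign `κ = (-1)^{⌊d/2⌋}`. -/
def kappa (d : ℕ) : ℤ := (-1) ^ (d / 2)

/-- The projections on `ℓ²(Y) ⊗ ℂ^{d'}` with the symmetries of the Hardy projection in
dimension `d`. -/
structure KHClass {Y : Type} (d : ℕ) (E : BOp (Y × Spin d)) : Prop where
  proj : IsStarProjection E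
  sigma_pos : kappa d = 1 → twist (diracSigma d) E = E
  sigma_neg : kappa d = -1 → twist (diracSigma d) E = 1 - E
  omega : Even d → adjoint (matOp (diracOmega d)) ∘L E ∘L matOp (diracOmega d) = 1 - E

/-! ### Index pairings -/

/-- `Q G Q + 1 - Q`. -/
def compress {ι : Type} (Q G : BOp ι) : BOp ι := Q ∘L G ∘L Q + 1 - Q

/-- The operator `T` of the index pairing, together with the index set of the space `ℓ²` on which
it acts: `P F P + 1 - P` for even `d`, where `F` is the off-diagonal entry of `2E - 1` in the basis
`(W₊, W₋)`; `E U E + 1 - E` for odd `d` and odd `j`, where `U` is the off-diagonal entry of `2P - 1`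
in the basis `(V₊, V₋)`; and `E (2P - 1) E + 1 - E` for odd `d` and even `j`. -/
def pairingOp {Y n h s m : Type} [Fintype n] [Fintype h] [Fintype s] [Fintype m] (j d : ℕ)
    (Vp Vm : Matrix n h ℂ) (Wp Wm : Matrix s m ℂ) (P : BOp (Y × n)) (E : BOp (Y × s)) :
    Σ ι : Type, BOp ι :=
  if Even d then
    ⟨(Y × n) × m, compress (amplRight m P) (amplMid n (chiralBlock Wp Wm E))⟩
  else if Odd j then
    ⟨(Y × h) × s, compress (amplMid h E) (amplRight s (chiralBlock Vp Vm P))⟩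
  else
    ⟨(Y × n) × s, compress (amplMid n E) (amplRight s ((2 : ℂ) • P - 1))⟩

/-- The dimension of the kernel. -/
def nullity (T : Σ ι : Type, BOp ι) : ℕ := Module.finrank ℂ T.2.ker

/-- The Noether index `dim Ker T - dim Ker T*`. -/
def ind (T : Σ ι : Type, BOp ι) : ℤ :=
  (Module.finrank ℂ T.2.ker : ℤ) -
    (Module.finrank ℂ (adjoint T.2).ker : ℤ)

/-- The secondary index `dim Ker T mod 2`. -/
def ind2 (T : Σ ι : Type, BOp ι) : ZMod 2 := (nullity T : ZMod 2)

/-- A norm-continuous homotopy of pairs of projections with the symmetries of class `j` and of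
dimension `d`, along which the operator `T` of the index pairing is a Fredholm operator. -/
structure IsHomotopy {Y n h m : Type} [Fintype n] [Fintype h] [Fintype m] (j d : ℕ)
    (Str Sph : Matrix n n ℂ) (Vp Vm : Matrix n h ℂ) (Wp Wm : Matrix (Spin d) m ℂ)
    (P : unitInterval → BOp (Y × n)) (E : unitInterval → BOp (Y × Spin d)) : Prop where
  contP : Continuous P
  contE : Continuous E
  symP : ∀ t, KClass j Str Sph (P t)
  symE : ∀ t, KHClass d (E t)
  fredholm : ∀ t, (pairingOp j d Vp Vm Wp Wm (P t) (E t)).2.IsFredholm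

/-! ### The periodic table -/

/-- The types `R`, `Q`, `S`, `O` of index theorems. -/
inductive Letter
  | R
  | Q
  | S
  | O

/-- The entries of the periodic table. -/
inductive Entry
  | zero
  | int
  | even (l : Letter)
  | two (l : Letter)

/-- The periodic table, with rows `j = 0, …, 7` and columns `d = 1, …, 8`. -/
def periodicTable : ℕ → ℕ → Entry
  | 0, 4 => .even .R
  | 0, 6 => .two .R
  | 0, 7 => .two .O
  | 0, 8 => .int
  | 1, 1 => .int
  | 1, 5 => .even .Q
  | 1, 7 => .two .O
  | 1, 8 => .two .O
  | 2, 1 => .two .R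
  | 2, 2 => .int
  | 2, 6 => .even .O
  | 2, 8 => .two .O
  | 3, 1 => .two .R
  | 3, 2 => .two .Q
  | 3, 3 => .int
  | 3, 7 => .even .O
  | 4, 2 => .two .Q
  | 4, 3 => .two .S
  | 4, 4 => .int
  | 4, 8 => .even .Q
  | 5, 1 => .even .R
  | 5, 3 => .two .S
  | 5, 4 => .two .S
  | 5, 5 => .int
  | 6, 2 => .even .S
  | 6, 4 => .two .S
  | 6, 5 => .two .Q
  | 6, 6 => .int
  | 7, 3 => .even .S
  | 7, 5 => .two .Q
  | 7, 6 => .two .R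
  | 7, 7 => .int
  | _, _ => .zero

/-- The symmetry relation of a projection `Q` with respect to a symmetry operator `S`: `R` even
real, `Q` odd real, `O` even Lagrangian, `S` odd Lagrangian. -/
def Letter.Holds {Y n : Type} [Fintype n] [DecidableEq n] (S : Matrix n n ℂ) (Q : BOp (Y × n)) :
    Letter → Prop
  | .R => IsSymmetryOp 1 S ∧ twist S Q = Q
  | .Q => IsSymmetryOp (-1) S ∧ twist S Q = Q
  | .O => IsSymmetryOp 1 S ∧ twist S Q = 1 - Q
  | .S => IsSymmetryOp (-1) S ∧ twist S Q = 1 - Q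

/-- An index theorem is of type `l` if `l` is the symmetry relation of the projection that
compresses in the index pairing: `P`, with respect to one of its symmetries, for even `d`, and `E`
for odd `d`. -/
def HasLetter {Y n : Type} [Fintype n] [DecidableEq n] (j d : ℕ) (Str Sph : Matrix n n ℂ)
    (P : BOp (Y × n)) (E : BOp (Y × Spin d)) (l : Letter) : Prop :=
  if Even d then
    (trs j ≠ 0 ∧ l.Holds Str P) ∨ (phs j ≠ 0 ∧ l.Holds Sph P)
  else
    l.Holds (diracSigma d) E

/-- The index theorem that an entry of the table asserts of the pairing of `P` and `E` over the
sites `Y`.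
* `ℤ`: the index is constant along homotopies.
* `2ℤ`: moreover, it is even.
* `ℤ₂`: the index vanishes, and `dim Ker T mod 2` is constant along homotopies.
* `0`: the index vanishes and, after adding finitely many sites, with a pairing over them for which
  `T` is injective, there is a homotopy to a pairing for which `dim Ker T mod 2` vanishes. -/
def IndexTheorem {Y n h m : Type} [Fintype n] [DecidableEq n] [Fintype h] [Fintype m] (j d : ℕ)
    (Str Sph : Matrix n n ℂ) (Vp Vm : Matrix n h ℂ) (Wp Wm : Matrix (Spin d) m ℂ)
    (P : BOp (Y × n)) (E : BOp (Y × Spin d)) : Entry → Prop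
  | .int =>
      ∀ (P' : unitInterval → BOp (Y × n)) (E' : unitInterval → BOp (Y × Spin d)),
        IsHomotopy j d Str Sph Vp Vm Wp Wm P' E' → P' 0 = P → E' 0 = E → ∀ t,
          ind (pairingOp j d Vp Vm Wp Wm (P' t) (E' t)) = ind (pairingOp j d Vp Vm Wp Wm P E)
  | .even l =>
      HasLetter j d Str Sph P E l ∧ Even (ind (pairingOp j d Vp Vm Wp Wm P E)) ∧
      ∀ (P' : unitInterval → BOp (Y × n)) (E' : unitInterval → BOp (Y × Spin d)),
        IsHomotopy j d Str Sph Vp Vm Wp Wm P' E' → P' 0 = P → E' 0 = E → ∀ t,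
          ind (pairingOp j d Vp Vm Wp Wm (P' t) (E' t)) = ind (pairingOp j d Vp Vm Wp Wm P E)
  | .two l =>
      HasLetter j d Str Sph P E l ∧ ind (pairingOp j d Vp Vm Wp Wm P E) = 0 ∧
      ∀ (P' : unitInterval → BOp (Y × n)) (E' : unitInterval → BOp (Y × Spin d)),
        IsHomotopy j d Str Sph Vp Vm Wp Wm P' E' → P' 0 = P → E' 0 = E → ∀ t,
          ind2 (pairingOp j d Vp Vm Wp Wm (P' t) (E' t)) = ind2 (pairingOp j d Vp Vm Wp Wm P E)
  | .zero =>
      ind (pairingOp j d Vp Vm Wp Wm P E) = 0 ∧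
      ∃ (k : ℕ) (P₀ : BOp (Fin k × n)) (E₀ : BOp (Fin k × Spin d))
        (P' : unitInterval → BOp ((Y ⊕ Fin k) × n))
        (E' : unitInterval → BOp ((Y ⊕ Fin k) × Spin d)),
        nullity (pairingOp j d Vp Vm Wp Wm P₀ E₀) = 0 ∧
        IsHomotopy j d Str Sph Vp Vm Wp Wm P' E' ∧
        P' 0 = dsumOp P P₀ ∧ E' 0 = dsumOp E E₀ ∧
        ind2 (pairingOp j d Vp Vm Wp Wm (P' 1) (E' 1)) = 0

end TopIns

end

/-! Each pairing operator is a compression $T=qFq+1-q$. It lifts to a space that carries a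
projection $Q$ and a reflection $G$: $Q=P\otimes 1$, $G=2E-1$ for even $d$, and $Q=E$, $G=2P-1$ for
odd $d$. The eigenspaces of $\Omega$ (even $d$) or of the chiral symmetry (odd $d$, odd $j$) give a
grading $M\oplus M'$ that $Q$ preserves and $G$ reverses; for odd $d$ and even $j$ there is no
grading and $M=M'$ is everything. Then $\mathrm{Ker}\,T$ is $\{v\in M: Qv=v,\ QGv=0\}$,
$\mathrm{Ker}\,T^*$ is the same with $M'$, and the eigenspaces of $T^*T$ for eigenvalues below $1$
are those of $QGQG$ on $M\cap\mathrm{Ran}\,Q$ (`FramePair.finrank_ker`, `FramePair.singMult_eq`).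

A symmetry $S$ of $P$ and the symmetry $\Sigma$ of $E$ combine to the antilinear operator
$C=(S\otimes\Sigma)\mathcal C$. Only four signs matter: $C^2=\varepsilon$, $CG=\delta GC$, whether
$C$ sends $Q$ to itself or to $1-Q$, and whether it preserves or swaps the grading. A space with an
antilinear map of negative square has even dimension (`even_finrank_of_antilin`). So $C$ or $CG$,
when it acts on $\mathrm{Ker}\,T$ with square $-1$, makes the kernel even; when it maps
$\mathrm{Ker}\,T$ to $\mathrm{Ker}\,T^*$ and back, the index vanishes; and $CQG$ or $QGQGC$, acting
on an eigenspace of $QGQG$ with negative square, makes the multiplicity of an eigenvalue in $(0,1)$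
even.

Stability comes from `index_parity_locally`. Near a Fredholm operator $T_0$ the spectral subspace of
$T^*T$ for a small interval $[0,e^2]$ has dimension $\dim\mathrm{Ker}\,T_0$, and it consists of
$\mathrm{Ker}\,T$ and eigenspaces for small positive eigenvalues. Those eigenvalues have the same
multiplicities for $TT^*$, so the index is locally constant; if the multiplicities are even, so is
the parity of the nullity. With this, the nonzero entries of the table reduce to a finite check of
signs (`entrySigns_periodicTable`).

For the entries without index theorem the index vanishes by the same signs. Either the kernel is
always even, and nothing has to be moved, or the parity has to be changed by a homotopy. Since
nullities add under direct sums, it suffices to find, over finitely many sites, a path of pairs from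
an injective pairing to one with odd kernel (`zero_of_hasFlip`). There $P$ and $E$ become
reflections $A$ and $B$, and the kernel of $AB+BA$ has four times the dimension of
$\mathrm{Ker}\,T$, or twice if there is no grading. Explicit paths exist on two-dimensional model
fibres (`flips_real_swap`, `flips_real_real`, `flips_symplectic`). They are transplanted to
arbitrary fibres in two moves: both fibres are doubled so that they contain the model as an
invariant subspace, off which the anticommutator is invertible (`Flips.of_inflation`), and the
doubling is then absorbed into the sites (`Flips.of_double`).

The symmetries of the Fermi projection follow from the uniqueness of positive and negative parts,
those of the Hardy projection from Clifford relations in each fibre. -/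

noncomputable section

namespace TopIns

open ContinuousLinearMap

/-! ### Low-lying spectrum of $T^*T$ and local stability of index and parity -/

section Spectral

variable {E : Type*} [NormedAddCommGroup E] [InnerProductSpace ℂ E] [CompleteSpace E]

/-- The operator `T* T - c`. -/
def absSqSub (T : E →L[ℂ] E) (c : ℝ) : E →L[ℂ] E :=
  adjoint T ∘L T - (c : ℂ) • (1 : E →L[ℂ] E)

theorem isSelfAdjoint_adjoint_comp (T : E →L[ℂ] E) : IsSelfAdjoint (adjoint T ∘L T) := by
  rw [← star_eq_adjoint]
  exact IsSelfAdjoint.star_mul_self T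

theorem isSelfAdjoint_sub_real {A : E →L[ℂ] E} (hA : IsSelfAdjoint A) (c : ℝ) :
    IsSelfAdjoint (A - (c : ℂ) • (1 : E →L[ℂ] E)) := by
  refine hA.sub ?_
  refine IsSelfAdjoint.smul ?_ (.one _)
  simp [isSelfAdjoint_iff]

theorem isSelfAdjoint_absSqSub (T : E →L[ℂ] E) (c : ℝ) : IsSelfAdjoint (absSqSub T c) :=
  isSelfAdjoint_sub_real (isSelfAdjoint_adjoint_comp T) c

/-- The spectral subspace of `T* T` for the interval `[0, c]`. -/
def lowSpace (T : E →L[ℂ] E) (c : ℝ) : Submodule ℂ E := ((absSqSub T c)⁺).ker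

theorem posPart_inner_nonneg (A : E →L[ℂ] E) (v : E) : 0 ≤ (inner ℂ (A⁺ v) v).re := by
  have h := (nonneg_iff_isPositive (A⁺)).1 (CFC.posPart_nonneg A)
  exact h.re_inner_nonneg_left v

theorem negPart_inner_nonneg (A : E →L[ℂ] E) (v : E) : 0 ≤ (inner ℂ (A⁻ v) v).re := by
  have h := (nonneg_iff_isPositive (A⁻)).1 (CFC.negPart_nonneg A)
  exact h.re_inner_nonneg_left v

theorem posPart_isSelfAdjoint (A : E →L[ℂ] E) : IsSelfAdjoint (A⁺) :=
  (CFC.posPart_nonneg A).isSelfAdjoint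

theorem posPart_negPart_apply (A : E →L[ℂ] E) (v : E) : A⁺ (A⁻ v) = 0 := by
  have := CFC.posPart_mul_negPart A
  exact congrArg (fun B : E →L[ℂ] E => B v) this

theorem posPart_sub_negPart_apply {A : E →L[ℂ] E} (hA : IsSelfAdjoint A) (v : E) :
    A⁺ v - A⁻ v = A v := by
  have := CFC.posPart_sub_negPart A
  exact congrArg (fun B : E →L[ℂ] E => B v) this

/-- The orthogonal complement of the kernel of `A⁺` is annihilated by `A⁻`. -/
theorem negPart_eq_zero_of_mem_orthogonal {A : E →L[ℂ] E} {v : E}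
    (hv : v ∈ ((A⁺).ker)ᗮ) : A⁻ v = 0 := by
  have h1 : A⁻ v ∈ (A⁺).ker := by
    simpa using posPart_negPart_apply A v
  have hsa : IsSelfAdjoint (A⁻) := (CFC.negPart_nonneg A).isSelfAdjoint
  have h2 : A⁻ (A⁻ v) ∈ (A⁺).ker := by
    simpa using posPart_negPart_apply A (A⁻ v)
  have h3 : inner ℂ (A⁻ (A⁻ v)) v = 0 := (Submodule.mem_orthogonal _ _).1 hv _ h2
  rw [hsa.isSymmetric.apply_clm] at h3
  exact inner_self_eq_zero.1 h3

theorem inner_absSqSub (T : E →L[ℂ] E) (c : ℝ) (v : E) :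
    (inner ℂ (absSqSub T c v) v).re = ‖T v‖ ^ 2 - c * ‖v‖ ^ 2 := by
  simp only [absSqSub, sub_apply, comp_apply, smul_apply, inner_sub_left,
    adjoint_inner_left, inner_smul_left, inner_self_eq_norm_sq_to_K]
  simp
  norm_cast

/-- On the kernel of $A^+$ the operator $A=T^*T-c$ acts as $-A^-\le 0$. -/
theorem norm_sq_le_of_mem_lowSpace {T : E →L[ℂ] E} {c : ℝ} {v : E} (hv : v ∈ lowSpace T c) :
    ‖T v‖ ^ 2 ≤ c * ‖v‖ ^ 2 := by
  have h := posPart_sub_negPart_apply (isSelfAdjoint_absSqSub T c) v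
  have h0 : (absSqSub T c)⁺ v = 0 := by simpa [lowSpace] using hv
  have h1 := negPart_inner_nonneg (absSqSub T c) v
  have h2 := inner_absSqSub T c v
  rw [← h, h0, zero_sub, inner_neg_left, Complex.neg_re] at h2
  linarith

/-- The complement of $\mathrm{Ker}\,A^+$ is annihilated by $A^-$, so $A=T^*T-c$ acts there as
$A^+\ge 0$. -/
theorem le_norm_sq_of_mem_orthogonal {T : E →L[ℂ] E} {c : ℝ} {v : E}
    (hv : v ∈ (lowSpace T c)ᗮ) : c * ‖v‖ ^ 2 ≤ ‖T v‖ ^ 2 := by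
  have h := posPart_sub_negPart_apply (isSelfAdjoint_absSqSub T c) v
  have h0 : (absSqSub T c)⁻ v = 0 := negPart_eq_zero_of_mem_orthogonal hv
  have h1 := posPart_inner_nonneg (absSqSub T c) v
  have h2 := inner_absSqSub T c v
  rw [← h, h0, sub_zero] at h2
  linarith

theorem isClosed_lowSpace (T : E →L[ℂ] E) (c : ℝ) : IsClosed (lowSpace T c : Set E) :=
  ContinuousLinearMap.isClosed_ker _

instance (T : E →L[ℂ] E) (c : ℝ) : CompleteSpace (lowSpace T c) :=
  (isClosed_lowSpace T c).completeSpace_coe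

omit [CompleteSpace E] in
/-- Two subspaces with `V ⊓ Kᗮ = 0`, `K` finite-dimensional: `dim V ≤ dim K`. -/
theorem finite_finrank_le_of_disjoint (V K : Submodule ℂ E) [FiniteDimensional ℂ K]
    (h : ∀ v ∈ V, v ∈ Kᗮ → v = 0) :
    FiniteDimensional ℂ V ∧ Module.finrank ℂ V ≤ Module.finrank ℂ K := by
  let f : V →ₗ[ℂ] K := (K.orthogonalProjectionOnto : E →ₗ[ℂ] K) ∘ₗ V.subtype
  have hf : Function.Injective f := by
    rw [← LinearMap.ker_eq_bot, LinearMap.ker_eq_bot']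
    intro v hv
    have h1 : (v : E) ∈ Kᗮ := by
      rw [← Submodule.ker_orthogonalProjectionOnto]
      exact hv
    exact Subtype.ext (h v v.2 h1)
  exact ⟨FiniteDimensional.of_injective f hf, LinearMap.finrank_le_finrank_of_injective hf⟩

omit [CompleteSpace E] in
theorem finrank_le_of_disjoint_complete (K V : Submodule ℂ E)
    [FiniteDimensional ℂ V]
    (h : ∀ v ∈ K, v ∈ Vᗮ → v = 0) :
    Module.finrank ℂ K ≤ Module.finrank ℂ V :=
  (finite_finrank_le_of_disjoint K V h).2

/-- A bounded operator with closed range is bounded below on the complement of its kernel. -/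
theorem exists_lower_bound {T : E →L[ℂ] E} (hT : IsClosed (T.range : Set E)) :
    ∃ g : ℝ, 0 < g ∧ ∀ v ∈ (T.ker)ᗮ, g * ‖v‖ ≤ ‖T v‖ := by
  have : CompleteSpace T.ker := T.isClosed_ker.completeSpace_coe
  -- Restricted to the complement of its kernel, $T$ is injective with the same closed range, so the
  -- open mapping theorem bounds it below.
  let f : (T.ker)ᗮ →L[ℂ] E := T ∘L (T.ker)ᗮ.subtypeL
  have hinj : Function.Injective f := by
    rw [← LinearMap.coe_coe, ← LinearMap.ker_eq_bot, LinearMap.ker_eq_bot']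
    intro v hv
    have h1 : (v : E) ∈ T.ker := by simpa [f] using hv
    have := (Submodule.mem_orthogonal _ _).1 v.2 v h1
    exact Subtype.ext (inner_self_eq_zero.1 this)
  have hr : Set.range f = (T.range : Set E) := by
    ext y
    constructor
    · rintro ⟨v, rfl⟩
      exact ⟨v, rfl⟩
    · rintro ⟨v, rfl⟩
      refine ⟨⟨v - T.ker.starProjection v, ?_⟩, ?_⟩
      · exact Submodule.sub_starProjection_mem_orthogonal v
      · have h2 : T (T.ker.starProjection v) = 0 := Submodule.starProjection_apply_mem T.ker v
        simp [f, h2]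
  obtain ⟨K, hK⟩ := antilipschitz_of_injective_of_isClosed_range f hinj (by rw [hr]; exact hT)
  -- The antilipschitz constant `K` may be zero; the shift by one keeps the quotient meaningful.
  refine ⟨1 / (K + 1), by positivity, fun v hv => ?_⟩
  have h3 := hK.le_mul_dist ⟨v, hv⟩ 0
  simp only [dist_zero_right, map_zero] at h3
  have h4 : ‖v‖ ≤ K * ‖T v‖ := h3
  have h5 : (0 : ℝ) < K + 1 := by positivity
  rw [div_mul_eq_mul_div, one_mul, div_le_iff₀ h5]
  nlinarith [norm_nonneg (T v)]

theorem orthogonal_ker_adjoint {T : E →L[ℂ] E} (hT : IsClosed (T.range : Set E)) :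
    ((adjoint T).ker)ᗮ = T.range := by
  rw [← T.orthogonal_range]
  have : CompleteSpace T.range := hT.completeSpace_coe
  exact Submodule.orthogonal_orthogonal _

/-- The bound for $T$ also serves the adjoint: vectors orthogonal to $\mathrm{Ker}\,T^*$ are of the
form $Tu$ with $u\perp\mathrm{Ker}\,T$, and $\|Tu\|^2=\langle u,T^*Tu\rangle\le
g^{-1}\|Tu\|\,\|T^*Tu\|$. -/
theorem exists_lower_bound_adjoint {T : E →L[ℂ] E} (hT : IsClosed (T.range : Set E)) :
    ∃ g : ℝ, 0 < g ∧ ∀ v ∈ ((adjoint T).ker)ᗮ, g * ‖v‖ ≤ ‖adjoint T v‖ := by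
  obtain ⟨g, hg, h⟩ := exists_lower_bound hT
  have : CompleteSpace T.ker := T.isClosed_ker.completeSpace_coe
  refine ⟨g, hg, fun v hv => ?_⟩
  rw [orthogonal_ker_adjoint hT] at hv
  obtain ⟨u₀, rfl⟩ := hv
  set u := u₀ - T.ker.starProjection u₀ with hu
  have hu1 : u ∈ (T.ker)ᗮ := Submodule.sub_starProjection_mem_orthogonal u₀
  have h2 : T (T.ker.starProjection u₀) = 0 := Submodule.starProjection_apply_mem T.ker u₀
  have h3 : T u = T u₀ := by rw [hu, map_sub, h2, sub_zero]
  change g * ‖T u₀‖ ≤ ‖adjoint T (T u₀)‖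
  rw [← h3]
  have h4 := h u hu1
  have h5 : ‖T u‖ ^ 2 ≤ ‖u‖ * ‖adjoint T (T u)‖ := by
    have : inner ℂ u (adjoint T (T u)) = inner ℂ (T u) (T u) := by rw [adjoint_inner_right]
    have h6 := norm_inner_le_norm (𝕜 := ℂ) u (adjoint T (T u))
    rw [this, inner_self_eq_norm_sq_to_K] at h6
    simpa using h6
  rcases (norm_nonneg (T u)).eq_or_lt with h0 | h0
  · rw [← h0]; simp
  · have h7 : g * ‖T u‖ * ‖T u‖ ≤ ‖adjoint T (T u)‖ * ‖T u‖ := by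
      have h8 : g * ‖u‖ * ‖adjoint T (T u)‖ ≤ ‖T u‖ * ‖adjoint T (T u)‖ :=
        mul_le_mul_of_nonneg_right h4 (norm_nonneg _)
      nlinarith
    exact le_of_mul_le_mul_right h7 h0

theorem finiteDimensional_ker_adjoint {T : E →L[ℂ] E} (hT : T.IsFredholm) :
    FiniteDimensional ℂ (adjoint T).ker := by
  rw [← T.orthogonal_range]
  have : CompleteSpace T.range := hT.isClosed_range.completeSpace_coe
  have : FiniteDimensional ℂ (E ⧸ T.range) := by
    have := hT.finite_coker
    exact this
  exact ((T.range.quotientEquivOfIsCompl _ (Submodule.isCompl_orthogonal _)).finiteDimensional)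

/-- With $A=T^*T-c$ one has $\|A^+v\|^2=(l-c)\langle A^+v,v\rangle\le 0$. -/
theorem mem_lowSpace_of_eigen {T : E →L[ℂ] E} {c l : ℝ} (hl : l ≤ c) {v : E}
    (hv : adjoint T (T v) = (l : ℂ) • v) : v ∈ lowSpace T c := by
  set A := absSqSub T c with hA
  have h1 : A v = ((l - c : ℝ) : ℂ) • v := by
    simp only [hA, absSqSub, sub_apply, comp_apply, smul_apply, hv]
    push_cast
    rw [sub_smul]
    rfl
  have h2 : A⁺ (A⁺ v) = A⁺ (A v) := by
    rw [← posPart_sub_negPart_apply (isSelfAdjoint_absSqSub T c) v, map_sub,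
      posPart_negPart_apply, sub_zero]
  have h3 : ‖A⁺ v‖ ^ 2 = (l - c) * (inner ℂ (A⁺ v) v).re := by
    have h4 : inner ℂ (A⁺ v) (A⁺ v) = inner ℂ (A⁺ (A⁺ v)) v :=
      ((posPart_isSelfAdjoint A).isSymmetric.apply_clm _ _).symm
    rw [h2, h1, map_smul, inner_smul_left, inner_self_eq_norm_sq_to_K] at h4
    have h5 := congrArg Complex.re h4
    rw [Complex.conj_ofReal, Complex.re_ofReal_mul] at h5
    rw [← h5]
    norm_cast
  have h6 := posPart_inner_nonneg A v
  have h7 : ‖A⁺ v‖ ^ 2 ≤ 0 := by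
    rw [h3]
    exact mul_nonpos_of_nonpos_of_nonneg (by linarith) h6
  have h8 : ‖A⁺ v‖ = 0 := by nlinarith [norm_nonneg (A⁺ v)]
  exact norm_eq_zero.1 h8

theorem mapsTo_lowSpace (T : E →L[ℂ] E) (c : ℝ) {v : E} (hv : v ∈ lowSpace T c) :
    adjoint T (T v) ∈ lowSpace T c := by
  set A := absSqSub T c with hA
  have h0 : A⁺ v = 0 := hv
  have h1 : A v = adjoint T (T v) - (c : ℂ) • v := rfl
  have h2 : adjoint T (T v) = A v + (c : ℂ) • v := by rw [h1]; abel
  change A⁺ (adjoint T (T v)) = 0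
  rw [h2, map_add, map_smul, h0, smul_zero, add_zero,
    ← posPart_sub_negPart_apply (isSelfAdjoint_absSqSub T c) v, map_sub,
      posPart_negPart_apply, sub_zero, h0, map_zero]

/-- The multiplicity of the eigenvalue `l` of `T* T`. -/
def singMult (T : E →L[ℂ] E) (l : ℝ) : ℕ :=
  Module.finrank ℂ (adjoint T ∘L T - (l : ℂ) • (1 : E →L[ℂ] E)).ker

theorem mem_ker_absSq {T : E →L[ℂ] E} {l : ℝ} {v : E} :
    v ∈ (adjoint T ∘L T - (l : ℂ) • (1 : E →L[ℂ] E)).ker ↔ adjoint T (T v) = (l : ℂ) • v := by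
  change adjoint T (T v) - (l : ℂ) • v = 0 ↔ _
  rw [sub_eq_zero]

theorem ker_absSq_zero (T : E →L[ℂ] E) :
    (adjoint T ∘L T - ((0 : ℝ) : ℂ) • (1 : E →L[ℂ] E)).ker = T.ker := by
  ext v
  rw [mem_ker_absSq]
  constructor
  · intro h
    have h1 : inner ℂ (T v) (T v) = (0 : ℂ) := by
      rw [← adjoint_inner_left, h]
      simp
    exact inner_self_eq_zero.1 h1
  · intro h
    have : T v = 0 := h
    simp [this]

theorem singMult_zero (T : E →L[ℂ] E) : singMult T 0 = Module.finrank ℂ T.ker := by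
  unfold singMult
  rw [ker_absSq_zero]

/-- The dimension of the spectral subspace is the sum of the multiplicities. -/
theorem finrank_lowSpace (T : E →L[ℂ] E) {c : ℝ} (hc : 0 ≤ c)
    [FiniteDimensional ℂ (lowSpace T c)] :
    ∃ s : Finset ℝ, (∀ l ∈ s, 0 < l ∧ l ≤ c) ∧ ∀ s' : Finset ℝ, s ⊆ s' → (∀ l ∈ s', 0 < l ∧ l ≤ c) →
      Module.finrank ℂ (lowSpace T c) = Module.finrank ℂ T.ker + ∑ l ∈ s', singMult T l := by
  classical
  set V := lowSpace T c with hV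
  let B : V →ₗ[ℂ] V :=
    ((adjoint T ∘L T : E →L[ℂ] E) : E →ₗ[ℂ] E).restrict (fun v hv => mapsTo_lowSpace T c hv)
  have hB : B.IsSymmetric := by
    intro x y
    exact (isSelfAdjoint_adjoint_comp T).isSymmetric.apply_clm x y
  have hBv : ∀ v : V, ((B v : V) : E) = adjoint T (T v) := fun v => rfl
  have heig : ∀ l : ℝ, l ≤ c →
      Module.finrank ℂ (Module.End.eigenspace B (l : ℂ)) = singMult T l := by
    intro l hl
    have : Submodule.map V.subtype (Module.End.eigenspace B (l : ℂ)) =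
        (adjoint T ∘L T - (l : ℂ) • (1 : E →L[ℂ] E)).ker := by
      ext v
      rw [mem_ker_absSq]
      constructor
      · rintro ⟨w, hw, rfl⟩
        have := (Module.End.mem_eigenspace_iff).1 hw
        have h2 := congrArg (Subtype.val) this
        exact h2
      · intro h
        refine ⟨⟨v, mem_lowSpace_of_eigen hl h⟩, ?_, rfl⟩
        rw [SetLike.mem_coe, Module.End.mem_eigenspace_iff]
        exact Subtype.ext h
    unfold singMult
    rw [← this]
    exact (LinearEquiv.finrank_eq (Submodule.equivMapOfInjective _ V.subtype_injective _))
  set n := Module.finrank ℂ V with hn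
  have hmem : ∀ i : Fin n, 0 ≤ hB.eigenvalues hn.symm i ∧ hB.eigenvalues hn.symm i ≤ c := by
    intro i
    set w := hB.eigenvectorBasis hn.symm i with hw
    set l := hB.eigenvalues hn.symm i with hl
    have h1 := hB.apply_eigenvectorBasis hn.symm i
    have h2 : adjoint T (T (w : E)) = (l : ℂ) • (w : E) := congrArg Subtype.val h1
    have h3 : ‖(w : E)‖ = 1 := (hB.eigenvectorBasis hn.symm).orthonormal.1 i
    have h4 : ‖T (w : E)‖ ^ 2 = l := by
      have h5 : inner ℂ (T (w : E)) (T (w : E)) = (l : ℂ) := by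
        rw [← adjoint_inner_left, h2, inner_smul_left, inner_self_eq_norm_sq_to_K, h3]
        simp
      rw [inner_self_eq_norm_sq_to_K] at h5
      refine Complex.ofReal_injective ?_
      rw [← h5]
      push_cast
      rfl
    have h6 := norm_sq_le_of_mem_lowSpace w.2
    rw [h3, h4] at h6
    constructor
    · rw [← h4]; positivity
    · linarith
  -- The positive eigenvalues on the low subspace. Enlarging the set only adds zero multiplicities;
  -- this freedom lets $T$ and $T^*$ be summed over one common set later.
  refine ⟨(Finset.univ.image (hB.eigenvalues hn.symm)).filter (0 < ·), ?_, ?_⟩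
  · intro l hl
    obtain ⟨hl1, hl2⟩ := Finset.mem_filter.1 hl
    obtain ⟨i, -, rfl⟩ := Finset.mem_image.1 hl1
    exact ⟨hl2, (hmem i).2⟩
  intro s' hs hs'
  have h0 : (0 : ℝ) ∉ s' := fun h => lt_irrefl _ (hs' 0 h).1
  have hsum : Module.finrank ℂ T.ker + ∑ l ∈ s', singMult T l =
      ∑ l ∈ insert 0 s', singMult T l := by
    rw [Finset.sum_insert h0, singMult_zero]
  rw [hsum]
  have hcard : ∀ l ∈ insert (0 : ℝ) s', singMult T l =
      (Finset.univ.filter fun i : Fin n => hB.eigenvalues hn.symm i = l).card := by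
    intro l hl
    have hlc : l ≤ c := by
      rcases Finset.mem_insert.1 hl with rfl | h
      · exact hc
      · exact (hs' l h).2
    rw [← heig l hlc, ← hB.card_filter_eigenvalues_eq hn.symm (l : ℂ)]
    congr 1
    ext i
    simp
  rw [Finset.sum_congr rfl hcard,
    ← Finset.card_eq_sum_card_fiberwise (s := Finset.univ)]
  · simp
  · intro i _
    rw [Finset.mem_coe, Finset.mem_insert]
    rcases (hmem i).1.eq_or_lt with h | h
    · exact Or.inl h.symm
    · right
      exact hs (Finset.mem_filter.2 ⟨Finset.mem_image_of_mem _ (Finset.mem_univ i), h⟩)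

/-- Near an operator that is bounded below off its finite-dimensional kernel, the low spectral
subspaces have the dimension of that kernel. -/
theorem finrank_lowSpace_of_near {T₀ : E →L[ℂ] E} [FiniteDimensional ℂ T₀.ker] {g : ℝ}
    (h₀ : ∀ v ∈ (T₀.ker)ᗮ, g * ‖v‖ ≤ ‖T₀ v‖) {e : ℝ} (he : 0 < e)
    (heg : 3 * e ≤ g) {T : E →L[ℂ] E} (hT : ‖T - T₀‖ < e) :
    FiniteDimensional ℂ (lowSpace T (e ^ 2)) ∧
      Module.finrank ℂ (lowSpace T (e ^ 2)) = Module.finrank ℂ T₀.ker := by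
  have hd : ∀ v, ‖T v - T₀ v‖ ≤ ‖T - T₀‖ * ‖v‖ := fun v => (T - T₀).le_opNorm v
  -- A nonzero vector here would have $\|T_0v\|<2e\|v\|$ against $\|T_0v\|\ge 3e\|v\|$. For the
  -- opposite inequality of dimensions, a nonzero $v\in\mathrm{Ker}\,T_0$ has $\|Tv\|<e\|v\|$, while
  -- off the low subspace $\|Tv\|\ge e\|v\|$.
  have h1 : ∀ v ∈ lowSpace T (e ^ 2), v ∈ (T₀.ker)ᗮ → v = 0 := by
    intro v hv hv0
    by_contra hne
    have hpos : 0 < ‖v‖ := norm_pos_iff.2 hne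
    have a := norm_sq_le_of_mem_lowSpace hv
    have b := h₀ v hv0
    have d := hd v
    have a' : ‖T v‖ ≤ e * ‖v‖ := by
      rw [← mul_pow] at a
      exact le_of_sq_le_sq a (by positivity) 
    have f : ‖T₀ v‖ ≤ ‖T v‖ + ‖T v - T₀ v‖ := by
      have := norm_sub_le (T v) (T v - T₀ v)
      simpa using this
    nlinarith
  obtain ⟨hfd, hle⟩ := finite_finrank_le_of_disjoint _ _ h1
  refine ⟨hfd, le_antisymm hle ?_⟩
  refine finrank_le_of_disjoint_complete _ _ ?_
  intro v hv hv0
  by_contra hne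
  have hpos : 0 < ‖v‖ := norm_pos_iff.2 hne
  have a := le_norm_sq_of_mem_orthogonal hv0
  have b : T₀ v = 0 := hv
  have d := hd v
  rw [b, sub_zero] at d
  have a' : e * ‖v‖ ≤ ‖T v‖ := by
    rw [← mul_pow] at a
    exact le_of_sq_le_sq a (norm_nonneg _)
  nlinarith

/-- The nonzero eigenvalues of `T* T` and `T T*` have the same multiplicities. -/
theorem singMult_adjoint (T : E →L[ℂ] E) {l : ℝ} (hl : 0 < l) :
    singMult (adjoint T) l = singMult T l := by
  have key : ∀ T : E →L[ℂ] E, Nonempty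
      ((adjoint T ∘L T - (l : ℂ) • (1 : E →L[ℂ] E)).ker ≃ₗ[ℂ]
        (adjoint (adjoint T) ∘L adjoint T - (l : ℂ) • (1 : E →L[ℂ] E)).ker) := by
    intro T
    have hl' : (l : ℂ) ≠ 0 := by exact_mod_cast hl.ne'
    -- $T$ maps one eigenspace to the other, and $l^{-1}T^*$ is its inverse.
    refine ⟨LinearEquiv.ofLinearMap
      ((T : E →ₗ[ℂ] E).restrict ?_) (((l : ℂ)⁻¹ • (adjoint T) : E →L[ℂ] E).toLinearMap.restrict ?_)
        ?_ ?_⟩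
    · intro v hv
      rw [mem_ker_absSq] at hv ⊢
      rw [adjoint_adjoint]
      change T (adjoint T (T v)) = _
      rw [hv, map_smul]
      rfl
    · intro v hv
      rw [mem_ker_absSq] at hv ⊢
      rw [adjoint_adjoint] at hv
      change adjoint T (T ((l : ℂ)⁻¹ • adjoint T v)) = (l : ℂ) • ((l : ℂ)⁻¹ • adjoint T v)
      rw [map_smul, map_smul, hv, map_smul, smul_comm]
    · ext ⟨v, hv⟩
      rw [mem_ker_absSq, adjoint_adjoint] at hv
      change T ((l : ℂ)⁻¹ • adjoint T v) = v
      rw [map_smul, hv, smul_smul, inv_mul_cancel₀ hl', one_smul]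
    · ext ⟨v, hv⟩
      rw [mem_ker_absSq] at hv
      change (l : ℂ)⁻¹ • adjoint T (T v) = v
      rw [hv, smul_smul, inv_mul_cancel₀ hl', one_smul]
  obtain ⟨f⟩ := key T
  exact (LinearEquiv.finrank_eq f).symm

/-- The index is locally constant, and so is the parity of the nullity if the small nonzero
eigenvalues of `T* T` have even multiplicity. -/
theorem index_parity_locally {T₀ : E →L[ℂ] E} (h : T₀.IsFredholm) :
    ∃ e : ℝ, 0 < e ∧ ∀ T : E →L[ℂ] E, ‖T - T₀‖ < e →
      ((Module.finrank ℂ T.ker : ℤ) - Module.finrank ℂ (adjoint T).ker =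
        (Module.finrank ℂ T₀.ker : ℤ) - Module.finrank ℂ (adjoint T₀).ker) ∧
      ((∀ l : ℝ, 0 < l → l < 1 → Even (singMult T l)) →
        ((Module.finrank ℂ T.ker : ZMod 2) = (Module.finrank ℂ T₀.ker : ZMod 2))) := by
  classical
  have := h.finite_ker
  have := finiteDimensional_ker_adjoint h
  obtain ⟨g, hg, h1⟩ := exists_lower_bound h.isClosed_range
  obtain ⟨g', hg', h2⟩ := exists_lower_bound_adjoint h.isClosed_range
  -- A third of both gaps at most; $e<1$ keeps the eigenvalues up to $e^2$ in the range $l<1$ where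
  -- even multiplicity is assumed.
  obtain ⟨e, he, heg, heg', he1⟩ : ∃ e : ℝ, 0 < e ∧ 3 * e ≤ g ∧ 3 * e ≤ g' ∧ e < 1 := by
    refine ⟨min (min g g') 1 / 3, by positivity, ?_, ?_, ?_⟩
    · have := (min_le_left (min g g') 1).trans (min_le_left g g'); linarith
    · have := (min_le_left (min g g') 1).trans (min_le_right g g'); linarith
    · have := (min_le_right (min g g') 1); linarith
  refine ⟨e, he, fun T hT => ?_⟩
  have hT' : ‖adjoint T - adjoint T₀‖ < e := by
    rw [← map_sub, LinearIsometryEquiv.norm_map]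
    exact hT
  obtain ⟨hf, hr⟩ := finrank_lowSpace_of_near h1 he heg hT
  obtain ⟨hf', hr'⟩ := finrank_lowSpace_of_near h2 he heg' hT'
  obtain ⟨s, hs0, hs⟩ := finrank_lowSpace T (sq_nonneg e)
  obtain ⟨s', hs0', hs'⟩ := finrank_lowSpace (adjoint T) (sq_nonneg e)
  have hu : ∀ l ∈ s ∪ s', 0 < l ∧ l ≤ e ^ 2 := by
    intro l hl
    rcases Finset.mem_union.1 hl with h | h
    · exact hs0 l h
    · exact hs0' l h
  have a := hs _ Finset.subset_union_left hu
  have b := hs' _ Finset.subset_union_right hu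
  have hsum : ∑ l ∈ s ∪ s', singMult (adjoint T) l = ∑ l ∈ s ∪ s', singMult T l :=
    Finset.sum_congr rfl fun l hl => singMult_adjoint T (hu l hl).1
  rw [hr] at a
  rw [hr', hsum] at b
  constructor
  · rw [a, b]
    push_cast
    ring
  · intro hev
    have : Even (∑ l ∈ s ∪ s', singMult T l) := by
      refine Finset.even_sum _ fun l hl => hev l (hu l hl).1 ?_
      have := (hu l hl).2
      nlinarith
    obtain ⟨r, hr⟩ := this
    rw [a, hr]
    push_cast
    rw [CharTwo.add_self_eq_zero, add_zero]

end Spectral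

/-! ### Invariance along norm-continuous paths of Fredholm operators -/

section Paths

variable {E : Type*} [NormedAddCommGroup E] [InnerProductSpace ℂ E] [CompleteSpace E]

theorem index_const_of_path {T : unitInterval → E →L[ℂ] E} (hc : Continuous T)
    (hF : ∀ t, (T t).IsFredholm) (t : unitInterval) :
    (Module.finrank ℂ (T t).ker : ℤ) - Module.finrank ℂ (adjoint (T t)).ker =
      (Module.finrank ℂ (T 0).ker : ℤ) - Module.finrank ℂ (adjoint (T 0)).ker := by
  have hl : IsLocallyConstant fun t =>
      (Module.finrank ℂ (T t).ker : ℤ) - Module.finrank ℂ (adjoint (T t)).ker := by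
    rw [IsLocallyConstant.iff_eventually_eq]
    intro t
    obtain ⟨e, he, h⟩ := index_parity_locally (hF t)
    filter_upwards [hc.continuousAt.eventually (Metric.ball_mem_nhds (T t) he)] with r hr
    exact (h (T r) (by rw [← dist_eq_norm]; exact hr)).1
  exact hl.apply_eq_of_preconnectedSpace t 0

theorem parity_const_of_path {T : unitInterval → E →L[ℂ] E} (hc : Continuous T)
    (hF : ∀ t, (T t).IsFredholm)
    (hev : ∀ t, ∀ l : ℝ, 0 < l → l < 1 → Even (singMult (T t) l)) (t : unitInterval) :
    (Module.finrank ℂ (T t).ker : ZMod 2) = (Module.finrank ℂ (T 0).ker : ZMod 2) := by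
  have hl : IsLocallyConstant fun t => (Module.finrank ℂ (T t).ker : ZMod 2) := by
    rw [IsLocallyConstant.iff_eventually_eq]
    intro t
    obtain ⟨e, he, h⟩ := index_parity_locally (hF t)
    filter_upwards [hc.continuousAt.eventually (Metric.ball_mem_nhds (T t) he)] with r hr
    exact (h (T r) (by rw [← dist_eq_norm]; exact hr)).2 (hev r)
  exact hl.apply_eq_of_preconnectedSpace t 0

end Paths

/-! ### Antilinear maps and dimensions -/

section Antilinear

variable {X : Type*} [AddCommGroup X] [Module ℂ X]

/-- Antilinear maps. -/
structure IsAntilin (C : X → X) : Prop where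
  add : ∀ u v, C (u + v) = C u + C v
  smul : ∀ (a : ℂ) v, C (a • v) = star a • C v

namespace IsAntilin

variable {C : X → X}

theorem zero (hC : IsAntilin C) : C 0 = 0 := by
  have := hC.smul 0 0
  simpa using this

theorem neg (hC : IsAntilin C) (v : X) : C (-v) = -C v := by
  have := hC.smul (-1) v
  simpa using this

theorem sub (hC : IsAntilin C) (u v : X) : C (u - v) = C u - C v := by
  rw [sub_eq_add_neg, hC.add, hC.neg, sub_eq_add_neg]

theorem real_smul (hC : IsAntilin C) (a : ℝ) (v : X) : C ((a : ℂ) • v) = (a : ℂ) • C v := by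
  rw [hC.smul]
  simp

theorem sum (hC : IsAntilin C) {ι : Type*} (s : Finset ι) (f : ι → X) :
    C (∑ i ∈ s, f i) = ∑ i ∈ s, C (f i) := by
  classical
  induction s using Finset.induction_on with
  | empty => simpa using hC.zero
  | insert a s ha ih => rw [Finset.sum_insert ha, hC.add, ih, Finset.sum_insert ha]

theorem comp_linear (hC : IsAntilin C) (A : X →ₗ[ℂ] X) : IsAntilin (fun v => C (A v)) :=
  ⟨fun u v => by rw [map_add, hC.add], fun a v => by rw [map_smul, hC.smul]⟩

theorem linear_comp (hC : IsAntilin C) (A : X →ₗ[ℂ] X) : IsAntilin (fun v => A (C v)) :=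
  ⟨fun u v => by rw [hC.add, map_add], fun a v => by rw [hC.smul, map_smul]⟩

end IsAntilin

/-- A space with an antilinear map of negative square has even dimension. -/
theorem even_finrank_of_antilin {V : Type*} [AddCommGroup V] [Module ℂ V] {K : V → V}
    (hK : IsAntilin K) {c : ℝ} (hc : 0 < c) (hKK : ∀ v, K (K v) = -((c : ℂ) • v)) :
    Even (Module.finrank ℂ V) := by
  classical
  by_cases hf : FiniteDimensional ℂ V
  swap
  · rw [Module.finrank_of_not_finite hf]
    exact Even.zero
  let b := Module.finBasis ℂ V
  set n := Module.finrank ℂ V with hn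
  let M : Matrix (Fin n) (Fin n) ℂ := Matrix.of fun i j => b.repr (K (b j)) i
  have hKb : ∀ j, K (b j) = ∑ i, M i j • b i := fun j => (b.sum_repr (K (b j))).symm
  -- In coordinates $K^2=-c$ reads $M\overline M=-c$. Taking determinants, $|\det M|^2=(-c)^n$,
  -- which is negative for odd $n$.
  have hM : M * M.map star = (-(c : ℂ)) • (1 : Matrix (Fin n) (Fin n) ℂ) := by
    ext k j
    have h1 : K (K (b j)) = ∑ k, (∑ i, M k i * star (M i j)) • b k := by
      rw [hKb j, hK.sum]
      simp_rw [hK.smul, hKb, Finset.smul_sum, smul_smul]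
      rw [Finset.sum_comm]
      refine Finset.sum_congr rfl fun k _ => ?_
      rw [Finset.sum_smul]
      refine Finset.sum_congr rfl fun i _ => ?_
      rw [mul_comm]
    have h2 := congrArg (fun v => b.repr v k) h1
    simp only [hKK] at h2
    rw [b.repr_sum_self] at h2
    rw [Matrix.mul_apply]
    simp only [Matrix.map_apply]
    rw [← h2]
    rw [map_neg, map_smul, b.repr_self]
    simp only [eq_comm, smul_eq_mul, Complex.coe_algebraMap, Finsupp.smul_single, mul_one,
      Finsupp.coe_neg, Pi.neg_apply, Finsupp.single_apply, Matrix.smul_apply, Matrix.one_apply]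
    split_ifs <;> simp
  have hdet := congrArg Matrix.det hM
  have hst : (M.map star).det = star M.det := by
    have := (RingHom.map_det (starRingEnd ℂ) M).symm
    exact this
  rw [Matrix.det_mul, hst, Matrix.det_smul, Matrix.det_one, mul_one, Fintype.card_fin] at hdet
  by_contra hodd
  rw [Nat.not_even_iff_odd] at hodd
  rw [hodd.neg_pow] at hdet
  have h3 : (Complex.normSq M.det : ℂ) = -((c : ℂ) ^ n) := by
    rw [← hdet]
    exact Complex.mul_conj M.det ▸ rfl
  have h4 : Complex.normSq M.det = -(c ^ n) := by exact_mod_cast h3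
  have h5 := Complex.normSq_nonneg M.det
  have h6 : 0 < c ^ n := by positivity
  linarith

theorem even_finrank_submodule {W : Submodule ℂ X} {K : X → X} (hK : IsAntilin K) {c : ℝ}
    (hc : 0 < c) (hW : ∀ v ∈ W, K v ∈ W) (hKK : ∀ v ∈ W, K (K v) = -((c : ℂ) • v)) :
    Even (Module.finrank ℂ W) := by
  refine even_finrank_of_antilin (K := fun v : W => ⟨K v, hW v v.2⟩) ⟨?_, ?_⟩ hc ?_
  · intro u v
    exact Subtype.ext (hK.add u v)
  · intro a v
    exact Subtype.ext (hK.smul a v)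
  · intro v
    exact Subtype.ext (hKK v v.2)

/-- An antilinear injection is semilinear along complex conjugation, and such maps still do not
decrease the rank. -/
theorem rank_le_of_antilin {W W' : Submodule ℂ X} {K : X → X} (hK : IsAntilin K)
    (hW : ∀ v ∈ W, K v ∈ W') (hinj : ∀ v ∈ W, K v = 0 → v = 0) :
    Module.rank ℂ W ≤ Module.rank ℂ W' := by
  refine rank_le_of_injective_injective (starRingEnd ℂ)
    (AddMonoidHom.mk' (fun v : W => (⟨K v, hW v v.2⟩ : W')) ?_) ?_ ?_ ?_
  · intro u v
    exact Subtype.ext (hK.add u v)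
  · intro r hr
    simpa using hr
  · rw [injective_iff_map_eq_zero]
    intro v hv
    exact Subtype.ext (hinj v v.2 (congrArg Subtype.val hv))
  · intro r v
    refine Subtype.ext ?_
    have := hK.smul (star r) v
    rw [star_star] at this
    exact this

/-- Comparing cardinal ranks in both directions makes finite dimensionality unnecessary. -/
theorem finrank_eq_of_antilin {W W' : Submodule ℂ X} {K K' : X → X} (hK : IsAntilin K)
    (hK' : IsAntilin K') (hW : ∀ v ∈ W, K v ∈ W') (hinj : ∀ v ∈ W, K v = 0 → v = 0)
    (hW' : ∀ v ∈ W', K' v ∈ W) (hinj' : ∀ v ∈ W', K' v = 0 → v = 0) :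
    Module.finrank ℂ W = Module.finrank ℂ W' :=
  congrArg Cardinal.toNat
    (le_antisymm (rank_le_of_antilin hK hW hinj) (rank_le_of_antilin hK' hW' hinj'))

end Antilinear

/-! ### Antilinear symmetries of a projection and an involution -/

section KernelPairs

variable {X : Type*} [NormedAddCommGroup X] [InnerProductSpace ℂ X]

/-- The vectors of `M` in the range of `Q` that `Q G` annihilates. -/
def kerPair (Q G : X →L[ℂ] X) (M : Submodule ℂ X) : Submodule ℂ X :=
  M ⊓ (Q - 1).ker ⊓ (Q ∘L G).ker

/-- The eigenvectors of `Q G Q G` in `M` and in the range of `Q`. -/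
def eigPair (Q G : X →L[ℂ] X) (M : Submodule ℂ X) (l : ℝ) : Submodule ℂ X :=
  M ⊓ (Q - 1).ker ⊓ (Q ∘L G ∘L Q ∘L G - (l : ℂ) • (1 : X →L[ℂ] X)).ker

variable {Q G : X →L[ℂ] X} {M M' : Submodule ℂ X} {l : ℝ}

theorem mem_kerPair {v : X} : v ∈ kerPair Q G M ↔ v ∈ M ∧ Q v = v ∧ Q (G v) = 0 := by
  simp only [kerPair, Submodule.mem_inf, and_assoc]
  refine and_congr Iff.rfl (and_congr ?_ Iff.rfl)
  change Q v - v = 0 ↔ _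
  rw [sub_eq_zero]

theorem mem_eigPair {v : X} :
    v ∈ eigPair Q G M l ↔ v ∈ M ∧ Q v = v ∧ Q (G (Q (G v))) = (l : ℂ) • v := by
  simp only [eigPair, Submodule.mem_inf, and_assoc]
  refine and_congr Iff.rfl (and_congr ?_ ?_)
  · change Q v - v = 0 ↔ _
    rw [sub_eq_zero]
  · change Q (G (Q (G v))) - (l : ℂ) • v = 0 ↔ _
    rw [sub_eq_zero]

/-- A projection `Q` and an involution `G`, with a grading `M ⊕ M'` that `Q` preserves and `G`
reverses, or with `M = M'`. -/
structure GradedPair (Q G : X →L[ℂ] X) (M M' : Submodule ℂ X) : Prop where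
  idem : ∀ v, Q (Q v) = Q v
  invol : ∀ v, G (G v) = v
  mapQ : ∀ v ∈ M, Q v ∈ M
  mapQ' : ∀ v ∈ M', Q v ∈ M'
  mapG : ∀ v ∈ M, G v ∈ M'
  mapG' : ∀ v ∈ M', G v ∈ M

theorem GradedPair.symm (h : GradedPair Q G M M') : GradedPair Q G M' M :=
  ⟨h.idem, h.invol, h.mapQ', h.mapQ, h.mapG', h.mapG⟩

/-- An antilinear symmetry of square `ε` that commutes with `G` up to the sign `δ`. -/
structure AntiSym (C : X → X) (ε δ : ℤ) (G : X →L[ℂ] X) : Prop where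
  anti : IsAntilin C
  sq : ∀ v, C (C v) = (ε : ℂ) • v
  comm : ∀ v, C (G v) = (δ : ℂ) • G (C v)

variable {C : X → X} {ε δ : ℤ}

theorem intCast_smul_comm_anti (hC : IsAntilin C) (n : ℤ) (v : X) :
    C ((n : ℂ) • v) = (n : ℂ) • C v := by
  rw [hC.smul]
  simp

/-- $C$ itself acts on the kernel, with square $-1$. -/
theorem even_kerPair_of_real (hC : AntiSym C (-1) δ G) (hQ : ∀ v, C (Q v) = Q (C v))
    (hM : ∀ v ∈ M, C v ∈ M) : Even (Module.finrank ℂ (kerPair Q G M)) := by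
  refine even_finrank_submodule hC.anti one_pos ?_ ?_
  · intro v hv
    rw [mem_kerPair] at hv ⊢
    obtain ⟨h1, h2, h3⟩ := hv
    refine ⟨hM v h1, by rw [← hQ, h2], ?_⟩
    -- Nothing restricts $\delta$ here. If $\delta=0$ then $CG=0$, and injectivity of $C$ gives
    -- $GC=0$.
    by_cases hδ : δ = 0
    · have h4 := hC.comm (G v)
      have h5 : C (C (G (C v))) = 0 := by
        have := hC.comm (C v)
        rw [hδ] at this
        have h6 : C (G (C v)) = 0 := by simpa using this
        rw [h6, hC.anti.zero]
      rw [hC.sq] at h5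
      have h6 : G (C v) = 0 := by simpa using h5
      rw [h6, map_zero]
    · have h4 : (δ : ℂ) • Q (G (C v)) = 0 := by
        rw [← map_smul, ← hC.comm, ← hQ, h3, hC.anti.zero]
      rcases smul_eq_zero.1 h4 with h5 | h5
      · exact absurd (by exact_mod_cast h5) hδ
      · exact h5
  · intro v _
    rw [hC.sq]
    simp

/-- $C$ exchanges $\mathrm{Ran}\,Q$ and $\mathrm{Ker}\,Q$, and on the kernel so does $G$: it maps
$v=Qv$ with $QGv=0$ into $\mathrm{Ker}\,Q$. Hence $CG$ acts on the kernel; its square is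
$\varepsilon\delta=-1$. -/
theorem even_kerPair_of_lagrangian (h : GradedPair Q G M M') (hC : AntiSym C ε δ G)
    (hε : ε * δ = -1)
    (hQ : ∀ v, C (Q v) = C v - Q (C v)) (hM : ∀ v ∈ M', C v ∈ M) :
    Even (Module.finrank ℂ (kerPair Q G M)) := by
  have hε' : (δ : ℂ) * ε = -1 := by rw [mul_comm]; exact_mod_cast hε
  refine even_finrank_submodule (hC.anti.comp_linear (G : X →ₗ[ℂ] X)) one_pos ?_ ?_
  · intro v hv
    rw [mem_kerPair] at hv ⊢
    obtain ⟨h1, h2, h3⟩ := hv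
    have h4 := hQ (G v)
    rw [h3, hC.anti.zero] at h4
    have h5 := hQ v
    rw [h2] at h5
    refine ⟨hM _ (h.mapG v h1), (sub_eq_zero.1 h4.symm).symm, ?_⟩
    change Q (G (C (G v))) = 0
    rw [hC.comm, map_smul, h.invol, map_smul]
    have : Q (C v) = 0 := by
      have := sub_eq_self.1 h5.symm
      exact this
    rw [this, smul_zero]
  · intro v hv
    change C (G (C (G v))) = _
    rw [hC.comm v, map_smul, h.invol, intCast_smul_comm_anti hC.anti, hC.sq, smul_smul, hε']
    simp

/-- $C$ swaps the gradings and commutes with $Q$, so it carries each of the two kernels into the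
other. -/
theorem finrank_kerPair_eq_of_real (hC : AntiSym C ε δ G) (hε : ε ≠ 0) (hδ : δ ≠ 0)
    (hQ : ∀ v, C (Q v) = Q (C v)) (hM : ∀ v ∈ M, C v ∈ M') (hM' : ∀ v ∈ M', C v ∈ M) :
    Module.finrank ℂ (kerPair Q G M) = Module.finrank ℂ (kerPair Q G M') := by
  have hinj : ∀ v, C v = 0 → v = 0 := by
    intro v hv
    have := hC.sq v
    rw [hv, hC.anti.zero] at this
    rcases smul_eq_zero.1 this.symm with h5 | h5
    · exact absurd (by exact_mod_cast h5) hε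
    · exact h5
  have key : ∀ {N N' : Submodule ℂ X}, (∀ v ∈ N, C v ∈ N') →
      ∀ v ∈ kerPair Q G N, C v ∈ kerPair Q G N' := by
    intro N N' hN v hv
    rw [mem_kerPair] at hv ⊢
    obtain ⟨h1, h2, h3⟩ := hv
    refine ⟨hN v h1, by rw [← hQ, h2], ?_⟩
    have h4 : (δ : ℂ) • Q (G (C v)) = 0 := by
      rw [← map_smul, ← hC.comm, ← hQ, h3, hC.anti.zero]
    rcases smul_eq_zero.1 h4 with h5 | h5
    · exact absurd (by exact_mod_cast h5) hδ
    · exact h5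
  exact finrank_eq_of_antilin hC.anti hC.anti (key hM) (fun v _ => hinj v) (key hM')
    (fun v _ => hinj v)

/-- The map is $K=CQG$: it reverses the grading twice, and $K^2=\varepsilon\delta(QG)^2=-l$ on the
eigenspace. -/
theorem even_eigPair_of_real (h : GradedPair Q G M M') (hC : AntiSym C ε δ G)
    (hε : ε * δ = -1) (hQ : ∀ v, C (Q v) = Q (C v)) (hM' : ∀ v ∈ M', C v ∈ M) (hl : 0 < l) :
    Even (Module.finrank ℂ (eigPair Q G M l)) := by
  have hε' : (δ : ℂ) * ε = -1 := by rw [mul_comm]; exact_mod_cast hε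
  have hδ2 : (δ : ℂ) * δ = 1 := by
    rcases Int.mul_eq_neg_one_iff_eq_one_or_neg_one.1 hε with ⟨-, h⟩ | ⟨-, h⟩ <;> simp [h]
  refine even_finrank_submodule (hC.anti.comp_linear ((Q ∘L G : X →L[ℂ] X) : X →ₗ[ℂ] X)) hl ?_ ?_
  · intro v hv
    rw [mem_eigPair] at hv ⊢
    obtain ⟨h1, h2, h3⟩ := hv
    change C (Q (G v)) ∈ M ∧ Q (C (Q (G v))) = C (Q (G v)) ∧
      Q (G (Q (G (C (Q (G v)))))) = (l : ℂ) • C (Q (G v))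
    refine ⟨hM' _ (h.mapQ' _ (h.mapG v h1)), by rw [← hQ, h.idem], ?_⟩
    have e1 : ∀ u, G (C u) = (δ : ℂ) • C (G u) := by
      intro u
      rw [hC.comm, smul_smul, hδ2, one_smul]
    rw [e1, map_smul, ← hQ, map_smul, e1, map_smul, map_smul, smul_smul, hδ2, one_smul, ← hQ,
      h3, map_smul, map_smul, hC.anti.real_smul]
  · intro v hv
    rw [mem_eigPair] at hv
    obtain ⟨h1, h2, h3⟩ := hv
    change C (Q (G (C (Q (G v))))) = _
    have e1 : ∀ u, G (C u) = (δ : ℂ) • C (G u) := by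
      intro u
      rw [hC.comm, smul_smul, hδ2, one_smul]
    rw [e1, map_smul, ← hQ, h3, intCast_smul_comm_anti hC.anti, hC.anti.real_smul,
      hC.anti.real_smul, hC.sq, smul_comm (l : ℂ), smul_smul, hε']
    simp

/-- The map is $CG$: $G$ changes the grading, $C$ preserves it, and both exchange $\mathrm{Ran}\,Q$
with $\mathrm{Ker}\,Q$ on the relevant vectors. -/
theorem finrank_kerPair_eq_of_lagrangian (h : GradedPair Q G M M') (hC : AntiSym C ε δ G)
    (hε : ε ≠ 0) (hQ : ∀ v, C (Q v) = C v - Q (C v))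
    (hM : ∀ v ∈ M, C v ∈ M) (hM' : ∀ v ∈ M', C v ∈ M') :
    Module.finrank ℂ (kerPair Q G M) = Module.finrank ℂ (kerPair Q G M') := by
  have hinj : ∀ v, C (G v) = 0 → v = 0 := by
    intro v hv
    have := hC.sq (G v)
    rw [hv, hC.anti.zero] at this
    rcases smul_eq_zero.1 this.symm with h5 | h5
    · exact absurd (by exact_mod_cast h5) hε
    · rw [← h.invol v, h5, map_zero]
  have key : ∀ {N N' : Submodule ℂ X}, (∀ v ∈ N, G v ∈ N') → (∀ v ∈ N', C v ∈ N') →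
      ∀ v ∈ kerPair Q G N, C (G v) ∈ kerPair Q G N' := by
    intro N N' hN hN' v hv
    rw [mem_kerPair] at hv ⊢
    obtain ⟨h1, h2, h3⟩ := hv
    have h4 := hQ (G v)
    rw [h3, hC.anti.zero] at h4
    have h5 := hQ v
    rw [h2] at h5
    refine ⟨hN' _ (hN v h1), (sub_eq_zero.1 h4.symm).symm, ?_⟩
    rw [hC.comm, map_smul, h.invol, map_smul]
    have : Q (C v) = 0 := sub_eq_self.1 h5.symm
    rw [this, smul_zero]
  have hanti := hC.anti.comp_linear (G : X →ₗ[ℂ] X)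
  exact finrank_eq_of_antilin hanti hanti (key h.mapG hM') (fun v _ => hinj v) (key h.mapG' hM)
    (fun v _ => hinj v)

/-- $C$ alone leaves $\mathrm{Ran}\,Q$, so it is brought back by $QGQG$. From $QC=C(1-Q)$ and
$C^2=1$ the map $K=QGQGC$ has $K^2=l^2-l=-l(1-l)$ on the eigenspace, negative only for $0<l<1$. -/
theorem even_eigPair_of_lagrangian (h : GradedPair Q G M M') (hC : AntiSym C 1 δ G)
    (hδ : δ * δ = 1) (hQ : ∀ v, C (Q v) = C v - Q (C v)) (hM : ∀ v ∈ M, C v ∈ M)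
    (hl : 0 < l) (hl1 : l < 1) : Even (Module.finrank ℂ (eigPair Q G M l)) := by
  have hδ2 : (δ : ℂ) * δ = 1 := by exact_mod_cast hδ
  have e1 : ∀ u, G (C u) = (δ : ℂ) • C (G u) := by
    intro u
    rw [hC.comm, smul_smul, hδ2, one_smul]
  have e2 : ∀ u, Q (C u) = C u - C (Q u) := by
    intro u
    rw [hQ]; abel
  have e3 : ∀ u, Q (G (Q (G (C u)))) = C u - C (Q u) - C (G (Q (G u))) + C (Q (G (Q (G u)))) := by
    intro u
    simp only [e1, e2, map_smul, map_sub, smul_sub, smul_smul, hδ2, one_smul, h.invol]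
    abel
  refine even_finrank_submodule
    (hC.anti.linear_comp ((Q ∘L G ∘L Q ∘L G : X →L[ℂ] X) : X →ₗ[ℂ] X)) (c := l * (1 - l))
      (mul_pos hl (by linarith)) ?_ ?_
  · intro v hv
    rw [mem_eigPair] at hv ⊢
    obtain ⟨h1, h2, h3⟩ := hv
    change Q (G (Q (G (C v)))) ∈ M ∧ Q (Q (G (Q (G (C v))))) = Q (G (Q (G (C v)))) ∧
      Q (G (Q (G (Q (G (Q (G (C v)))))))) = (l : ℂ) • Q (G (Q (G (C v))))
    refine ⟨h.mapQ _ (h.mapG' _ (h.mapQ' _ (h.mapG _ (hM _ h1)))), h.idem _, ?_⟩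
    have e4 : Q (G (Q (G (C v)))) = (l : ℂ) • C v - C (G (Q (G v))) := by
      rw [e3, h2, h3, hC.anti.real_smul]; abel
    rw [e4, map_sub, map_smul, map_sub, map_smul, map_sub, map_smul, map_sub, map_smul, e4,
      e3 (G (Q (G v))), h3, h.invol, h.idem, h3, hC.anti.real_smul]
    module
  · intro v hv
    rw [mem_eigPair] at hv
    obtain ⟨h1, h2, h3⟩ := hv
    have e4 : Q (G (Q (G (C v)))) = (l : ℂ) • C v - C (G (Q (G v))) := by
      rw [e3, h2, h3, hC.anti.real_smul]; abel
    change Q (G (Q (G (C (Q (G (Q (G (C v))))))))) = _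
    rw [e4, hC.anti.sub, hC.anti.real_smul, hC.sq, hC.sq]
    simp only [Int.cast_one, one_smul, map_sub, map_smul, h3, h.invol, h.idem]
    push_cast
    module

end KernelPairs

/-! ### From the compressed operator to the graded pair -/

section Frames

variable {X Z : Type*} [NormedAddCommGroup X] [InnerProductSpace ℂ X] [CompleteSpace X]
  [NormedAddCommGroup Z] [InnerProductSpace ℂ Z] [CompleteSpace Z]

/-- The data that identify the kernel of `q F q + 1 - q` with a graded part of the kernel of
`Q G Q`. -/
structure FramePair (q F : Z →L[ℂ] Z) (Q G : X →L[ℂ] X) (M M' : Submodule ℂ X)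
    (w w' : Z →L[ℂ] X) : Prop where
  proj : IsStarProjection q
  iso : ∀ z, adjoint w (w z) = z
  iso' : ∀ z, adjoint w' (w' z) = z
  surj : ∀ v ∈ M, w (adjoint w v) = v
  surj' : ∀ v ∈ M', w' (adjoint w' v) = v
  mem : ∀ z, w z ∈ M
  mem' : ∀ z, w' z ∈ M'
  commQ : ∀ z, Q (w z) = w (q z)
  commQ' : ∀ z, Q (w' z) = w' (q z)
  commG : ∀ z, G (w z) = w' (F z)
  commG' : ∀ z, G (w' z) = w (adjoint F z)

variable {q F : Z →L[ℂ] Z} {Q G : X →L[ℂ] X} {M M' : Submodule ℂ X} {w w' : Z →L[ℂ] X}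

theorem FramePair.symm (h : FramePair q F Q G M M' w w') :
    FramePair q (adjoint F) Q G M' M w' w :=
  ⟨h.proj, h.iso', h.iso, h.surj', h.surj, h.mem', h.mem, h.commQ', h.commQ, h.commG',
    fun z => by rw [adjoint_adjoint]; exact h.commG z⟩

theorem FramePair.injective (h : FramePair q F Q G M M' w w') : Function.Injective w :=
  Function.LeftInverse.injective h.iso

theorem FramePair.idem (h : FramePair q F Q G M M' w w') (z : Z) : q (q z) = q z := by
  have := h.proj.isIdempotentElem
  exact congrArg (fun B : Z →L[ℂ] Z => B z) this

/-- The operator `q F q + 1 - q`. -/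
def compressCLM (q F : Z →L[ℂ] Z) : Z →L[ℂ] Z := q ∘L F ∘L q + 1 - q

omit [CompleteSpace Z] in
theorem compressCLM_apply (q F : Z →L[ℂ] Z) (z : Z) :
    compressCLM q F z = q (F (q z)) + z - q z := rfl

/-- On $\mathrm{Ker}\,q$ the operator $qFq+1-q$ is the identity, so its kernel lies in
$\mathrm{Ran}\,q$ and is given there by $qFz=0$; the isometries $w$, $w'$ translate this to $Q$ and
$G$. -/
theorem FramePair.map_ker (h : FramePair q F Q G M M' w w') :
    Submodule.map (w : Z →ₗ[ℂ] X) (compressCLM q F).ker = kerPair Q G M := by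
  ext v
  rw [mem_kerPair]
  constructor
  · rintro ⟨z, hz, rfl⟩
    have hz : q (F (q z)) + z - q z = 0 := hz
    have h1 : q z = z := by
      have := congrArg q hz
      rw [map_sub, map_add, h.idem, h.idem, map_zero, add_sub_cancel_right] at this
      rw [this, zero_add, sub_eq_zero] at hz
      exact hz.symm
    rw [h1] at hz
    refine ⟨h.mem z, ?_, ?_⟩
    · change Q (w z) = w z
      rw [h.commQ, h1]
    · change Q (G (w z)) = 0
      rw [h.commG, h.commQ']
      have : q (F z) = 0 := by simpa using hz
      rw [this, map_zero]
  · rintro ⟨h1, h2, h3⟩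
    refine ⟨adjoint w v, ?_, h.surj v h1⟩
    obtain ⟨z, rfl⟩ : ∃ z, w z = v := ⟨_, h.surj v h1⟩
    rw [h.iso]
    have h4 : q z = z := h.injective (by rw [← h.commQ, h2])
    rw [h.commG, h.commQ'] at h3
    have h5 : q (F z) = 0 := h.symm.injective (by rw [h3, map_zero])
    change q (F (q z)) + z - q z = 0
    rw [h4, h5]
    abel

theorem FramePair.finrank_ker (h : FramePair q F Q G M M' w w') :
    Module.finrank ℂ (compressCLM q F).ker = Module.finrank ℂ (kerPair Q G M) := by
  rw [← h.map_ker]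
  exact LinearEquiv.finrank_eq (Submodule.equivMapOfInjective _ h.injective _)

theorem adjoint_compressCLM (hq : IsStarProjection q) :
    adjoint (compressCLM q F) = compressCLM q (adjoint F) := by
  have h1 : adjoint q = q := hq.isSelfAdjoint.adjoint_eq
  have h2 : adjoint (1 : Z →L[ℂ] Z) = 1 := star_one _
  simp only [compressCLM, map_sub, map_add, adjoint_comp, h1, h2, comp_assoc]

theorem FramePair.finrank_ker_adjoint (h : FramePair q F Q G M M' w w') :
    Module.finrank ℂ (adjoint (compressCLM q F)).ker = Module.finrank ℂ (kerPair Q G M') := by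
  rw [adjoint_compressCLM h.proj]
  exact h.symm.finrank_ker

/-- $T^*T$ is $qF^*qFq$ on $\mathrm{Ran}\,q$ and $1$ on $\mathrm{Ker}\,q$. For $l<1$ the second
summand contributes no eigenvectors. -/
theorem FramePair.singMult_eq (h : FramePair q F Q G M M' w w') {l : ℝ} (hl : l < 1) :
    singMult (compressCLM q F) l = Module.finrank ℂ (eigPair Q G M l) := by
  have key : Submodule.map (w : Z →ₗ[ℂ] X) (adjoint (compressCLM q F) ∘L compressCLM q F -
      (l : ℂ) • (1 : Z →L[ℂ] Z)).ker = eigPair Q G M l := by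
    have hTT : ∀ z, adjoint (compressCLM q F) (compressCLM q F z) =
        q (adjoint F (q (F (q z)))) + z - q z := by
      intro z
      rw [adjoint_compressCLM h.proj]
      simp only [compressCLM_apply, map_add, map_sub, h.idem]
      abel
    ext v
    rw [mem_eigPair]
    constructor
    · rintro ⟨z, hz, rfl⟩
      rw [SetLike.mem_coe, mem_ker_absSq, hTT] at hz
      have h1 : q z = z := by
        have h2 := congrArg q hz
        rw [map_sub, map_add, h.idem, h.idem, map_smul, add_sub_cancel_right] at h2
        rw [h2] at hz
        have h3 : ((1 - l : ℝ) : ℂ) • (z - q z) = 0 := by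
          push_cast
          rw [sub_smul, smul_sub, smul_sub, one_smul, one_smul, ← sub_eq_zero.2 hz]
          abel
        rcases smul_eq_zero.1 h3 with h4 | h4
        · exfalso
          have : 1 - l = 0 := by exact_mod_cast h4
          linarith
        · exact (sub_eq_zero.1 h4).symm
      rw [h1] at hz
      refine ⟨h.mem z, ?_, ?_⟩
      · change Q (w z) = w z
        rw [h.commQ, h1]
      · change Q (G (Q (G (w z)))) = (l : ℂ) • w z
        rw [h.commG, h.commQ', h.commG', h.commQ, ← map_smul, ← hz]
        congr 1
        abel
    · rintro ⟨h1, h2, h3⟩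
      refine ⟨adjoint w v, ?_, h.surj v h1⟩
      obtain ⟨z, rfl⟩ : ∃ z, w z = v := ⟨_, h.surj v h1⟩
      rw [h.iso]
      have h4 : q z = z := h.injective (by rw [← h.commQ, h2])
      rw [h.commG, h.commQ', h.commG', h.commQ, ← map_smul] at h3
      have h5 := h.injective h3
      rw [SetLike.mem_coe, mem_ker_absSq, hTT, h4, h5]
      abel
  unfold singMult
  rw [← key]
  exact LinearEquiv.finrank_eq (Submodule.equivMapOfInjective _ h.injective _)

end Frames


/-! ### Restriction and extension by zero in coordinates -/

section Coordinates

variable {ι κ : Type}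

theorem inner_single_one [DecidableEq ι] (i : ι) (v : L2 ι) :
    inner ℂ (lp.single 2 i (1 : ℂ) : L2 ι) v = v i := by
  rw [lp.inner_single_left]
  simp

/-- The extension is defined as an adjoint, so its entries are read off by pairing with the standard
basis vectors. -/
theorem extendL_apply_self (e : ι ↪ κ) (v : L2 ι) (i : ι) : extendL e v (e i) = v i := by
  classical
  rw [← inner_single_one (e i), extendL, adjoint_inner_right]
  have : restrictL e (lp.single 2 (e i) (1 : ℂ)) = (lp.single 2 i (1 : ℂ) : L2 ι) := by
    ext k
    simp [lp.single_apply, Pi.single_apply, e.injective.eq_iff]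
  rw [this, inner_single_one]

theorem extendL_apply_of_notMem (e : ι ↪ κ) (v : L2 ι) {k : κ} (hk : k ∉ Set.range e) :
    extendL e v k = 0 := by
  classical
  rw [← inner_single_one k, extendL, adjoint_inner_right]
  have : restrictL e (lp.single 2 k (1 : ℂ)) = 0 := by
    ext i
    have : e i ≠ k := fun h => hk ⟨i, h⟩
    simp [lp.single_apply, Pi.single_apply, this]
  rw [this, inner_zero_left]

theorem restrictL_extendL (e : ι ↪ κ) (v : L2 ι) : restrictL e (extendL e v) = v := by
  ext i
  exact extendL_apply_self e v i

theorem restrictL_extendL_of_disjoint {ι' : Type} {e : ι ↪ κ} {e' : ι' ↪ κ}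
    (h : ∀ i i', e i ≠ e' i') (v : L2 ι) : restrictL e' (extendL e v) = 0 := by
  ext i
  refine extendL_apply_of_notMem e v ?_
  rintro ⟨k, hk⟩
  exact h k i hk

theorem adjoint_extendL (e : ι ↪ κ) : adjoint (extendL e) = restrictL e := adjoint_adjoint _

theorem restrictL_star (e : ι ↪ κ) (v : L2 κ) : restrictL e (star v) = star (restrictL e v) := by
  ext i
  simp

end Coordinates

/-! ### Operators on tensor products, computed slice by slice -/

section Slices

variable {Y Y' Y'' n m k s : Type}

/-- The component of a vector of `ℓ²(Y) ⊗ ℂⁿ` along a fibre index. -/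
abbrev slice (i : n) : L2 (Y × n) →L[ℂ] L2 Y := restrictL (atFibre i)

/-- The component of a vector of `ℓ²(Y) ⊗ ℂⁿ ⊗ ℂˢ` along an index of `ℂⁿ`. -/
abbrev sliceMid (a : n) : L2 ((Y × n) × s) →L[ℂ] L2 (Y × s) := restrictL (atMid a)

theorem slice_ext {v w : L2 (Y × n)} (h : ∀ i, slice i v = slice i w) : v = w := by
  ext ⟨y, i⟩
  exact congrArg (fun u : L2 Y => u y) (h i)

theorem sliceMid_ext {v w : L2 ((Y × n) × s)} (h : ∀ a : n, sliceMid a v = sliceMid a w) :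
    v = w := by
  ext ⟨⟨y, a⟩, i⟩
  exact congrArg (fun u : L2 (Y × s) => u (y, i)) (h a)

theorem slice_extendL [DecidableEq n] (i j : n) (v : L2 Y) :
    slice i (extendL (atFibre j) v) = if i = j then v else 0 := by
  split_ifs with h
  · rw [h]; exact restrictL_extendL _ v
  · refine restrictL_extendL_of_disjoint ?_ v
    intro y y' h'
    exact h (Prod.ext_iff.1 h').2.symm

theorem sliceMid_extendL [DecidableEq n] (a b : n) (v : L2 (Y × s)) :
    sliceMid a (extendL (atMid b) v) = if a = b then v else 0 := by
  split_ifs with h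
  · rw [h]; exact restrictL_extendL _ v
  · refine restrictL_extendL_of_disjoint ?_ v
    intro y y' h'
    exact h (Prod.ext_iff.1 (Prod.ext_iff.1 h').1).2.symm

/-- `A ⊗ 1_s` for an operator `A` between different spaces. -/
def amplR (s : Type) [Fintype s] (A : L2 Y →L[ℂ] L2 Y') : L2 (Y × s) →L[ℂ] L2 (Y' × s) :=
  ∑ i : s, extendL (atFibre i) ∘L A ∘L restrictL (atFibre i)

theorem amplRight_eq [Fintype s] (A : BOp Y) : amplRight s A = amplR s A := rfl

variable [Fintype n] [Fintype m] [Fintype k] [Fintype s]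

theorem slice_amplR (A : L2 Y →L[ℂ] L2 Y') (v : L2 (Y × s)) (i : s) :
    slice i (amplR s A v) = A (slice i v) := by
  classical
  simp only [amplR, sum_apply, comp_apply, map_sum, slice_extendL, Finset.sum_ite_eq,
    Finset.mem_univ, if_true]

theorem sliceMid_amplMid (A : BOp (Y × s)) (v : L2 ((Y × n) × s)) (a : n) :
    sliceMid a (amplMid n A v) = A (sliceMid a v) := by
  classical
  simp only [amplMid, sum_apply, comp_apply, map_sum, sliceMid_extendL, Finset.sum_ite_eq,
    Finset.mem_univ, if_true]

theorem slice_matOp (M : Matrix n m ℂ) (v : L2 (Y × m)) (i : n) :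
    slice i (matOp M v) = ∑ k, M i k • slice k v := by
  classical
  simp only [matOp, sum_apply, smul_apply, comp_apply, map_sum, map_smul, slice_extendL,
    smul_ite, smul_zero]
  rw [Finset.sum_comm]
  simp

theorem matOp_apply (M : Matrix n m ℂ) (v : L2 (Y × m)) (y : Y) (i : n) :
    matOp M v (y, i) = ∑ k, M i k * v (y, k) := by
  have h := congrArg (fun u : L2 Y => u y) (slice_matOp M v i)
  have h2 : matOp M v (y, i) = (∑ k, M i k • slice k v : L2 Y) y := h
  rw [h2, lp.coeFn_sum, Finset.sum_apply]
  rfl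

theorem amplR_apply (A : L2 Y →L[ℂ] L2 Y') (v : L2 (Y × s)) (y : Y') (i : s) :
    amplR s A v (y, i) = A (slice i v) y :=
  congrArg (fun u : L2 Y' => u y) (slice_amplR A v i)

theorem amplMid_apply (A : BOp (Y × s)) (v : L2 ((Y × n) × s)) (y : Y) (a : n) (i : s) :
    amplMid n A v ((y, a), i) = A (sliceMid a v) (y, i) :=
  congrArg (fun u : L2 (Y × s) => u (y, i)) (sliceMid_amplMid A v a)

theorem sliceMid_amplR_matOp (M : Matrix n m ℂ) (v : L2 ((Y × m) × s)) (a : n) :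
    sliceMid a (amplR s (matOp M) v) = ∑ b, M a b • sliceMid b v := by
  ext ⟨y, i⟩
  change amplR s (matOp M) v ((y, a), i) = _
  rw [amplR_apply, matOp_apply, lp.coeFn_sum, Finset.sum_apply]
  rfl

theorem sliceMid_matOp (M : Matrix k s ℂ) (v : L2 ((Y × n) × s)) (a : n) :
    sliceMid a (matOp M v) = matOp M (sliceMid a v) := by
  ext ⟨y, i⟩
  change matOp M v ((y, a), i) = _
  rw [matOp_apply, matOp_apply]
  rfl

theorem matOp_mul (M : Matrix n m ℂ) (N : Matrix m k ℂ) (v : L2 (Y × k)) :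
    matOp M (matOp N v) = matOp (M * N) v := by
  ext ⟨y, i⟩
  simp only [matOp_apply, Matrix.mul_apply, Finset.mul_sum, Finset.sum_mul]
  rw [Finset.sum_comm]
  simp only [mul_assoc]

theorem matOp_one [DecidableEq n] (v : L2 (Y × n)) : matOp (1 : Matrix n n ℂ) v = v := by
  ext ⟨y, i⟩
  simp [matOp_apply, Matrix.one_apply]

theorem matOp_smul (a : ℂ) (M : Matrix n m ℂ) (v : L2 (Y × m)) :
    matOp (a • M) v = a • matOp M v := by
  ext ⟨y, i⟩
  rw [lp.coeFn_smul, Pi.smul_apply, matOp_apply, matOp_apply]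
  simp [Finset.mul_sum, mul_assoc]

theorem matOp_add (M M' : Matrix n m ℂ) (v : L2 (Y × m)) :
    matOp (M + M') v = matOp M v + matOp M' v := by
  ext ⟨y, i⟩
  rw [lp.coeFn_add, Pi.add_apply, matOp_apply, matOp_apply, matOp_apply]
  simp [add_mul, Finset.sum_add_distrib]

theorem adjoint_extendL_comp (e : Y ↪ Y') {Y'' Y₃ : Type} (e' : Y'' ↪ Y₃) (A : L2 Y →L[ℂ] L2 Y'') :
    adjoint (extendL e' ∘L A ∘L restrictL e) = extendL e ∘L adjoint A ∘L restrictL e' := by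
  simp only [adjoint_comp, adjoint_extendL, comp_assoc]
  rfl

theorem adjoint_matOp (M : Matrix n m ℂ) :
    adjoint (matOp (Y := Y) M) = matOp M.conjTranspose := by
  simp only [matOp, map_sum, LinearIsometryEquiv.map_smulₛₗ, adjoint_comp, adjoint_extendL,
    Matrix.conjTranspose_apply]
  rw [Finset.sum_comm]
  rfl

theorem adjoint_amplR (A : L2 Y →L[ℂ] L2 Y') : adjoint (amplR s A) = amplR s (adjoint A) := by
  simp only [amplR, map_sum, adjoint_extendL_comp]

theorem adjoint_amplMid (A : BOp (Y × s)) : adjoint (amplMid n A) = amplMid n (adjoint A) := by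
  simp only [amplMid, map_sum, adjoint_extendL_comp]

theorem amplR_amplR (B : L2 Y' →L[ℂ] L2 Y'') (A : L2 Y →L[ℂ] L2 Y') (v : L2 (Y × s)) :
    amplR s B (amplR s A v) = amplR s (B ∘L A) v := by
  refine slice_ext fun i => ?_
  simp only [slice_amplR, comp_apply]

theorem amplMid_amplMid (A B : BOp (Y × s)) (v : L2 ((Y × n) × s)) :
    amplMid n B (amplMid n A v) = amplMid n (B ∘L A) v := by
  refine sliceMid_ext fun i => ?_
  simp only [sliceMid_amplMid, comp_apply]

theorem amplR_sub (A B : L2 Y →L[ℂ] L2 Y') : amplR s (A - B) = amplR s A - amplR s B := by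
  simp only [amplR, sub_comp, comp_sub, Finset.sum_sub_distrib]

theorem amplR_smul (a : ℂ) (A : L2 Y →L[ℂ] L2 Y') : amplR s (a • A) = a • amplR s A := by
  simp only [amplR, smul_comp, comp_smul, Finset.smul_sum]

theorem amplR_one : amplR s (1 : BOp Y) = 1 := by
  ext1 v
  refine slice_ext fun i => ?_
  rw [slice_amplR]
  rfl

theorem amplMid_sub (A B : BOp (Y × s)) : amplMid n (A - B) = amplMid n A - amplMid n B := by
  simp only [amplMid, sub_comp, comp_sub, Finset.sum_sub_distrib]

theorem amplMid_smul (a : ℂ) (A : BOp (Y × s)) : amplMid n (a • A) = a • amplMid n A := by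
  simp only [amplMid, smul_comp, comp_smul, Finset.smul_sum]

theorem amplMid_one : amplMid n (1 : BOp (Y × s)) = 1 := by
  ext1 v
  refine sliceMid_ext fun i => ?_
  rw [sliceMid_amplMid]
  rfl

theorem amplR_star (A : L2 Y →L[ℂ] L2 Y') (A' : L2 Y →L[ℂ] L2 Y')
    (h : ∀ v, A (star v) = star (A' v)) (v : L2 (Y × s)) :
    amplR s A (star v) = star (amplR s A' v) := by
  refine slice_ext fun i => ?_
  rw [slice_amplR, slice, restrictL_star, h, restrictL_star]
  exact congrArg star (slice_amplR A' v i).symm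

theorem matOp_star (M : Matrix n m ℂ) (v : L2 (Y × m)) :
    matOp M (star v) = star (matOp (M.map star) v) := by
  ext ⟨y, i⟩
  rw [lp.star_apply, matOp_apply, matOp_apply, star_sum]
  simp [mul_comm]

theorem continuous_amplR {T : Type*} [TopologicalSpace T] {A : T → (L2 Y →L[ℂ] L2 Y')}
    (hA : Continuous A) : Continuous fun t => amplR s (A t) := by
  unfold amplR
  refine continuous_finsetSum _ fun i _ => ?_
  exact continuous_const.clm_comp (hA.clm_comp continuous_const)

theorem continuous_amplMid {T : Type*} [TopologicalSpace T] {A : T → BOp (Y × s)}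
    (hA : Continuous A) : Continuous fun t => amplMid n (A t) := by
  unfold amplMid
  refine continuous_finsetSum _ fun i _ => ?_
  exact continuous_const.clm_comp (hA.clm_comp continuous_const)

/-- `A ⊗ 1_s` commutes with `1 ⊗ M`. -/
theorem amplR_matOp (A : BOp Y) (M : Matrix n m ℂ) (v : L2 (Y × m)) :
    amplR n A (matOp M v) = matOp M (amplR m A v) := by
  refine slice_ext fun i => ?_
  simp only [slice_amplR, slice_matOp, map_sum, map_smul]

/-- An operator on `ℓ²(Y) ⊗ ℂˢ` commutes with a matrix acting on the middle factor. -/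
theorem amplMid_amplR_matOp (A : BOp (Y × s)) (M : Matrix n m ℂ) (v : L2 ((Y × m) × s)) :
    amplMid n A (amplR s (matOp M) v) = amplR s (matOp M) (amplMid m A v) := by
  refine sliceMid_ext fun i => ?_
  simp only [sliceMid_amplMid, sliceMid_amplR_matOp, map_sum, map_smul]

theorem amplR_matOp_matOp {n' : Type} [Fintype n'] (M : Matrix n m ℂ) (M' : Matrix n' s ℂ)
    (v : L2 ((Y × m) × s)) :
    amplR n' (matOp M) (matOp M' v) = matOp M' (amplR s (matOp M) v) := by
  refine slice_ext fun i => ?_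
  simp only [slice_amplR, slice_matOp, map_sum, map_smul]

end Slices


/-! ### The antilinear symmetries of $P$, of $E$ and of the pairing -/

section FibreSymmetries

variable {Y n s : Type} [Fintype n] [Fintype s] [DecidableEq n] [DecidableEq s]

theorem IsSymmetryOp.matOp_star {ε : ℤ} {S : Matrix n n ℂ} (hS : IsSymmetryOp ε S)
    (v : L2 (Y × n)) : matOp S (star v) = star (matOp S v) := by
  rw [TopIns.matOp_star, hS.real]

theorem matOp_mul_self {a : ℂ} {S : Matrix n n ℂ} (hS : S * S = a • 1) (v : L2 (Y × n)) :
    matOp S (matOp S v) = a • v := by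
  rw [matOp_mul, hS, matOp_smul, matOp_one]

theorem adjoint_matOp_matOp {k : Type} [Fintype k] [DecidableEq k] {V : Matrix n k ℂ}
    (hV : V.conjTranspose * V = 1) (v : L2 (Y × k)) : adjoint (matOp V) (matOp V v) = v := by
  rw [adjoint_matOp, matOp_mul, hV, matOp_one]

theorem matOp_adjoint_matOp {S : Matrix n n ℂ}
    (hV : S.conjTranspose * S = 1) (v : L2 (Y × n)) : matOp S (adjoint (matOp S) v) = v := by
  rw [adjoint_matOp, matOp_mul, mul_eq_one_comm.1 hV, matOp_one]

/-- The relation $S^*\overline PS=A$ is rewritten as an intertwining relation with the antilinear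
operator $S\mathcal C$, which is the form that all symmetry arguments use. Reality of $S$ lets it
pass through $\mathcal C$. -/
theorem twist_spec {ε : ℤ} {S : Matrix n n ℂ} (hS : IsSymmetryOp ε S) {P A : BOp (Y × n)}
    (h : twist S P = A) (v : L2 (Y × n)) :
    P (matOp S (star v)) = matOp S (star (A v)) := by
  have h1 : adjoint (matOp S) (star (P (star (matOp S v)))) = A v :=
    congrArg (fun B : BOp (Y × n) => B v) h
  have h2 := congrArg (matOp S) h1
  rw [matOp_adjoint_matOp hS.unitary] at h2
  have h3 := congrArg star h2
  rw [star_star] at h3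
  rw [hS.matOp_star, h3, hS.matOp_star]

theorem twist_eq_self {ε : ℤ} {S : Matrix n n ℂ} (hS : IsSymmetryOp ε S) {P : BOp (Y × n)}
    (h : twist S P = P) (v : L2 (Y × n)) :
    matOp S (star (P v)) = P (matOp S (star v)) := (twist_spec hS h v).symm

theorem twist_eq_compl {ε : ℤ} {S : Matrix n n ℂ} (hS : IsSymmetryOp ε S) {P : BOp (Y × n)}
    (h : twist S P = 1 - P) (v : L2 (Y × n)) :
    matOp S (star (P v)) = matOp S (star v) - P (matOp S (star v)) := by
  rw [twist_spec hS h v]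
  change _ = _ - matOp S (star (v - P v))
  rw [star_sub, map_sub]
  abel

/-- The antilinear operator `(S ⊗ Σ) 𝒞`. -/
def fibC (S : Matrix n n ℂ) (Sg : Matrix s s ℂ) (v : L2 ((Y × n) × s)) : L2 ((Y × n) × s) :=
  amplR s (matOp S) (matOp Sg (star v))

variable {ε σ : ℤ} {S : Matrix n n ℂ} {Sg : Matrix s s ℂ}

theorem fibC_anti : IsAntilin (fibC S Sg : L2 ((Y × n) × s) → _) where
  add u v := by simp only [fibC, star_add, map_add]
  smul a v := by simp only [fibC, star_smul, map_smul]

theorem fibC_comm (v : L2 ((Y × n) × s)) :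
    fibC S Sg v = matOp Sg (amplR s (matOp S) (star v)) := by
  rw [fibC, amplR_matOp_matOp]

theorem amplR_matOp_star (hS : IsSymmetryOp ε S) (v : L2 ((Y × n) × s)) :
    amplR s (matOp S) (star v) = star (amplR s (matOp S) v) :=
  amplR_star _ _ (fun u => hS.matOp_star u) v

/-- Both matrices are real, so they commute with $\mathcal C$ and the two signs multiply. -/
theorem fibC_sq (hS : IsSymmetryOp ε S) (hG : IsSymmetryOp σ Sg) (v : L2 ((Y × n) × s)) :
    fibC S Sg (fibC S Sg v) = ((ε * σ : ℤ) : ℂ) • v := by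
  rw [fibC_comm v, fibC, ← hG.matOp_star, matOp_mul_self hG.sq, map_smul,
    ← amplR_matOp_star hS, star_star, amplR_amplR]
  have : (matOp S ∘L matOp S : BOp (Y × n)) = (ε : ℂ) • 1 := by
    ext1 u
    exact matOp_mul_self hS.sq u
  rw [this, amplR_smul, amplR_one, smul_apply, smul_smul]
  push_cast
  rw [mul_comm]
  rfl

theorem amplRight_comm_star {P A : BOp (Y × n)}
    (h : ∀ v, matOp S (star (P v)) = A (matOp S (star v))) (v : L2 ((Y × n) × s)) :
    fibC S Sg (amplRight s P v) = amplRight s A (fibC S Sg v) := by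
  rw [fibC_comm, fibC_comm, amplRight_eq, amplRight_eq, amplR_matOp]
  congr 1
  refine slice_ext fun i => ?_
  simp only [slice_amplR, slice, restrictL_star]
  rw [← h]

theorem amplMid_comm_star {E A : BOp (Y × s)}
    (h : ∀ v, matOp Sg (star (E v)) = A (matOp Sg (star v))) (v : L2 ((Y × n) × s)) :
    fibC S Sg (amplMid n E v) = amplMid n A (fibC S Sg v) := by
  rw [fibC, fibC, amplMid_amplR_matOp]
  congr 1
  refine sliceMid_ext fun i => ?_
  simp only [sliceMid_amplMid, sliceMid_matOp, sliceMid, restrictL_star]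
  rw [← h]

theorem amplRight_one_sub (P : BOp (Y × n)) :
    amplRight s (1 - P) = 1 - amplRight s P := by
  rw [amplRight_eq, amplR_sub, amplR_one, amplRight_eq]

theorem amplMid_one_sub (E : BOp (Y × s)) :
    amplMid n (1 - E) = 1 - amplMid n E := by
  rw [amplMid_sub, amplMid_one]

end FibreSymmetries

/-! ### Eigenspaces of the chiral symmetries as gradings -/

section ChiralFrames

variable {Y n s m : Type} [Fintype n] [Fintype s] [Fintype m] [DecidableEq n]
  [DecidableEq s] [DecidableEq m] {R : Matrix s s ℂ} {c : ℂ} {Wp Wm : Matrix s m ℂ}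

theorem IsChiralFrame.swap (h : IsChiralFrame R c Wp Wm) : IsChiralFrame R (-c) Wm Wp where
  isoP := h.isoM
  isoM := h.isoP
  complete := by rw [add_comm]; exact h.complete
  eigP := by rw [h.eigM, neg_smul]
  eigM := by rw [h.eigP, neg_smul, neg_neg]

theorem IsChiralFrame.complete_apply (h : IsChiralFrame R c Wp Wm) (v : L2 (Y × s)) :
    matOp Wp (adjoint (matOp Wp) v) + matOp Wm (adjoint (matOp Wm) v) = v := by
  rw [adjoint_matOp, adjoint_matOp, matOp_mul, matOp_mul, ← matOp_add, h.complete, matOp_one]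

theorem IsChiralFrame.eigP_apply (h : IsChiralFrame R c Wp Wm) (v : L2 (Y × m)) :
    matOp R (matOp Wp v) = c • matOp Wp v := by
  rw [matOp_mul, h.eigP, matOp_smul]

theorem IsChiralFrame.eigM_apply (h : IsChiralFrame R c Wp Wm) (v : L2 (Y × m)) :
    matOp R (matOp Wm v) = -c • matOp Wm v := h.swap.eigP_apply v

/-- The $V_-$ component of $v$ has eigenvalue $-c$; since $c\ne-c$ it must vanish. -/
theorem IsChiralFrame.mem_of_eig (h : IsChiralFrame R c Wp Wm) (hc : c ≠ 0) {v : L2 (Y × s)}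
    (hv : matOp R v = c • v) : matOp Wp (adjoint (matOp Wp) v) = v := by
  have h1 := h.complete_apply v
  rw [← h1, map_add, h.eigP_apply, h.eigM_apply, smul_add, add_right_inj, neg_smul,
    neg_eq_iff_add_eq_zero, ← two_smul ℂ, smul_smul] at hv
  rcases smul_eq_zero.1 hv with h2 | h2
  · exact absurd h2 (mul_ne_zero two_ne_zero hc)
  · rwa [h2, add_zero] at h1

theorem IsChiralFrame.eig_of_mem (h : IsChiralFrame R c Wp Wm) {v : L2 (Y × s)}
    (hv : matOp Wp (adjoint (matOp Wp) v) = v) : matOp R v = c • v := by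
  rw [← hv, h.eigP_apply]

theorem subsingleton_L2 [IsEmpty m] (v : L2 (Y × m)) : v = 0 := by
  ext ⟨y, i⟩
  exact isEmptyElim i

/-- $2E-1$ anticommutes with $R$, hence maps the eigenspace of $-c$ to that of $c$. For an empty
index set $c$ is meaningless, but there is nothing to prove. -/
theorem IsChiralFrame.block_spec (h : IsChiralFrame R c Wp Wm) (hc : Nonempty m → c ≠ 0)
    {E : BOp (Y × s)} (hE : ∀ v, matOp R (E v) = matOp R v - E (matOp R v)) (z : L2 (Y × m)) :
    ((2 : ℂ) • E - 1) (matOp Wm z) = matOp Wp (chiralBlock Wp Wm E z) := by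
  rcases isEmpty_or_nonempty m with hm | hm
  · rw [subsingleton_L2 z, map_zero, map_zero, map_zero, map_zero]
  · refine (h.mem_of_eig (hc hm) ?_).symm
    change matOp R ((2 : ℂ) • E (matOp Wm z) - matOp Wm z) =
      c • ((2 : ℂ) • E (matOp Wm z) - matOp Wm z)
    rw [map_sub, map_smul, hE, h.eigM_apply, map_smul]
    module

theorem adjoint_chiralBlock {E : BOp (Y × s)} (hE : IsSelfAdjoint E) :
    adjoint (chiralBlock Wp Wm E) = chiralBlock Wm Wp E := by
  have h1 : adjoint E = E := hE.adjoint_eq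
  have h2 : adjoint (1 : BOp (Y × s)) = 1 := star_one _
  have h3 : adjoint ((2 : ℂ) • E - 1) = (2 : ℂ) • E - 1 := by
    rw [map_sub, LinearIsometryEquiv.map_smulₛₗ, h1, h2, map_ofNat]
  rw [chiralBlock, chiralBlock, adjoint_comp, adjoint_comp, adjoint_adjoint, h3, comp_assoc]

theorem IsChiralFrame.block_spec' (h : IsChiralFrame R c Wp Wm) (hc : Nonempty m → c ≠ 0)
    {E : BOp (Y × s)} (hEs : IsSelfAdjoint E)
    (hE : ∀ v, matOp R (E v) = matOp R v - E (matOp R v)) (z : L2 (Y × m)) :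
    ((2 : ℂ) • E - 1) (matOp Wp z) = matOp Wm (adjoint (chiralBlock Wp Wm E) z) := by
  rw [adjoint_chiralBlock hEs]
  exact h.swap.block_spec (fun hm => neg_ne_zero.2 (hc hm)) hE z

/-- The range of an isometry. -/
def isoRange {X Z : Type*} [NormedAddCommGroup X] [InnerProductSpace ℂ X] [CompleteSpace X]
    [NormedAddCommGroup Z] [InnerProductSpace ℂ Z] [CompleteSpace Z] (w : Z →L[ℂ] X) :
    Submodule ℂ X :=
  LinearMap.ker (((w ∘L adjoint w - 1 : X →L[ℂ] X)) : X →ₗ[ℂ] X)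

theorem mem_isoRange {X Z : Type*} [NormedAddCommGroup X] [InnerProductSpace ℂ X]
    [CompleteSpace X] [NormedAddCommGroup Z] [InnerProductSpace ℂ Z] [CompleteSpace Z]
    {w : Z →L[ℂ] X} {v : X} : v ∈ isoRange w ↔ w (adjoint w v) = v := by
  change w (adjoint w v) - v = 0 ↔ _
  rw [sub_eq_zero]

variable {Q : Type*}

theorem isStarProjection_amplRight {P : BOp Y} (hP : IsStarProjection P) :
    IsStarProjection (amplRight s P) := by
  constructor
  · ext1 v
    change amplR s P (amplR s P v) = amplR s P v
    rw [amplR_amplR]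
    exact congrArg (fun B => amplR s B v) hP.isIdempotentElem
  · change adjoint _ = _
    rw [amplRight_eq, adjoint_amplR, hP.isSelfAdjoint.adjoint_eq]

theorem isStarProjection_amplMid {P : BOp (Y × s)} (hP : IsStarProjection P) :
    IsStarProjection (amplMid n P) := by
  constructor
  · ext1 v
    change amplMid n P (amplMid n P v) = amplMid n P v
    rw [amplMid_amplMid]
    exact congrArg (fun B => amplMid n B v) hP.isIdempotentElem
  · change adjoint _ = _
    rw [adjoint_amplMid, hP.isSelfAdjoint.adjoint_eq]

theorem idem_apply {X : Type*} [NormedAddCommGroup X] [InnerProductSpace ℂ X] [CompleteSpace X]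
    {P : X →L[ℂ] X} (hP : IsStarProjection P) (v : X) : P (P v) = P v :=
  congrArg (fun B : X →L[ℂ] X => B v) hP.isIdempotentElem

theorem reflection_invol {X : Type*} [NormedAddCommGroup X] [InnerProductSpace ℂ X]
    [CompleteSpace X] {P : X →L[ℂ] X} (hP : IsStarProjection P) (v : X) :
    ((2 : ℂ) • P - 1) (((2 : ℂ) • P - 1) v) = v := by
  change (2 : ℂ) • P ((2 : ℂ) • P v - v) - ((2 : ℂ) • P v - v) = v
  rw [map_sub, map_smul, idem_apply hP]
  module

/-- A frame pair whose operator reverses its grading is graded. -/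
theorem FramePair.graded {X Z : Type*} [NormedAddCommGroup X] [InnerProductSpace ℂ X]
    [CompleteSpace X] [NormedAddCommGroup Z] [InnerProductSpace ℂ Z] [CompleteSpace Z]
    {q F : Z →L[ℂ] Z} {Q G : X →L[ℂ] X} {w w' : Z →L[ℂ] X} {M M' : Submodule ℂ X}
    (h : FramePair q F Q G M M' w w')
    (hQ : ∀ v, Q (Q v) = Q v) (hG : ∀ v, G (G v) = v) :
    GradedPair Q G M M' := by
  refine ⟨hQ, hG, ?_, ?_, ?_, ?_⟩ <;> intro v hv
  · rw [← h.surj v hv, h.commQ]; exact h.mem _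
  · rw [← h.surj' v hv, h.commQ']; exact h.mem' _
  · rw [← h.surj v hv, h.commG]; exact h.mem' _
  · rw [← h.surj' v hv, h.commG']; exact h.mem _

/-- $F$ is the upper right block, so it maps $W_-$ components to $W_+$ components: the source
grading is the eigenspace of $\Omega$ for $-1$. -/
theorem framePair_even (h : IsChiralFrame R c Wp Wm) (hc : Nonempty m → c ≠ 0)
    {P : BOp (Y × n)} {E : BOp (Y × s)} (hP : IsStarProjection P) (hEs : IsSelfAdjoint E)
    (hE : ∀ v, matOp R (E v) = matOp R v - E (matOp R v)) :
    FramePair (amplRight m P) (amplMid n (chiralBlock Wp Wm E)) (amplRight s P)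
      (amplMid n ((2 : ℂ) • E - 1)) (isoRange (matOp Wm)) (isoRange (matOp Wp))
      (matOp Wm) (matOp Wp) where
  proj := isStarProjection_amplRight hP
  iso := adjoint_matOp_matOp h.isoM
  iso' := adjoint_matOp_matOp h.isoP
  surj v hv := mem_isoRange.1 hv
  surj' v hv := mem_isoRange.1 hv
  mem z := by rw [mem_isoRange, adjoint_matOp_matOp h.isoM]
  mem' z := by rw [mem_isoRange, adjoint_matOp_matOp h.isoP]
  commQ z := amplR_matOp _ _ _
  commQ' z := amplR_matOp _ _ _
  commG z := by
    refine sliceMid_ext fun a => ?_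
    rw [sliceMid_amplMid, sliceMid_matOp, h.block_spec hc hE, sliceMid_matOp, sliceMid_amplMid]
  commG' z := by
    rw [adjoint_amplMid]
    refine sliceMid_ext fun a => ?_
    rw [sliceMid_amplMid, sliceMid_matOp, h.block_spec' hc hEs hE, sliceMid_matOp,
      sliceMid_amplMid]

theorem framePair_oddOdd {R : Matrix n n ℂ} {Wp Wm : Matrix n m ℂ}
    (h : IsChiralFrame R c Wp Wm) (hc : Nonempty m → c ≠ 0)
    {P : BOp (Y × n)} {E : BOp (Y × s)} (hE : IsStarProjection E) (hPs : IsSelfAdjoint P)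
    (hP : ∀ v, matOp R (P v) = matOp R v - P (matOp R v)) :
    FramePair (amplMid m E) (amplRight s (chiralBlock Wp Wm P)) (amplMid n E)
      (amplRight s ((2 : ℂ) • P - 1)) (isoRange (amplR s (matOp Wm)))
      (isoRange (amplR s (matOp Wp))) (amplR s (matOp Wm)) (amplR s (matOp Wp)) := by
  have iso : ∀ {V : Matrix n m ℂ}, V.conjTranspose * V = 1 → ∀ z : L2 ((Y × m) × s),
      adjoint (amplR s (matOp V)) (amplR s (matOp V) z) = z := by
    intro V hV z
    rw [adjoint_amplR]
    refine slice_ext fun i => ?_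
    rw [slice_amplR, slice_amplR, adjoint_matOp_matOp hV]
  exact
  { proj := isStarProjection_amplMid hE
    iso := iso h.isoM
    iso' := iso h.isoP
    surj := fun v hv => mem_isoRange.1 hv
    surj' := fun v hv => mem_isoRange.1 hv
    mem := fun z => by rw [mem_isoRange, iso h.isoM]
    mem' := fun z => by rw [mem_isoRange, iso h.isoP]
    commQ := fun z => amplMid_amplR_matOp _ _ _
    commQ' := fun z => amplMid_amplR_matOp _ _ _
    commG := fun z => by
      simp only [amplRight_eq]
      refine slice_ext fun a => ?_
      rw [slice_amplR, slice_amplR, h.block_spec hc hP, slice_amplR, slice_amplR]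
    commG' := fun z => by
      simp only [amplRight_eq]
      rw [adjoint_amplR]
      refine slice_ext fun a => ?_
      rw [slice_amplR, slice_amplR, h.block_spec' hc hPs hP, slice_amplR, slice_amplR] }

/-- Without a chiral symmetry the frame is trivial; self-adjointness of the reflection makes the
relation for $F^*$ the same as that for $F$. -/
theorem framePair_oddEven {P : BOp (Y × n)} {E : BOp (Y × s)} (hE : IsStarProjection E)
    (hPs : IsSelfAdjoint P) :
    FramePair (amplMid n E) (amplRight s ((2 : ℂ) • P - 1)) (amplMid n E)
      (amplRight s ((2 : ℂ) • P - 1)) ⊤ ⊤ 1 1 := by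
  have h1 : adjoint (1 : BOp ((Y × n) × s)) = 1 := star_one _
  have h2 : adjoint (amplRight s ((2 : ℂ) • P - 1)) = amplRight s ((2 : ℂ) • P - 1) := by
    rw [amplRight_eq, adjoint_amplR, map_sub, LinearIsometryEquiv.map_smulₛₗ, hPs.adjoint_eq,
      show adjoint (1 : BOp (Y × n)) = 1 from star_one _, map_ofNat]
  exact
  { proj := isStarProjection_amplMid hE
    iso := fun z => by rw [h1]; rfl
    iso' := fun z => by rw [h1]; rfl
    surj := fun v _ => by rw [h1]; rfl
    surj' := fun v _ => by rw [h1]; rfl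
    mem := fun z => trivial
    mem' := fun z => trivial
    commQ := fun z => rfl
    commQ' := fun z => rfl
    commG := fun z => rfl
    commG' := fun z => by rw [h2]; rfl }

end ChiralFrames


/-! ### Clifford relations and the signs of $\Sigma$ and $\Omega$ -/

section Clifford

theorem tensorMat_mul {k : ℕ} (a b : Fin k → Matrix (Fin 2) (Fin 2) ℂ) :
    tensorMat a * tensorMat b = tensorMat fun i => a i * b i := by
  ext x z
  simp only [tensorMat, Matrix.mul_apply, Matrix.of_apply, ← Finset.prod_mul_distrib]
  exact (Fintype.prod_sum fun i y => a i (x i) y * b i y (z i)).symm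

theorem tensorMat_one {k : ℕ} : tensorMat (fun _ : Fin k => 1) = 1 := by
  ext x y
  simp only [tensorMat, Matrix.of_apply, Matrix.one_apply]
  by_cases h : x = y
  · simp [h]
  · rw [if_neg h]
    obtain ⟨i, hi⟩ := Function.ne_iff.1 h
    exact Finset.prod_eq_zero (Finset.mem_univ i) (if_neg hi)

theorem tensorMat_conjTranspose {k : ℕ} (a : Fin k → Matrix (Fin 2) (Fin 2) ℂ) :
    (tensorMat a).conjTranspose = tensorMat fun i => (a i).conjTranspose := by
  ext x y
  simp [tensorMat, Matrix.conjTranspose_apply]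

theorem tensorMat_map_star {k : ℕ} (a : Fin k → Matrix (Fin 2) (Fin 2) ℂ) :
    (tensorMat a).map star = tensorMat fun i => (a i).map star := by
  ext x y
  simp [tensorMat]

/-- Signs arise in a single tensor factor; this pulls them out of the product. -/
theorem tensorMat_smul_at {k : ℕ} (a : Fin k → Matrix (Fin 2) (Fin 2) ℂ) (i₀ : Fin k) (r : ℂ) :
    tensorMat (fun i => (if i = i₀ then r else 1) • a i) = r • tensorMat a := by
  ext x y
  simp only [tensorMat, Matrix.of_apply, Matrix.smul_apply, smul_eq_mul, Finset.prod_mul_distrib,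
    Finset.prod_ite_eq', Finset.mem_univ, if_true]

theorem pauli_sq : pauli1 * pauli1 = 1 ∧ pauli2 * pauli2 = 1 ∧ pauli3 * pauli3 = 1 := by
  refine ⟨?_, ?_, ?_⟩ <;> ext i j <;> fin_cases i <;> fin_cases j <;>
    simp [pauli1, pauli2, pauli3]

theorem pauli_anticomm : pauli1 * pauli2 = (-1 : ℂ) • (pauli2 * pauli1) ∧
    pauli1 * pauli3 = (-1 : ℂ) • (pauli3 * pauli1) ∧
    pauli2 * pauli3 = (-1 : ℂ) • (pauli3 * pauli2) := by
  refine ⟨?_, ?_, ?_⟩ <;> ext i j <;> fin_cases i <;> fin_cases j <;>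
    simp [pauli1, pauli2, pauli3]

theorem pauli_conjTranspose : pauli1.conjTranspose = pauli1 ∧ pauli2.conjTranspose = pauli2 ∧
    pauli3.conjTranspose = pauli3 := by
  refine ⟨?_, ?_, ?_⟩ <;> ext i j <;> fin_cases i <;> fin_cases j <;>
    simp [pauli1, pauli2, pauli3]

theorem pauli_map_star : pauli1.map star = pauli1 ∧ pauli2.map star = (-1 : ℂ) • pauli2 ∧
    pauli3.map star = pauli3 := by
  refine ⟨?_, ?_, ?_⟩ <;> ext i j <;> fin_cases i <;> fin_cases j <;>
    simp [pauli1, pauli2, pauli3]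

variable (d : ℕ)

theorem gam_sq (n : ℕ) : gam d n * gam d n = 1 := by
  rw [gam, tensorMat_mul, ← tensorMat_one]
  congr 1
  ext1 i
  split_ifs
  exacts [pauli_sq.2.2, pauli_sq.1, pauli_sq.2.1, one_mul _]

theorem gam_conjTranspose (n : ℕ) : (gam d n).conjTranspose = gam d n := by
  rw [gam, tensorMat_conjTranspose]
  congr 1
  ext1 i
  split_ifs
  exacts [pauli_conjTranspose.2.2, pauli_conjTranspose.1, pauli_conjTranspose.2.1,
    Matrix.conjTranspose_one]

/-- The only imaginary factor is $\sigma_2$ in position `n / 2`, present for odd $n$. The bound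
$n<d$ ensures that this position exists. -/
theorem gam_map_star {n : ℕ} (hn : n < d) :
    (gam d n).map star = (-1 : ℂ) ^ n • gam d n := by
  rcases Nat.even_or_odd n with he | ho
  · rw [he.neg_one_pow, one_smul, gam, tensorMat_map_star]
    congr 1
    ext1 i
    split_ifs
    exacts [pauli_map_star.2.2, pauli_map_star.1, Matrix.map_one _ (star_zero _) (star_one _)]
  · have hlt : n / 2 < d / 2 := by obtain ⟨k, rfl⟩ := ho; omega
    rw [ho.neg_one_pow, gam, tensorMat_map_star, ← tensorMat_smul_at _ ⟨n / 2, hlt⟩]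
    congr 1
    ext1 i
    have he : ¬ Even n := Nat.not_even_iff_odd.2 ho
    rcases lt_trichotomy i.1 (n / 2) with h | h | h
    · have : i ≠ ⟨n / 2, hlt⟩ := fun h' => by rw [h'] at h; exact lt_irrefl _ h
      simp only [if_pos h, if_neg this, one_smul]
      exact pauli_map_star.2.2
    · have : i = ⟨n / 2, hlt⟩ := Fin.ext h
      simp only [h, lt_irrefl, if_false, if_true, he, this]
      exact pauli_map_star.2.1
    · have : i ≠ ⟨n / 2, hlt⟩ := fun h' => by rw [h'] at h; exact lt_irrefl _ h
      simp only [if_neg (show ¬ i.1 < n / 2 by omega), if_neg (show ¬ i.1 = n / 2 by omega),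
        if_neg this, one_smul]
      exact Matrix.map_one _ (star_zero _) (star_one _)

/-- The factors of the two generators commute except at position `n / 2`, where $\sigma_1$ or
$\sigma_2$ meets the $\sigma_3$ of the later generator, or $\sigma_1$ meets $\sigma_2$ if both
belong to the same pair. -/
theorem gam_anticomm_of_lt {n m : ℕ} (h : n < m) (hm : m < d) :
    gam d n * gam d m = (-1 : ℂ) • (gam d m * gam d n) := by
  have hlt : n / 2 < d / 2 := by
    rcases Nat.even_or_odd' m with ⟨k, rfl | rfl⟩ <;> omega
  rw [gam, gam, tensorMat_mul, tensorMat_mul, ← tensorMat_smul_at _ ⟨n / 2, hlt⟩]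
  congr 1
  ext1 i
  rcases lt_trichotomy i.1 (n / 2) with h1 | h1 | h1
  · have : i ≠ ⟨n / 2, hlt⟩ := fun h' => by rw [h'] at h1; exact lt_irrefl _ h1
    rw [if_neg this, if_pos h1, if_pos (show i.1 < m / 2 by omega), one_smul]
  · have : i = ⟨n / 2, hlt⟩ := Fin.ext h1
    rw [if_pos this, if_neg (show ¬ i.1 < n / 2 by omega), if_pos h1]
    by_cases h2 : n / 2 = m / 2
    · rw [if_neg (show ¬ i.1 < m / 2 by omega), if_pos (show i.1 = m / 2 by omega)]
      have hn : Even n := by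
        rcases Nat.even_or_odd' n with ⟨k, rfl | rfl⟩
        · exact even_two_mul k
        · omega
      have hm : ¬ Even m := by
        rintro ⟨k, rfl⟩
        obtain ⟨l, rfl⟩ := hn
        omega
      rw [if_pos hn, if_neg hm]
      exact pauli_anticomm.1
    · rw [if_pos (show i.1 < m / 2 by omega)]
      split_ifs
      exacts [pauli_anticomm.2.1, pauli_anticomm.2.2]
  · have : i ≠ ⟨n / 2, hlt⟩ := fun h' => by rw [h'] at h1; exact lt_irrefl _ h1
    rw [if_neg this, if_neg (show ¬ i.1 < n / 2 by omega), if_neg (show ¬ i.1 = n / 2 by omega),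
      one_smul, one_mul, mul_one]

theorem gam_anticomm {n m : ℕ} (h : n ≠ m) (hn : n < d) (hm : m < d) :
    gam d n * gam d m = (-1 : ℂ) • (gam d m * gam d n) := by
  rcases lt_or_gt_of_ne h with h | h
  · exact gam_anticomm_of_lt d h hm
  · rw [gam_anticomm_of_lt d h hn, smul_smul]
    norm_num

/-- The product of the first `k` imaginary generators. -/
def oddProd (k : ℕ) : Matrix (Spin d) (Spin d) ℂ :=
  (List.ofFn fun i : Fin k => gam d (2 * i.1 + 1)).prod

/-- The product of the first `k` generators. -/
def fullProd (k : ℕ) : Matrix (Spin d) (Spin d) ℂ := (List.ofFn fun i : Fin k => gam d i.1).prod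

theorem oddProd_succ (k : ℕ) : oddProd d (k + 1) = oddProd d k * gam d (2 * k + 1) := by
  rw [oddProd, List.ofFn_succ', List.concat_eq_append, List.prod_append, List.prod_singleton]
  rfl

theorem fullProd_succ (k : ℕ) : fullProd d (k + 1) = fullProd d k * gam d k := by
  rw [fullProd, List.ofFn_succ', List.concat_eq_append, List.prod_append, List.prod_singleton]
  rfl

theorem oddProd_zero : oddProd d 0 = 1 := by simp [oddProd]

theorem fullProd_zero : fullProd d 0 = 1 := by simp [fullProd]

theorem map_star_mul {n : Type} [Fintype n] (A B : Matrix n n ℂ) :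
    (A * B).map star = A.map star * B.map star :=
  Matrix.map_mul (f := starRingEnd ℂ)

theorem map_star_smul {n : Type} (a : ℂ) (A : Matrix n n ℂ) :
    (a • A).map star = star a • A.map star := by
  ext i j
  simp

theorem oddProd_map_star {k : ℕ} (hk : 2 * k ≤ d) :
    (oddProd d k).map star = (-1 : ℂ) ^ k • oddProd d k := by
  induction k with
  | zero => simp [oddProd_zero]
  | succ k ih =>
    rw [oddProd_succ, map_star_mul, ih (by omega), gam_map_star d (by omega),
      Odd.neg_one_pow ⟨k, rfl⟩, pow_succ]
    simp only [Matrix.smul_mul, Matrix.mul_smul, smul_smul, mul_comm]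

theorem oddProd_unitary (k : ℕ) : (oddProd d k).conjTranspose * oddProd d k = 1 := by
  induction k with
  | zero => simp [oddProd_zero]
  | succ k ih =>
    rw [oddProd_succ, Matrix.conjTranspose_mul, Matrix.mul_assoc,
      ← Matrix.mul_assoc (oddProd d k).conjTranspose, ih, Matrix.one_mul, gam_conjTranspose, gam_sq]

theorem fullProd_unitary (k : ℕ) : (fullProd d k).conjTranspose * fullProd d k = 1 := by
  induction k with
  | zero => simp [fullProd_zero]
  | succ k ih =>
    rw [fullProd_succ, Matrix.conjTranspose_mul, Matrix.mul_assoc,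
      ← Matrix.mul_assoc (fullProd d k).conjTranspose, ih, Matrix.one_mul, gam_conjTranspose,
      gam_sq]

/-- Each of the $k$ factors contributes a sign, except the generator itself, which commutes with its
own copy. -/
theorem gam_mul_oddProd {k n : ℕ} (hk : 2 * k ≤ d) (hn : n < d) :
    gam d n * oddProd d k =
      ((-1) ^ k * if Odd n ∧ n < 2 * k then -1 else 1 : ℂ) • (oddProd d k * gam d n) := by
  induction k with
  | zero => simp [oddProd_zero]
  | succ k ih =>
    rw [oddProd_succ, ← Matrix.mul_assoc, ih (by omega), Matrix.smul_mul, Matrix.mul_assoc,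
      Matrix.mul_assoc]
    by_cases h : n = 2 * k + 1
    · rw [h, if_neg (by omega), if_pos ⟨⟨k, rfl⟩, by omega⟩, pow_succ]
      ring_nf
    · rw [gam_anticomm d h hn (by omega), Matrix.mul_smul, smul_smul, pow_succ]
      congr 1
      have : (Odd n ∧ n < 2 * k) ↔ (Odd n ∧ n < 2 * (k + 1)) := by
        refine and_congr_right fun ⟨l, hl⟩ => ?_
        omega
      simp only [this]
      ring

theorem gam_mul_fullProd {k n : ℕ} (hk : k ≤ d) (hn : n < d) :
    gam d n * fullProd d k =
      ((-1) ^ k * if n < k then -1 else 1 : ℂ) • (fullProd d k * gam d n) := by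
  induction k with
  | zero => simp [fullProd_zero]
  | succ k ih =>
    rw [fullProd_succ, ← Matrix.mul_assoc, ih (by omega), Matrix.smul_mul, Matrix.mul_assoc,
      Matrix.mul_assoc]
    by_cases h : n = k
    · rw [h, if_neg (by omega), if_pos (by omega), pow_succ]
      ring_nf
    · rw [gam_anticomm d h hn (by omega), Matrix.mul_smul, smul_smul, pow_succ]
      congr 1
      have : n < k ↔ n < k + 1 := by omega
      simp only [this]
      ring

/-- Sorting the doubled product costs $k(k-1)/2$ transpositions of anticommuting generators. -/
theorem oddProd_sq {k : ℕ} (hk : 2 * k ≤ d) :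
    oddProd d k * oddProd d k = (-1 : ℂ) ^ (k * (k - 1) / 2) • 1 := by
  induction k with
  | zero => simp [oddProd_zero]
  | succ k ih =>
    rw [oddProd_succ, Matrix.mul_assoc, ← Matrix.mul_assoc (gam d (2 * k + 1)),
      gam_mul_oddProd d (by omega) (by omega), if_neg (by omega), mul_one, Matrix.smul_mul,
      Matrix.mul_smul, Matrix.mul_assoc, gam_sq, Matrix.mul_one, ih (by omega), smul_smul, ← pow_add]
    congr 2
    rcases k with _ | k
    · rfl
    · have : (k + 1 + 1) * (k + 1 + 1 - 1) = (k + 1) * (k + 1 - 1) + 2 * (k + 1) := by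
        simp only [Nat.add_sub_cancel]; ring
      rw [this]
      omega

/-- The sign of `Σ²`. -/
def sigmaSign (d : ℕ) : ℤ := (-1) ^ (d / 2 + d / 2 * (d / 2 - 1) / 2)

theorem diracSigma_eq : diracSigma d = Complex.I ^ (d / 2) • oddProd d (d / 2) := rfl

theorem diracOmega_eq : diracOmega d = (-Complex.I) ^ (d / 2) • fullProd d d := rfl

theorem isSymmetryOp_diracSigma : IsSymmetryOp (sigmaSign d) (diracSigma d) where
  real := by
    rw [diracSigma_eq, map_star_smul, oddProd_map_star d (by omega), smul_smul, star_pow, ← mul_pow]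
    simp
  unitary := by
    rw [diracSigma_eq, Matrix.conjTranspose_smul, Matrix.smul_mul, Matrix.mul_smul, smul_smul,
      oddProd_unitary, star_pow, ← mul_pow]
    simp
  sq := by
    rw [diracSigma_eq, Matrix.smul_mul, Matrix.mul_smul, smul_smul, oddProd_sq d (by omega),
      smul_smul, ← mul_pow, Complex.I_mul_I, ← pow_add, sigmaSign]
    push_cast
    rfl

/-- For an imaginary generator the sign of complex conjugation cancels the sign of its own copy in
$\Sigma$. So real and imaginary generators pass $\Sigma$ with the same sign $(-1)^{\lfloor
d/2\rfloor}=\kappa$. -/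
theorem gam_mul_diracSigma {n : ℕ} (hn : n < d) :
    (gam d n).map star * diracSigma d = (kappa d : ℂ) • (diracSigma d * gam d n) := by
  rw [gam_map_star d hn, diracSigma_eq, Matrix.smul_mul, Matrix.mul_smul,
    gam_mul_oddProd d (by omega) hn, Matrix.smul_mul, smul_smul, smul_smul, smul_smul, kappa]
  congr 1
  push_cast
  have : (-1 : ℂ) ^ n * (if Odd n ∧ n < 2 * (d / 2) then -1 else 1) = 1 := by
    rcases Nat.even_or_odd n with h | h
    · rw [if_neg (fun h' => Nat.not_odd_iff_even.2 h h'.1), h.neg_one_pow, one_mul]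
    · rw [if_pos ⟨h, by obtain ⟨k, rfl⟩ := h; omega⟩, h.neg_one_pow]
      norm_num
  linear_combination (Complex.I ^ (d / 2) * (-1) ^ (d / 2)) * this

theorem fullProd_mul_diracSigma {k : ℕ} (hk : k ≤ d) :
    (fullProd d k).map star * diracSigma d =
      (kappa d : ℂ) ^ k • (diracSigma d * fullProd d k) := by
  induction k with
  | zero => simp [fullProd_zero, Matrix.map_one]
  | succ k ih =>
    rw [fullProd_succ, map_star_mul, Matrix.mul_assoc, gam_mul_diracSigma d (by omega),
      Matrix.mul_smul, ← Matrix.mul_assoc, ih (by omega), Matrix.smul_mul, smul_smul,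
      Matrix.mul_assoc, pow_succ']

theorem kappa_sq : kappa d * kappa d = 1 := by
  rw [kappa, ← mul_pow]
  norm_num

/-- For even $d$ the generators contribute $\kappa^d=1$. What remains is the conjugation of the
prefactor $(-\imath)^{d/2}$, which yields $\kappa$. -/
theorem diracOmega_mul_diracSigma (hd : Even d) :
    (diracOmega d).map star * diracSigma d = (kappa d : ℂ) • (diracSigma d * diracOmega d) := by
  obtain ⟨r, hr⟩ := hd
  have h1 : (kappa d : ℂ) ^ d = 1 := by
    have : (kappa d : ℂ) * kappa d = 1 := by exact_mod_cast kappa_sq d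
    generalize (kappa d : ℂ) = x at this
    rw [hr, pow_add, ← mul_pow, this, one_pow]
  rw [diracOmega_eq, map_star_smul, Matrix.smul_mul, fullProd_mul_diracSigma d le_rfl, h1, one_smul,
    Matrix.mul_smul, smul_smul, kappa, star_pow]
  congr 1
  push_cast
  rw [← mul_pow]
  simp

theorem diracOmega_unitary : (diracOmega d).conjTranspose * diracOmega d = 1 := by
  rw [diracOmega_eq, Matrix.conjTranspose_smul, Matrix.smul_mul, Matrix.mul_smul, smul_smul,
    fullProd_unitary, star_pow, ← mul_pow]
  simp

theorem gam_mul_diracOmega (hd : Even d) {n : ℕ} (hn : n < d) :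
    gam d n * diracOmega d = (-1 : ℂ) • (diracOmega d * gam d n) := by
  rw [diracOmega_eq, Matrix.mul_smul, gam_mul_fullProd d le_rfl hn, if_pos hn, hd.neg_one_pow,
    Matrix.smul_mul, smul_comm, one_mul]

end Clifford


/-! ### The four signs of a pairing and their consequences -/

section PairingSymmetries

/-- The operator `T` is the compression of a graded pair with an antilinear symmetry. The signs
say: the symmetry has square `ε`, it commutes with the operator `G` up to `δ`, it sends the
projection to itself (`r = 1`) or to its complement (`r = -1`), and it preserves (`p = 1`) or swaps
(`p = -1`) the grading. -/
def PairSym (T : Σ ι : Type, BOp ι) (ε δ r p : ℤ) : Prop :=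
  ∃ (κ : Type) (q F : BOp T.1) (Q G : BOp κ) (M M' : Submodule ℂ (L2 κ))
    (w w' : L2 T.1 →L[ℂ] L2 κ) (C : L2 κ → L2 κ),
    T.2 = compressCLM q F ∧ FramePair q F Q G M M' w w' ∧ GradedPair Q G M M' ∧ AntiSym C ε δ G ∧
    (r = 1 → ∀ v, C (Q v) = Q (C v)) ∧ (r = -1 → ∀ v, C (Q v) = C v - Q (C v)) ∧
    (p = 1 → (∀ v ∈ M, C v ∈ M) ∧ ∀ v ∈ M', C v ∈ M') ∧
    (p = -1 → (∀ v ∈ M, C v ∈ M') ∧ ∀ v ∈ M', C v ∈ M)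

/-- The signs for which the kernels have even dimension. -/
def EvenKer (ε δ r p : ℤ) : Prop :=
  r = 1 ∧ p = 1 ∧ ε = -1 ∨ r = -1 ∧ p = -1 ∧ ε * δ = -1

/-- The signs for which the index vanishes. -/
def ZeroInd (ε δ r p : ℤ) : Prop :=
  ε ≠ 0 ∧ δ ≠ 0 ∧ (r = 1 ∧ p = -1 ∨ r = -1 ∧ p = 1)

/-- The signs for which the singular values in `(0, 1)` have even multiplicity. -/
def EvenSing (ε δ r p : ℤ) : Prop :=
  r = 1 ∧ p = -1 ∧ ε * δ = -1 ∨ r = -1 ∧ p = 1 ∧ ε = 1 ∧ δ * δ = 1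

variable {T : Σ ι : Type, BOp ι} {ε δ r p : ℤ}

theorem PairSym.even_nullity (h : PairSym T ε δ r p) (hs : EvenKer ε δ r p) :
    Even (nullity T) ∧ Even (ind T) := by
  obtain ⟨κ, q, F, Q, G, M, M', w, w', C, hT, hf, hg, hC, h1, h2, h3, h4⟩ := h
  have key : Even (Module.finrank ℂ (kerPair Q G M)) ∧ Even (Module.finrank ℂ (kerPair Q G M')) := by
    rcases hs with ⟨hr, hp, rfl⟩ | ⟨hr, hp, he⟩
    · exact ⟨even_kerPair_of_real hC (h1 hr) (h3 hp).1, even_kerPair_of_real hC (h1 hr) (h3 hp).2⟩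
    · exact ⟨even_kerPair_of_lagrangian hg hC he (h2 hr) (h4 hp).2,
        even_kerPair_of_lagrangian hg.symm hC he (h2 hr) (h4 hp).1⟩
  rw [nullity, ind, hT, hf.finrank_ker, hf.finrank_ker_adjoint]
  refine ⟨key.1, Even.sub ?_ ?_⟩
  · exact_mod_cast key.1
  · exact_mod_cast key.2

theorem PairSym.ind_eq_zero (h : PairSym T ε δ r p) (hs : ZeroInd ε δ r p) : ind T = 0 := by
  obtain ⟨κ, q, F, Q, G, M, M', w, w', C, hT, hf, hg, hC, h1, h2, h3, h4⟩ := h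
  obtain ⟨he, hd, hs⟩ := hs
  rw [ind, hT, hf.finrank_ker, hf.finrank_ker_adjoint, sub_eq_zero]
  congr 1
  rcases hs with ⟨hr, hp⟩ | ⟨hr, hp⟩
  · exact finrank_kerPair_eq_of_real hC he hd (h1 hr) (h4 hp).1 (h4 hp).2
  · exact finrank_kerPair_eq_of_lagrangian hg hC he (h2 hr) (h3 hp).1 (h3 hp).2

theorem PairSym.even_singMult (h : PairSym T ε δ r p) (hs : EvenSing ε δ r p) {l : ℝ}
    (hl : 0 < l) (hl1 : l < 1) : Even (singMult T.2 l) := by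
  obtain ⟨κ, q, F, Q, G, M, M', w, w', C, hT, hf, hg, hC, h1, h2, h3, h4⟩ := h
  rw [hT, hf.singMult_eq hl1]
  rcases hs with ⟨hr, hp, he⟩ | ⟨hr, hp, rfl, hd⟩
  · exact even_eigPair_of_real hg hC he (h1 hr) (h4 hp).2 hl
  · exact even_eigPair_of_lagrangian hg hC hd (h2 hr) (h3 hp).1 hl hl1

variable {Y n h s m : Type} [Fintype n] [Fintype h] [Fintype s] [Fintype m] [DecidableEq n]
  [DecidableEq h] [DecidableEq s] [DecidableEq m] {j d : ℕ} {Str Sph : Matrix n n ℂ}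
  {Vp Vm : Matrix n h ℂ} {c : ℂ} {P : BOp (Y × n)} {E : BOp (Y × Spin d)}

omit [DecidableEq n] [DecidableEq h] [DecidableEq s] [DecidableEq m] in
theorem pairingOp_even (hd : Even d) (Vp Vm : Matrix n h ℂ) (Wp Wm : Matrix s m ℂ)
    (P : BOp (Y × n)) (E : BOp (Y × s)) :
    pairingOp j d Vp Vm Wp Wm P E =
      ⟨(Y × n) × m, compressCLM (amplRight m P) (amplMid n (chiralBlock Wp Wm E))⟩ := by
  rw [pairingOp, if_pos hd]; rfl

omit [DecidableEq n] [DecidableEq h] [DecidableEq s] [DecidableEq m] in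
theorem pairingOp_odd_odd (hd : ¬ Even d) (hj : Odd j) (Vp Vm : Matrix n h ℂ)
    (Wp Wm : Matrix s m ℂ) (P : BOp (Y × n)) (E : BOp (Y × s)) :
    pairingOp j d Vp Vm Wp Wm P E =
      ⟨(Y × h) × s, compressCLM (amplMid h E) (amplRight s (chiralBlock Vp Vm P))⟩ := by
  rw [pairingOp, if_neg hd, if_pos hj]; rfl

omit [DecidableEq n] [DecidableEq h] [DecidableEq s] [DecidableEq m] in
theorem pairingOp_odd_even (hd : ¬ Even d) (hj : ¬ Odd j) (Vp Vm : Matrix n h ℂ)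
    (Wp Wm : Matrix s m ℂ) (P : BOp (Y × n)) (E : BOp (Y × s)) :
    pairingOp j d Vp Vm Wp Wm P E =
      ⟨(Y × n) × s, compressCLM (amplMid n E) (amplRight s ((2 : ℂ) • P - 1))⟩ := by
  rw [pairingOp, if_neg hd, if_neg hj]; rfl

theorem continuous_chiralBlock {τ : Type*} [TopologicalSpace τ] {Q : τ → BOp (Y × n)}
    (hQ : Continuous Q) : Continuous fun t => chiralBlock Vp Vm (Q t) := by
  unfold chiralBlock
  exact continuous_const.clm_comp ((((continuous_const_smul (2 : ℂ)).comp hQ).sub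
    continuous_const).clm_comp continuous_const)

theorem continuous_compressCLM {τ ι : Type} [TopologicalSpace τ] {q F : τ → BOp ι}
    (hq : Continuous q) (hF : Continuous F) : Continuous fun t => compressCLM (q t) (F t) := by
  unfold compressCLM
  exact ((hq.clm_comp (hF.clm_comp hq)).add continuous_const).sub hq

theorem continuous_amplRight {τ : Type*} [TopologicalSpace τ] {A : τ → BOp Y}
    (hA : Continuous A) : Continuous fun t => amplRight s (A t) := continuous_amplR hA

/-- Along a homotopy, `T` is a norm-continuous path of operators on a fixed space. -/
theorem IsHomotopy.exists_path {Wp Wm : Matrix (Spin d) m ℂ} {P : unitInterval → BOp (Y × n)}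
    {E : unitInterval → BOp (Y × Spin d)} (hom : IsHomotopy j d Str Sph Vp Vm Wp Wm P E) :
    ∃ (ι : Type) (A : unitInterval → BOp ι), Continuous A ∧
      ∀ t, pairingOp j d Vp Vm Wp Wm (P t) (E t) = ⟨ι, A t⟩ := by
  by_cases hd : Even d
  · refine ⟨_, _, ?_, fun t => pairingOp_even hd _ _ _ _ _ _⟩
    exact continuous_compressCLM (continuous_amplRight hom.contP)
      (continuous_amplMid (continuous_chiralBlock hom.contE))
  · by_cases hj : Odd j
    · refine ⟨_, _, ?_, fun t => pairingOp_odd_odd hd hj _ _ _ _ _ _⟩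
      exact continuous_compressCLM (continuous_amplMid hom.contE)
        (continuous_amplRight (continuous_chiralBlock hom.contP))
    · refine ⟨_, _, ?_, fun t => pairingOp_odd_even hd hj _ _ _ _ _ _⟩
      exact continuous_compressCLM (continuous_amplMid hom.contE)
        (continuous_amplRight (((continuous_const_smul (2 : ℂ)).comp hom.contP).sub
          continuous_const))

theorem IsHomotopy.ind_const {Wp Wm : Matrix (Spin d) m ℂ} {P : unitInterval → BOp (Y × n)}
    {E : unitInterval → BOp (Y × Spin d)} (hom : IsHomotopy j d Str Sph Vp Vm Wp Wm P E)
    (t : unitInterval) : ind (pairingOp j d Vp Vm Wp Wm (P t) (E t)) =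
      ind (pairingOp j d Vp Vm Wp Wm (P 0) (E 0)) := by
  obtain ⟨ι, A, hA, h⟩ := hom.exists_path
  have hF : ∀ t, (A t).IsFredholm := fun t => by
    have := hom.fredholm t
    rw [h] at this
    exact this
  rw [h, h]
  exact index_const_of_path hA hF t

theorem IsHomotopy.ind2_const {Wp Wm : Matrix (Spin d) m ℂ} {P : unitInterval → BOp (Y × n)}
    {E : unitInterval → BOp (Y × Spin d)} (hom : IsHomotopy j d Str Sph Vp Vm Wp Wm P E)
    (hev : ∀ t, ∀ l : ℝ, 0 < l → l < 1 →
      Even (singMult (pairingOp j d Vp Vm Wp Wm (P t) (E t)).2 l))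
    (t : unitInterval) : ind2 (pairingOp j d Vp Vm Wp Wm (P t) (E t)) =
      ind2 (pairingOp j d Vp Vm Wp Wm (P 0) (E 0)) := by
  obtain ⟨ι, A, hA, h⟩ := hom.exists_path
  have hF : ∀ t, (A t).IsFredholm := fun t => by
    have := hom.fredholm t
    rw [h] at this
    exact this
  have hev' : ∀ t, ∀ l : ℝ, 0 < l → l < 1 → Even (singMult (A t) l) := fun t => by
    have := hev t
    rw [h] at this
    exact this
  rw [h, h]
  exact parity_const_of_path hA hF hev' t

/-- The antilinear symmetry `S` of square `ε` sends `P` to itself (`a = 1`) or to its complement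
(`a = -1`). -/
structure FactorSym (ε a : ℤ) (S : Matrix n n ℂ) (P : BOp (Y × n)) : Prop where
  sym : IsSymmetryOp ε S
  keep : a = 1 → twist S P = P
  flip : a = -1 → twist S P = 1 - P
  sign : a = 1 ∨ a = -1

theorem reflection_comm {X : Type*} [NormedAddCommGroup X] [InnerProductSpace ℂ X]
    [CompleteSpace X] {C : X → X} (hC : IsAntilin C) {P : X →L[ℂ] X} {a : ℤ}
    (ha : a = 1 ∨ a = -1)
    (h1 : a = 1 → ∀ v, C (P v) = P (C v)) (h2 : a = -1 → ∀ v, C (P v) = C v - P (C v)) (v : X) :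
    C (((2 : ℂ) • P - 1) v) = (a : ℂ) • ((2 : ℂ) • P - 1) (C v) := by
  change C ((2 : ℂ) • P v - v) = (a : ℂ) • ((2 : ℂ) • P (C v) - C v)
  have : C ((2 : ℂ) • P v) = (2 : ℂ) • C (P v) := by
    have := hC.real_smul 2 (P v)
    simpa using this
  rw [hC.sub, this]
  rcases ha with rfl | rfl
  · rw [h1 rfl]; simp
  · rw [h2 rfl]
    push_cast
    module

variable {σ ε a κ : ℤ} {Sg : Matrix s s ℂ} {E' : BOp (Y × s)} {S : Matrix n n ℂ}

theorem amplMid_reflection (E : BOp (Y × s)) :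
    amplMid n ((2 : ℂ) • E - 1) = (2 : ℂ) • amplMid n E - 1 := by
  rw [amplMid_sub, amplMid_smul, amplMid_one]

theorem amplRight_reflection (P : BOp (Y × n)) :
    amplRight s ((2 : ℂ) • P - 1) = (2 : ℂ) • amplRight s P - 1 := by
  rw [amplRight_eq, amplR_sub, amplR_smul, amplR_one, amplRight_eq]

theorem one_or_neg_one_of_mul_self {a : ℤ} (h : a * a = 1) : a = 1 ∨ a = -1 :=
  mul_self_eq_one_iff.1 h

/-- The number is $\pm1$ if $\eta=1$ and $\pm\imath$ if $\eta=-1$. -/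
theorem star_eq_of_sq_real {c : ℂ} {η : ℤ} (hη : η = 1 ∨ η = -1) (h : c * c = η) :
    star c = η * c := by
  rcases hη with rfl | rfl
  · have : c = 1 ∨ c = -1 := mul_self_eq_one_iff.1 (by simpa using h)
    rcases this with rfl | rfl <;> simp
  · have h2 : (c - Complex.I) * (c + Complex.I) = 0 := by
      push_cast at h
      linear_combination h - Complex.I_mul_I
    rcases mul_eq_zero.1 h2 with h3 | h3
    · rw [sub_eq_zero.1 h3]; simp
    · rw [eq_neg_of_add_eq_zero_left h3]; simp

/-- Two graded pieces of a matrix symmetry that commutes with an antilinear operator up to a sign are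
preserved or swapped. -/
theorem chiral_map_mem {X Z : Type*} [NormedAddCommGroup X] [InnerProductSpace ℂ X]
    [CompleteSpace X] [NormedAddCommGroup Z] [InnerProductSpace ℂ Z] [CompleteSpace Z]
    {w w' : Z →L[ℂ] X} {R : X →L[ℂ] X} {c : ℂ} {C : X → X} (hC : IsAntilin C) {a p : ℤ}
    (hR : ∀ v, C (R v) = (a : ℂ) • R (C v)) (ha : a = 1 ∨ a = -1) (hc : star c = (a * p : ℤ) * c)
    (h1 : ∀ v ∈ isoRange w, R v = c • v) (h2 : ∀ v, R v = ((p : ℂ) * c) • v → v ∈ isoRange w')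
    {v : X} (hv : v ∈ isoRange w) : C v ∈ isoRange w' := by
  refine h2 _ ?_
  have h3 := hR v
  rw [h1 v hv, hC.smul, hc] at h3
  have ha2 : (a : ℂ) * a = 1 := by rcases ha with rfl | rfl <;> simp
  have h4 := congrArg (fun u => (a : ℂ) • u) h3
  simp only [smul_smul, ha2, one_smul] at h4
  rw [← h4]
  congr 1
  push_cast
  linear_combination ((p : ℂ) * c) * ha2

theorem FactorSym.right_keep (hS : FactorSym ε a S P) (ha : a = 1) (v : L2 ((Y × n) × s)) :
    fibC S Sg (amplRight s P v) = amplRight s P (fibC S Sg v) :=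
  amplRight_comm_star (twist_eq_self hS.sym (hS.keep ha)) v

theorem FactorSym.right_flip (hS : FactorSym ε a S P) (ha : a = -1) (v : L2 ((Y × n) × s)) :
    fibC S Sg (amplRight s P v) = fibC S Sg v - amplRight s P (fibC S Sg v) := by
  rw [amplRight_comm_star (A := 1 - P) (twist_eq_compl hS.sym (hS.flip ha)), amplRight_one_sub]
  rfl

theorem FactorSym.mid_keep (hS : FactorSym σ a Sg E') (ha : a = 1) (v : L2 ((Y × n) × s)) :
    fibC S Sg (amplMid n E' v) = amplMid n E' (fibC S Sg v) :=
  amplMid_comm_star (twist_eq_self hS.sym (hS.keep ha)) v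

theorem FactorSym.mid_flip (hS : FactorSym σ a Sg E') (ha : a = -1) (v : L2 ((Y × n) × s)) :
    fibC S Sg (amplMid n E' v) = fibC S Sg v - amplMid n E' (fibC S Sg v) := by
  rw [amplMid_comm_star (A := 1 - E') (twist_eq_compl hS.sym (hS.flip ha)), amplMid_one_sub]
  rfl

theorem antiSym_right (hS : FactorSym ε a S P) (hG : IsSymmetryOp σ Sg) :
    AntiSym (fibC S Sg : L2 ((Y × n) × s) → _) (ε * σ) a (amplRight s ((2 : ℂ) • P - 1)) where
  anti := fibC_anti
  sq := fibC_sq hS.sym hG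
  comm := by
    rw [amplRight_reflection]
    exact reflection_comm fibC_anti hS.sign hS.right_keep hS.right_flip

theorem antiSym_mid (hS : IsSymmetryOp ε S) (hG : FactorSym σ κ Sg E') :
    AntiSym (fibC S Sg : L2 ((Y × n) × s) → _) (ε * σ) κ (amplMid n ((2 : ℂ) • E' - 1)) where
  anti := fibC_anti
  sq := fibC_sq hS hG.sym
  comm := by
    rw [amplMid_reflection]
    exact reflection_comm fibC_anti hG.sign hG.mid_keep hG.mid_flip

theorem amplMid_reflection_invol (hE : IsStarProjection E') (v : L2 ((Y × n) × s)) :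
    amplMid n ((2 : ℂ) • E' - 1) (amplMid n ((2 : ℂ) • E' - 1) v) = v := by
  rw [amplMid_reflection]
  exact reflection_invol (isStarProjection_amplMid hE) v

theorem amplRight_reflection_invol (hP : IsStarProjection P) (v : L2 ((Y × n) × s)) :
    amplRight s ((2 : ℂ) • P - 1) (amplRight s ((2 : ℂ) • P - 1) v) = v := by
  rw [amplRight_reflection]
  exact reflection_invol (isStarProjection_amplRight hP) v

theorem KHClass.factorSym (hE : KHClass d E) :
    FactorSym (sigmaSign d) (kappa d) (diracSigma d) E :=
  ⟨isSymmetryOp_diracSigma d, hE.sigma_pos, hE.sigma_neg,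
    one_or_neg_one_of_mul_self (kappa_sq d)⟩

theorem KHClass.omega_apply (hE : KHClass d E) (hd : Even d) (v : L2 (Y × Spin d)) :
    matOp (diracOmega d) (E v) =
      matOp (diracOmega d) v - E (matOp (diracOmega d) v) := by
  have h : adjoint (matOp (diracOmega d)) (E (matOp (diracOmega d) v)) = v - E v :=
    congrArg (fun B : BOp (Y × Spin d) => B v) (hE.omega hd)
  have h2 := congrArg (matOp (diracOmega d)) h
  rw [matOp_adjoint_matOp (diracOmega_unitary d), map_sub] at h2
  rw [h2]
  abel

/-- Since $\Omega$ has real eigenvalues, this means that $C$ preserves its eigenspaces if $\kappa=1$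
and swaps them if $\kappa=-1$. -/
theorem fibC_omega (hd : Even d) (v : L2 ((Y × n) × Spin d)) :
    fibC S (diracSigma d) (matOp (diracOmega d) v) =
      (kappa d : ℂ) • matOp (diracOmega d) (fibC S (diracSigma d) v) := by
  have hreal := (isSymmetryOp_diracSigma d).real
  have h1 : diracOmega d * diracSigma d =
      (kappa d : ℂ) • (diracSigma d * (diracOmega d).map star) := by
    have h := congrArg (fun M : Matrix _ _ ℂ => M.map star) (diracOmega_mul_diracSigma d hd)
    simp only [map_star_mul, map_star_smul, hreal] at h
    have h3 : ((diracOmega d).map star).map star = diracOmega d := by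
      ext i j
      simp
    rw [h3] at h
    rw [h]
    simp
  have hk : (kappa d : ℂ) * kappa d = 1 := by exact_mod_cast kappa_sq d
  have h2 : diracSigma d * (diracOmega d).map star =
      (kappa d : ℂ) • (diracOmega d * diracSigma d) := by
    rw [h1, smul_smul, hk, one_smul]
  have h3 : star (matOp (diracOmega d) v) = matOp ((diracOmega d).map star) (star v) := by
    have := TopIns.matOp_star ((diracOmega d).map star) v
    rw [this]
    congr 3
    ext i j
    simp
  rw [fibC_comm, fibC_comm, h3, amplR_matOp_matOp, matOp_mul, h2, matOp_smul, ← matOp_mul]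

/-- $Q$ comes from $P$ and $G$ from $2E-1$: the relation of $P$ decides what happens to $Q$, and
$\kappa$ enters twice, through the relation of $E$ and through the grading by $\Omega$. -/
theorem pairSym_even (hd : Even d) {Wp Wm : Matrix (Spin d) m ℂ}
    (hW : IsChiralFrame (diracOmega d) 1 Wp Wm) (hP : IsStarProjection P) (hE : KHClass d E)
    (hS : FactorSym ε a S P) :
    PairSym (pairingOp j d Vp Vm Wp Wm P E) (ε * sigmaSign d) (kappa d) a (kappa d) := by
  rw [pairingOp_even hd]
  have hf := framePair_even (n := n) hW (fun _ => one_ne_zero) hP hE.proj.isSelfAdjoint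
    (hE.omega_apply hd)
  have hm : ∀ p : ℤ, kappa d = p → star (1 : ℂ) = (kappa d * p : ℤ) * 1 ∧
      star (-1 : ℂ) = (kappa d * p : ℤ) * (-1) := by
    rintro p rfl
    rw [kappa_sq]
    simp
  have hsign := one_or_neg_one_of_mul_self (kappa_sq d)
  have hp1 : ∀ v ∈ isoRange (matOp Wp : L2 ((Y × n) × m) →L[ℂ] _),
      matOp (diracOmega d) v = (1 : ℂ) • v := fun v hv => hW.eig_of_mem (mem_isoRange.1 hv)
  have hm1 : ∀ v ∈ isoRange (matOp Wm : L2 ((Y × n) × m) →L[ℂ] _),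
      matOp (diracOmega d) v = (-1 : ℂ) • v := fun v hv => hW.swap.eig_of_mem (mem_isoRange.1 hv)
  have hp2 : ∀ v, matOp (diracOmega d) v = (1 : ℂ) • v →
      v ∈ isoRange (matOp Wp : L2 ((Y × n) × m) →L[ℂ] _) :=
    fun v hv => mem_isoRange.2 (hW.mem_of_eig one_ne_zero hv)
  have hm2 : ∀ v, matOp (diracOmega d) v = (-1 : ℂ) • v →
      v ∈ isoRange (matOp Wm : L2 ((Y × n) × m) →L[ℂ] _) :=
    fun v hv => mem_isoRange.2 (hW.swap.mem_of_eig (neg_ne_zero.2 one_ne_zero) hv)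
  refine ⟨_, _, _, _, _, _, _, _, _, fibC S (diracSigma d), rfl, hf,
    hf.graded (idem_apply (isStarProjection_amplRight hP)) (amplMid_reflection_invol hE.proj),
    antiSym_mid hS.sym hE.factorSym, hS.right_keep, hS.right_flip, fun hk => ⟨?_, ?_⟩,
    fun hk => ⟨?_, ?_⟩⟩ <;> intro v hv
  · exact chiral_map_mem fibC_anti (fibC_omega hd) hsign (hm 1 hk).2 hm1
      (fun v hv => hm2 v (by rw [hv]; norm_num)) hv
  · exact chiral_map_mem fibC_anti (fibC_omega hd) hsign (hm 1 hk).1 hp1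
      (fun v hv => hp2 v (by rw [hv]; norm_num)) hv
  · exact chiral_map_mem fibC_anti (fibC_omega hd) hsign (hm (-1) hk).2 hm1
      (fun v hv => hp2 v (by rw [hv]; norm_num)) hv
  · exact chiral_map_mem fibC_anti (fibC_omega hd) hsign (hm (-1) hk).1 hp1
      (fun v hv => hm2 v (by rw [hv]; norm_num)) hv

/-- The roles of $P$ and $E$ are exchanged. Both graded parts are the whole space, so the grading is
preserved and swapped at once and the sign `p` is free. -/
theorem pairSym_odd_even (hd : ¬ Even d) (hj : ¬ Odd j) {Wp Wm : Matrix (Spin d) m ℂ}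
    (hP : IsStarProjection P) (hE : KHClass d E) (hS : FactorSym ε a S P) (p : ℤ) :
    PairSym (pairingOp j d Vp Vm Wp Wm P E) (ε * sigmaSign d) a (kappa d) p := by
  rw [pairingOp_odd_even hd hj]
  have hf := framePair_oddEven (n := n) (s := Spin d) hE.proj hP.isSelfAdjoint
  exact ⟨_, _, _, _, _, _, _, _, _, fibC S (diracSigma d), rfl, hf,
    hf.graded (idem_apply (isStarProjection_amplMid hE.proj)) (amplRight_reflection_invol hP),
    antiSym_right hS (isSymmetryOp_diracSigma d), hE.factorSym.mid_keep, hE.factorSym.mid_flip,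
    fun _ => ⟨fun _ _ => trivial, fun _ _ => trivial⟩,
    fun _ => ⟨fun _ _ => trivial, fun _ _ => trivial⟩⟩

theorem KClass.factorSym_tr (hS : IsFibreSymmetry j Str Sph) (hP : KClass j Str Sph P)
    (h : trs j ≠ 0) : FactorSym (trs j) 1 Str P :=
  ⟨hS.tr h, fun _ => hP.tr h, fun h => absurd h (by norm_num), Or.inl rfl⟩

theorem KClass.factorSym_ph (hS : IsFibreSymmetry j Str Sph) (hP : KClass j Str Sph P)
    (h : phs j ≠ 0) : FactorSym (phs j) (-1) Sph P :=
  ⟨hS.ph h, fun h => absurd h (by norm_num), fun _ => hP.ph h, Or.inr rfl⟩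

/-- $S_{tr}\mathcal C$ fixes $P$ and $S_{ph}\mathcal C$ sends it to its complement; the product is
linear and does the latter. -/
theorem chiral_flip (hS : IsFibreSymmetry j Str Sph) (hP : KClass j Str Sph P)
    (ht : trs j ≠ 0) (hp : phs j ≠ 0) (v : L2 (Y × n)) :
    matOp (Str * Sph) (P v) = matOp (Str * Sph) v - P (matOp (Str * Sph) v) := by
  have h1 := congrArg star (twist_eq_compl (hS.ph hp) (hP.ph hp) v)
  rw [star_sub, (hS.ph hp).matOp_star, (hS.ph hp).matOp_star, star_star, star_star] at h1
  rw [← matOp_mul, ← matOp_mul, h1, map_sub, twist_eq_self (hS.tr ht) (hP.tr ht),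
    star_star]

theorem chiral_sq (hS : IsFibreSymmetry j Str Sph) (ht : trs j ≠ 0) (hp : phs j ≠ 0) :
    Str * Sph * (Str * Sph) = ((trs j * phs j : ℤ) : ℂ) • 1 := by
  have hc := hS.comm ht hp
  rw [Matrix.mul_assoc, ← Matrix.mul_assoc Sph, ← hc, Matrix.mul_assoc Str Sph Sph,
    ← Matrix.mul_assoc, (hS.tr ht).sq, (hS.ph hp).sq, Matrix.smul_mul, Matrix.mul_smul, smul_smul,
    Matrix.one_mul]
  push_cast
  rfl

theorem IsChiralFrame.sq_eq {R : Matrix n n ℂ} (hV : IsChiralFrame R c Vp Vm) [hh : Nonempty h]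
    {a : ℂ} (hR : R * R = a • 1) : c * c = a := by
  have h1 : R * (R * Vp) = (c * c) • Vp := by
    rw [hV.eigP, Matrix.mul_smul, hV.eigP, smul_smul]
  rw [← Matrix.mul_assoc, hR, Matrix.smul_mul, Matrix.one_mul] at h1
  have h2 := congrArg (fun M => Vp.conjTranspose * M) h1
  simp only [Matrix.mul_smul, hV.isoP] at h2
  obtain ⟨i⟩ := hh
  have h3 := congrFun (congrFun h2 i) i
  simpa using h3.symm

theorem fibC_chiral (hS : IsFibreSymmetry j Str Sph) (ht : trs j ≠ 0) (hp : phs j ≠ 0)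
    (hcom : S * (Str * Sph) = Str * Sph * S) (v : L2 ((Y × n) × s)) :
    fibC S Sg (amplR s (matOp (Str * Sph)) v) =
      ((1 : ℤ) : ℂ) • amplR s (matOp (Str * Sph)) (fibC S Sg v) := by
  have hr : ∀ u : L2 (Y × n), star (matOp (Str * Sph) u) = matOp (Str * Sph) (star u) := by
    intro u
    rw [TopIns.matOp_star, map_star_mul, (hS.tr ht).real, (hS.ph hp).real]
  rw [fibC_comm, fibC_comm, amplR_matOp_matOp, ← amplR_star _ _ (fun u => (hr u).symm), amplR_amplR,
    amplR_amplR, Int.cast_one, one_smul]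
  have : (matOp S ∘L matOp (Str * Sph) : BOp (Y × n)) = matOp (Str * Sph) ∘L matOp S := by
    ext1 u
    change matOp S (matOp _ u) = matOp _ (matOp S u)
    rw [matOp_mul, matOp_mul, hcom]
  rw [this]

theorem mem_isoRange_amplR {V : Matrix n h ℂ} {v : L2 ((Y × n) × s)} :
    v ∈ isoRange (amplR s (matOp V) : L2 ((Y × h) × s) →L[ℂ] _) ↔
      ∀ i, slice i v ∈ isoRange (matOp V : L2 (Y × h) →L[ℂ] L2 (Y × n)) := by
  simp only [mem_isoRange, adjoint_amplR]
  constructor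
  · intro hv i
    rw [← slice_amplR, ← slice_amplR, hv]
  · intro hv
    refine slice_ext fun i => ?_
    rw [slice_amplR, slice_amplR, hv]

theorem IsChiralFrame.amplR_eig {R : Matrix n n ℂ} (hV : IsChiralFrame R c Vp Vm)
    {v : L2 ((Y × n) × s)}
    (hv : v ∈ isoRange (amplR s (matOp Vp) : L2 ((Y × h) × s) →L[ℂ] _)) :
    amplR s (matOp R) v = c • v := by
  rw [mem_isoRange_amplR] at hv
  refine slice_ext fun i => ?_
  rw [slice_amplR, map_smul]
  exact hV.eig_of_mem (mem_isoRange.1 (hv i))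

theorem IsChiralFrame.mem_amplR {R : Matrix n n ℂ} (hV : IsChiralFrame R c Vp Vm) (hc : c ≠ 0)
    {v : L2 ((Y × n) × s)} (hv : amplR s (matOp R) v = c • v) :
    v ∈ isoRange (amplR s (matOp Vp) : L2 ((Y × h) × s) →L[ℂ] _) := by
  rw [mem_isoRange_amplR]
  intro i
  refine mem_isoRange.2 (hV.mem_of_eig hc ?_)
  rw [← map_smul, ← hv]
  exact (slice_amplR _ _ _).symm

theorem isoRange_eq_zero [IsEmpty h] {V : Matrix n h ℂ} {v : L2 ((Y × n) × s)}
    (hv : v ∈ isoRange (amplR s (matOp V) : L2 ((Y × h) × s) →L[ℂ] _)) : v = 0 := by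
  rw [mem_isoRange_amplR] at hv
  refine slice_ext fun i => ?_
  rw [← mem_isoRange.1 (hv i), subsingleton_L2 (adjoint (matOp V) _), map_zero, map_zero]

/-- The real matrix $R$ commutes with $C$, so $C$ maps the eigenspace of $c$ to that of $\overline
c$. As $c^2=S_{tr}^2S_{ph}^2=\pm1$, $\overline c$ is $c$ or $-c$ according to this sign, which is
therefore the sign of the grading. -/
theorem pairSym_odd_odd (hd : ¬ Even d) (hj : Odd j) {Wp Wm : Matrix (Spin d) m ℂ}
    (hFS : IsFibreSymmetry j Str Sph) (ht : trs j ≠ 0) (hp : phs j ≠ 0)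
    (hpr : trs j * phs j = 1 ∨ trs j * phs j = -1)
    (hV : IsChiralFrame (Str * Sph) c Vp Vm)
    (hP : KClass j Str Sph P) (hE : KHClass d E) (hS : FactorSym ε a S P)
    (hcom : S * (Str * Sph) = Str * Sph * S) :
    PairSym (pairingOp j d Vp Vm Wp Wm P E) (ε * sigmaSign d) a (kappa d) (trs j * phs j) := by
  rw [pairingOp_odd_odd hd hj]
  have hc0 : Nonempty h → c ≠ 0 := by
    rintro hh rfl
    have h1 := hV.sq_eq (chiral_sq hFS ht hp)
    rw [mul_zero] at h1
    have h2 : trs j * phs j = 0 := by exact_mod_cast h1.symm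
    omega
  have hf := framePair_oddOdd (s := Spin d) hV hc0 hE.proj hP.proj.isSelfAdjoint
    (chiral_flip hFS hP ht hp)
  have hcomm := fibC_chiral (Y := Y) (Sg := diracSigma d) hFS ht hp hcom
  -- Over empty frames $c$ is unconstrained, but then both graded parts are zero.
  have hz : ∀ V : Matrix n h ℂ, IsEmpty h →
      ∀ v ∈ isoRange (amplR (Spin d) (matOp V) : L2 ((Y × h) × Spin d) →L[ℂ] _),
        ∀ W : Matrix n h ℂ, fibC S (diracSigma d) v ∈
          isoRange (amplR (Spin d) (matOp W) : L2 ((Y × h) × Spin d) →L[ℂ] _) := by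
    intro V _ v hv W
    rw [isoRange_eq_zero hv, fibC_anti.zero]
    exact zero_mem _
  have hcs : Nonempty h → star c = ((1 : ℤ) * (trs j * phs j) : ℤ) * c := by
    intro hh
    have := star_eq_of_sq_real hpr (hV.sq_eq (chiral_sq hFS ht hp))
    rw [one_mul, this]
  have hcs' : Nonempty h → star (-c) = ((1 : ℤ) * (trs j * phs j) : ℤ) * (-c) := by
    intro hh
    rw [star_neg, hcs hh]
    ring
  refine ⟨_, _, _, _, _, _, _, _, _, fibC S (diracSigma d), rfl, hf,
    hf.graded (idem_apply (isStarProjection_amplMid hE.proj)) (amplRight_reflection_invol hP.proj),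
    antiSym_right hS (isSymmetryOp_diracSigma d), hE.factorSym.mid_keep, hE.factorSym.mid_flip,
    fun hk => ⟨?_, ?_⟩, fun hk => ⟨?_, ?_⟩⟩ <;> intro v hv <;>
    rcases isEmpty_or_nonempty h with hh | hh <;> try exact hz _ hh v hv _
  · exact chiral_map_mem fibC_anti hcomm (Or.inl rfl) (hcs' hh) (fun v hv => hV.swap.amplR_eig hv)
      (fun v hv => hV.swap.mem_amplR (neg_ne_zero.2 (hc0 hh)) (by rw [hv, hk]; norm_num)) hv
  · exact chiral_map_mem fibC_anti hcomm (Or.inl rfl) (hcs hh) (fun v hv => hV.amplR_eig hv)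
      (fun v hv => hV.mem_amplR (hc0 hh) (by rw [hv, hk]; norm_num)) hv
  · exact chiral_map_mem fibC_anti hcomm (Or.inl rfl) (hcs' hh) (fun v hv => hV.swap.amplR_eig hv)
      (fun v hv => hV.mem_amplR (hc0 hh) (by rw [hv, hk]; norm_num)) hv
  · exact chiral_map_mem fibC_anti hcomm (Or.inl rfl) (hcs hh) (fun v hv => hV.amplR_eig hv)
      (fun v hv => hV.swap.mem_amplR (neg_ne_zero.2 (hc0 hh)) (by rw [hv, hk]; norm_num)) hv

/-- The signs of the symmetry of a pairing that is induced by a symmetry of `P` with signs `ε` and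
`a`, for a class `j` with signs `t` and `u` of its symmetries. -/
def pairSigns (d : ℕ) (t u ε a : ℤ) (Φ : ℤ → ℤ → ℤ → ℤ → Prop) : Prop :=
  if Even d then Φ (ε * sigmaSign d) (kappa d) a (kappa d)
  else if t * u = 0 then ∃ p, Φ (ε * sigmaSign d) a (kappa d) p
  else Φ (ε * sigmaSign d) a (kappa d) (t * u)

theorem odd_iff_trs_mul_phs {j : ℕ} (hj : j < 8) : Odd j ↔ trs j * phs j ≠ 0 := by
  interval_cases j <;> simp [trs, phs] <;> decide

theorem pairSym_of_factorSym (hj : j < 8) (hFS : IsFibreSymmetry j Str Sph)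
    {Wp Wm : Matrix (Spin d) m ℂ} (hV : Odd j → IsChiralFrame (Str * Sph) c Vp Vm)
    (hW : Even d → IsChiralFrame (diracOmega d) 1 Wp Wm)
    (hP : KClass j Str Sph P) (hE : KHClass d E) (hS : FactorSym ε a S P)
    (hcom : trs j ≠ 0 → phs j ≠ 0 → S * (Str * Sph) = Str * Sph * S)
    {Φ : ℤ → ℤ → ℤ → ℤ → Prop} (h : pairSigns d (trs j) (phs j) ε a Φ) :
    ∃ ε' δ' r' p', Φ ε' δ' r' p' ∧ PairSym (pairingOp j d Vp Vm Wp Wm P E) ε' δ' r' p' := by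
  rw [pairSigns] at h
  by_cases hd : Even d
  · rw [if_pos hd] at h
    exact ⟨_, _, _, _, h, pairSym_even hd (hW hd) hP.proj hE hS⟩
  · rw [if_neg hd] at h
    by_cases ho : Odd j
    · have h1 := (odd_iff_trs_mul_phs hj).1 ho
      rw [if_neg h1] at h
      have ht := left_ne_zero_of_mul h1
      have hp := right_ne_zero_of_mul h1
      refine ⟨_, _, _, _, h, pairSym_odd_odd hd ho hFS ht hp ?_ (hV ho) hP hE hS (hcom ht hp)⟩
      interval_cases j <;> simp [trs, phs] at h1 ⊢
    · have h1 := mt (odd_iff_trs_mul_phs hj).2 ho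
      rw [not_ne_iff] at h1
      rw [if_pos h1] at h
      obtain ⟨p, h⟩ := h
      exact ⟨_, _, _, _, h, pairSym_odd_even hd ho hP.proj hE hS p⟩

/-- One of the symmetries of class `j` induces a symmetry with the signs `Φ` of the pairings in
dimension `d`. -/
def ClassSigns (j d : ℕ) (Φ : ℤ → ℤ → ℤ → ℤ → Prop) : Prop :=
  trs j ≠ 0 ∧ pairSigns d (trs j) (phs j) (trs j) 1 Φ ∨
    phs j ≠ 0 ∧ pairSigns d (trs j) (phs j) (phs j) (-1) Φ

theorem exists_pairSym (hj : j < 8) (hFS : IsFibreSymmetry j Str Sph)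
    {Wp Wm : Matrix (Spin d) m ℂ} (hV : Odd j → IsChiralFrame (Str * Sph) c Vp Vm)
    (hW : Even d → IsChiralFrame (diracOmega d) 1 Wp Wm)
    (hP : KClass j Str Sph P) (hE : KHClass d E)
    {Φ : ℤ → ℤ → ℤ → ℤ → Prop} (h : ClassSigns j d Φ) :
    ∃ ε' δ' r' p', Φ ε' δ' r' p' ∧ PairSym (pairingOp j d Vp Vm Wp Wm P E) ε' δ' r' p' := by
  rcases h with ⟨ht, h⟩ | ⟨hp, h⟩
  · refine pairSym_of_factorSym hj hFS hV hW hP hE (hP.factorSym_tr hFS ht) (fun _ hp => ?_) h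
    rw [Matrix.mul_assoc, hFS.comm ht hp]
  · refine pairSym_of_factorSym hj hFS hV hW hP hE (hP.factorSym_ph hFS hp) (fun ht _ => ?_) h
    rw [← Matrix.mul_assoc, ← hFS.comm ht hp]

/-- The entries of the table without index theorem in which the parity of the kernel is not
constant. -/
def IsFlip (j d : ℕ) : Prop :=
  (j, d) ∈ ([(0, 2), (2, 4), (4, 6), (6, 8), (7, 1), (1, 3), (3, 5), (5, 7), (0, 1), (2, 3), (4, 5),
    (6, 7), (1, 2), (3, 4), (5, 6), (7, 8)] : List (ℕ × ℕ))

end PairingSymmetries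

/-- What the signs have to give for an entry of the table. -/
def entrySigns (j d : ℕ) : Entry → Prop
  | .zero => ClassSigns j d ZeroInd ∧ (ClassSigns j d EvenKer ∨ IsFlip j d)
  | .int => True
  | .even _ => ClassSigns j d EvenKer
  | .two _ => ClassSigns j d ZeroInd ∧ ClassSigns j d EvenSing

/-- Unfolded, each of the 64 entries is a statement about explicit signs $\pm1$. -/
theorem entrySigns_periodicTable {j d : ℕ} (hj : j < 8) (hd : 1 ≤ d) (hd8 : d ≤ 8) :
    entrySigns j d (periodicTable j d) := by
  have hk : ∀ (x y : ℤ) (Φ : ℤ → ℤ → ℤ → ℤ → Prop) (u v w : ℤ), (Φ u v w 1 ∨ Φ u v w (-1)) →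
    ∃ p, Φ u v w p := fun x y Φ u v w h => h.elim (fun h => ⟨_, h⟩) (fun h => ⟨_, h⟩)
  interval_cases j <;> interval_cases d <;>
    simp [periodicTable, entrySigns, ClassSigns, pairSigns, trs, phs, ZeroInd, EvenKer, EvenSing,
      IsFlip, sigmaSign, kappa, Nat.even_iff]


open scoped Matrix

/-! ### Antiunitary symmetries and spectral projections -/

section Twist

variable {Y n : Type} [Fintype n]

theorem inner_star_star {ι : Type} (u v : L2 ι) :
    inner ℂ (star u) (star v) = star (inner ℂ u v) := by
  rw [lp.inner_eq_tsum, lp.inner_eq_tsum]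
  rw [show star (∑' i, inner ℂ (u i) (v i)) = ∑' i, star (inner ℂ (u i) (v i)) from tsum_star]
  refine tsum_congr fun i => ?_
  simp [mul_comm]

/-- Antiunitary operators of square `ε`. -/
structure IsAntiunitary {X : Type*} [NormedAddCommGroup X] [InnerProductSpace ℂ X] (ε : ℤ)
    (J : X →L⋆[ℂ] X) : Prop where
  sq : ∀ v, J (J v) = (ε : ℂ) • v
  sign : ε * ε = 1
  inner_map : ∀ u v, inner ℂ (J u) (J v) = star (inner ℂ u v)

section Antiunitary

variable {X : Type*} [NormedAddCommGroup X] [InnerProductSpace ℂ X] [CompleteSpace X] {ε : ℤ}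
  {J : X →L⋆[ℂ] X}

/-- `J⁻¹ A J`. -/
def conjBy (ε : ℤ) (J : X →L⋆[ℂ] X) (A : X →L[ℂ] X) : X →L[ℂ] X :=
  (ε : ℂ) • J.comp (A.comp J)

omit [CompleteSpace X] in
theorem conjBy_apply (A : X →L[ℂ] X) (v : X) : conjBy ε J A v = (ε : ℂ) • J (A (J v)) := rfl

omit [CompleteSpace X] in
theorem conjBy_sub (A B : X →L[ℂ] X) : conjBy ε J (A - B) = conjBy ε J A - conjBy ε J B := by
  ext1 v
  simp only [conjBy_apply, sub_apply, map_sub, smul_sub]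

omit [CompleteSpace X] in
theorem map_intCast_smul (n : ℤ) (v : X) : J ((n : ℂ) • v) = (n : ℂ) • J v := by
  rw [map_smulₛₗ]
  simp

omit [CompleteSpace X] in
theorem IsAntiunitary.sign_cast (hJ : IsAntiunitary ε J) : (ε : ℂ) * ε = 1 := by
  exact_mod_cast hJ.sign

omit [CompleteSpace X] in
theorem IsAntiunitary.conjBy_mul (hJ : IsAntiunitary ε J) (A B : X →L[ℂ] X) :
    conjBy ε J A * conjBy ε J B = conjBy ε J (A * B) := by
  ext1 v
  change conjBy ε J A (conjBy ε J B v) = conjBy ε J (A * B) v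
  simp only [conjBy_apply, map_intCast_smul, hJ.sq, smul_smul, hJ.sign_cast, one_smul]
  rfl

omit [CompleteSpace X] in
theorem IsAntiunitary.inner_conjBy (hJ : IsAntiunitary ε J) (A : X →L[ℂ] X) (u v : X) :
    inner ℂ (conjBy ε J A u) v = inner ℂ (J v) (A (J u)) := by
  have h := hJ.inner_map (A (J u)) (J v)
  rw [hJ.sq, inner_smul_right] at h
  rw [conjBy_apply, inner_smul_left, ← inner_conj_symm (J v)]
  simp only [map_intCast]
  exact h

theorem IsAntiunitary.conjBy_nonneg (hJ : IsAntiunitary ε J) {A : X →L[ℂ] X} (hA : 0 ≤ A) :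
    0 ≤ conjBy ε J A := by
  have h := (nonneg_iff_isPositive A).1 hA
  rw [nonneg_iff_isPositive, isPositive_def]
  refine ⟨fun u v => ?_, fun v => ?_⟩
  · change inner ℂ (conjBy ε J A u) v = inner ℂ u (conjBy ε J A v)
    rw [← inner_conj_symm u, hJ.inner_conjBy, hJ.inner_conjBy, inner_conj_symm]
    exact (h.isSymmetric _ _).symm
  · rw [reApplyInnerSelf_apply, hJ.inner_conjBy]
    exact h.re_inner_nonneg_right (J v)

/-- Conjugation by $J$ is multiplicative and preserves positivity, so the conjugates of $A^\pm$ are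
positive, have product zero and the right difference. These properties determine positive and
negative parts; no functional calculus for antilinear maps is needed. -/
theorem IsAntiunitary.conjBy_posPart (hJ : IsAntiunitary ε J) {A : X →L[ℂ] X}
    (hA : IsSelfAdjoint A) :
    (conjBy ε J A)⁺ = conjBy ε J (A⁺) ∧ (conjBy ε J A)⁻ = conjBy ε J (A⁻) := by
  have h0 : conjBy ε J (0 : X →L[ℂ] X) = 0 := by
    ext1 v
    simp [conjBy_apply]
  have h1 : conjBy ε J A = conjBy ε J (A⁺) - conjBy ε J (A⁻) := by
    rw [← conjBy_sub, CFC.posPart_sub_negPart A]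
  exact CFC.posPart_negPart_unique h1
    (by rw [hJ.conjBy_mul, CFC.posPart_mul_negPart, h0])
    (hJ.conjBy_nonneg (CFC.posPart_nonneg A)) (hJ.conjBy_nonneg (CFC.negPart_nonneg A))

omit [CompleteSpace X] in
theorem IsAntiunitary.conjBy_eq_iff (hJ : IsAntiunitary ε J) {A B : X →L[ℂ] X} :
    conjBy ε J A = B ↔ ∀ v, A (J v) = J (B v) := by
  constructor
  · rintro rfl v
    rw [conjBy_apply, map_intCast_smul, hJ.sq, smul_smul, hJ.sign_cast, one_smul]
  · intro h
    ext1 v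
    rw [conjBy_apply, h, hJ.sq, smul_smul, hJ.sign_cast, one_smul]

omit [CompleteSpace X] in
theorem IsAntiunitary.map_orthogonal (hJ : IsAntiunitary ε J) {K : Submodule ℂ X}
    (h : ∀ v ∈ K, J v ∈ K) {v : X} (hv : v ∈ Kᗮ) : J v ∈ Kᗮ := by
  rw [Submodule.mem_orthogonal] at hv ⊢
  intro u hu
  have h1 := hJ.inner_map (J u) v
  rw [hv _ (h u hu), star_zero, hJ.sq, inner_smul_left] at h1
  refine (mul_eq_zero.1 h1).resolve_left fun h2 => ?_
  have h3 : (ε : ℂ) = 0 := by simpa using h2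
  have h4 := hJ.sign_cast
  rw [h3, mul_zero] at h4
  exact zero_ne_one h4

omit [CompleteSpace X] in
theorem starProjection_map_of_mapsTo {K K' : Submodule ℂ X} [K.HasOrthogonalProjection]
    [K'.HasOrthogonalProjection]
    (h1 : ∀ v ∈ K, J v ∈ K') (h2 : ∀ v ∈ Kᗮ, J v ∈ K'ᗮ) (v : X) :
    J (K.starProjection v) = K'.starProjection (J v) := by
  have h3 : v = K.starProjection v + (v - K.starProjection v) := by abel
  conv_rhs => rw [h3]
  rw [map_add, map_add, Submodule.starProjection_eq_self_iff.2
    (h1 _ (Submodule.starProjection_apply_mem K v)),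
    (Submodule.starProjection_apply_eq_zero_iff K').2
      (h2 _ (Submodule.sub_starProjection_mem_orthogonal v)), add_zero]

omit [CompleteSpace X] in
theorem starProjection_map_compl {K : Submodule ℂ X} [K.HasOrthogonalProjection]
    (h1 : ∀ v ∈ K, J v ∈ Kᗮ) (h2 : ∀ v ∈ Kᗮ, J v ∈ K) (v : X) :
    J (K.starProjection v) = J v - K.starProjection (J v) := by
  have h3 : v = K.starProjection v + (v - K.starProjection v) := by abel
  have h4 := Submodule.starProjection_eq_self_iff.2
    (h2 _ (Submodule.sub_starProjection_mem_orthogonal v))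
  have h5 := (Submodule.starProjection_apply_eq_zero_iff K).2
    (h1 _ (Submodule.starProjection_apply_mem K v))
  have h6 : K.starProjection (J v) = J (v - K.starProjection v) := by
    conv_lhs => rw [h3]
    rw [map_add, map_add, h4, h5, zero_add]
  rw [h6, map_sub]
  abel

/-- Here it matters that $0$ is not an eigenvalue: the projection of $v$ to $\mathrm{Ker}\,A^+$ is
annihilated by $A^+$ and by $A^-$, hence by $A$. -/
theorem mem_orthogonal_of_negPart {A : X →L[ℂ] X} (hA : IsSelfAdjoint A)
    (h0 : ∀ v, A v = 0 → v = 0) {v : X} (hv : A⁻ v = 0) : v ∈ ((A⁺).ker)ᗮ := by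
  have h1 := Submodule.sub_starProjection_mem_orthogonal (K := (A⁺).ker) v
  have h2 := negPart_eq_zero_of_mem_orthogonal h1
  have h3 : A⁺ ((A⁺).ker.starProjection v) = 0 := Submodule.starProjection_apply_mem (A⁺).ker v
  rw [map_sub, hv, zero_sub, neg_eq_zero] at h2
  have h4 := h0 ((A⁺).ker.starProjection v)
    (by rw [← posPart_sub_negPart_apply hA, h2, h3, sub_zero])
  rwa [h4, sub_zero] at h1

theorem isStarProjection_fermiProj (H : X →L[ℂ] X) (μ : ℝ) : IsStarProjection (fermiProj H μ) :=
  isStarProjection_starProjection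

theorem IsAntiunitary.fermiProj_comm (hJ : IsAntiunitary ε J) {H : X →L[ℂ] X}
    (hH : IsSelfAdjoint H) (μ : ℝ) (h : ∀ v, H (J v) = J (H v)) (v : X) :
    J (fermiProj H μ v) = fermiProj H μ (J v) := by
  have hA := isSelfAdjoint_sub_real hH μ
  have h1 : conjBy ε J (H - (μ : ℂ) • 1) = H - (μ : ℂ) • 1 := by
    rw [hJ.conjBy_eq_iff]
    intro v
    change H (J v) - (μ : ℂ) • J v = J (H v - (μ : ℂ) • v)
    rw [map_sub, map_smulₛₗ, h]
    simp
  have h2 := (hJ.conjBy_posPart hA).1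
  rw [h1, eq_comm, hJ.conjBy_eq_iff] at h2
  have hk : ∀ v ∈ ((H - (μ : ℂ) • (1 : X →L[ℂ] X))⁺).ker,
      J v ∈ ((H - (μ : ℂ) • (1 : X →L[ℂ] X))⁺).ker := by
    intro v hv
    have hv : (H - (μ : ℂ) • (1 : X →L[ℂ] X))⁺ v = 0 := hv
    change (H - (μ : ℂ) • (1 : X →L[ℂ] X))⁺ (J v) = 0
    rw [h2, hv, map_zero]
  exact starProjection_map_of_mapsTo hk (fun v hv => hJ.map_orthogonal hk hv) v

/-- $J^{-1}HJ=-H$ exchanges $H^+$ and $H^-$. For injective $H$ the kernels of $H^+$ and $H^-$ are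
orthogonal complements, so $J$ exchanges the range and the kernel of the projection. -/
theorem IsAntiunitary.fermiProj_compl (hJ : IsAntiunitary ε J) {H : X →L[ℂ] X}
    (hH : IsSelfAdjoint H) (h0 : ∀ v, H v = 0 → v = 0) (h : ∀ v, H (J v) = -J (H v)) (v : X) :
    J (fermiProj H 0 v) = J v - fermiProj H 0 (J v) := by
  have h1 : conjBy ε J H = -H := by
    rw [hJ.conjBy_eq_iff]
    intro v
    rw [h, neg_apply, map_neg]
  obtain ⟨h2, h3⟩ := hJ.conjBy_posPart hH
  rw [h1, CFC.posPart_neg, eq_comm, hJ.conjBy_eq_iff] at h2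
  rw [h1, CFC.negPart_neg, eq_comm, hJ.conjBy_eq_iff] at h3
  have e : H - ((0 : ℝ) : ℂ) • (1 : X →L[ℂ] X) = H := by simp
  refine starProjection_map_compl (fun v hv => ?_) (fun v hv => ?_) v
  · have hv : (H - ((0 : ℝ) : ℂ) • (1 : X →L[ℂ] X))⁺ v = 0 := hv
    rw [e] at hv ⊢
    exact mem_orthogonal_of_negPart hH h0 (by rw [h3, hv, map_zero])
  · rw [e] at hv
    have hv : H⁻ v = 0 := negPart_eq_zero_of_mem_orthogonal hv
    change (H - ((0 : ℝ) : ℂ) • (1 : X →L[ℂ] X))⁺ (J v) = 0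
    rw [e, h2, hv, map_zero]

end Antiunitary

theorem twist_apply (S : Matrix n n ℂ) (A : BOp (Y × n)) (v : L2 (Y × n)) :
    twist S A v = adjoint (matOp S) (star (A (star (matOp S v)))) := rfl

variable [DecidableEq n] {ε : ℤ} {S : Matrix n n ℂ}

theorem IsSymmetryOp.adjoint_apply (hS : IsSymmetryOp ε S) (hε : ε * ε = 1) (v : L2 (Y × n)) :
    adjoint (matOp S) v = (ε : ℂ) • matOp S v := by
  have h1 : (ε : ℂ) * ε = 1 := by exact_mod_cast hε
  have h2 : v = matOp S ((ε : ℂ) • matOp S v) := by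
    rw [map_smul, matOp_mul_self hS.sq, smul_smul, h1, one_smul]
  conv_lhs => rw [h2]
  rw [adjoint_matOp_matOp hS.unitary]

theorem twist_eq_of_apply (hS : IsSymmetryOp ε S) (hε : ε * ε = 1) {P A : BOp (Y × n)}
    (h : ∀ v, matOp S (star (P v)) = A (matOp S (star v))) : twist S P = A := by
  have h1 : (ε : ℂ) * ε = 1 := by exact_mod_cast hε
  ext1 v
  rw [twist_apply, hS.adjoint_apply hε, h, star_star, matOp_mul_self hS.sq, map_smul, smul_smul,
    h1, one_smul]

/-- The antilinear operator `S 𝒞`. -/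
def symOp (S : Matrix n n ℂ) : L2 (Y × n) →L⋆[ℂ] L2 (Y × n) :=
  (matOp S).comp ((starₗᵢ ℂ : L2 (Y × n) ≃ₗᵢ⋆[ℂ] L2 (Y × n)) : L2 (Y × n) →L⋆[ℂ] L2 (Y × n))

theorem symOp_apply (S : Matrix n n ℂ) (v : L2 (Y × n)) : symOp S v = matOp S (star v) := rfl

theorem IsSymmetryOp.isAntiunitary (hS : IsSymmetryOp ε S) (hε : ε * ε = 1) :
    IsAntiunitary ε (symOp S : L2 (Y × n) →L⋆[ℂ] _) where
  sq v := by rw [symOp_apply, symOp_apply, ← hS.matOp_star, star_star, matOp_mul_self hS.sq]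
  sign := hε
  inner_map u v := by
    rw [symOp_apply, symOp_apply, ← adjoint_inner_right, adjoint_matOp_matOp hS.unitary,
      inner_star_star]

end Twist

/-! ### Symmetries of the Fermi projection -/

section Fermi

variable {Y n : Type} [Fintype n] [DecidableEq n] {j : ℕ} {Str Sph : Matrix n n ℂ}
  {H : BOp (Y × n)} {μ : ℝ}

theorem trs_sq {j : ℕ} (h : trs j ≠ 0) : trs j * trs j = 1 := by
  unfold trs at *
  split at * <;> simp_all

theorem phs_sq {j : ℕ} (h : phs j ≠ 0) : phs j * phs j = 1 := by
  unfold phs at *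
  split at * <;> simp_all

theorem kClass_fermiProj (hS : IsFibreSymmetry j Str Sph) (hH : IsHamiltonian j Str Sph H μ) :
    KClass j Str Sph (fermiProj H μ) where
  proj := isStarProjection_fermiProj H μ
  tr ht := by
    have hst := hS.tr ht
    refine twist_eq_of_apply hst (trs_sq ht) ?_
    exact (hst.isAntiunitary (trs_sq ht)).fermiProj_comm hH.selfAdjoint μ
      (fun v => twist_spec hst (hH.tr ht) v)
  ph hp := by
    have hst := hS.ph hp
    refine twist_eq_of_apply hst (phs_sq hp) ?_
    rw [hH.level hp]
    exact (hst.isAntiunitary (phs_sq hp)).fermiProj_compl hH.selfAdjoint (hH.gap hp)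
      (fun v => (twist_spec hst (hH.ph hp) v).trans
        (by rw [symOp_apply, neg_apply, star_neg, map_neg]))

end Fermi

/-! ### Symmetries of the Hardy projection -/

section Hardy

variable {s : Type} [Fintype s] [DecidableEq s]

/-- $M^2=r^2$ leaves $r$ as the only possible positive eigenvalue. -/
theorem mem_posSpace {M : Matrix s s ℂ} {r : ℝ} (hr : 0 < r) (hM : M * M = ((r ^ 2 : ℝ) : ℂ) • 1)
    {v : s → ℂ} : v ∈ posSpace M ↔ M.mulVec v = (r : ℂ) • v := by
  have h1 : posSpace M = Module.End.eigenspace (Matrix.toLin' M) (r : ℂ) := by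
    refine le_antisymm (iSup_le fun l => ?_) (le_iSup (fun l : {r : ℝ // 0 < r} =>
      Module.End.eigenspace (Matrix.toLin' M) ((l.1 : ℝ) : ℂ)) ⟨r, hr⟩)
    intro v hv
    rw [Module.End.mem_eigenspace_iff, Matrix.toLin'_apply] at hv ⊢
    have h2 : M.mulVec (M.mulVec v) = ((r ^ 2 : ℝ) : ℂ) • v := by
      rw [Matrix.mulVec_mulVec, hM, Matrix.smul_mulVec, Matrix.one_mulVec]
    rw [hv, Matrix.mulVec_smul, hv, smul_smul, ← sub_eq_zero, ← sub_smul] at h2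
    rcases smul_eq_zero.1 h2 with h3 | h3
    · have h4 : l.1 * l.1 = r ^ 2 := by exact_mod_cast sub_eq_zero.1 h3
      have h5 : l.1 = r := by nlinarith [l.2]
      rw [hv, h5]
    · rw [h3, Matrix.mulVec_zero, smul_zero]
  rw [h1, Module.End.mem_eigenspace_iff, Matrix.toLin'_apply]

variable (d : ℕ)

/-- The matrix whose positive spectral subspace is the fibre of the Hardy space. -/
def hardyAt (x : Fin d → ℤ) : Matrix (Spin d) (Spin d) ℂ :=
  if x = 0 then gam d 0 else diracAt d x

/-- The positive eigenvalue of `hardyAt d x`. -/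
def hardyRadius (x : Fin d → ℤ) : ℝ :=
  if x = 0 then 1 else √(∑ i, (x i : ℝ) ^ 2)

variable {d}

theorem hardyRadius_pos (x : Fin d → ℤ) : 0 < hardyRadius d x := by
  unfold hardyRadius
  split_ifs with h
  · exact one_pos
  · obtain ⟨i, hi⟩ := Function.ne_iff.1 h
    refine Real.sqrt_pos.2 (Finset.sum_pos' (fun i _ => sq_nonneg _) ⟨i, Finset.mem_univ i, ?_⟩)
    have : (x i : ℝ) ≠ 0 := by exact_mod_cast hi
    positivity

/-- The double sum is added to itself with exchanged indices, whereupon the mixed terms cancel by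
the Clifford relations. -/
theorem diracAt_sq (x : Fin d → ℤ) :
    diracAt d x * diracAt d x = ((∑ i, (x i : ℝ) ^ 2 : ℝ) : ℂ) • 1 := by
  have h1 : diracAt d x * diracAt d x =
      ∑ i : Fin d, ∑ k : Fin d, ((x i : ℂ) * x k) • (gam d i * gam d k) := by
    simp only [diracAt, Finset.sum_mul, Finset.mul_sum, Matrix.smul_mul, Matrix.mul_smul, smul_smul]
    rw [Finset.sum_comm]
    exact Finset.sum_congr rfl fun i _ => Finset.sum_congr rfl fun k _ => by rw [mul_comm (x k : ℂ)]
  have h1' : diracAt d x * diracAt d x =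
      ∑ i : Fin d, ∑ k : Fin d, ((x i : ℂ) * x k) • (gam d k * gam d i) := by
    rw [h1, Finset.sum_comm]
    exact Finset.sum_congr rfl fun i _ => Finset.sum_congr rfl fun k _ => by rw [mul_comm (x k : ℂ)]
  have h2 : (2 : ℂ) • (diracAt d x * diracAt d x) =
      ∑ i : Fin d, ∑ k : Fin d, if i = k then (2 * ((x i : ℂ) * x i)) • 1 else 0 := by
    rw [two_smul]
    nth_rewrite 2 [h1']
    rw [h1, ← Finset.sum_add_distrib]
    refine Finset.sum_congr rfl fun i _ => ?_
    rw [← Finset.sum_add_distrib]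
    refine Finset.sum_congr rfl fun k _ => ?_
    split_ifs with h
    · rw [h, gam_sq]
      module
    · rw [gam_anticomm d (fun h' => h (Fin.ext h')) i.2 k.2]
      module
  simp only [Finset.sum_ite_eq, Finset.mem_univ, if_true, ← Finset.sum_smul] at h2
  have h3 : diracAt d x * diracAt d x =
      (1 / 2 : ℂ) • ((2 : ℂ) • (diracAt d x * diracAt d x)) := by
    rw [smul_smul]; norm_num
  rw [h3, h2, smul_smul]
  congr 1
  push_cast
  rw [← Finset.mul_sum, ← mul_assoc]
  norm_num
  exact Finset.sum_congr rfl fun i _ => by ring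

theorem hardyAt_sq (x : Fin d → ℤ) :
    hardyAt d x * hardyAt d x = ((hardyRadius d x ^ 2 : ℝ) : ℂ) • 1 := by
  unfold hardyAt hardyRadius
  split_ifs with h
  · rw [gam_sq]; simp
  · rw [diracAt_sq, Real.sq_sqrt (Finset.sum_nonneg fun i _ => sq_nonneg _)]

theorem hardyAt_conjTranspose (x : Fin d → ℤ) : (hardyAt d x).conjTranspose = hardyAt d x := by
  unfold hardyAt
  split_ifs with h
  · exact gam_conjTranspose d 0
  · rw [diracAt, Matrix.conjTranspose_sum]
    refine Finset.sum_congr rfl fun i _ => ?_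
    rw [Matrix.conjTranspose_smul, gam_conjTranspose]
    simp

theorem hardyAt_mul_diracSigma (hd : 1 ≤ d) (x : Fin d → ℤ) :
    (hardyAt d x).map star * diracSigma d =
      (kappa d : ℂ) • (diracSigma d * hardyAt d x) := by
  unfold hardyAt
  split_ifs with h
  · exact gam_mul_diracSigma d hd
  · have : (diracAt d x).map star = ∑ i : Fin d, (x i : ℂ) • (gam d i).map star := by
      ext a b
      simp [diracAt, Matrix.sum_apply]
    rw [this, diracAt, Finset.sum_mul, Finset.mul_sum, Finset.smul_sum]
    refine Finset.sum_congr rfl fun i _ => ?_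
    rw [Matrix.smul_mul, gam_mul_diracSigma d i.2, Matrix.mul_smul, smul_comm]

theorem hardyAt_mul_diracOmega (hd : 1 ≤ d) (he : Even d) (x : Fin d → ℤ) :
    hardyAt d x * diracOmega d = (-1 : ℂ) • (diracOmega d * hardyAt d x) := by
  unfold hardyAt
  split_ifs with h
  · exact gam_mul_diracOmega d he hd
  · rw [diracAt, Finset.sum_mul, Finset.mul_sum, Finset.smul_sum]
    refine Finset.sum_congr rfl fun i _ => ?_
    rw [Matrix.smul_mul, gam_mul_diracOmega d he i.2, Matrix.mul_smul, smul_comm]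

theorem mem_hardySpace {v : L2 ((Fin d → ℤ) × Spin d)} :
    v ∈ hardySpace d ↔ ∀ x, (hardyAt d x).mulVec (fibreAt x v) =
      (hardyRadius d x : ℂ) • fibreAt x v := by
  simp only [hardySpace, Submodule.mem_iInf, Submodule.mem_comap]
  exact forall_congr' fun x => mem_posSpace (hardyRadius_pos x) (hardyAt_sq x)

/-- The vector over one site with given fibre. -/
def siteVec {Y : Type} [DecidableEq Y] (x : Y) (u : s → ℂ) : L2 (Y × s) :=
  ∑ i, u i • lp.single 2 (x, i) (1 : ℂ)

theorem siteVec_apply {Y : Type} [DecidableEq Y] (x y : Y) (u : s → ℂ) (i : s) :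
    siteVec x u (y, i) = if y = x then u i else 0 := by
  rw [siteVec, lp.coeFn_sum, Finset.sum_apply]
  simp only [lp.coeFn_smul, Pi.smul_apply, smul_eq_mul, lp.single_apply, Pi.single_apply,
    Prod.mk.injEq]
  split_ifs with h
  · simp [h]
  · simp [h]

theorem inner_siteVec {Y : Type} [DecidableEq Y] (x : Y) (u : s → ℂ) (v : L2 (Y × s)) :
    inner ℂ (siteVec x u) v = ∑ i, star (u i) * fibreAt x v i := by
  rw [siteVec, sum_inner]
  refine Finset.sum_congr rfl fun i _ => ?_
  rw [inner_smul_left, inner_single_one]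
  rfl

/-- With $w$ the fibre of $v$ at $x$, the vector $u=(M+r)w$ satisfies $Mu=ru$, so placed at $x$ it
lies in the Hardy space. Then $\langle u,w\rangle=0$, and by symmetry of $M$ also $\langle
u,Mw\rangle=0$; hence $\langle u,u\rangle=0$. -/
theorem neg_eig_of_mem_orthogonal {v : L2 ((Fin d → ℤ) × Spin d)} (hv : v ∈ (hardySpace d)ᗮ)
    (x : Fin d → ℤ) :
    (hardyAt d x).mulVec (fibreAt x v) = -(hardyRadius d x : ℂ) • fibreAt x v := by
  set M := hardyAt d x with hM
  set r := hardyRadius d x with hr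
  set w := fibreAt x v with hw
  set u := M.mulVec w + (r : ℂ) • w with hu
  have hMM : M.mulVec (M.mulVec w) = ((r ^ 2 : ℝ) : ℂ) • w := by
    rw [Matrix.mulVec_mulVec, hardyAt_sq, Matrix.smul_mulVec, Matrix.one_mulVec]
  have hMu : M.mulVec u = (r : ℂ) • u := by
    rw [hu, Matrix.mulVec_add, hMM, Matrix.mulVec_smul]
    push_cast
    module
  have h1 : siteVec x u ∈ hardySpace d := by
    rw [mem_hardySpace]
    intro y
    have h2 : fibreAt y (siteVec x u) = if y = x then u else 0 := by
      ext i
      change siteVec x u (y, i) = _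
      rw [siteVec_apply]
      split_ifs <;> rfl
    rw [h2]
    split_ifs with h
    · rw [h]; exact hMu
    · simp
  have h3 := (Submodule.mem_orthogonal _ _).1 hv _ h1
  rw [inner_siteVec] at h3
  have h4 : star u ⬝ᵥ w = 0 := h3
  have h5 : star u ⬝ᵥ M.mulVec w = 0 := by
    have : star u ⬝ᵥ M.mulVec w = star (M.mulVec u) ⬝ᵥ w := by
      rw [Matrix.star_mulVec, hardyAt_conjTranspose, Matrix.dotProduct_mulVec]
    rw [this, hMu, star_smul, smul_dotProduct, h4, smul_zero]
  have h6 : star u ⬝ᵥ u = 0 := by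
    conv_lhs => rw [hu]
    rw [dotProduct_add, dotProduct_smul, h5, h4, smul_zero, add_zero]
  have h7 : u = 0 := by
    open scoped ComplexOrder in exact dotProduct_star_self_eq_zero.1 h6
  rw [neg_smul]
  exact eq_neg_of_add_eq_zero_left h7

/-- For the converse, the fibres of the Hardy projection of $v$ have eigenvalue $r$, but as
differences of vectors of eigenvalue $-r$ also $-r$, so they vanish. -/
theorem mem_orthogonal_hardySpace {v : L2 ((Fin d → ℤ) × Spin d)} :
    v ∈ (hardySpace d)ᗮ ↔ ∀ x, (hardyAt d x).mulVec (fibreAt x v) =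
      -(hardyRadius d x : ℂ) • fibreAt x v := by
  refine ⟨neg_eig_of_mem_orthogonal, fun h => ?_⟩
  have h1 := Submodule.sub_starProjection_mem_orthogonal (K := hardySpace d) v
  set p := (hardySpace d).starProjection v with hp
  have h2 := mem_hardySpace.1 (Submodule.starProjection_apply_mem (hardySpace d) v)
  have h3 := neg_eig_of_mem_orthogonal h1
  have h4 : p = 0 := by
    ext ⟨x, i⟩
    have h5 := h3 x
    rw [map_sub, Matrix.mulVec_sub, h x, smul_sub, sub_right_inj, h2 x] at h5
    have h6 : ((2 * hardyRadius d x : ℝ) : ℂ) • fibreAt x p = 0 := by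
      push_cast
      rw [mul_smul, two_smul]
      nth_rewrite 1 [h5]
      rw [neg_smul, neg_add_cancel]
    rcases smul_eq_zero.1 h6 with h7 | h7
    · have h8 : 2 * hardyRadius d x = 0 := by exact_mod_cast h7
      linarith [hardyRadius_pos x]
    · exact congrFun h7 i
  rwa [h4, sub_zero] at h1

theorem fibreAt_matOp {Y : Type} (S : Matrix s s ℂ) (v : L2 (Y × s)) (y : Y) :
    fibreAt y (matOp S v) = S.mulVec (fibreAt y v) := by
  ext i
  exact matOp_apply S v y i

theorem mulVec_star (M : Matrix s s ℂ) (v : s → ℂ) : M.mulVec (star v) = star ((M.map star).mulVec v) := by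
  ext i
  simp [Matrix.mulVec, dotProduct, mul_comm]

/-- $\Sigma\mathcal C$ commutes with the fibre matrices up to $\kappa$. So it preserves the positive
spectral subspaces for $\kappa=1$ and exchanges them with the negative ones for $\kappa=-1$. -/
theorem hardy_symOp_eig (hd : 1 ≤ d) {v : L2 ((Fin d → ℤ) × Spin d)} {x : Fin d → ℤ} {a : ℝ}
    (h : (hardyAt d x).mulVec (fibreAt x v) = (a : ℂ) • fibreAt x v) :
    (hardyAt d x).mulVec (fibreAt x (symOp (diracSigma d) v)) =
      (kappa d * a : ℂ) • fibreAt x (symOp (diracSigma d) v) := by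
  have h0 : fibreAt x (star v) = star (fibreAt x v) := rfl
  have h1 : hardyAt d x * diracSigma d =
      (kappa d : ℂ) • (diracSigma d * (hardyAt d x).map star) := by
    have h := congrArg (fun M : Matrix _ _ ℂ => M.map star) (hardyAt_mul_diracSigma hd x)
    simp only [map_star_mul, map_star_smul, (isSymmetryOp_diracSigma d).real] at h
    have h3 : ((hardyAt d x).map star).map star = hardyAt d x := by
      ext i j
      simp
    rw [h3] at h
    rw [h]
    simp
  have h2 : ((hardyAt d x).map star).map star = hardyAt d x := by
    ext i j
    simp
  rw [symOp_apply, fibreAt_matOp, h0, Matrix.mulVec_mulVec, h1, Matrix.smul_mulVec,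
    ← Matrix.mulVec_mulVec, mulVec_star ((hardyAt d x).map star), h2, h, star_smul,
    Matrix.mulVec_smul, smul_smul]
  simp

theorem khClass_hardyProj (hd : 1 ≤ d) : KHClass d (hardyProj d) where
  proj := isStarProjection_starProjection
  sigma_pos hk := by
    have hs : sigmaSign d * sigmaSign d = 1 := by
      rw [sigmaSign, ← mul_pow]; norm_num
    refine twist_eq_of_apply (isSymmetryOp_diracSigma d) hs
      (starProjection_map_of_mapsTo (J := symOp (diracSigma d)) ?_ ?_)
    · intro v hv
      rw [mem_hardySpace] at hv ⊢
      intro x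
      rw [hardy_symOp_eig hd (hv x), hk]
      simp
    · intro v hv
      rw [mem_orthogonal_hardySpace] at hv ⊢
      intro x
      rw [hardy_symOp_eig (a := -hardyRadius d x) hd (by rw [hv x]; simp), hk]
      simp
  sigma_neg hk := by
    have hs : sigmaSign d * sigmaSign d = 1 := by
      rw [sigmaSign, ← mul_pow]; norm_num
    refine twist_eq_of_apply (isSymmetryOp_diracSigma d) hs
      (starProjection_map_compl (J := symOp (diracSigma d)) ?_ ?_)
    · intro v hv
      rw [mem_hardySpace] at hv
      rw [mem_orthogonal_hardySpace]
      intro x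
      rw [hardy_symOp_eig hd (hv x), hk]
      simp
    · intro v hv
      rw [mem_orthogonal_hardySpace] at hv
      rw [mem_hardySpace]
      intro x
      rw [hardy_symOp_eig (a := -hardyRadius d x) hd (by rw [hv x]; simp), hk]
      simp
  omega he := by
    have hΩ : ∀ (v : L2 ((Fin d → ℤ) × Spin d)) (x : Fin d → ℤ) (a : ℂ),
        (hardyAt d x).mulVec (fibreAt x v) = a • fibreAt x v →
        (hardyAt d x).mulVec (fibreAt x (matOp (diracOmega d) v)) =
          -a • fibreAt x (matOp (diracOmega d) v) := by
      intro v x a h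
      rw [fibreAt_matOp, Matrix.mulVec_mulVec, hardyAt_mul_diracOmega hd he, Matrix.smul_mulVec,
        ← Matrix.mulVec_mulVec, h, Matrix.mulVec_smul, smul_smul]
      simp
    have h1 : ∀ v ∈ hardySpace d, matOp (diracOmega d) v ∈ (hardySpace d)ᗮ := by
      intro v hv
      rw [mem_hardySpace] at hv
      rw [mem_orthogonal_hardySpace]
      exact fun x => hΩ v x _ (hv x)
    have h2 : ∀ v ∈ (hardySpace d)ᗮ, matOp (diracOmega d) v ∈ hardySpace d := by
      intro v hv
      rw [mem_orthogonal_hardySpace] at hv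
      rw [mem_hardySpace]
      intro x
      rw [hΩ v x _ (hv x), neg_neg]
    ext1 v
    change adjoint (matOp (diracOmega d)) ((hardySpace d).starProjection (matOp (diracOmega d) v)) =
      v - (hardySpace d).starProjection v
    have h3 : v = (hardySpace d).starProjection v + (v - (hardySpace d).starProjection v) := by abel
    have h4 : (hardySpace d).starProjection (matOp (diracOmega d) v) =
        matOp (diracOmega d) (v - (hardySpace d).starProjection v) := by
      conv_lhs => rw [h3]
      rw [map_add, map_add, Submodule.starProjection_eq_self_iff.2
        (h2 _ (Submodule.sub_starProjection_mem_orthogonal v)),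
        (Submodule.starProjection_apply_eq_zero_iff _).2
        (h1 _ (Submodule.starProjection_apply_mem _ v)), zero_add]
    rw [h4, adjoint_matOp_matOp (diracOmega_unitary d)]

end Hardy


/-! ### Kernels and Fredholm property of orthogonal sums -/

section OrthogonalSums

variable {X Z₁ Z₂ : Type*} [NormedAddCommGroup X] [InnerProductSpace ℂ X] [CompleteSpace X]
  [NormedAddCommGroup Z₁] [InnerProductSpace ℂ Z₁] [CompleteSpace Z₁]
  [NormedAddCommGroup Z₂] [InnerProductSpace ℂ Z₂] [CompleteSpace Z₂]

/-- `X` is the orthogonal sum of the ranges of the isometries `w₁` and `w₂`. -/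
structure SumIso (w₁ : Z₁ →L[ℂ] X) (w₂ : Z₂ →L[ℂ] X) : Prop where
  iso₁ : ∀ z, adjoint w₁ (w₁ z) = z
  iso₂ : ∀ z, adjoint w₂ (w₂ z) = z
  complete : ∀ v, w₁ (adjoint w₁ v) + w₂ (adjoint w₂ v) = v

variable {w₁ : Z₁ →L[ℂ] X} {w₂ : Z₂ →L[ℂ] X} {T : X →L[ℂ] X} {T₁ : Z₁ →L[ℂ] Z₁} {T₂ : Z₂ →L[ℂ] Z₂}

theorem SumIso.symm (h : SumIso w₁ w₂) : SumIso w₂ w₁ :=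
  ⟨h.iso₂, h.iso₁, fun v => by rw [add_comm]; exact h.complete v⟩

theorem SumIso.inj (h : SumIso w₁ w₂) {z : Z₁} (hz : w₁ z = 0) : z = 0 := by
  rw [← h.iso₁ z, hz, map_zero]

theorem SumIso.orth (h : SumIso w₁ w₂) (z : Z₂) : adjoint w₁ (w₂ z) = 0 := by
  have h1 := h.complete (w₂ z)
  rw [h.iso₂, add_eq_right] at h1
  exact h.inj h1

theorem SumIso.finrank_ker (h : SumIso w₁ w₂) (h1 : ∀ z, T (w₁ z) = w₁ (T₁ z))
    (h2 : ∀ z, T (w₂ z) = w₂ (T₂ z)) [FiniteDimensional ℂ T₁.ker] [FiniteDimensional ℂ T₂.ker] :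
    Module.finrank ℂ T.ker = Module.finrank ℂ T₁.ker + Module.finrank ℂ T₂.ker := by
  have key : ∀ z₁ z₂, T (w₁ z₁ + w₂ z₂) = 0 ↔ T₁ z₁ = 0 ∧ T₂ z₂ = 0 := by
    intro z₁ z₂
    rw [map_add, h1, h2]
    constructor
    · intro h3
      have h4 := congrArg (adjoint w₁) h3
      have h5 := congrArg (adjoint w₂) h3
      rw [map_add, h.iso₁, h.orth, map_zero, add_zero] at h4
      rw [map_add, h.iso₂, h.symm.orth, map_zero, zero_add] at h5
      exact ⟨h4, h5⟩
    · rintro ⟨h3, h4⟩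
      rw [h3, h4, map_zero, map_zero, add_zero]
  let e : (T₁.ker × T₂.ker) ≃ₗ[ℂ] T.ker :=
    { toFun := fun p => ⟨w₁ p.1.1 + w₂ p.2.1, (key _ _).2 ⟨p.1.2, p.2.2⟩⟩
      map_add' := fun p q => by
        ext1
        change w₁ (p.1.1 + q.1.1) + w₂ (p.2.1 + q.2.1) = w₁ p.1.1 + w₂ p.2.1 + (w₁ q.1.1 + w₂ q.2.1)
        rw [map_add, map_add]
        abel
      map_smul' := fun a p => by
        ext1
        change w₁ (a • p.1.1) + w₂ (a • p.2.1) = a • (w₁ p.1.1 + w₂ p.2.1)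
        rw [map_smul, map_smul, smul_add]
      invFun := fun v =>
        have hv := (key (adjoint w₁ v.1) (adjoint w₂ v.1)).1 (by rw [h.complete]; exact v.2)
        (⟨adjoint w₁ v.1, hv.1⟩, ⟨adjoint w₂ v.1, hv.2⟩)
      left_inv := fun p => by
        refine Prod.ext (Subtype.ext ?_) (Subtype.ext ?_)
        · change adjoint w₁ (w₁ p.1.1 + w₂ p.2.1) = p.1.1
          rw [map_add, h.iso₁, h.orth, add_zero]
        · change adjoint w₂ (w₁ p.1.1 + w₂ p.2.1) = p.2.1
          rw [map_add, h.iso₂, h.symm.orth, zero_add]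
      right_inv := fun v => Subtype.ext (h.complete v.1) }
  rw [← e.finrank_eq, Module.finrank_prod]

/-- A parametrix of $T_1$, extended by zero, is one of $T$: the new error is the old one minus the
projection onto the finite-dimensional second summand. -/
theorem SumIso.isFredholm (h : SumIso w₁ w₂) (h1 : ∀ z, T (w₁ z) = w₁ (T₁ z))
    (h2 : ∀ z, T (w₂ z) = w₂ (T₂ z)) [FiniteDimensional ℂ Z₂] (hT : T₁.IsFredholm) :
    T.IsFredholm := by
  obtain ⟨S, hS1, hS2⟩ := hT.exists_isQuasiInverse
  refine IsFredholm.of_isQuasiInverse (v := w₁ ∘L S ∘L adjoint w₁) ⟨?_, ?_⟩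
  · refine LinearMap.FiniteRangeSetoid.equiv_iff_hasNoetherianRange.2 ?_
    have h3 := LinearMap.FiniteRangeSetoid.equiv_iff_hasNoetherianRange.1 hS1
    have h4 : ((w₁ ∘L S ∘L adjoint w₁ : X →L[ℂ] X) : X →ₗ[ℂ] X) ∘ₗ (T : X →ₗ[ℂ] X) - LinearMap.id =
        (w₁ : Z₁ →ₗ[ℂ] X) ∘ₗ (((S : Z₁ →ₗ[ℂ] Z₁) ∘ₗ (T₁ : Z₁ →ₗ[ℂ] Z₁) - LinearMap.id) ∘ₗ
          (adjoint w₁ : X →ₗ[ℂ] Z₁)) - (w₂ : Z₂ →ₗ[ℂ] X) ∘ₗ (adjoint w₂ : X →ₗ[ℂ] Z₂) := by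
      ext v
      change w₁ (S (adjoint w₁ (T v))) - v =
        w₁ (S (T₁ (adjoint w₁ v)) - adjoint w₁ v) - w₂ (adjoint w₂ v)
      have h5 : adjoint w₁ (T v) = T₁ (adjoint w₁ v) := by
        conv_lhs => rw [← h.complete v]
        rw [map_add, map_add, h1, h2, h.iso₁, h.orth, add_zero]
      rw [h5, map_sub]
      nth_rewrite 2 [← h.complete v]
      abel
    rw [h4]
    exact ((h3.comp_right _).comp_left _).sub
      ((LinearMap.HasNoetherianRange.of_isNoetherian_rng).comp_left _)
  · refine LinearMap.FiniteRangeSetoid.equiv_iff_hasNoetherianRange.2 ?_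
    have h3 := LinearMap.FiniteRangeSetoid.equiv_iff_hasNoetherianRange.1 hS2
    have h4 : (T : X →ₗ[ℂ] X) ∘ₗ ((w₁ ∘L S ∘L adjoint w₁ : X →L[ℂ] X) : X →ₗ[ℂ] X) - LinearMap.id =
        (w₁ : Z₁ →ₗ[ℂ] X) ∘ₗ (((T₁ : Z₁ →ₗ[ℂ] Z₁) ∘ₗ (S : Z₁ →ₗ[ℂ] Z₁) - LinearMap.id) ∘ₗ
          (adjoint w₁ : X →ₗ[ℂ] Z₁)) - (w₂ : Z₂ →ₗ[ℂ] X) ∘ₗ (adjoint w₂ : X →ₗ[ℂ] Z₂) := by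
      ext v
      change T (w₁ (S (adjoint w₁ v))) - v =
        w₁ (T₁ (S (adjoint w₁ v)) - adjoint w₁ v) - w₂ (adjoint w₂ v)
      rw [h1, map_sub]
      nth_rewrite 2 [← h.complete v]
      abel
    rw [h4]
    exact ((h3.comp_right _).comp_left _).sub
      ((LinearMap.HasNoetherianRange.of_isNoetherian_rng).comp_left _)

theorem compressCLM_intertwine {q F : X →L[ℂ] X} {q₁ F₁ : Z₁ →L[ℂ] Z₁}
    (hq : ∀ z, q (w₁ z) = w₁ (q₁ z)) (hF : ∀ z, F (w₁ z) = w₁ (F₁ z)) (z : Z₁) :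
    compressCLM q F (w₁ z) = w₁ (compressCLM q₁ F₁ z) := by
  simp only [compressCLM_apply, hq, hF, map_add, map_sub]

end OrthogonalSums

/-! ### Naturality of the pairing under maps of the sites -/

section SiteMaps

instance {ι : Type} [Finite ι] : FiniteDimensional ℂ (L2 ι) := by
  have : Function.Injective
      ({ toFun := fun v i => v i, map_add' := fun _ _ => rfl, map_smul' := fun _ _ => rfl } :
        L2 ι →ₗ[ℂ] (ι → ℂ)) := fun u v h => by
    ext i
    exact congrFun h i
  exact FiniteDimensional.of_injective _ this

variable {Y Y' Z n m h s : Type} [Fintype n] [Fintype m] [Fintype h] [Fintype s]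

theorem amplR_matOp_rect (u : L2 Y →L[ℂ] L2 Z) (M : Matrix n m ℂ) (v : L2 (Y × m)) :
    amplR n u (matOp M v) = matOp M (amplR m u v) := by
  refine slice_ext fun i => ?_
  simp only [slice_amplR, slice_matOp, map_sum, map_smul]

theorem sliceMid_amplR_amplR (u : L2 Y →L[ℂ] L2 Z) (v : L2 ((Y × n) × s)) (a : n) :
    sliceMid a (amplR s (amplR n u) v) = amplR s u (sliceMid a v) := by
  ext ⟨y, i⟩
  change amplR s (amplR n u) v ((y, a), i) = _
  rw [amplR_apply, amplR_apply, amplR_apply]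
  rfl

variable {u : L2 Y →L[ℂ] L2 Z} {P : BOp (Y × n)} {B : BOp (Z × n)}

theorem amplRight_intertwine (hP : ∀ v, B (amplR n u v) = amplR n u (P v)) (v : L2 ((Y × n) × s)) :
    amplRight s B (amplR s (amplR n u) v) = amplR s (amplR n u) (amplRight s P v) := by
  refine slice_ext fun i => ?_
  simp only [amplRight_eq, slice_amplR, hP]

theorem amplMid_intertwine {E : BOp (Y × s)} {D : BOp (Z × s)}
    (hE : ∀ v, D (amplR s u v) = amplR s u (E v)) (v : L2 ((Y × n) × s)) :
    amplMid n D (amplR s (amplR n u) v) = amplR s (amplR n u) (amplMid n E v) := by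
  refine sliceMid_ext fun a => ?_
  simp only [sliceMid_amplMid, sliceMid_amplR_amplR, hE]

theorem chiralBlock_intertwine (hP : ∀ v, B (amplR n u v) = amplR n u (P v)) (Vp Vm : Matrix n h ℂ)
    (v : L2 (Y × h)) :
    chiralBlock Vp Vm B (amplR h u v) = amplR h u (chiralBlock Vp Vm P v) := by
  change adjoint (matOp Vp) ((2 : ℂ) • B (matOp Vm (amplR h u v)) - matOp Vm (amplR h u v)) =
    amplR h u (adjoint (matOp Vp) ((2 : ℂ) • P (matOp Vm v) - matOp Vm v))
  rw [adjoint_matOp, adjoint_matOp, amplR_matOp_rect, ← amplR_matOp_rect, hP, map_sub (amplR n u),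
    map_smul]

theorem reflection_intertwine (hP : ∀ v, B (amplR n u v) = amplR n u (P v)) (v : L2 (Y × n)) :
    ((2 : ℂ) • B - 1) (amplR n u v) = amplR n u (((2 : ℂ) • P - 1) v) := by
  change (2 : ℂ) • B (amplR n u v) - amplR n u v = amplR n u ((2 : ℂ) • P v - v)
  rw [hP, map_sub, map_smul]

theorem SumIso.amplR {u₁ : L2 Y →L[ℂ] L2 Z} {u₂ : L2 Y' →L[ℂ] L2 Z} (hu : SumIso u₁ u₂) :
    SumIso (amplR n u₁) (amplR n u₂) where
  iso₁ z := by
    rw [adjoint_amplR]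
    refine slice_ext fun i => ?_
    rw [slice_amplR, slice_amplR, hu.iso₁]
  iso₂ z := by
    rw [adjoint_amplR]
    refine slice_ext fun i => ?_
    rw [slice_amplR, slice_amplR, hu.iso₂]
  complete v := by
    rw [adjoint_amplR, adjoint_amplR]
    refine slice_ext fun i => ?_
    rw [map_add, slice_amplR, slice_amplR, slice_amplR, slice_amplR, hu.complete]

/-- Everything in the pairing operator except $P$ and $E$ acts on the fibres and commutes with
isometries of the sites. A decomposition of $P$ and $E$ therefore decomposes $T$. -/
theorem pairingOp_sum {j d : ℕ} {u₁ : L2 Y →L[ℂ] L2 Z} {u₂ : L2 Y' →L[ℂ] L2 Z}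
    (hu : SumIso u₁ u₂) {Vp Vm : Matrix n h ℂ} {Wp Wm : Matrix s m ℂ} {P : BOp (Y × n)}
    {P₀ : BOp (Y' × n)} {B : BOp (Z × n)} {E : BOp (Y × s)} {E₀ : BOp (Y' × s)} {D : BOp (Z × s)}
    (hP : ∀ v, B (TopIns.amplR n u₁ v) = TopIns.amplR n u₁ (P v))
    (hP₀ : ∀ v, B (TopIns.amplR n u₂ v) = TopIns.amplR n u₂ (P₀ v))
    (hE : ∀ v, D (TopIns.amplR s u₁ v) = TopIns.amplR s u₁ (E v))
    (hE₀ : ∀ v, D (TopIns.amplR s u₂ v) = TopIns.amplR s u₂ (E₀ v)) [Finite Y']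
    (hT : (pairingOp j d Vp Vm Wp Wm P E).2.IsFredholm) :
    (pairingOp j d Vp Vm Wp Wm B D).2.IsFredholm ∧
      nullity (pairingOp j d Vp Vm Wp Wm B D) =
        nullity (pairingOp j d Vp Vm Wp Wm P E) + nullity (pairingOp j d Vp Vm Wp Wm P₀ E₀) := by
  have key : ∀ {ι ι₀ κ : Type} [Finite ι₀] {w₁ : L2 ι →L[ℂ] L2 κ} {w₂ : L2 ι₀ →L[ℂ] L2 κ}
      {T : BOp κ} {T₁ : BOp ι} {T₂ : BOp ι₀}, SumIso w₁ w₂ → (∀ z, T (w₁ z) = w₁ (T₁ z)) →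
      (∀ z, T (w₂ z) = w₂ (T₂ z)) → T₁.IsFredholm → T.IsFredholm ∧
      Module.finrank ℂ T.ker = Module.finrank ℂ T₁.ker + Module.finrank ℂ T₂.ker := by
    intro ι ι₀ κ _ w₁ w₂ T T₁ T₂ hw h1 h2 hF
    have := hF.finite_ker
    exact ⟨hw.isFredholm h1 h2 hF, hw.finrank_ker h1 h2⟩
  by_cases hd : Even d
  · rw [pairingOp_even hd] at hT
    rw [pairingOp_even hd, pairingOp_even hd, pairingOp_even hd]
    exact key (hu.amplR.amplR)
      (compressCLM_intertwine (amplRight_intertwine hP)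
        (amplMid_intertwine (chiralBlock_intertwine hE Wp Wm)))
      (compressCLM_intertwine (amplRight_intertwine hP₀)
        (amplMid_intertwine (chiralBlock_intertwine hE₀ Wp Wm))) hT
  · by_cases hj : Odd j
    · rw [pairingOp_odd_odd hd hj] at hT
      rw [pairingOp_odd_odd hd hj, pairingOp_odd_odd hd hj, pairingOp_odd_odd hd hj]
      exact key (hu.amplR.amplR)
        (compressCLM_intertwine (amplMid_intertwine hE)
          (amplRight_intertwine (chiralBlock_intertwine hP Vp Vm)))
        (compressCLM_intertwine (amplMid_intertwine hE₀)
          (amplRight_intertwine (chiralBlock_intertwine hP₀ Vp Vm))) hT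
    · rw [pairingOp_odd_even hd hj] at hT
      rw [pairingOp_odd_even hd hj, pairingOp_odd_even hd hj, pairingOp_odd_even hd hj]
      exact key (hu.amplR.amplR)
        (compressCLM_intertwine (amplMid_intertwine hE)
          (amplRight_intertwine (reflection_intertwine hP)))
        (compressCLM_intertwine (amplMid_intertwine hE₀)
          (amplRight_intertwine (reflection_intertwine hP₀))) hT

end SiteMaps

/-! ### Adding finitely many sites -/

section DirectSums

variable {Y Y' n h m s : Type} [Fintype n] [Fintype h] [Fintype m] [Fintype s]

theorem extendL_add_eq {ι ι' κ : Type} {e : ι ↪ κ} {e' : ι' ↪ κ}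
    (hd : ∀ i i', e i ≠ e' i') (hs : ∀ k, k ∈ Set.range e ∨ k ∈ Set.range e') :
    SumIso (extendL e) (extendL e') where
  iso₁ z := by rw [adjoint_extendL, restrictL_extendL]
  iso₂ z := by rw [adjoint_extendL, restrictL_extendL]
  complete v := by
    rw [adjoint_extendL, adjoint_extendL]
    ext k
    rw [lp.coeFn_add, Pi.add_apply]
    rcases hs k with ⟨i, rfl⟩ | ⟨i, rfl⟩
    · rw [extendL_apply_self, extendL_apply_of_notMem, add_zero]
      · rfl
      · rintro ⟨i', hi'⟩
        exact hd i i' hi'.symm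
    · rw [extendL_apply_self, extendL_apply_of_notMem, zero_add]
      · rfl
      · rintro ⟨i', hi'⟩
        exact hd i' i hi'

theorem sumIso_inl_inr :
    SumIso (extendL (Function.Embedding.inl : Y ↪ Y ⊕ Y')) (extendL Function.Embedding.inr) := by
  refine extendL_add_eq (fun _ _ => Sum.inl_ne_inr) ?_
  rintro (y | y)
  · exact Or.inl ⟨y, rfl⟩
  · exact Or.inr ⟨y, rfl⟩

omit [Fintype n] in
theorem slice_extendL_prod {κ : Type} {f : Y ↪ κ} {e : Y × n ↪ κ × n}
    (he : ∀ y i, e (y, i) = (f y, i)) (v : L2 (Y × n)) (i : n) :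
    slice i (extendL e v) = extendL f (slice i v) := by
  ext z
  change extendL e v (z, i) = _
  by_cases hz : z ∈ Set.range f
  · obtain ⟨y, rfl⟩ := hz
    rw [← he, extendL_apply_self, extendL_apply_self]
    rfl
  · rw [extendL_apply_of_notMem _ _ hz, extendL_apply_of_notMem]
    rintro ⟨⟨y, k⟩, hk⟩
    rw [he] at hk
    exact hz ⟨y, (Prod.ext_iff.1 hk).1⟩

theorem amplR_inl (v : L2 (Y × n)) :
    amplR n (extendL (Function.Embedding.inl : Y ↪ Y ⊕ Y')) v = extendL inlSite v := by
  refine slice_ext fun i => ?_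
  rw [slice_amplR, slice_extendL_prod (f := Function.Embedding.inl) (fun _ _ => rfl)]

theorem amplR_inr (v : L2 (Y' × n)) :
    amplR n (extendL (Function.Embedding.inr : Y' ↪ Y ⊕ Y')) v = extendL inrSite v := by
  refine slice_ext fun i => ?_
  rw [slice_amplR, slice_extendL_prod (f := Function.Embedding.inr) (fun _ _ => rfl)]

variable {A : BOp (Y × n)} {B : BOp (Y' × n)}

omit [Fintype n] in
theorem sumIso_site :
    SumIso (extendL (inlSite : Y × n ↪ (Y ⊕ Y') × n)) (extendL (inrSite : Y' × n ↪ _)) := by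
  refine extendL_add_eq (fun _ _ h => Sum.inl_ne_inr (Prod.ext_iff.1 h).1) ?_
  rintro ⟨y | y, i⟩
  · exact Or.inl ⟨(y, i), rfl⟩
  · exact Or.inr ⟨(y, i), rfl⟩

omit [Fintype n] in
theorem dsumOp_apply (A : BOp (Y × n)) (B : BOp (Y' × n)) (v : L2 ((Y ⊕ Y') × n)) :
    dsumOp A B v = extendL inlSite (A (restrictL inlSite v)) +
      extendL inrSite (B (restrictL inrSite v)) := rfl

omit [Fintype n] in
theorem dsumOp_inl (v : L2 (Y × n)) : dsumOp A B (extendL inlSite v) = extendL inlSite (A v) := by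
  have h := (sumIso_site (n := n) (Y := Y) (Y' := Y')).symm.orth v
  rw [adjoint_extendL] at h
  rw [dsumOp_apply, restrictL_extendL, h, map_zero, map_zero, add_zero]

omit [Fintype n] in
theorem dsumOp_inr (v : L2 (Y' × n)) : dsumOp A B (extendL inrSite v) = extendL inrSite (B v) := by
  have h := (sumIso_site (n := n) (Y := Y) (Y' := Y')).orth v
  rw [adjoint_extendL] at h
  rw [dsumOp_apply, restrictL_extendL, h, map_zero, map_zero, zero_add]

omit [Fintype n] in
theorem site_induction {p : L2 ((Y ⊕ Y') × n) → Prop} (hl : ∀ v, p (extendL inlSite v))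
    (hr : ∀ v, p (extendL inrSite v)) (ha : ∀ u v, p u → p v → p (u + v)) (v) : p v := by
  rw [← (sumIso_site (n := n) (Y := Y) (Y' := Y')).complete v]
  exact ha _ _ (hl _) (hr _)

omit [Fintype n] in
theorem isStarProjection_dsumOp (hA : IsStarProjection A) (hB : IsStarProjection B) :
    IsStarProjection (dsumOp A B) := by
  constructor
  · ext1 v
    change dsumOp A B (dsumOp A B v) = dsumOp A B v
    induction v using site_induction with
    | hl v =>
      rw [dsumOp_inl, dsumOp_inl, idem_apply hA]
    | hr v =>
      rw [dsumOp_inr, dsumOp_inr, idem_apply hB]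
    | ha u v hu hv =>
      rw [map_add, map_add, hu, hv]
  · change adjoint _ = _
    simp only [dsumOp, map_add, adjoint_comp, adjoint_extendL, hA.isSelfAdjoint.adjoint_eq,
      hB.isSelfAdjoint.adjoint_eq, comp_assoc]
    rfl

omit [Fintype n] in
theorem dsumOp_one_sub (A : BOp (Y × n)) (B : BOp (Y' × n)) :
    dsumOp (1 - A) (1 - B) = 1 - dsumOp A B := by
  ext1 v
  change dsumOp (1 - A) (1 - B) v = v - dsumOp A B v
  induction v using site_induction with
  | hl v =>
    rw [dsumOp_inl, dsumOp_inl, sub_apply, map_sub]; rfl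
  | hr v =>
    rw [dsumOp_inr, dsumOp_inr, sub_apply, map_sub]; rfl
  | ha u v hu hv =>
    rw [map_add, map_add, hu, hv]; abel

theorem matOp_inl {k : Type} [Fintype k] (M : Matrix k n ℂ) (v : L2 (Y × n)) :
    matOp M (extendL (inlSite : _ ↪ (Y ⊕ Y') × n) v) = extendL inlSite (matOp M v) := by
  rw [← amplR_inl, ← amplR_inl, amplR_matOp_rect]

theorem matOp_inr {k : Type} [Fintype k] (M : Matrix k n ℂ) (v : L2 (Y' × n)) :
    matOp M (extendL (inrSite : _ ↪ (Y ⊕ Y') × n) v) = extendL inrSite (matOp M v) := by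
  rw [← amplR_inr, ← amplR_inr, amplR_matOp_rect]

theorem extendL_star {ι κ : Type} (e : ι ↪ κ) (v : L2 ι) : extendL e (star v) = star (extendL e v) := by
  ext k
  rw [lp.star_apply]
  by_cases hk : k ∈ Set.range e
  · obtain ⟨i, rfl⟩ := hk
    rw [extendL_apply_self, extendL_apply_self, lp.star_apply]
  · rw [extendL_apply_of_notMem _ _ hk, extendL_apply_of_notMem _ _ hk, star_zero]

theorem twist_dsumOp (S : Matrix n n ℂ) (A : BOp (Y × n)) (B : BOp (Y' × n)) :
    twist S (dsumOp A B) = dsumOp (twist S A) (twist S B) := by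
  ext1 v
  induction v using site_induction with
  | hl v =>
    rw [dsumOp_inl, twist_apply, twist_apply, matOp_inl, ← extendL_star, dsumOp_inl,
      ← extendL_star, adjoint_matOp, matOp_inl, adjoint_matOp]
  | hr v =>
    rw [dsumOp_inr, twist_apply, twist_apply, matOp_inr, ← extendL_star, dsumOp_inr,
      ← extendL_star, adjoint_matOp, matOp_inr, adjoint_matOp]
  | ha u v hu hv =>
    rw [map_add, map_add, hu, hv]

variable {j d : ℕ} {Str Sph : Matrix n n ℂ}

theorem KClass.dsum (hA : KClass j Str Sph A) (hB : KClass j Str Sph B) :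
    KClass j Str Sph (dsumOp A B) where
  proj := isStarProjection_dsumOp hA.proj hB.proj
  tr h := by rw [twist_dsumOp, hA.tr h, hB.tr h]
  ph h := by rw [twist_dsumOp, hA.ph h, hB.ph h, dsumOp_one_sub]

theorem KHClass.dsum {E : BOp (Y × Spin d)} {E₀ : BOp (Y' × Spin d)} (hE : KHClass d E)
    (hE₀ : KHClass d E₀) : KHClass d (dsumOp E E₀) where
  proj := isStarProjection_dsumOp hE.proj hE₀.proj
  sigma_pos h := by rw [twist_dsumOp, hE.sigma_pos h, hE₀.sigma_pos h]
  sigma_neg h := by rw [twist_dsumOp, hE.sigma_neg h, hE₀.sigma_neg h, dsumOp_one_sub]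
  omega h := by
    rw [← dsumOp_one_sub, ← hE.omega h, ← hE₀.omega h]
    ext1 v
    change adjoint (matOp (diracOmega d)) (dsumOp E E₀ (matOp (diracOmega d) v)) = _
    induction v using site_induction with
    | hl v =>
      rw [dsumOp_inl, matOp_inl, dsumOp_inl, adjoint_matOp, matOp_inl, comp_apply, comp_apply, adjoint_matOp]
    | hr v =>
      rw [dsumOp_inr, matOp_inr, dsumOp_inr, adjoint_matOp, matOp_inr, comp_apply, comp_apply, adjoint_matOp]
    | ha u v hu hv =>
      rw [map_add, map_add, map_add, map_add, hu, hv]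

omit [Fintype n] in
theorem continuous_dsumOp {τ : Type*} [TopologicalSpace τ] {B : τ → BOp (Y' × n)}
    (hB : Continuous B) : Continuous fun t => dsumOp A (B t) := by
  unfold dsumOp
  exact continuous_const.add (continuous_const.clm_comp (hB.clm_comp continuous_const))

theorem pairingOp_dsum [Finite Y'] {Vp Vm : Matrix n h ℂ} {Wp Wm : Matrix s m ℂ} {E : BOp (Y × s)}
    {E₀ : BOp (Y' × s)} (hT : (pairingOp j d Vp Vm Wp Wm A E).2.IsFredholm) :
    (pairingOp j d Vp Vm Wp Wm (dsumOp A B) (dsumOp E E₀)).2.IsFredholm ∧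
      nullity (pairingOp j d Vp Vm Wp Wm (dsumOp A B) (dsumOp E E₀)) =
        nullity (pairingOp j d Vp Vm Wp Wm A E) + nullity (pairingOp j d Vp Vm Wp Wm B E₀) := by
  refine pairingOp_sum sumIso_inl_inr (fun v => ?_) (fun v => ?_) (fun v => ?_) (fun v => ?_) hT
  · rw [amplR_inl, amplR_inl, dsumOp_inl]
  · rw [amplR_inr, amplR_inr, dsumOp_inr]
  · rw [amplR_inl, amplR_inl, dsumOp_inl]
  · rw [amplR_inr, amplR_inr, dsumOp_inr]

/-- Paths of pairs over finitely many sites, from an injective pairing to a pairing whose kernel has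
the parity `a`. -/
def HasFlip (j d : ℕ) (Str Sph : Matrix n n ℂ) (Vp Vm : Matrix n h ℂ) (Wp Wm : Matrix (Spin d) m ℂ)
    (a : ZMod 2) : Prop :=
  ∃ (k : ℕ) (P : unitInterval → BOp (Fin k × n)) (E : unitInterval → BOp (Fin k × Spin d)),
    Continuous P ∧ Continuous E ∧ (∀ t, KClass j Str Sph (P t)) ∧ (∀ t, KHClass d (E t)) ∧
    nullity (pairingOp j d Vp Vm Wp Wm (P 0) (E 0)) = 0 ∧
    ind2 (pairingOp j d Vp Vm Wp Wm (P 1) (E 1)) = a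

/-- The given pair is kept constant and only the added finite pair moves. Nullities add, so an added
pairing that ends with the parity of $T$ makes the total even. -/
theorem zero_of_hasFlip [DecidableEq n] {Vp Vm : Matrix n h ℂ} {Wp Wm : Matrix (Spin d) m ℂ}
    {E : BOp (Y × Spin d)} (hA : KClass j Str Sph A) (hE : KHClass d E)
    (hT : (pairingOp j d Vp Vm Wp Wm A E).2.IsFredholm)
    (hind : ind (pairingOp j d Vp Vm Wp Wm A E) = 0)
    (hflip : HasFlip j d Str Sph Vp Vm Wp Wm (ind2 (pairingOp j d Vp Vm Wp Wm A E))) :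
    IndexTheorem j d Str Sph Vp Vm Wp Wm A E .zero := by
  obtain ⟨k, P₀, E₀, hcP, hcE, hP, hE₀, h0, h1⟩ := hflip
  refine ⟨hind, k, P₀ 0, E₀ 0, fun t => dsumOp A (P₀ t), fun t => dsumOp E (E₀ t), h0,
    ⟨continuous_dsumOp hcP, continuous_dsumOp hcE, fun t => hA.dsum (hP t),
      fun t => hE.dsum (hE₀ t), fun t => (pairingOp_dsum hT).1⟩, rfl, rfl, ?_⟩
  rw [ind2, (pairingOp_dsum hT).2, Nat.cast_add]
  change ind2 _ + ind2 _ = 0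
  rw [h1]
  exact CharTwo.add_self_eq_zero _

/-- No sites at all are needed. -/
theorem hasFlip_zero {Vp Vm : Matrix n h ℂ} {Wp Wm : Matrix (Spin d) m ℂ} :
    HasFlip j d Str Sph Vp Vm Wp Wm 0 := by
  have hsub : ∀ (κ : Type) (e : κ → Fin 0) (v : L2 κ), v = 0 := fun κ e v => by
    ext i
    exact (e i).elim0
  have hop : ∀ (κ : Type) (e : κ → Fin 0) (A B : BOp κ), A = B := fun κ e A B => by
    ext1 v
    rw [hsub κ e (A v), hsub κ e (B v)]
  have hP : KClass j Str Sph (0 : BOp (Fin 0 × n)) :=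
    ⟨.zero _, fun _ => hop _ Prod.fst _ _, fun _ => hop _ Prod.fst _ _⟩
  have hE : KHClass d (0 : BOp (Fin 0 × Spin d)) :=
    ⟨.zero _, fun _ => hop _ Prod.fst _ _, fun _ => hop _ Prod.fst _ _, fun _ => hop _ Prod.fst _ _⟩
  have hn : nullity (pairingOp j d Vp Vm Wp Wm (0 : BOp (Fin 0 × n))
      (0 : BOp (Fin 0 × Spin d))) = 0 := by
    have key : ∀ (κ : Type) (e : κ → Fin 0) (T : BOp κ), Module.finrank ℂ T.ker = 0 := by
      intro κ e T
      have : T.ker = ⊥ := by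
        rw [eq_bot_iff]
        intro v _
        exact hsub κ e v
      rw [this, finrank_bot]
    by_cases hd : Even d
    · rw [pairingOp_even hd]
      exact key _ (fun p => p.1.1) _
    · by_cases hj : Odd j
      · rw [pairingOp_odd_odd hd hj]
        exact key _ (fun p => p.1.1) _
      · rw [pairingOp_odd_even hd hj]
        exact key _ (fun p => p.1.1) _
  refine ⟨0, fun _ => 0, fun _ => 0, continuous_const, continuous_const, fun _ => hP, fun _ => hE,
    hn, ?_⟩
  rw [ind2, hn, Nat.cast_zero]

end DirectSums


open scoped Matrix Kronecker

/-! ### Nullities of pairings as nullities of anticommutators -/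

section Anticommutators

variable {X Z : Type*} [NormedAddCommGroup X] [InnerProductSpace ℂ X] {Q G : X →L[ℂ] X}
  {M M' : Submodule ℂ X}

/-- The anticommutator of `2Q - 1` and `G`. -/
def antiComm (Q G : X →L[ℂ] X) : X →L[ℂ] X :=
  ((2 : ℂ) • Q - 1) ∘L G + G ∘L ((2 : ℂ) • Q - 1)

theorem antiComm_apply (v : X) : antiComm Q G v = (2 : ℂ) • (Q (G v) + G (Q v) - G v) := by
  change ((2 : ℂ) • Q (G v) - G v) + G ((2 : ℂ) • Q v - v) = _
  rw [map_sub, map_smul]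
  module

theorem antiComm_eq_zero {v : X} : antiComm Q G v = 0 ↔ Q (G v) + G (Q v) = G v := by
  rw [antiComm_apply, smul_eq_zero, sub_eq_zero]
  simp

/-- If the anticommutator annihilates $v$, then $Qv$ and $G(v-Qv)$ both lie in $\mathcal K=\{u:
Qu=u,\ QGu=0\}$. The kernel is thus $\mathcal K\oplus G\mathcal K$. -/
theorem finrank_ker_antiComm [FiniteDimensional ℂ X] (hQ : ∀ v, Q (Q v) = Q v)
    (hG : ∀ v, G (G v) = v) :
    Module.finrank ℂ (antiComm Q G).ker = 2 * Module.finrank ℂ (kerPair Q G ⊤) := by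
  have h1 : ∀ v ∈ (antiComm Q G).ker, Q v ∈ kerPair Q G ⊤ ∧ G (v - Q v) ∈ kerPair Q G ⊤ := by
    intro v hv
    have hv' : Q (G v) + G (Q v) = G v := antiComm_eq_zero.1 hv
    have h2 : Q (G (Q v)) = 0 := by
      have := congrArg Q hv'
      rwa [map_add, hQ, add_eq_left] at this
    refine ⟨mem_kerPair.2 ⟨trivial, hQ v, h2⟩, mem_kerPair.2 ⟨trivial, ?_, ?_⟩⟩
    · rw [map_sub, map_sub, h2, sub_zero, eq_sub_iff_add_eq, hv']
    · rw [hG, map_sub, hQ, sub_self]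
  have h2 : ∀ v ∈ kerPair Q G ⊤, v ∈ (antiComm Q G).ker ∧ G v ∈ (antiComm Q G).ker := by
    intro v hv
    obtain ⟨-, h3, h4⟩ := mem_kerPair.1 hv
    refine ⟨antiComm_eq_zero.2 ?_, antiComm_eq_zero.2 ?_⟩
    · rw [h3, h4, zero_add]
    · rw [hG, h4, h3, map_zero, add_zero]
  let e : (kerPair Q G ⊤ × kerPair Q G ⊤) ≃ₗ[ℂ] (antiComm Q G).ker :=
    { toFun := fun p => ⟨p.1.1 + G p.2.1, Submodule.add_mem _ (h2 _ p.1.2).1 (h2 _ p.2.2).2⟩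
      map_add' := fun p q => by
        ext1
        change p.1.1 + q.1.1 + G (p.2.1 + q.2.1) = p.1.1 + G p.2.1 + (q.1.1 + G q.2.1)
        rw [map_add]
        abel
      map_smul' := fun a p => by
        ext1
        change a • p.1.1 + G (a • p.2.1) = a • (p.1.1 + G p.2.1)
        rw [map_smul, smul_add]
      invFun := fun v => (⟨Q v.1, (h1 v.1 v.2).1⟩, ⟨G (v.1 - Q v.1), (h1 v.1 v.2).2⟩)
      left_inv := fun p => by
        obtain ⟨-, h3, h4⟩ := mem_kerPair.1 p.1.2
        obtain ⟨-, h5, h6⟩ := mem_kerPair.1 p.2.2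
        have h7 : Q (p.1.1 + G p.2.1) = p.1.1 := by rw [map_add, h3, h6, add_zero]
        refine Prod.ext (Subtype.ext h7) (Subtype.ext ?_)
        change G (p.1.1 + G p.2.1 - Q (p.1.1 + G p.2.1)) = p.2.1
        rw [h7, add_sub_cancel_left, hG]
      right_inv := fun v => Subtype.ext (by
        change Q v.1 + G (G (v.1 - Q v.1)) = v.1
        rw [hG, add_sub_cancel]) }
  rw [← e.finrank_eq, Module.finrank_prod, two_mul]

theorem finrank_ker_adjoint_eq [CompleteSpace X] [FiniteDimensional ℂ X] (T : X →L[ℂ] X) :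
    Module.finrank ℂ (adjoint T).ker = Module.finrank ℂ T.ker := by
  have h1 := LinearMap.finrank_range_add_finrank_ker (T : X →ₗ[ℂ] X)
  have h2 := Submodule.finrank_add_finrank_orthogonal T.range
  rw [orthogonal_range] at h2
  change _ + Module.finrank ℂ T.ker = _ at h1
  change Module.finrank ℂ T.range + _ = _ at h1
  omega

variable [NormedAddCommGroup Z] [InnerProductSpace ℂ Z] [CompleteSpace X] [CompleteSpace Z]
  {q F : Z →L[ℂ] Z} {w w' : Z →L[ℂ] X}

/-- The grading splits the space of the ungraded count into copies of $\mathrm{Ker}\,T$ and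
$\mathrm{Ker}\,T^*$, equal in dimension since everything is finite. This doubles the factor two. -/
theorem FramePair.finrank_ker_antiComm [FiniteDimensional ℂ X] [FiniteDimensional ℂ Z]
    (h : FramePair q F Q G M M' w w') (hQ : ∀ v, Q (Q v) = Q v) (hG : ∀ v, G (G v) = v)
    (hw : ∀ v, w (adjoint w v) + w' (adjoint w' v) = v) :
    Module.finrank ℂ (antiComm Q G).ker =
      4 * Module.finrank ℂ (compressCLM q F).ker := by
  have hs : SumIso w w' := ⟨h.iso, h.iso', hw⟩
  have hg := h.graded hQ hG
  have h1 : kerPair Q G M ⊓ kerPair Q G M' = ⊥ := by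
    rw [eq_bot_iff]
    rintro v ⟨hv, hv'⟩
    obtain ⟨z, rfl⟩ : ∃ z, w z = v := ⟨_, h.surj v (mem_kerPair.1 hv).1⟩
    have := h.surj' _ (mem_kerPair.1 hv').1
    rw [hs.symm.orth, map_zero] at this
    exact this.symm
  have h2 : kerPair Q G M ⊔ kerPair Q G M' = kerPair Q G ⊤ := by
    refine le_antisymm (sup_le ?_ ?_) ?_
    · intro v hv
      exact mem_kerPair.2 ⟨trivial, (mem_kerPair.1 hv).2⟩
    · intro v hv
      exact mem_kerPair.2 ⟨trivial, (mem_kerPair.1 hv).2⟩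
    · intro v hv
      obtain ⟨-, h3, h4⟩ := mem_kerPair.1 hv
      have h5 := hs.complete v
      have key : ∀ {a b : Z}, w a + w' b = 0 → a = 0 ∧ b = 0 := by
        intro a b hab
        have h6 := congrArg (adjoint w) hab
        have h7 := congrArg (adjoint w') hab
        rw [map_add, hs.iso₁, hs.orth, map_zero, add_zero] at h6
        rw [map_add, hs.iso₂, hs.symm.orth, map_zero, zero_add] at h7
        exact ⟨h6, h7⟩
      have h6 : q (adjoint w v) - adjoint w v = 0 ∧ q (adjoint w' v) - adjoint w' v = 0 := by
        refine key ?_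
        rw [map_sub, map_sub, ← h.commQ, ← h.commQ']
        have : Q (w (adjoint w v) + w' (adjoint w' v)) - (w (adjoint w v) + w' (adjoint w' v)) = 0 := by
          rw [h5, h3, sub_self]
        rw [← this, map_add]
        abel
      have h7 : q (adjoint F (adjoint w' v)) = 0 ∧ q (F (adjoint w v)) = 0 := by
        refine key ?_
        rw [← h.commQ, ← h.commQ', ← h.commG, ← h.commG', ← map_add, ← map_add, add_comm, h5, h4]
      rw [← h5]
      refine Submodule.add_mem_sup (mem_kerPair.2 ⟨h.mem _, ?_, ?_⟩)
        (mem_kerPair.2 ⟨h.mem' _, ?_, ?_⟩)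
      · rw [h.commQ, sub_eq_zero.1 h6.1]
      · rw [h.commG, h.commQ', h7.2, map_zero]
      · rw [h.commQ', sub_eq_zero.1 h6.2]
      · rw [h.commG', h.commQ, h7.1, map_zero]
  have h3 := Submodule.finrank_sup_add_finrank_inf_eq (kerPair Q G M) (kerPair Q G M')
  rw [h1, h2, finrank_bot, add_zero, ← h.finrank_ker, ← h.finrank_ker_adjoint,
    finrank_ker_adjoint_eq] at h3
  rw [TopIns.finrank_ker_antiComm hQ hG, h3]
  ring

end Anticommutators

/-! ### Operators over finitely many sites as matrices -/

section Matrices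

variable {ι κ μ Y n s : Type} [Fintype ι] [Fintype κ] [Fintype μ] [Fintype Y] [Fintype n]
  [Fintype s]

/-- The operator of a matrix on finite-dimensional `ℓ²` spaces. -/
def opMat : Matrix ι κ ℂ →ₗ[ℂ] L2 κ →L[ℂ] L2 ι where
  toFun M := LinearMap.toContinuousLinearMap
    { toFun := fun v => ⟨M *ᵥ (v : κ → ℂ), Memℓp.all _⟩
      map_add' := fun u v => lp.ext (Matrix.mulVec_add M u v)
      map_smul' := fun a v => lp.ext (Matrix.mulVec_smul M a v) }
  map_add' M N := by
    ext v i
    exact congrFun (Matrix.add_mulVec M N v) i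
  map_smul' a M := by
    ext v i
    exact congrFun (Matrix.smul_mulVec a M v) i

theorem opMat_apply (M : Matrix ι κ ℂ) (v : L2 κ) (i : ι) : opMat M v i = ∑ k, M i k * v k := rfl

theorem opMat_opMat (M : Matrix ι κ ℂ) (N : Matrix κ μ ℂ) (v : L2 μ) :
    opMat M (opMat N v) = opMat (M * N) v :=
  lp.ext (Matrix.mulVec_mulVec (v : μ → ℂ) M N)

theorem opMat_comp (M : Matrix ι κ ℂ) (N : Matrix κ μ ℂ) : opMat M ∘L opMat N = opMat (M * N) :=
  ContinuousLinearMap.ext (opMat_opMat M N)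

theorem opMat_one [DecidableEq ι] : opMat (1 : Matrix ι ι ℂ) = 1 :=
  ContinuousLinearMap.ext fun v => lp.ext (Matrix.one_mulVec (v : ι → ℂ))

theorem opMat_star (M : Matrix ι κ ℂ) (v : L2 κ) :
    star (opMat M v) = opMat (M.map star) (star v) := by
  ext i
  rw [lp.star_apply, opMat_apply, opMat_apply, star_sum]
  exact Finset.sum_congr rfl fun k _ => by rw [star_mul', lp.star_apply]; rfl

theorem adjoint_opMat (M : Matrix ι κ ℂ) : adjoint (opMat M) = opMat Mᴴ := by
  refine ((eq_adjoint_iff _ _).2 fun u v => ?_).symm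
  rw [lp.inner_eq_tsum, lp.inner_eq_tsum, tsum_fintype, tsum_fintype]
  simp only [opMat_apply, RCLike.inner_apply, Finset.mul_sum, Finset.sum_mul, map_sum, map_mul]
  rw [Finset.sum_comm]
  refine Finset.sum_congr rfl fun k _ => Finset.sum_congr rfl fun i _ => ?_
  rw [Matrix.conjTranspose_apply, Complex.star_def, Complex.conj_conj]
  ring

theorem continuous_opMat {τ : Type*} [TopologicalSpace τ] {M : τ → Matrix ι κ ℂ}
    (hM : Continuous M) : Continuous fun t => opMat (M t) :=
  (LinearMap.continuous_of_finiteDimensional opMat).comp hM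

/-- The dimension of the kernel of a matrix. -/
def nul (M : Matrix ι κ ℂ) : ℕ := Module.finrank ℂ (LinearMap.ker M.mulVecLin)

theorem finrank_ker_opMat (M : Matrix ι κ ℂ) : Module.finrank ℂ (opMat M).ker = nul M := by
  let e : (opMat M).ker ≃ₗ[ℂ] LinearMap.ker M.mulVecLin :=
    { toFun := fun v => ⟨(v.1 : κ → ℂ), congrArg (fun u : L2 ι => (u : ι → ℂ)) v.2⟩
      map_add' := fun _ _ => rfl
      map_smul' := fun _ _ => rfl
      invFun := fun v => ⟨⟨v.1, Memℓp.all _⟩, lp.ext v.2⟩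
      left_inv := fun _ => rfl
      right_inv := fun _ => rfl }
  exact e.finrank_eq

theorem matOp_eq_opMat [DecidableEq Y] (S : Matrix n s ℂ) :
    (matOp S : L2 (Y × s) →L[ℂ] _) = opMat ((1 : Matrix Y Y ℂ) ⊗ₖ S) := by
  ext v ⟨y, i⟩
  rw [matOp_apply, opMat_apply, Fintype.sum_prod_type]
  simp [Matrix.one_apply, Finset.sum_ite_eq]

theorem amplRight_opMat [DecidableEq s] (M : Matrix Y Y ℂ) :
    amplRight s (opMat M) = opMat (M ⊗ₖ (1 : Matrix s s ℂ)) := by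
  ext v ⟨y, i⟩
  rw [amplRight_eq, amplR_apply, opMat_apply, opMat_apply, Fintype.sum_prod_type]
  simp only [Matrix.kroneckerMap_apply, Matrix.one_apply, mul_ite, mul_one, mul_zero, ite_mul,
    zero_mul, Finset.sum_ite_eq, Finset.mem_univ, if_true]
  rfl

/-- `M ⊗ 1` with the middle factor `1`. -/
def midMat {Y Y' s s' : Type} (n : Type) [DecidableEq n] (M : Matrix (Y × s) (Y' × s') ℂ) :
    Matrix ((Y × n) × s) ((Y' × n) × s') ℂ :=
  Matrix.of fun p q => if p.1.2 = q.1.2 then M (p.1.1, p.2) (q.1.1, q.2) else 0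

theorem amplMid_opMat [DecidableEq n] (M : Matrix (Y × s) (Y × s) ℂ) :
    amplMid n (opMat M) = opMat (midMat n M) := by
  ext v ⟨⟨y, a⟩, i⟩
  rw [amplMid_apply, opMat_apply, opMat_apply, Fintype.sum_prod_type, Fintype.sum_prod_type,
    Fintype.sum_prod_type]
  simp only [midMat, Matrix.of_apply, ite_mul, zero_mul]
  refine Finset.sum_congr rfl fun y' _ => ?_
  rw [Finset.sum_comm]
  refine Finset.sum_congr rfl fun i' _ => ?_
  rw [Finset.sum_ite_eq, if_pos (Finset.mem_univ _)]
  rfl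

/-- The anticommutator of two matrices over common sites. -/
def acMat [DecidableEq n] [DecidableEq s] (A : Matrix (Y × n) (Y × n) ℂ)
    (B : Matrix (Y × s) (Y × s) ℂ) : Matrix ((Y × n) × s) ((Y × n) × s) ℂ :=
  (A ⊗ₖ (1 : Matrix s s ℂ)) * midMat n B + midMat n B * (A ⊗ₖ (1 : Matrix s s ℂ))

end Matrices

/-! ### Reflections with prescribed symmetries -/

section MatrixClasses

variable {Y n s h m : Type} [Fintype Y] [Fintype n] [Fintype s] [Fintype h] [Fintype m]
  [DecidableEq Y] [DecidableEq n] [DecidableEq s] [DecidableEq h] [DecidableEq m]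

/-- A reflection over finitely many sites that commutes up to the sign `δ` with the antiunitary
symmetry `S 𝒞` and anticommutes with `R`. -/
structure MatClass (δ : ℂ) (S R : Matrix n n ℂ) (G : Matrix (Y × n) (Y × n) ℂ) : Prop where
  herm : Gᴴ = G
  sq : G * G = 1
  sym : G * ((1 : Matrix Y Y ℂ) ⊗ₖ S) = δ • (((1 : Matrix Y Y ℂ) ⊗ₖ S) * G.map star)
  chiral : ((1 : Matrix Y Y ℂ) ⊗ₖ R) * G = -(G * ((1 : Matrix Y Y ℂ) ⊗ₖ R))

/-- The projection `(1 + G) / 2` of a reflection `G`. -/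
def reflProj (G : Matrix (Y × n) (Y × n) ℂ) : BOp (Y × n) := opMat ((1 / 2 : ℂ) • (1 + G))

variable {δ c : ℂ} {S R : Matrix n n ℂ} {G : Matrix (Y × n) (Y × n) ℂ}

theorem reflProj_apply (G : Matrix (Y × n) (Y × n) ℂ) (v : L2 (Y × n)) :
    reflProj G v = (1 / 2 : ℂ) • (v + opMat G v) := by
  rw [reflProj, map_smul, map_add, opMat_one]
  rfl

theorem two_smul_reflProj_sub_one (G : Matrix (Y × n) (Y × n) ℂ) :
    (2 : ℂ) • reflProj G - 1 = opMat G := by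
  ext1 v
  change (2 : ℂ) • reflProj G v - v = _
  rw [reflProj_apply]
  module

theorem MatClass.isStarProjection (hG : MatClass δ S R G) : IsStarProjection (reflProj G) := by
  constructor
  · change reflProj G ∘L reflProj G = _
    rw [reflProj, opMat_comp]
    congr 1
    rw [Matrix.smul_mul, Matrix.mul_smul, Matrix.add_mul, Matrix.mul_add, Matrix.mul_add, hG.sq]
    simp only [Matrix.mul_one, Matrix.one_mul]
    module
  · change adjoint _ = _
    rw [reflProj, adjoint_opMat, Matrix.conjTranspose_smul, Matrix.conjTranspose_add, hG.herm,
      Matrix.conjTranspose_one]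
    simp

theorem MatClass.sym_apply (hG : MatClass δ S R G) (hδ : δ * δ = 1) (v : L2 (Y × n)) :
    matOp S (star (opMat G v)) = δ • opMat G (matOp S (star v)) := by
  rw [opMat_star, matOp_eq_opMat, opMat_opMat, opMat_opMat, hG.sym, map_smul, smul_apply,
    smul_smul, hδ, one_smul]

theorem MatClass.twist_keep (hG : MatClass δ S R G) (hδ : δ = 1) {ε : ℤ} (hS : IsSymmetryOp ε S)
    (hε : ε * ε = 1) : twist S (reflProj G) = reflProj G := by
  refine twist_eq_of_apply hS hε fun v => ?_
  rw [reflProj_apply, reflProj_apply, star_smul, map_smul, star_add, map_add,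
    hG.sym_apply (by rw [hδ, one_mul]), hδ, one_smul]
  simp

theorem MatClass.twist_flip (hG : MatClass δ S R G) (hδ : δ = -1) {ε : ℤ} (hS : IsSymmetryOp ε S)
    (hε : ε * ε = 1) : twist S (reflProj G) = 1 - reflProj G := by
  refine twist_eq_of_apply hS hε fun v => ?_
  change _ = matOp S (star v) - reflProj G (matOp S (star v))
  rw [reflProj_apply, reflProj_apply, star_smul, map_smul, star_add, map_add,
    hG.sym_apply (by rw [hδ]; norm_num), hδ]
  simp only [star_div₀, star_one, star_ofNat]
  module

theorem MatClass.chiral_apply (hG : MatClass δ S R G) (v : L2 (Y × n)) :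
    matOp R (reflProj G v) = matOp R v - reflProj G (matOp R v) := by
  have h1 : matOp R (opMat G v) = -opMat G (matOp R v) := by
    rw [matOp_eq_opMat, opMat_opMat, opMat_opMat, hG.chiral, map_neg]
    rfl
  rw [reflProj_apply, reflProj_apply, map_smul, map_add, h1]
  module

variable {j d : ℕ} {Str Sph : Matrix n n ℂ} {Vp Vm : Matrix n h ℂ}

/-- For even $j$ exactly one of the two symmetries imposes a condition, so one pair of a matrix and
a sign encodes the class. -/
theorem MatClass.kClass_even (hFS : IsFibreSymmetry j Str Sph) (hj : j < 8) (ho : ¬ Odd j)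
    (hG : MatClass (if trs j ≠ 0 then 1 else -1) (if trs j ≠ 0 then Str else Sph) R G) :
    KClass j Str Sph (reflProj G) where
  proj := hG.isStarProjection
  tr ht := by
    rw [if_pos ht, if_pos ht] at hG
    exact hG.twist_keep rfl (hFS.tr ht) (trs_sq ht)
  ph hp := by
    have ht : ¬ trs j ≠ 0 := fun ht => ho ((odd_iff_trs_mul_phs hj).2 (mul_ne_zero ht hp))
    rw [if_neg ht, if_neg ht] at hG
    exact hG.twist_flip rfl (hFS.ph hp) (phs_sq hp)

/-- It suffices to prescribe $S_{tr}$ and $R=S_{tr}S_{ph}$, because $S_{ph}=\pm S_{tr}R$. -/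
theorem MatClass.kClass_odd (hFS : IsFibreSymmetry j Str Sph) (hj : j < 8) (ho : Odd j)
    (hG : MatClass 1 Str (Str * Sph) G) : KClass j Str Sph (reflProj G) := by
  have h0 := (odd_iff_trs_mul_phs hj).1 ho
  have ht : trs j ≠ 0 := left_ne_zero_of_mul h0
  have hp : phs j ≠ 0 := right_ne_zero_of_mul h0
  refine ⟨hG.isStarProjection, fun _ => hG.twist_keep rfl (hFS.tr ht) (trs_sq ht), fun _ => ?_⟩
  have h1 := twist_eq_self (hFS.tr ht) (hG.twist_keep rfl (hFS.tr ht) (trs_sq ht))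
  have h2 : ∀ v : L2 (Y × n), matOp Str (matOp Sph v) = matOp (Str * Sph) v := matOp_mul _ _
  have h3 : ∀ v : L2 (Y × n), matOp Str (matOp Str v) = (trs j : ℂ) • v :=
    matOp_mul_self (hFS.tr ht).sq
  have hc : (trs j : ℂ) * trs j = 1 := by exact_mod_cast trs_sq ht
  have h4 : ∀ v : L2 (Y × n), matOp Sph v = (trs j : ℂ) • matOp Str (matOp (Str * Sph) v) := by
    intro v
    rw [← h2, h3, smul_smul, hc, one_smul]
  have h5 : ∀ v : L2 (Y × n), matOp (Str * Sph) (star v) = star (matOp (Str * Sph) v) := by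
    intro v
    rw [← h2, ← h2, (hFS.ph hp).matOp_star, (hFS.tr ht).matOp_star]
  refine twist_eq_of_apply (hFS.ph hp) (phs_sq hp) fun v => ?_
  change _ = matOp Sph (star v) - reflProj G (matOp Sph (star v))
  rw [h4, h5, hG.chiral_apply, star_sub, map_sub, h1, h4 (star v), h5, map_smul, smul_sub]

theorem sigmaSign_sq (d : ℕ) : sigmaSign d * sigmaSign d = 1 := by
  rw [sigmaSign, ← mul_pow]
  norm_num

theorem MatClass.khClass {G : Matrix (Y × Spin d) (Y × Spin d) ℂ}
    (hG : MatClass (kappa d) (diracSigma d) (if Even d then diracOmega d else 0) G) :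
    KHClass d (reflProj G) where
  proj := hG.isStarProjection
  sigma_pos hk := hG.twist_keep (by rw [hk]; norm_num) (isSymmetryOp_diracSigma d) (sigmaSign_sq d)
  sigma_neg hk := hG.twist_flip (by rw [hk]; norm_num) (isSymmetryOp_diracSigma d) (sigmaSign_sq d)
  omega hd := by
    rw [if_pos hd] at hG
    ext1 v
    change adjoint (matOp (diracOmega d)) (reflProj G (matOp (diracOmega d) v)) = v - reflProj G v
    have h1 := hG.chiral_apply v
    rw [eq_sub_iff_add_eq, ← eq_sub_iff_add_eq'] at h1
    rw [h1, map_sub, adjoint_matOp_matOp (diracOmega_unitary d),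
      adjoint_matOp_matOp (diracOmega_unitary d)]

theorem antiComm_right (A : Matrix (Y × n) (Y × n) ℂ) (B : Matrix (Y × s) (Y × s) ℂ) :
    antiComm (amplRight s (reflProj A)) (amplMid n ((2 : ℂ) • reflProj B - 1)) =
      opMat (acMat A B) := by
  rw [antiComm, ← amplRight_reflection, two_smul_reflProj_sub_one, two_smul_reflProj_sub_one,
    amplRight_opMat, amplMid_opMat, opMat_comp, opMat_comp, ← map_add]
  rfl

theorem antiComm_mid (A : Matrix (Y × n) (Y × n) ℂ) (B : Matrix (Y × s) (Y × s) ℂ) :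
    antiComm (amplMid n (reflProj B)) (amplRight s ((2 : ℂ) • reflProj A - 1)) =
      opMat (acMat A B) := by
  rw [antiComm, ← amplMid_reflection, two_smul_reflProj_sub_one, two_smul_reflProj_sub_one,
    amplRight_opMat, amplMid_opMat, opMat_comp, opMat_comp, ← map_add, add_comm]
  rfl

variable {δ' c' : ℂ} {S' R' : Matrix s s ℂ} {Wp Wm : Matrix s m ℂ} {A : Matrix (Y × n) (Y × n) ℂ}
  {B : Matrix (Y × s) (Y × s) ℂ}

omit [DecidableEq h] in
-- From here on the parity of the pairing is a question about the matrix $AB+BA$, in which $P$ and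
-- $E$ play symmetric roles.
theorem nullity_even (hd : Even d) (hW : IsChiralFrame R' c' Wp Wm) (hc : Nonempty m → c' ≠ 0)
    (hA : MatClass δ S R A) (hB : MatClass δ' S' R' B) :
    4 * nullity (pairingOp j d Vp Vm Wp Wm (reflProj A) (reflProj B)) = nul (acMat A B) := by
  have hf := framePair_even (P := reflProj A) (E := reflProj B) hW hc hA.isStarProjection
    hB.isStarProjection.isSelfAdjoint hB.chiral_apply
  rw [pairingOp_even hd, nullity, ← finrank_ker_opMat, ← antiComm_right]
  refine (hf.finrank_ker_antiComm (idem_apply (isStarProjection_amplRight hA.isStarProjection))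
    (amplMid_reflection_invol hB.isStarProjection) fun v => ?_).symm
  rw [add_comm]
  exact hW.complete_apply v

omit [DecidableEq m] in
theorem nullity_odd_odd (hd : ¬ Even d) (hj : Odd j) (hV : IsChiralFrame R c Vp Vm)
    (hc : Nonempty h → c ≠ 0) (hA : MatClass δ S R A) (hB : MatClass δ' S' R' B) :
    4 * nullity (pairingOp j d Vp Vm Wp Wm (reflProj A) (reflProj B)) = nul (acMat A B) := by
  have hf := framePair_oddOdd (P := reflProj A) (E := reflProj B) hV hc hB.isStarProjection
    hA.isStarProjection.isSelfAdjoint hA.chiral_apply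
  rw [pairingOp_odd_odd hd hj, nullity, ← finrank_ker_opMat, ← antiComm_mid]
  refine (hf.finrank_ker_antiComm (idem_apply (isStarProjection_amplMid hB.isStarProjection))
    (amplRight_reflection_invol hA.isStarProjection) fun v => ?_).symm
  rw [adjoint_amplR, adjoint_amplR, add_comm]
  refine slice_ext fun i => ?_
  rw [map_add, slice_amplR, slice_amplR, slice_amplR, slice_amplR, hV.complete_apply]

omit [DecidableEq h] [DecidableEq m] in
theorem nullity_odd_even (hd : ¬ Even d) (hj : ¬ Odd j) (hA : MatClass δ S R A)
    (hB : MatClass δ' S' R' B) :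
    2 * nullity (pairingOp j d Vp Vm Wp Wm (reflProj A) (reflProj B)) = nul (acMat A B) := by
  have hf := framePair_oddEven (P := reflProj A) (E := reflProj B) hB.isStarProjection
    hA.isStarProjection.isSelfAdjoint
  rw [pairingOp_odd_even hd hj, nullity, ← finrank_ker_opMat, ← antiComm_mid,
    finrank_ker_antiComm (idem_apply (isStarProjection_amplMid hB.isStarProjection))
    (amplRight_reflection_invol hA.isStarProjection), hf.finrank_ker]

end MatrixClasses


open scoped Matrix Kronecker

/-! ### Extending a reflection from an invariant subspace -/

section Inflation

variable {ι κ : Type} [Fintype ι] [Fintype κ] [DecidableEq ι] [DecidableEq κ]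

/-- `g` on the range of the isometry `T`, and `X` on its complement. -/
def inflate (X : Matrix ι ι ℂ) (T : Matrix ι κ ℂ) (g : Matrix κ κ ℂ) : Matrix ι ι ℂ :=
  X * (1 - T * Tᴴ) + T * g * Tᴴ

/-- The isometry `T` and the matrix `X` intertwine the symmetries `S`, `R` with `S'`, `R'`. -/
structure Inflation (δ : ℂ) (S R : Matrix ι ι ℂ) (S' R' : Matrix κ κ ℂ) (X : Matrix ι ι ℂ)
    (T : Matrix ι κ ℂ) : Prop where
  iso : Tᴴ * T = 1
  herm : Xᴴ = X
  comm : X * (T * Tᴴ) = T * Tᴴ * X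
  sq : X * X * (1 - T * Tᴴ) = 1 - T * Tᴴ
  symX : X * S = δ • (S * X.map star)
  chiX : R * X = -(X * R)
  symT : S * T.map star = T * S'
  symT' : Tᴴ * S = S' * Tᵀ
  chiT : R * T = T * R'
  chiT' : Tᴴ * R = R' * Tᴴ

variable {δ : ℂ} {S R X : Matrix ι ι ℂ} {S' R' g : Matrix κ κ ℂ} {T : Matrix ι κ ℂ}

theorem Inflation.mul_right (h : Inflation δ S R S' R' X T) : inflate X T g * T = T * g := by
  rw [inflate, Matrix.add_mul, Matrix.mul_assoc X, Matrix.sub_mul, Matrix.mul_assoc T, h.iso,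
    Matrix.one_mul, Matrix.mul_one, sub_self, Matrix.mul_zero, zero_add, Matrix.mul_assoc, h.iso,
    Matrix.mul_one]

theorem Inflation.conjTranspose (h : Inflation δ S R S' R' X T) (hg : gᴴ = g) :
    (inflate X T g)ᴴ = inflate X T g := by
  simp only [inflate, Matrix.conjTranspose_add, Matrix.conjTranspose_mul, Matrix.conjTranspose_sub,
    Matrix.conjTranspose_one, Matrix.conjTranspose_conjTranspose, h.herm, hg]
  rw [Matrix.sub_mul, Matrix.mul_sub, h.comm, Matrix.one_mul, Matrix.mul_one, ← Matrix.mul_assoc]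

theorem Inflation.mul_left (h : Inflation δ S R S' R' X T) : Tᴴ * inflate X T g = g * Tᴴ := by
  have h1 : Tᴴ * (1 - T * Tᴴ) = 0 := by
    rw [Matrix.mul_sub, ← Matrix.mul_assoc, h.iso, Matrix.one_mul, Matrix.mul_one, sub_self]
  have h2 : X * (1 - T * Tᴴ) = (1 - T * Tᴴ) * X := by
    rw [Matrix.sub_mul, Matrix.mul_sub, h.comm, Matrix.one_mul, Matrix.mul_one]
  rw [inflate, h2, Matrix.mul_add, ← Matrix.mul_assoc, h1, Matrix.zero_mul, zero_add,
    ← Matrix.mul_assoc, ← Matrix.mul_assoc, h.iso, Matrix.one_mul]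

theorem Inflation.mul_compl (h : Inflation δ S R S' R' X T) :
    inflate X T g * (1 - T * Tᴴ) = X * (1 - T * Tᴴ) := by
  rw [Matrix.mul_sub, ← Matrix.mul_assoc, h.mul_right, inflate, Matrix.mul_one, add_sub_cancel_right]

theorem Inflation.compl_mul (h : Inflation δ S R S' R' X T) :
    (1 - T * Tᴴ) * inflate X T g = inflate X T g * (1 - T * Tᴴ) := by
  rw [Matrix.mul_sub, Matrix.sub_mul, ← Matrix.mul_assoc, h.mul_right, Matrix.mul_assoc T,
    h.mul_left, Matrix.mul_one, Matrix.one_mul, Matrix.mul_assoc]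

theorem Inflation.mul_self (h : Inflation δ S R S' R' X T) (hg : g * g = 1) :
    inflate X T g * inflate X T g = 1 := by
  have h2 : X * (1 - T * Tᴴ) = (1 - T * Tᴴ) * X := by
    rw [Matrix.sub_mul, Matrix.mul_sub, h.comm, Matrix.one_mul, Matrix.mul_one]
  conv_lhs => lhs; rw [inflate]
  rw [Matrix.add_mul, Matrix.mul_assoc X, h.compl_mul, h.mul_compl, ← Matrix.mul_assoc, h.sq,
    Matrix.mul_assoc, h.mul_left, Matrix.mul_assoc, ← Matrix.mul_assoc g, hg, Matrix.one_mul,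
    sub_add_cancel]

theorem map_star_mul' {l m n : Type} [Fintype m] (A : Matrix l m ℂ) (B : Matrix m n ℂ) :
    (A * B).map star = A.map star * B.map star := by
  ext i j
  simp [Matrix.mul_apply]

theorem map_star_conjTranspose {l m : Type} (A : Matrix l m ℂ) : Aᴴ.map star = Aᵀ := by
  ext i j
  simp

theorem Inflation.map_star (h : Inflation δ S R S' R' X T) (hg : g * S' = δ • (S' * g.map star)) :
    inflate X T g * S = δ • (S * (inflate X T g).map star) := by
  have h1 : (inflate X T g).map star =
      X.map star * (1 - T.map star * Tᵀ) + T.map star * g.map star * Tᵀ := by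
    have h2 : ∀ A B : Matrix ι ι ℂ, (A + B).map star = A.map star + B.map star := fun A B => by
      ext i j; simp
    have h3 : ∀ A B : Matrix ι ι ℂ, (A - B).map star = A.map star - B.map star := fun A B => by
      ext i j; simp
    have h4 : (1 : Matrix ι ι ℂ).map star = 1 := by
      ext i j
      by_cases hij : i = j
      · rw [hij, Matrix.map_apply, Matrix.one_apply_eq, star_one]
      · rw [Matrix.map_apply, Matrix.one_apply_ne hij, star_zero]
    rw [inflate, h2, map_star_mul', h3, map_star_mul', map_star_mul', map_star_mul',
      map_star_conjTranspose, h4]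
  have h2 : (1 - T * Tᴴ) * S = S * (1 - T.map star * Tᵀ) := by
    rw [Matrix.sub_mul, Matrix.mul_sub, Matrix.mul_assoc, h.symT', ← Matrix.mul_assoc S, h.symT,
      Matrix.mul_assoc, Matrix.one_mul, Matrix.mul_one]
  rw [h1, inflate, Matrix.add_mul, Matrix.mul_assoc X, h2, ← Matrix.mul_assoc X, h.symX,
    Matrix.mul_assoc (T * g), h.symT', ← Matrix.mul_assoc (T * g), Matrix.mul_assoc T, hg,
    Matrix.mul_smul, ← Matrix.mul_assoc T, ← h.symT, Matrix.smul_mul, Matrix.smul_mul, ← smul_add,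
    Matrix.mul_add]
  simp only [Matrix.mul_assoc]

theorem Inflation.chiral (h : Inflation δ S R S' R' X T) (hg : R' * g = -(g * R')) :
    R * inflate X T g = -(inflate X T g * R) := by
  have h2 : (1 - T * Tᴴ) * R = R * (1 - T * Tᴴ) := by
    rw [Matrix.sub_mul, Matrix.mul_sub, Matrix.mul_assoc, h.chiT', ← Matrix.mul_assoc R, h.chiT,
      Matrix.mul_assoc, Matrix.one_mul, Matrix.mul_one]
  rw [inflate, Matrix.mul_add, Matrix.add_mul, Matrix.mul_assoc X, h2, ← Matrix.mul_assoc R, h.chiX,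
    Matrix.mul_assoc (T * g), h.chiT', ← Matrix.mul_assoc R, ← Matrix.mul_assoc R, h.chiT,
    Matrix.mul_assoc T R', hg]
  simp only [Matrix.mul_assoc, Matrix.neg_mul, Matrix.mul_neg, neg_add]

omit [DecidableEq ι] in
-- The kernel of $N$ is contained in the range of the isometry $W$, where $N$ acts as $N'$.
theorem nul_eq_of_intertwine {N : Matrix ι ι ℂ} {N' : Matrix κ κ ℂ} {W : Matrix ι κ ℂ}
    (hW : Wᴴ * W = 1) (h : N * W = W * N') (hN : ∀ v, N *ᵥ v = 0 → (W * Wᴴ) *ᵥ v = v) :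
    nul N = nul N' := by
  have hinj : Function.Injective W.mulVecLin := by
    intro u v huv
    have := congrArg (fun w => Wᴴ *ᵥ w) huv
    simpa [Matrix.mulVec_mulVec, hW] using this
  have key : Submodule.map W.mulVecLin (LinearMap.ker N'.mulVecLin) = LinearMap.ker N.mulVecLin := by
    ext v
    constructor
    · rintro ⟨u, hu, rfl⟩
      have hu' : N' *ᵥ u = 0 := hu
      change N *ᵥ (W *ᵥ u) = 0
      rw [Matrix.mulVec_mulVec, h, ← Matrix.mulVec_mulVec, hu', Matrix.mulVec_zero]
    · intro hv
      have hv' : N *ᵥ v = 0 := hv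
      have h1 := hN v hv'
      refine ⟨Wᴴ *ᵥ v, ?_, by change W *ᵥ (Wᴴ *ᵥ v) = v; rw [Matrix.mulVec_mulVec, h1]⟩
      refine hinj ?_
      change W *ᵥ (N' *ᵥ (Wᴴ *ᵥ v)) = W *ᵥ 0
      rw [Matrix.mulVec_mulVec, ← h, Matrix.mulVec_mulVec, Matrix.mulVec_zero, Matrix.mul_assoc,
        ← Matrix.mulVec_mulVec, h1, hv']
  rw [nul, nul, ← key]
  exact (LinearEquiv.finrank_eq (Submodule.equivMapOfInjective _ hinj _)).symm

end Inflation

/-! ### Where the anticommutator is invertible -/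

section Anticommutators

variable {ι : Type} [Fintype ι] [DecidableEq ι]

/-- On the range of $p$ the reflection $A$ agrees with an involution $X$ that commutes with $B$, so
the anticommutator is the invertible $2XB$. -/
theorem compl_mulVec_eq_zero {A B p X : Matrix ι ι ℂ} (hA : p * A = A * p) (hB : p * B = B * p)
    (hX : A * p = X * p) (hXB : X * B = B * X) (hXX : X * X = 1) (hBB : B * B = 1) {v : ι → ℂ}
    (hv : (A * B + B * A) *ᵥ v = 0) : p *ᵥ v = 0 := by
  have h1 : p * (A * B + B * A) = (2 : ℂ) • (X * (B * p)) := by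
    have h2 : p * (A * B) = X * (B * p) := by
      rw [← Matrix.mul_assoc, hA, hX, Matrix.mul_assoc, hB]
    have h3 : p * (B * A) = X * (B * p) := by
      rw [← Matrix.mul_assoc, hB, Matrix.mul_assoc, hA, hX, ← Matrix.mul_assoc, ← hXB,
        Matrix.mul_assoc]
    rw [Matrix.mul_add, h2, h3, two_smul]
  have h2 : ((2 : ℂ) • (X * (B * p))) *ᵥ v = 0 := by
    rw [← h1, ← Matrix.mulVec_mulVec, hv, Matrix.mulVec_zero]
  have h3 : (X * (B * p)) *ᵥ v = 0 := by
    rw [Matrix.smul_mulVec] at h2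
    exact (smul_eq_zero.1 h2).resolve_left two_ne_zero
  have h4 := congrArg (fun u => (B * X) *ᵥ u) h3
  simp only [Matrix.mulVec_mulVec, Matrix.mulVec_zero] at h4
  rwa [Matrix.mul_assoc B, ← Matrix.mul_assoc X, hXX, Matrix.one_mul, ← Matrix.mul_assoc, hBB,
    Matrix.one_mul] at h4

end Anticommutators

/-! ### Matrices that skip a tensor factor -/

section MiddleFactors

variable {Y Y' Y'' n n' s s' s'' : Type} [DecidableEq n]

theorem midMat_apply (M : Matrix (Y × s) (Y' × s') ℂ) (p q) :
    midMat n M p q = if p.1.2 = q.1.2 then M (p.1.1, p.2) (q.1.1, q.2) else 0 := rfl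

theorem midMat_mul [Fintype Y'] [Fintype n] [Fintype s'] (M : Matrix (Y × s) (Y' × s') ℂ) (N : Matrix (Y' × s') (Y'' × s'') ℂ) :
    midMat n M * midMat n N = midMat n (M * N) := by
  ext ⟨⟨y, a⟩, i⟩ ⟨⟨y'', a''⟩, i''⟩
  simp only [Matrix.mul_apply, midMat_apply, Fintype.sum_prod_type, ite_mul, zero_mul, mul_ite,
    mul_zero]
  split_ifs with h
  · refine Finset.sum_congr rfl fun y' _ => ?_
    rw [Finset.sum_comm]
    refine Finset.sum_congr rfl fun i' _ => ?_
    simp [h]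
  · refine Finset.sum_eq_zero fun y' _ => Finset.sum_eq_zero fun a' _ => Finset.sum_eq_zero
      fun i' _ => ?_
    split_ifs with h1 h2
    · exact absurd (h2.trans h1) h
    · rfl
    · rfl

theorem midMat_one_kronecker [DecidableEq Y] (M : Matrix s s' ℂ) :
    midMat n ((1 : Matrix Y Y ℂ) ⊗ₖ M) = (1 : Matrix (Y × n) (Y × n) ℂ) ⊗ₖ M := by
  ext ⟨⟨y, a⟩, i⟩ ⟨⟨y', a'⟩, i'⟩
  simp only [midMat_apply, Matrix.kroneckerMap_apply, Matrix.one_apply, Prod.mk.injEq]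
  by_cases h : a = a'
  · simp [h]
  · simp [h]

theorem midMat_one [DecidableEq Y] [DecidableEq s] : midMat n (1 : Matrix (Y × s) (Y × s) ℂ) = 1 := by
  rw [← Matrix.one_kronecker_one, midMat_one_kronecker, Matrix.one_kronecker_one]

theorem midMat_comm [DecidableEq n'] [DecidableEq Y] [DecidableEq Y'] [DecidableEq s]
    [DecidableEq s'] [Fintype Y] [Fintype Y'] [Fintype n] [Fintype n'] [Fintype s] [Fintype s'] (M : Matrix (Y × s) (Y' × s') ℂ)
    (N : Matrix n n' ℂ) :
    midMat n M * (((1 : Matrix Y' Y' ℂ) ⊗ₖ N) ⊗ₖ (1 : Matrix s' s' ℂ)) =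
      (((1 : Matrix Y Y ℂ) ⊗ₖ N) ⊗ₖ (1 : Matrix s s ℂ)) * midMat n' M := by
  ext ⟨⟨y, a⟩, i⟩ ⟨⟨y', a'⟩, i'⟩
  simp [Matrix.mul_apply, midMat_apply, Fintype.sum_prod_type, Matrix.one_apply, mul_comm]

end MiddleFactors


open scoped Matrix Kronecker

/-! ### Transplanting paths from a model fibre -/

section FibreInflation

variable {Y n s σ τ : Type} [Fintype Y] [Fintype n] [Fintype s] [Fintype σ] [Fintype τ]
  [DecidableEq Y] [DecidableEq n] [DecidableEq s] [DecidableEq σ] [DecidableEq τ]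

omit [Fintype Y] in
theorem map_star_one : (1 : Matrix Y Y ℂ).map star = 1 := by
  have h := map_star_conjTranspose (1 : Matrix Y Y ℂ)
  rwa [Matrix.conjTranspose_one, Matrix.transpose_one] at h

theorem kronecker_map_star {l m p q : Type} (A : Matrix l m ℂ) (B : Matrix p q ℂ) :
    (A ⊗ₖ B).map star = A.map star ⊗ₖ B.map star := by
  ext i j
  simp

theorem one_kronecker_mul {l m p : Type} [Fintype m] (A : Matrix l m ℂ) (B : Matrix m p ℂ) :
    ((1 : Matrix Y Y ℂ) ⊗ₖ A) * ((1 : Matrix Y Y ℂ) ⊗ₖ B) = (1 : Matrix Y Y ℂ) ⊗ₖ (A * B) := by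
  rw [← Matrix.mul_kronecker_mul, Matrix.one_mul]

theorem mul_kronecker_one {l m p : Type} [Fintype m] (A : Matrix l m ℂ) (B : Matrix m p ℂ) :
    (A ⊗ₖ (1 : Matrix Y Y ℂ)) * (B ⊗ₖ (1 : Matrix Y Y ℂ)) = (A * B) ⊗ₖ (1 : Matrix Y Y ℂ) := by
  rw [← Matrix.mul_kronecker_mul, Matrix.one_mul]

omit [Fintype Y] in
theorem one_kronecker_conjTranspose {l m : Type} (A : Matrix l m ℂ) :
    ((1 : Matrix Y Y ℂ) ⊗ₖ A)ᴴ = (1 : Matrix Y Y ℂ) ⊗ₖ Aᴴ := by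
  rw [Matrix.conjTranspose_kronecker, Matrix.conjTranspose_one]

omit [Fintype Y] in
theorem kronecker_one_conjTranspose {l m : Type} (A : Matrix l m ℂ) :
    (A ⊗ₖ (1 : Matrix Y Y ℂ))ᴴ = Aᴴ ⊗ₖ (1 : Matrix Y Y ℂ) := by
  rw [Matrix.conjTranspose_kronecker, Matrix.conjTranspose_one]

omit [Fintype Y] in
theorem one_kronecker_map_star {l m : Type} (A : Matrix l m ℂ) :
    ((1 : Matrix Y Y ℂ) ⊗ₖ A).map star = (1 : Matrix Y Y ℂ) ⊗ₖ A.map star := by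
  rw [kronecker_map_star, map_star_one]

omit [Fintype Y] in
theorem one_kronecker_transpose {l m : Type} (A : Matrix l m ℂ) :
    ((1 : Matrix Y Y ℂ) ⊗ₖ A)ᵀ = (1 : Matrix Y Y ℂ) ⊗ₖ Aᵀ := by
  rw [← Matrix.kroneckerMap_transpose, Matrix.transpose_one]

omit [Fintype Y] in
theorem one_kronecker_neg {l m : Type} (A : Matrix l m ℂ) :
    (1 : Matrix Y Y ℂ) ⊗ₖ (-A) = -((1 : Matrix Y Y ℂ) ⊗ₖ A) := by
  ext i j
  simp

omit [Fintype Y] [Fintype n] in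
theorem one_sub_one_kronecker (A : Matrix n n ℂ) :
    1 - (1 : Matrix Y Y ℂ) ⊗ₖ A = (1 : Matrix Y Y ℂ) ⊗ₖ (1 - A) := by
  rw [← Matrix.one_kronecker_one (m := Y) (n := n)]
  ext i j
  simp only [Matrix.sub_apply, Matrix.kroneckerMap_apply, mul_sub]

omit [Fintype Y] [Fintype n] in
theorem one_sub_kronecker_one (A : Matrix n n ℂ) :
    1 - A ⊗ₖ (1 : Matrix Y Y ℂ) = (1 - A) ⊗ₖ (1 : Matrix Y Y ℂ) := by
  rw [← Matrix.one_kronecker_one (m := n) (n := Y)]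
  ext i j
  simp only [Matrix.sub_apply, Matrix.kroneckerMap_apply, sub_mul]

variable {δ : ℂ} {S R X : Matrix n n ℂ} {C θ : Matrix σ σ ℂ} {Z : Matrix n σ ℂ}

theorem Inflation.one_kronecker (h : Inflation δ S R C θ X Z) :
    Inflation δ ((1 : Matrix Y Y ℂ) ⊗ₖ S) ((1 : Matrix Y Y ℂ) ⊗ₖ R) ((1 : Matrix Y Y ℂ) ⊗ₖ C)
      ((1 : Matrix Y Y ℂ) ⊗ₖ θ) ((1 : Matrix Y Y ℂ) ⊗ₖ X) ((1 : Matrix Y Y ℂ) ⊗ₖ Z) where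
  iso := by rw [one_kronecker_conjTranspose, one_kronecker_mul, h.iso, Matrix.one_kronecker_one]
  herm := by rw [one_kronecker_conjTranspose, h.herm]
  comm := by
    rw [one_kronecker_conjTranspose, one_kronecker_mul, one_kronecker_mul, one_kronecker_mul, h.comm]
  sq := by
    rw [one_kronecker_conjTranspose, one_kronecker_mul, one_kronecker_mul, one_sub_one_kronecker,
      one_kronecker_mul, h.sq]
  symX := by
    rw [one_kronecker_map_star, one_kronecker_mul, one_kronecker_mul, h.symX, Matrix.kronecker_smul]
  chiX := by rw [one_kronecker_mul, one_kronecker_mul, h.chiX, one_kronecker_neg]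
  symT := by rw [one_kronecker_map_star, one_kronecker_mul, one_kronecker_mul, h.symT]
  symT' := by
    rw [one_kronecker_conjTranspose, one_kronecker_transpose, one_kronecker_mul, one_kronecker_mul,
      h.symT']
  chiT := by rw [one_kronecker_mul, one_kronecker_mul, h.chiT]
  chiT' := by
    rw [one_kronecker_conjTranspose, one_kronecker_mul, one_kronecker_mul, h.chiT']

theorem MatClass.of_inflation {Y' : Type} [Fintype Y'] [DecidableEq Y'] {X : Matrix (Y × n) (Y × n) ℂ}
    {T : Matrix (Y × n) (Y' × σ) ℂ} {g : Matrix (Y' × σ) (Y' × σ) ℂ} (hg : MatClass δ C θ g)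
    (h : Inflation δ ((1 : Matrix Y Y ℂ) ⊗ₖ S) ((1 : Matrix Y Y ℂ) ⊗ₖ R)
      ((1 : Matrix Y' Y' ℂ) ⊗ₖ C) ((1 : Matrix Y' Y' ℂ) ⊗ₖ θ) X T) :
    MatClass δ S R (inflate X T g) :=
  ⟨h.conjTranspose hg.herm, h.mul_self hg.sq, h.map_star hg.sym, h.chiral hg.chiral⟩

theorem continuous_inflate {ι κ : Type} {τ : Type*} [TopologicalSpace τ] [Fintype ι] [Fintype κ]
    [DecidableEq ι] (X : Matrix ι ι ℂ) (T : Matrix ι κ ℂ) {g : τ → Matrix κ κ ℂ}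
    (hg : Continuous g) : Continuous fun t => inflate X T (g t) :=
  continuous_const.add ((continuous_const.matrix_mul hg).matrix_mul continuous_const)

/-- Over finitely many sites there are paths of reflections with the given symmetries, whose
anticommutator is injective at `t = 0` and has a kernel of dimension `q` at `t = 1`. -/
def Flips (δ : ℂ) (S R : Matrix n n ℂ) (δ' : ℂ) (S' R' : Matrix s s ℂ) (q : ℕ) : Prop :=
  ∃ (Y : Type) (_ : Fintype Y) (_ : DecidableEq Y) (A : unitInterval → Matrix (Y × n) (Y × n) ℂ)
    (B : unitInterval → Matrix (Y × s) (Y × s) ℂ), Continuous A ∧ Continuous B ∧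
    (∀ t, MatClass δ S R (A t)) ∧ (∀ t, MatClass δ' S' R' (B t)) ∧
    nul (acMat (A 0) (B 0)) = 0 ∧ nul (acMat (A 1) (B 1)) = q

variable {δ' : ℂ} {S' R' X' : Matrix s s ℂ} {C' θ' : Matrix τ τ ℂ} {Z' : Matrix s τ ℂ}

/-- Off the embedded model one of the two reflections acts by a constant fibre matrix, which
commutes with the other reflection. The anticommutator is invertible there and its kernel stays in
the product of the two model fibres. -/
theorem nul_acMat_inflate (h : Inflation δ S R C θ X Z) (hX : X * X = 1)
    (h' : Inflation δ' S' R' C' θ' X' Z') (hX' : X' * X' = 1) {a : Matrix (Y × σ) (Y × σ) ℂ}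
    {b : Matrix (Y × τ) (Y × τ) ℂ} (ha : a * a = 1) (hb : b * b = 1) :
    nul (acMat (inflate ((1 : Matrix Y Y ℂ) ⊗ₖ X) ((1 : Matrix Y Y ℂ) ⊗ₖ Z) a)
      (inflate ((1 : Matrix Y Y ℂ) ⊗ₖ X') ((1 : Matrix Y Y ℂ) ⊗ₖ Z') b)) = nul (acMat a b) := by
  have hA := h.one_kronecker (Y := Y)
  have hB := h'.one_kronecker (Y := Y)
  set A := inflate ((1 : Matrix Y Y ℂ) ⊗ₖ X) ((1 : Matrix Y Y ℂ) ⊗ₖ Z) a with hAdef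
  set B := inflate ((1 : Matrix Y Y ℂ) ⊗ₖ X') ((1 : Matrix Y Y ℂ) ⊗ₖ Z') b with hBdef
  have hAA : A * A = 1 := hA.mul_self ha
  have hBB : B * B = 1 := hB.mul_self hb
  set T : Matrix ((Y × n) × s) ((Y × σ) × s) ℂ :=
    ((1 : Matrix Y Y ℂ) ⊗ₖ Z) ⊗ₖ (1 : Matrix s s ℂ) with hT
  set T' : Matrix ((Y × σ) × s) ((Y × σ) × τ) ℂ := (1 : Matrix (Y × σ) (Y × σ) ℂ) ⊗ₖ Z' with hT'
  have hTT : Tᴴ * T = 1 := by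
    rw [hT, kronecker_one_conjTranspose, mul_kronecker_one, hA.iso, Matrix.one_kronecker_one]
  have hTT' : T'ᴴ * T' = 1 := by
    rw [hT', one_kronecker_conjTranspose, one_kronecker_mul, h'.iso, Matrix.one_kronecker_one]
  have h1 : (A ⊗ₖ (1 : Matrix s s ℂ)) * (T * T') = T * T' * (a ⊗ₖ (1 : Matrix τ τ ℂ)) := by
    rw [← Matrix.mul_assoc, hT, mul_kronecker_one, hA.mul_right, ← mul_kronecker_one,
      Matrix.mul_assoc, Matrix.mul_assoc, hT', ← Matrix.mul_kronecker_mul a,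
      ← Matrix.mul_kronecker_mul _ a, Matrix.mul_one, Matrix.one_mul, Matrix.one_mul,
      Matrix.mul_one]
  have h2 : midMat n B * (T * T') = T * T' * midMat σ b := by
    rw [← Matrix.mul_assoc, hT, midMat_comm, Matrix.mul_assoc, Matrix.mul_assoc, hT',
      ← midMat_one_kronecker, midMat_mul, midMat_mul, hB.mul_right]
  refine nul_eq_of_intertwine (W := T * T') ?_ ?_ fun v hv => ?_
  · rw [Matrix.conjTranspose_mul, Matrix.mul_assoc, ← Matrix.mul_assoc Tᴴ, hTT, Matrix.one_mul, hTT']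
  · rw [acMat, acMat, Matrix.add_mul, Matrix.mul_add, Matrix.mul_assoc, h2, ← Matrix.mul_assoc, h1,
      Matrix.mul_assoc (midMat n B), h1, ← Matrix.mul_assoc (midMat n B), h2,
      Matrix.mul_assoc (T * T'), Matrix.mul_assoc (T * T')]
  · set p : Matrix ((Y × n) × s) ((Y × n) × s) ℂ :=
      (1 - ((1 : Matrix Y Y ℂ) ⊗ₖ Z) * ((1 : Matrix Y Y ℂ) ⊗ₖ Z)ᴴ) ⊗ₖ (1 : Matrix s s ℂ) with hp
    set p' : Matrix ((Y × n) × s) ((Y × n) × s) ℂ :=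
      midMat n (1 - ((1 : Matrix Y Y ℂ) ⊗ₖ Z') * ((1 : Matrix Y Y ℂ) ⊗ₖ Z')ᴴ) with hp'
    have e1 : p = ((1 : Matrix Y Y ℂ) ⊗ₖ (1 - Z * Zᴴ)) ⊗ₖ (1 : Matrix s s ℂ) := by
      rw [hp, one_kronecker_conjTranspose, one_kronecker_mul, one_sub_one_kronecker]
    have e2 : p' = (1 : Matrix (Y × n) (Y × n) ℂ) ⊗ₖ (1 - Z' * Z'ᴴ) := by
      rw [hp', one_kronecker_conjTranspose, one_kronecker_mul, one_sub_one_kronecker,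
        midMat_one_kronecker]
    have h3 : p *ᵥ v = 0 := by
      refine compl_mulVec_eq_zero (A := A ⊗ₖ (1 : Matrix s s ℂ)) (B := midMat n B)
        (X := ((1 : Matrix Y Y ℂ) ⊗ₖ X) ⊗ₖ (1 : Matrix s s ℂ)) ?_ ?_ ?_ ?_ ?_ ?_ hv
      · rw [hp, mul_kronecker_one, mul_kronecker_one, hA.compl_mul]
      · rw [e1, midMat_comm]
      · rw [hp, mul_kronecker_one, mul_kronecker_one, hA.mul_compl]
      · rw [midMat_comm]
      · rw [mul_kronecker_one, one_kronecker_mul, hX, Matrix.one_kronecker_one,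
          Matrix.one_kronecker_one]
      · rw [midMat_mul, hBB, midMat_one]
    have h4 : p' *ᵥ v = 0 := by
      refine compl_mulVec_eq_zero (A := midMat n B) (B := A ⊗ₖ (1 : Matrix s s ℂ))
        (X := midMat n ((1 : Matrix Y Y ℂ) ⊗ₖ X')) ?_ ?_ ?_ ?_ ?_ ?_
        (by rw [add_comm]; exact hv)
      · rw [hp', midMat_mul, midMat_mul, hB.compl_mul]
      · rw [e2, ← Matrix.mul_kronecker_mul, ← Matrix.mul_kronecker_mul, Matrix.one_mul,
          Matrix.mul_one, Matrix.one_mul, Matrix.mul_one]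
      · rw [hp', midMat_mul, midMat_mul, hB.mul_compl]
      · rw [midMat_one_kronecker, ← Matrix.mul_kronecker_mul, ← Matrix.mul_kronecker_mul,
          Matrix.one_mul, Matrix.mul_one, Matrix.one_mul, Matrix.mul_one]
      · rw [midMat_mul, one_kronecker_mul, hX', Matrix.one_kronecker_one, midMat_one]
      · rw [mul_kronecker_one, hAA, Matrix.one_kronecker_one]
    -- The range projection of the joint embedding is the product of the two commuting complements,
    -- so a vector annihilated by `p` and `p'` is fixed by it.
    have h5 : T * T' * (T * T')ᴴ = (1 - p') * (1 - p) := by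
      rw [Matrix.conjTranspose_mul, e1, e2, hT, hT', one_kronecker_conjTranspose,
        kronecker_one_conjTranspose, one_kronecker_conjTranspose, Matrix.mul_assoc,
        ← Matrix.mul_assoc _ _ (((1 : Matrix Y Y ℂ) ⊗ₖ Zᴴ) ⊗ₖ (1 : Matrix s s ℂ)),
        one_kronecker_mul, ← Matrix.mul_assoc, one_sub_one_kronecker, one_sub_kronecker_one,
        one_sub_one_kronecker, sub_sub_cancel, sub_sub_cancel]
      simp only [← Matrix.mul_kronecker_mul, Matrix.one_mul, Matrix.mul_one]
    rw [h5, ← Matrix.mulVec_mulVec, Matrix.sub_mulVec 1 p, h3, Matrix.one_mulVec, sub_zero,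
      Matrix.sub_mulVec, h4, Matrix.one_mulVec, sub_zero]

theorem Flips.of_inflation (h : Inflation δ S R C θ X Z) (hX : X * X = 1)
    (h' : Inflation δ' S' R' C' θ' X' Z') (hX' : X' * X' = 1) {q : ℕ}
    (hf : Flips δ C θ δ' C' θ' q) : Flips δ S R δ' S' R' q := by
  obtain ⟨Y, _, _, a, b, ha, hb, hca, hcb, h0, h1⟩ := hf
  refine ⟨Y, inferInstance, inferInstance,
    fun t => inflate ((1 : Matrix Y Y ℂ) ⊗ₖ X) ((1 : Matrix Y Y ℂ) ⊗ₖ Z) (a t),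
    fun t => inflate ((1 : Matrix Y Y ℂ) ⊗ₖ X') ((1 : Matrix Y Y ℂ) ⊗ₖ Z') (b t),
    continuous_inflate _ _ ha, continuous_inflate _ _ hb,
    fun t => (hca t).of_inflation h.one_kronecker,
    fun t => (hcb t).of_inflation h'.one_kronecker, ?_, ?_⟩
  · rw [nul_acMat_inflate h hX h' hX' (hca 0).sq (hcb 0).sq, h0]
  · rw [nul_acMat_inflate h hX h' hX' (hca 1).sq (hcb 1).sq, h1]

end FibreInflation

/-! ### Moving fibre indices into the sites -/

section Doubling

theorem submatrix_id_mul_submatrix {l l' m k p : Type} [Fintype m] (A : Matrix l' m ℂ)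
    (B : Matrix m p ℂ) (e : l → l') (f : k → p) :
    A.submatrix e id * B.submatrix id f = (A * B).submatrix e f := rfl

theorem mul_submatrix_id {l m k p : Type} [Fintype m] (A : Matrix l m ℂ) (B : Matrix m p ℂ)
    (f : k → p) : A * B.submatrix id f = (A * B).submatrix id f := rfl

variable {Y Z n s L R : Type} [Fintype Y] [Fintype Z] [Fintype n] [Fintype s] [Fintype L]
  [Fintype R] [DecidableEq Y] [DecidableEq Z] [DecidableEq n] [DecidableEq s] [DecidableEq L]
  [DecidableEq R]

/-- `((y, (l, a)), r) ↦ (((y, l), r), a)` -/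
def fibreEquiv (Y L n R : Type) : (Y × (L × n)) × R ≃ ((Y × L) × R) × n where
  toFun p := (((p.1.1, p.1.2.1), p.2), p.1.2.2)
  invFun p := ((p.1.1.1, (p.1.1.2, p.2)), p.1.2)
  left_inv _ := rfl
  right_inv _ := rfl

/-- `((y, (l, a)), (r, i)) ↦ (((y, (r, i)), a), l)` -/
def midEquiv (Y L n t : Type) : (Y × (L × n)) × t ≃ ((Y × t) × n) × L where
  toFun p := (((p.1.1, p.2), p.1.2.2), p.1.2.1)
  invFun p := ((p.1.1.1, (p.2, p.1.2)), p.1.1.2)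
  left_inv _ := rfl
  right_inv _ := rfl

/-- `((y, r), l) ↦ ((y, l), r)` -/
def swapEquiv (Y L R : Type) : (Y × R) × L ≃ (Y × L) × R where
  toFun p := ((p.1.1, p.2), p.1.2)
  invFun p := ((p.1.1, p.2), p.1.2)
  left_inv _ := rfl
  right_inv _ := rfl

/-- The unitary `U ⊗ 1`, with the index `L` moved into the fibre. -/
def siteIso (n : Type) [DecidableEq n] (U : Matrix Z ((Y × L) × R) ℂ) :
    Matrix (Z × n) ((Y × (L × n)) × R) ℂ :=
  (U ⊗ₖ (1 : Matrix n n ℂ)).submatrix id (fibreEquiv Y L n R)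

/-- The unitary `U` carries the real structure `(1 ⊗ K ⊗ K') 𝒞` to the complex conjugation. -/
structure RealUnitary (K : Matrix L L ℂ) (K' : Matrix R R ℂ) (U : Matrix Z ((Y × L) × R) ℂ) :
    Prop where
  iso : Uᴴ * U = 1
  iso' : U * Uᴴ = 1
  real : U.map star = U * (((1 : Matrix Y Y ℂ) ⊗ₖ K) ⊗ₖ K')

variable {K : Matrix L L ℂ} {K' : Matrix R R ℂ} {U : Matrix Z ((Y × L) × R) ℂ}

theorem RealUnitary.swap (hU : RealUnitary K K' U) :
    RealUnitary K' K (U.submatrix id (swapEquiv Y L R)) where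
  iso := by
    rw [Matrix.conjTranspose_submatrix, submatrix_id_mul_submatrix, hU.iso,
      Matrix.submatrix_one_equiv]
  iso' := by
    rw [Matrix.conjTranspose_submatrix, Matrix.submatrix_mul_equiv, hU.iso', Matrix.submatrix_id_id]
  real := by
    have h1 : (((1 : Matrix Y Y ℂ) ⊗ₖ K') ⊗ₖ K) =
        (((1 : Matrix Y Y ℂ) ⊗ₖ K) ⊗ₖ K').submatrix (swapEquiv Y L R) (swapEquiv Y L R) := by
      ext ⟨⟨y, r⟩, l⟩ ⟨⟨y', r'⟩, l'⟩
      simp only [Matrix.kroneckerMap_apply, Matrix.submatrix_apply, swapEquiv, Equiv.coe_fn_mk]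
      ring
    rw [h1, Matrix.submatrix_mul_equiv, ← hU.real]
    rfl

theorem RealUnitary.siteIso_iso (hU : RealUnitary K K' U) :
    (siteIso n U)ᴴ * siteIso n U = 1 ∧ siteIso n U * (siteIso n U)ᴴ = 1 := by
  constructor
  · rw [siteIso, Matrix.conjTranspose_submatrix, submatrix_id_mul_submatrix,
      kronecker_one_conjTranspose, mul_kronecker_one, hU.iso, Matrix.one_kronecker_one,
      Matrix.submatrix_one_equiv]
  · rw [siteIso, Matrix.conjTranspose_submatrix, Matrix.submatrix_mul_equiv,
      kronecker_one_conjTranspose, mul_kronecker_one, hU.iso', Matrix.one_kronecker_one,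
      Matrix.submatrix_id_id]

/-- $U$ turns plain conjugation on the sites into $(1\otimes K\otimes K')\mathcal C$. After the
index $L$ has joined the fibre, the symmetry is $K\otimes S$ there and $K'$ on the spectator $R$.
The embedding is unitary, so the complement is zero and $X=0$ serves. -/
theorem RealUnitary.inflation (hU : RealUnitary K K' U) (δ : ℂ) (S T : Matrix n n ℂ) :
    Inflation δ ((1 : Matrix Z Z ℂ) ⊗ₖ S) ((1 : Matrix Z Z ℂ) ⊗ₖ T)
      (((1 : Matrix Y Y ℂ) ⊗ₖ (K ⊗ₖ S)) ⊗ₖ K')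
      (((1 : Matrix Y Y ℂ) ⊗ₖ ((1 : Matrix L L ℂ) ⊗ₖ T)) ⊗ₖ (1 : Matrix R R ℂ)) 0
      (siteIso n U) := by
  obtain ⟨h1, h2⟩ := hU.siteIso_iso (n := n)
  have h3 : ((1 : Matrix Z Z ℂ) ⊗ₖ S) * (siteIso n U).map star =
      siteIso n U * (((1 : Matrix Y Y ℂ) ⊗ₖ (K ⊗ₖ S)) ⊗ₖ K') := by
    have e : (((1 : Matrix Y Y ℂ) ⊗ₖ (K ⊗ₖ S)) ⊗ₖ K') =
        ((((1 : Matrix Y Y ℂ) ⊗ₖ K) ⊗ₖ K') ⊗ₖ S).submatrix (fibreEquiv Y L n R)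
          (fibreEquiv Y L n R) := by
      ext ⟨⟨y, ⟨l, a⟩⟩, r⟩ ⟨⟨y', ⟨l', a'⟩⟩, r'⟩
      simp only [Matrix.kroneckerMap_apply, Matrix.submatrix_apply, fibreEquiv, Equiv.coe_fn_mk]
      ring
    rw [e, siteIso, Matrix.submatrix_mul_equiv, ← Matrix.mul_kronecker_mul, ← hU.real,
      Matrix.one_mul, ← Matrix.submatrix_map, kronecker_map_star, map_star_one]
    rw [mul_submatrix_id, ← Matrix.mul_kronecker_mul, Matrix.one_mul, Matrix.mul_one]
  have h4 : ((1 : Matrix Z Z ℂ) ⊗ₖ T) * siteIso n U = siteIso n U *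
      (((1 : Matrix Y Y ℂ) ⊗ₖ ((1 : Matrix L L ℂ) ⊗ₖ T)) ⊗ₖ (1 : Matrix R R ℂ)) := by
    have e : (((1 : Matrix Y Y ℂ) ⊗ₖ ((1 : Matrix L L ℂ) ⊗ₖ T)) ⊗ₖ (1 : Matrix R R ℂ)) =
        ((1 : Matrix ((Y × L) × R) ((Y × L) × R) ℂ) ⊗ₖ T).submatrix (fibreEquiv Y L n R)
          (fibreEquiv Y L n R) := by
      rw [← Matrix.one_kronecker_one (m := Y × L) (n := R), ← Matrix.one_kronecker_one (m := Y)]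
      ext ⟨⟨y, ⟨l, a⟩⟩, r⟩ ⟨⟨y', ⟨l', a'⟩⟩, r'⟩
      simp only [Matrix.kroneckerMap_apply, Matrix.submatrix_apply, fibreEquiv, Equiv.coe_fn_mk]
      ring
    rw [e, siteIso, Matrix.submatrix_mul_equiv, ← Matrix.mul_kronecker_mul, Matrix.mul_one,
      Matrix.one_mul]
    rw [mul_submatrix_id, ← Matrix.mul_kronecker_mul, Matrix.one_mul, Matrix.mul_one]
  refine ⟨h1, by simp, by simp, by rw [h2]; simp, by ext; simp, by simp, h3, ?_, h4, ?_⟩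
  · have h5 : (siteIso n U).map star * (siteIso n U)ᵀ = 1 := by
      rw [← map_star_conjTranspose, ← map_star_mul', h2, map_star_one]
    rw [← Matrix.mul_one ((siteIso n U)ᴴ * _), ← h5, ← Matrix.mul_assoc, Matrix.mul_assoc _ _
      ((siteIso n U).map star), h3, ← Matrix.mul_assoc, h1, Matrix.one_mul]
  · rw [← Matrix.mul_one ((siteIso n U)ᴴ * _), ← h2, ← Matrix.mul_assoc, Matrix.mul_assoc _ _
      (siteIso n U), h4, ← Matrix.mul_assoc, h1, Matrix.one_mul]

/-- The reflection acts as $1$ on the spectator factor, where $K'$ imposes no condition. -/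
theorem MatClass.double (hU : RealUnitary K K' U) {δ : ℂ} {S T : Matrix n n ℂ}
    {g : Matrix (Y × (L × n)) (Y × (L × n)) ℂ} (hg : MatClass δ (K ⊗ₖ S) ((1 : Matrix L L ℂ) ⊗ₖ T) g) :
    MatClass δ S T (inflate 0 (siteIso n U) (g ⊗ₖ (1 : Matrix R R ℂ))) := by
  have h := hU.inflation δ S T
  refine ⟨h.conjTranspose ?_, h.mul_self ?_, h.map_star ?_, h.chiral ?_⟩
  · rw [kronecker_one_conjTranspose, hg.herm]
  · rw [mul_kronecker_one, hg.sq, Matrix.one_kronecker_one]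
  · rw [← Matrix.mul_kronecker_mul, hg.sym, kronecker_map_star, ← Matrix.mul_kronecker_mul,
      map_star_one, Matrix.one_mul, Matrix.mul_one, Matrix.smul_kronecker]
  · rw [mul_kronecker_one, mul_kronecker_one, hg.chiral]
    ext i j
    simp

theorem nul_acMat_double (hU : RealUnitary K K' U) (a : Matrix (Y × (L × n)) (Y × (L × n)) ℂ)
    (b : Matrix (Y × (R × s)) (Y × (R × s)) ℂ) :
    nul (acMat (inflate 0 (siteIso n U) (a ⊗ₖ (1 : Matrix R R ℂ)))
      (inflate 0 (siteIso s (U.submatrix id (swapEquiv Y L R))) (b ⊗ₖ (1 : Matrix L L ℂ)))) =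
      nul (acMat a b) := by
  have hA := hU.inflation 1 (0 : Matrix n n ℂ) 0
  have hB := hU.swap.inflation 1 (0 : Matrix s s ℂ) 0
  obtain ⟨h1, h2⟩ := hU.siteIso_iso (n := n)
  set A := inflate 0 (siteIso n U) (a ⊗ₖ (1 : Matrix R R ℂ)) with hAdef
  set B := inflate 0 (siteIso s (U.submatrix id (swapEquiv Y L R))) (b ⊗ₖ (1 : Matrix L L ℂ))
    with hBdef
  set e : (Y × (L × n)) × (R × s) ≃ ((Y × (L × n)) × R) × s := (Equiv.prodAssoc _ _ _).symm with he
  set W : Matrix ((Z × n) × s) ((Y × (L × n)) × (R × s)) ℂ :=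
    (siteIso n U ⊗ₖ (1 : Matrix s s ℂ)).submatrix id e with hW
  -- One and the same unitary `W` comes from either side: $L$ is part of the fibre of $A$ and a
  -- spectator for $B$, and $R$ the other way round.
  have hW' : W = (midMat n (siteIso s (U.submatrix id (swapEquiv Y L R)))).submatrix id
      (midEquiv Y L n (R × s)) := by
    ext ⟨⟨z, a⟩, i⟩ ⟨⟨y', ⟨l', a'⟩⟩, ⟨r', i'⟩⟩
    simp only [hW, he, siteIso, midMat_apply, Matrix.submatrix_apply, Matrix.kroneckerMap_apply,
      fibreEquiv, midEquiv, swapEquiv, Equiv.prodAssoc_symm_apply, Equiv.coe_fn_mk, id,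
      Matrix.one_apply, mul_ite, mul_one, mul_zero]
    split_ifs <;> rfl
  have h3 : (A ⊗ₖ (1 : Matrix s s ℂ)) * W = W * (a ⊗ₖ (1 : Matrix (R × s) (R × s) ℂ)) := by
    have h4 : a ⊗ₖ (1 : Matrix (R × s) (R × s) ℂ) =
        ((a ⊗ₖ (1 : Matrix R R ℂ)) ⊗ₖ (1 : Matrix s s ℂ)).submatrix e e := by
      rw [← Matrix.one_kronecker_one (m := R) (n := s)]
      ext ⟨p, ⟨r, i⟩⟩ ⟨p', ⟨r', i'⟩⟩
      simp only [he, Matrix.kroneckerMap_apply, Matrix.submatrix_apply,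
        Equiv.prodAssoc_symm_apply, mul_assoc]
    rw [h4, hW, Matrix.submatrix_mul_equiv, mul_kronecker_one, ← hA.mul_right, ← mul_kronecker_one]
    rw [mul_submatrix_id]
  have h5 : midMat n B * W = W * midMat (L × n) b := by
    have h4 : midMat (L × n) b = (midMat n (b ⊗ₖ (1 : Matrix L L ℂ))).submatrix
        (midEquiv Y L n (R × s)) (midEquiv Y L n (R × s)) := by
      ext ⟨⟨y, ⟨l, a⟩⟩, t⟩ ⟨⟨y', ⟨l', a'⟩⟩, t'⟩
      simp only [midMat_apply, Matrix.submatrix_apply, Matrix.kroneckerMap_apply, midEquiv,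
        Equiv.coe_fn_mk, Matrix.one_apply, Prod.mk.injEq, mul_ite, mul_one, mul_zero]
      by_cases h6 : l = l' <;> by_cases h7 : a = a' <;> simp [h6, h7]
    rw [h4, hW', Matrix.submatrix_mul_equiv, midMat_mul, ← hB.mul_right, ← midMat_mul]
    rw [mul_submatrix_id]
  have h6 : Wᴴ * W = 1 := by
    rw [hW, Matrix.conjTranspose_submatrix, submatrix_id_mul_submatrix,
      kronecker_one_conjTranspose, mul_kronecker_one, h1, Matrix.one_kronecker_one,
      Matrix.submatrix_one_equiv]
  have h7 : W * Wᴴ = 1 := by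
    rw [hW, Matrix.conjTranspose_submatrix, Matrix.submatrix_mul_equiv,
      kronecker_one_conjTranspose, mul_kronecker_one, h2, Matrix.one_kronecker_one,
      Matrix.submatrix_id_id]
  refine nul_eq_of_intertwine h6 ?_ fun v _ => by rw [h7, Matrix.one_mulVec]
  rw [acMat, acMat, Matrix.add_mul, Matrix.mul_add, Matrix.mul_assoc, h5, ← Matrix.mul_assoc, h3,
    Matrix.mul_assoc (midMat n B), h3, ← Matrix.mul_assoc (midMat n B), h5,
    Matrix.mul_assoc W, Matrix.mul_assoc W]

end Doubling


open scoped Matrix Kronecker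

/-! ### Embedding a model fibre into a doubled fibre -/

section DoubledFibres

variable {n σ : Type} [Fintype n] [Fintype σ] [DecidableEq n] [DecidableEq σ]

/-- If the range of $Z$ is invariant under the self-adjoint involution $X$, the conditions on $ZZ^*$
hold. The adjoint relations follow from those for $Z$, as $S$, $C$ are unitary and $R$, $\theta$ are
self-adjoint up to the same factor. -/
theorem Inflation.of_eigen {δ r : ℂ} {S R X : Matrix n n ℂ} {C θ x : Matrix σ σ ℂ}
    {Z : Matrix n σ ℂ} (iso : Zᴴ * Z = 1) (herm : Xᴴ = X) (sq : X * X = 1)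
    (symX : X * S = δ • (S * X.map star)) (chiX : R * X = -(X * R)) (hx : xᴴ = x)
    (hXZ : X * Z = Z * x) (hS : Sᴴ * S = 1) (hC : Cᴴ * C = 1) (symT : S * Z.map star = Z * C)
    (chiT : R * Z = Z * θ) (hR : Rᴴ = r • R) (hθ : θᴴ = r • θ) : Inflation δ S R C θ X Z where
  iso := iso
  herm := herm
  comm := by
    have h1 : Zᴴ * X = x * Zᴴ := by
      have := congrArg Matrix.conjTranspose hXZ
      rwa [Matrix.conjTranspose_mul, Matrix.conjTranspose_mul, herm, hx] at this
    rw [← Matrix.mul_assoc, hXZ, Matrix.mul_assoc, Matrix.mul_assoc, h1]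
  sq := by rw [sq, Matrix.one_mul]
  symX := symX
  chiX := chiX
  symT := symT
  symT' := by
    have h1 : Sᴴ * Z = Z.map star * Cᴴ := by
      rw [← Matrix.mul_one (Sᴴ * Z), ← mul_eq_one_comm.1 hC, ← Matrix.mul_assoc, Matrix.mul_assoc _ Z,
        ← symT, ← Matrix.mul_assoc, hS, Matrix.one_mul]
    have h2 := congrArg Matrix.conjTranspose h1
    rw [Matrix.conjTranspose_mul, Matrix.conjTranspose_mul, Matrix.conjTranspose_conjTranspose,
      Matrix.conjTranspose_conjTranspose] at h2
    rw [h2]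
    congr 1
    ext i j
    simp
  chiT := chiT
  chiT' := by
    have h1 : Rᴴ * Z = Z * θᴴ := by rw [hR, hθ, Matrix.smul_mul, Matrix.mul_smul, chiT]
    have h2 := congrArg Matrix.conjTranspose h1
    rwa [Matrix.conjTranspose_mul, Matrix.conjTranspose_mul, Matrix.conjTranspose_conjTranspose,
      Matrix.conjTranspose_conjTranspose] at h2

theorem Inflation.submatrix {n' : Type} [Fintype n'] [DecidableEq n'] {δ : ℂ} {S R X : Matrix n n ℂ}
    {C θ : Matrix σ σ ℂ} {Z : Matrix n σ ℂ} (h : Inflation δ S R C θ X Z) (e : n' ≃ n) :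
    Inflation δ (S.submatrix e e) (R.submatrix e e) C θ (X.submatrix e e) (Z.submatrix e id) where
  iso := by
    rw [Matrix.conjTranspose_submatrix, Matrix.submatrix_mul_equiv, h.iso, Matrix.submatrix_id_id]
  herm := by rw [Matrix.conjTranspose_submatrix, h.herm]
  comm := by
    rw [Matrix.conjTranspose_submatrix, submatrix_id_mul_submatrix, Matrix.submatrix_mul_equiv,
      Matrix.submatrix_mul_equiv, h.comm]
  sq := by
    rw [Matrix.conjTranspose_submatrix, submatrix_id_mul_submatrix, Matrix.submatrix_mul_equiv]
    have h1 : (1 : Matrix n' n' ℂ) - (Z * Zᴴ).submatrix e e = (1 - Z * Zᴴ).submatrix e e := by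
      rw [← Matrix.submatrix_one_equiv e]
      rfl
    rw [h1, Matrix.submatrix_mul_equiv, h.sq]
  symX := by
    rw [Matrix.submatrix_mul_equiv, h.symX, ← Matrix.submatrix_map, Matrix.submatrix_mul_equiv]
    rfl
  chiX := by
    rw [Matrix.submatrix_mul_equiv, h.chiX, Matrix.submatrix_mul_equiv]
    rfl
  symT := by
    rw [← Matrix.submatrix_map, Matrix.submatrix_mul_equiv, h.symT]
    rfl
  symT' := by
    rw [Matrix.conjTranspose_submatrix, Matrix.submatrix_mul_equiv, h.symT', Matrix.transpose_submatrix]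
    rfl
  chiT := by
    rw [Matrix.submatrix_mul_equiv, h.chiT]
    rfl
  chiT' := by
    rw [Matrix.conjTranspose_submatrix, Matrix.submatrix_mul_equiv, h.chiT']
    rfl

/-- The matrix with upper right entry `ε` and lower left entry `1`. -/
def doubleK (ε : ℂ) : Matrix Bool Bool ℂ :=
  Matrix.of fun a b => if a = b then 0 else if a then 1 else ε

omit [Fintype n] [DecidableEq n] in
theorem doubleK_kronecker (ε : ℂ) (S : Matrix n n ℂ) :
    (Matrix.fromBlocks 0 (ε • S) S 0).submatrix (Equiv.boolProdEquivSum n)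
      (Equiv.boolProdEquivSum n) = doubleK ε ⊗ₖ S := by
  ext ⟨a, i⟩ ⟨b, k⟩
  cases a <;> cases b <;> simp [doubleK, Equiv.boolProdEquivSum]

omit [Fintype n] [DecidableEq n] in
theorem one_kronecker_bool (R : Matrix n n ℂ) :
    (Matrix.fromBlocks R 0 0 R).submatrix (Equiv.boolProdEquivSum n) (Equiv.boolProdEquivSum n) =
      (1 : Matrix Bool Bool ℂ) ⊗ₖ R := by
  ext ⟨a, i⟩ ⟨b, k⟩
  cases a <;> cases b <;> simp [Equiv.boolProdEquivSum]

variable {δ ε r η : ℂ} {S R X : Matrix n n ℂ} {C θ x : Matrix σ σ ℂ} {A : Matrix n σ ℂ}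

theorem fromBlocks_map_star {l m p q : Type} (A : Matrix l m ℂ) (B : Matrix l q ℂ)
    (C : Matrix p m ℂ) (D : Matrix p q ℂ) :
    (Matrix.fromBlocks A B C D).map star =
      Matrix.fromBlocks (A.map star) (B.map star) (C.map star) (D.map star) :=
  Matrix.fromBlocks_map _ _ _ _ _

theorem map_star_smul' {l m : Type} (a : ℂ) (A : Matrix l m ℂ) :
    (a • A).map star = star a • A.map star := by
  ext i j
  simp

theorem fromRows_map_star {l m p : Type} (A : Matrix l m ℂ) (B : Matrix p m ℂ) :
    (Matrix.fromRows A B).map star = Matrix.fromRows (A.map star) (B.map star) := by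
  ext (i | i) j <;> rfl

theorem map_star_map_star {l m : Type} (A : Matrix l m ℂ) : (A.map star).map star = A := by
  ext i j
  simp

theorem conjTranspose_of_real {l m : Type} {A : Matrix l m ℂ} (h : A.map star = A) : Aᴴ = Aᵀ := by
  rw [← map_star_conjTranspose, ← Matrix.conjTranspose_conjTranspose (Aᴴ.map star)]
  have : (Aᴴ.map star)ᴴ = A := by
    conv_rhs => rw [← h]
    ext i j
    simp
  rw [this]

/-- The columns of `A` and their images under the symmetry of the doubled fibre span a space on
which the symmetry acts as `C`. -/
theorem exists_inflation {εn : ℤ} (hS : IsSymmetryOp εn S) (hεn : εn * εn = 1) (hε : star ε = ε)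
    (hεε : ε * ε = 1) (hδ : star δ = δ) (hδδ : δ * δ = 1) (hCr : C.map star = C) (hC : Cᴴ * C = 1)
    (hCC : C * C = (ε * εn) • (1 : Matrix σ σ ℂ)) (hX : Xᴴ = X) (hXX : X * X = 1)
    (hA : Aᴴ * A + C * (Aᴴ * A).map star * Cᴴ = (2 : ℂ) • 1) (hx : xᴴ = x) (hXA : X * A = A * x)
    (hXA' : δ • (X * (A * Cᴴ)) = A * Cᴴ * x.map star) (hRX : R * X = -(X * R))
    (hRS : R * S = η • (S * R.map star)) (hη : star η = η) (hRA : R * A = A * θ)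
    (hθ : η • (θ.map star * Cᴴ) = Cᴴ * θ)
    (hRr : Rᴴ = r • R) (hθr : θᴴ = r • θ) :
    ∃ (X' : Matrix (Bool × n) (Bool × n) ℂ) (Z : Matrix (Bool × n) σ ℂ), X' * X' = 1 ∧
      Inflation δ (doubleK ε ⊗ₖ S) ((1 : Matrix Bool Bool ℂ) ⊗ₖ R) C θ X' Z := by
  have hSS : S * S = (εn : ℂ) • (1 : Matrix n n ℂ) := hS.sq
  have hεc : (εn : ℂ) * εn = 1 := by exact_mod_cast hεn
  have hSh : Sᴴ = (εn : ℂ) • S := by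
    have h1 : Sᴴ * S * S = Sᴴ * (εn : ℂ) • (1 : Matrix n n ℂ) := by rw [Matrix.mul_assoc, hSS]
    rw [hS.unitary, Matrix.one_mul, Matrix.mul_smul, Matrix.mul_one] at h1
    conv_rhs => rw [h1, smul_smul, hεc, one_smul]
  have hSU : S * Sᴴ = 1 := mul_eq_one_comm.1 hS.unitary
  have hShr : Sᴴ.map star = Sᴴ := by rw [map_star_conjTranspose, conjTranspose_of_real hS.real]
  have hChr : Cᴴ.map star = Cᴴ := by rw [map_star_conjTranspose, conjTranspose_of_real hCr]
  have hCh : C = (ε * εn) • Cᴴ := by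
    have h1 : Cᴴ * C * C = Cᴴ * (ε * εn) • (1 : Matrix σ σ ℂ) := by rw [Matrix.mul_assoc, hCC]
    rwa [hC, Matrix.one_mul, Matrix.mul_smul, Matrix.mul_one] at h1
  -- The upper and lower halves `A` and `B` together have $A^*A+B^*B=2$.
  set a : ℂ := (((Real.sqrt 2)⁻¹ : ℝ) : ℂ) with ha
  have ha1 : star a = a := Complex.conj_ofReal _
  have ha2 : a * a * 2 = 1 := by
    rw [ha, ← Complex.ofReal_mul, ← mul_inv, Real.mul_self_sqrt (by norm_num)]
    norm_num
  -- The requirement that the doubled symmetry act on the columns as $C$ leaves no other choice for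
  -- the lower half.
  set B : Matrix n σ ℂ := S * A.map star * Cᴴ with hB
  have hXs : (X.map star)ᴴ = X.map star := by
    ext i j
    have := congrFun (congrFun hX j) i
    rw [Matrix.conjTranspose_apply] at this
    simp only [Matrix.conjTranspose_apply, Matrix.map_apply, star_star]
    rw [← this]
  have hXXs : X.map star * X.map star = 1 := by rw [← map_star_mul', hXX, map_star_one]
  -- Likewise, commutation of $X\oplus D$ with the doubled symmetry up to $\delta$ determines `D`.
  set D : Matrix n n ℂ := δ • (S * X.map star * Sᴴ) with hD
  have hDS : D * S = δ • (S * X.map star) := by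
    rw [hD, Matrix.smul_mul, Matrix.mul_assoc, hS.unitary, Matrix.mul_one]
  have hDD : D * D = 1 := by
    rw [hD, Matrix.smul_mul, Matrix.mul_smul, smul_smul, hδδ, one_smul]
    calc S * X.map star * Sᴴ * (S * X.map star * Sᴴ) =
        S * (X.map star * (Sᴴ * S) * X.map star) * Sᴴ := by simp only [Matrix.mul_assoc]
      _ = 1 := by rw [hS.unitary, Matrix.mul_one, hXXs, Matrix.mul_one, hSU]
  have hDs : D.map star = δ • (S * X * Sᴴ) := by
    rw [hD, map_star_smul', map_star_mul', map_star_mul', hS.real, map_star_map_star, hShr, hδ]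
  have main : Inflation δ (Matrix.fromBlocks 0 (ε • S) S 0) (Matrix.fromBlocks R 0 0 R) C θ
      (Matrix.fromBlocks X 0 0 D) (a • Matrix.fromRows A B) := by
    refine Inflation.of_eigen (r := r) (x := x) ?_ ?_ ?_ ?_ ?_ hx ?_ ?_ hC ?_ ?_ ?_ hθr
    · rw [Matrix.conjTranspose_smul, Matrix.smul_mul, Matrix.mul_smul, smul_smul, ha1,
        Matrix.conjTranspose_fromRows_eq_fromCols_conjTranspose, Matrix.fromCols_mul_fromRows]
      have h1 : Bᴴ * B = C * (Aᴴ * A).map star * Cᴴ := by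
        rw [hB, Matrix.conjTranspose_mul, Matrix.conjTranspose_mul, Matrix.conjTranspose_conjTranspose,
          map_star_mul', map_star_conjTranspose]
        have h2 : (A.map star)ᴴ = Aᵀ := by ext i j; simp
        rw [h2]
        calc C * (Aᵀ * Sᴴ) * (S * A.map star * Cᴴ) = C * (Aᵀ * (Sᴴ * S) * A.map star) * Cᴴ := by
              simp only [Matrix.mul_assoc]
          _ = _ := by rw [hS.unitary, Matrix.mul_one]
      rw [h1, hA, smul_smul, ha2, one_smul]
    · rw [Matrix.fromBlocks_conjTranspose, hX, hD, Matrix.conjTranspose_smul,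
        Matrix.conjTranspose_mul, Matrix.conjTranspose_mul, Matrix.conjTranspose_conjTranspose, hXs,
        hδ, Matrix.conjTranspose_zero, Matrix.mul_assoc]
    · rw [Matrix.fromBlocks_multiply, hXX, hDD]
      simp [Matrix.fromBlocks_one]
    · rw [fromBlocks_map_star, Matrix.fromBlocks_multiply, Matrix.fromBlocks_multiply,
        Matrix.fromBlocks_smul, hDs, hDS]
      have h1 : X * ε • S = δ • ((ε • S) * δ • (S * X * Sᴴ)) := by
        have h2 : S * (S * X * Sᴴ) = X * S := by
          rw [← Matrix.mul_assoc, ← Matrix.mul_assoc, hSS, hSh, Matrix.smul_mul, Matrix.smul_mul,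
            Matrix.one_mul, Matrix.mul_smul, smul_smul, hεc, one_smul]
        simp only [Matrix.smul_mul, Matrix.mul_smul, smul_smul, h2]
        congr 1
        linear_combination (-ε) * hδδ
      simp only [Matrix.zero_mul, Matrix.mul_zero, zero_add, add_zero, Matrix.map_zero _ (star_zero ℂ),
        smul_zero, h1]
    · have h1 : R * D = -(D * R) := by
        have h2 : R.map star * X.map star = -(X.map star * R.map star) := by
          rw [← map_star_mul', hRX, ← map_star_mul']
          ext i j
          exact star_neg _
        have h3 : Sᴴ * R = η • (R.map star * Sᴴ) := by
          have h4 := congrArg (fun M => Sᴴ * M.map star * Sᴴ) hRS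
          simp only [map_star_mul', map_star_smul', hS.real, hη, map_star_map_star,
            Matrix.mul_smul, Matrix.smul_mul] at h4
          rw [← Matrix.mul_assoc Sᴴ S, hS.unitary, Matrix.one_mul, ← Matrix.mul_assoc Sᴴ,
            Matrix.mul_assoc _ S, hSU, Matrix.mul_one] at h4
          have h5 := congrArg (fun M => M.map star) h4
          simp only [map_star_mul', map_star_smul', hη, hShr, map_star_map_star] at h5
          exact h5
        rw [hD, Matrix.mul_smul, Matrix.smul_mul, Matrix.mul_assoc _ Sᴴ, h3, ← Matrix.mul_assoc,
          ← Matrix.mul_assoc, hRS, Matrix.smul_mul, Matrix.smul_mul, Matrix.mul_assoc S, h2,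
          Matrix.mul_smul]
        simp only [Matrix.mul_neg, Matrix.neg_mul, smul_neg, Matrix.mul_assoc]
      rw [Matrix.fromBlocks_multiply, Matrix.fromBlocks_multiply, Matrix.fromBlocks_neg, hRX, h1]
      simp
    · rw [Matrix.mul_smul, Matrix.smul_mul, Matrix.fromBlocks_mul_fromRows, Matrix.fromRows_mul, hXA]
      congr 2
      · simp
      · rw [Matrix.zero_mul, zero_add, hB, ← Matrix.mul_assoc, ← Matrix.mul_assoc, hDS,
          Matrix.smul_mul, Matrix.smul_mul]
        have h1 := congrArg (fun M => S * M.map star) hXA'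
        simp only [map_star_mul', map_star_smul', hδ, map_star_map_star, hChr, Matrix.mul_smul] at h1
        simp only [Matrix.mul_assoc] at h1 ⊢
        exact h1
    · rw [Matrix.fromBlocks_conjTranspose, Matrix.fromBlocks_multiply, Matrix.conjTranspose_smul, hε]
      simp only [Matrix.smul_mul, Matrix.mul_smul, smul_smul, hεε, hS.unitary]
      simp [Matrix.fromBlocks_one]
    · rw [map_star_smul', ha1, fromRows_map_star, Matrix.mul_smul, Matrix.smul_mul,
        Matrix.fromBlocks_mul_fromRows, Matrix.fromRows_mul]
      congr 2
      · rw [Matrix.zero_mul, zero_add, hB, map_star_mul', map_star_mul', hS.real,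
          map_star_map_star, hChr, Matrix.smul_mul, ← Matrix.mul_assoc, ← Matrix.mul_assoc, hSS,
          Matrix.smul_mul, Matrix.smul_mul, Matrix.one_mul, smul_smul]
        conv_rhs => rw [hCh, Matrix.mul_smul]
      · rw [Matrix.zero_mul, add_zero, hB, Matrix.mul_assoc, hC, Matrix.mul_one]
    · rw [Matrix.mul_smul, Matrix.smul_mul, Matrix.fromBlocks_mul_fromRows, Matrix.fromRows_mul, hRA]
      congr 2
      · simp
      · rw [Matrix.zero_mul, zero_add, hB, ← Matrix.mul_assoc, ← Matrix.mul_assoc, hRS,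
          Matrix.smul_mul, Matrix.smul_mul, Matrix.mul_assoc S, ← map_star_mul', hRA, map_star_mul',
          Matrix.mul_assoc, Matrix.mul_assoc, Matrix.mul_assoc, Matrix.mul_assoc, ← hθ,
          Matrix.mul_smul, Matrix.mul_smul]
    · rw [Matrix.fromBlocks_conjTranspose, Matrix.fromBlocks_smul, hRr]
      simp
  have h2 := main.submatrix (Equiv.boolProdEquivSum n)
  rw [doubleK_kronecker, one_kronecker_bool] at h2
  refine ⟨_, _, ?_, h2⟩
  have h3 : Matrix.fromBlocks X 0 0 D * Matrix.fromBlocks X 0 0 D = 1 := by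
    rw [Matrix.fromBlocks_multiply, hXX, hDD]
    simp [Matrix.fromBlocks_one]
  rw [Matrix.submatrix_mul_equiv, h3, Matrix.submatrix_one_equiv]

end DoubledFibres


open scoped Matrix Kronecker

/-! ### Absorbing the doubling into the sites -/

section RealUnitary

variable {Y n s : Type} [Fintype Y] [Fintype n] [Fintype s] [DecidableEq Y] [DecidableEq n]
  [DecidableEq s] {ε : ℂ}

theorem doubleK_real (hε : star ε = ε) : (doubleK ε).map star = doubleK ε := by
  ext a b
  cases a <;> cases b <;> simp [doubleK]
  exact hε

theorem doubleK_conjTranspose (hε : star ε = ε) (hεε : ε * ε = 1) :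
    (doubleK ε)ᴴ = ε • doubleK ε := by
  ext a b
  cases a <;> cases b <;> simp [doubleK, hεε]
  exact hε

theorem doubleK_mul_self : doubleK ε * doubleK ε = ε • (1 : Matrix Bool Bool ℂ) := by
  ext a b
  cases a <;> cases b <;> simp [doubleK, Matrix.mul_apply]

/-- A unitary that carries the real structure `D 𝒞` to the complex conjugation. -/
theorem exists_unitary_of_real_involution {D : Matrix n n ℂ} (hD : D.map star = D) (hDh : Dᴴ = D)
    (hDD : D * D = 1) : ∃ B : Matrix n n ℂ, Bᴴ * B = 1 ∧ B * Bᴴ = 1 ∧ B.map star = B * D := by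
  have hi : star Complex.I = -Complex.I := Complex.conj_I
  have h2 : star (2⁻¹ : ℂ) = 2⁻¹ := by simp
  -- This is $1$ on the eigenspace $D=1$ and $\imath$ on $D=-1$, a square root of $D$ whose
  -- conjugate is $BD$.
  set B : Matrix n n ℂ := (2⁻¹ : ℂ) • ((1 + Complex.I) • 1 + (1 - Complex.I) • D) with hB
  have h1 : Bᴴ * B = 1 := by
    simp only [hB, Matrix.conjTranspose_smul, Matrix.conjTranspose_add, hDh, h2, star_mul,
      Matrix.conjTranspose_one, star_add, star_sub, star_one, hi, Matrix.smul_mul, Matrix.mul_smul,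
      Matrix.add_mul, Matrix.mul_add, Matrix.one_mul, Matrix.mul_one, hDD, smul_smul, smul_add]
    match_scalars
    · linear_combination (-(1 / 2) : ℂ) * Complex.I_sq
    · linear_combination (1 / 2 : ℂ) * Complex.I_sq
  refine ⟨B, h1, mul_eq_one_comm.1 h1, ?_⟩
  simp only [hB, map_star_smul', Matrix.map_add star star_add, h2, hD, map_star_one, star_add,
    star_sub, star_one, hi, Matrix.smul_mul, Matrix.add_mul, Matrix.one_mul, hDD]
  match_scalars <;> ring

/-- Whatever the sign $\varepsilon$, $K_\varepsilon\otimes K_\varepsilon$ is a real symmetric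
involution. This is why $P$ and $E$ are doubled with the same $\varepsilon$. -/
theorem exists_realUnitary (Y : Type) [Fintype Y] [DecidableEq Y] (hε : star ε = ε)
    (hεε : ε * ε = 1) : ∃ (k : ℕ) (U : Matrix (Fin k) ((Y × Bool) × Bool) ℂ),
    RealUnitary (doubleK ε) (doubleK ε) U := by
  obtain ⟨B, h1, h2, h3⟩ := exists_unitary_of_real_involution (D := doubleK ε ⊗ₖ doubleK ε)
    (by rw [kronecker_map_star, doubleK_real hε])
    (by rw [Matrix.conjTranspose_kronecker, doubleK_conjTranspose hε hεε, Matrix.smul_kronecker,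
      Matrix.kronecker_smul, smul_smul, hεε, one_smul])
    (by rw [← Matrix.mul_kronecker_mul, doubleK_mul_self, Matrix.smul_kronecker,
      Matrix.kronecker_smul, smul_smul, hεε, one_smul, Matrix.one_kronecker_one])
  set e : (Y × Bool) × Bool ≃ Y × (Bool × Bool) := Equiv.prodAssoc _ _ _ with he
  set f : Fin (Fintype.card ((Y × Bool) × Bool)) ≃ Y × (Bool × Bool) :=
    (Fintype.equivFin _).symm.trans e with hf
  refine ⟨_, ((1 : Matrix Y Y ℂ) ⊗ₖ B).submatrix f e, ?_, ?_, ?_⟩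
  · rw [Matrix.conjTranspose_submatrix, Matrix.submatrix_mul_equiv, one_kronecker_conjTranspose,
      one_kronecker_mul, h1, Matrix.one_kronecker_one, Matrix.submatrix_one_equiv]
  · rw [Matrix.conjTranspose_submatrix, Matrix.submatrix_mul_equiv, one_kronecker_conjTranspose,
      one_kronecker_mul, h2, Matrix.one_kronecker_one, Matrix.submatrix_one_equiv]
  · have h4 : ((1 : Matrix Y Y ℂ) ⊗ₖ doubleK ε) ⊗ₖ doubleK ε =
        ((1 : Matrix Y Y ℂ) ⊗ₖ (doubleK ε ⊗ₖ doubleK ε)).submatrix e e := by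
      ext ⟨⟨y, a⟩, b⟩ ⟨⟨y', a'⟩, b'⟩
      simp [he, mul_assoc]
    rw [h4, Matrix.submatrix_mul_equiv, one_kronecker_mul, ← h3, ← Matrix.submatrix_map,
      one_kronecker_map_star]

variable {δ δ' : ℂ} {S R : Matrix n n ℂ} {S' R' : Matrix s s ℂ} {q : ℕ}

/-- The doubling of the fibres can be moved into the sites. -/
theorem Flips.of_double (hε : star ε = ε) (hεε : ε * ε = 1)
    (h : Flips δ (doubleK ε ⊗ₖ S) ((1 : Matrix Bool Bool ℂ) ⊗ₖ R) δ' (doubleK ε ⊗ₖ S')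
      ((1 : Matrix Bool Bool ℂ) ⊗ₖ R') q) :
    ∃ (k : ℕ) (A : unitInterval → Matrix (Fin k × n) (Fin k × n) ℂ)
      (B : unitInterval → Matrix (Fin k × s) (Fin k × s) ℂ), Continuous A ∧ Continuous B ∧
      (∀ t, MatClass δ S R (A t)) ∧ (∀ t, MatClass δ' S' R' (B t)) ∧
      nul (acMat (A 0) (B 0)) = 0 ∧ nul (acMat (A 1) (B 1)) = q := by
  obtain ⟨Y, _, _, a, b, ha, hb, hca, hcb, h0, h1⟩ := h
  obtain ⟨k, U, hU⟩ := exists_realUnitary Y hε hεε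
  have hk : ∀ {l : Type} [DecidableEq l] {g : unitInterval → Matrix (Y × (Bool × l)) (Y × (Bool × l)) ℂ},
      Continuous g → Continuous fun t => g t ⊗ₖ (1 : Matrix Bool Bool ℂ) := by
    intro l _ g hg
    refine continuous_matrix fun i j => ?_
    simp only [Matrix.kroneckerMap_apply]
    exact (hg.matrix_elem _ _).mul continuous_const
  refine ⟨k, fun t => inflate 0 (siteIso n U) (a t ⊗ₖ (1 : Matrix Bool Bool ℂ)),
    fun t => inflate 0 (siteIso s (U.submatrix id (swapEquiv Y Bool Bool)))
      (b t ⊗ₖ (1 : Matrix Bool Bool ℂ)), continuous_inflate _ _ (hk ha),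
    continuous_inflate _ _ (hk hb), fun t => (hca t).double hU, fun t => (hcb t).double hU.swap,
    ?_, ?_⟩
  · rw [nul_acMat_double hU, h0]
  · rw [nul_acMat_double hU, h1]

end RealUnitary


open scoped Matrix Kronecker

/-! ### The two-dimensional model fibres -/

section ModelFibres

variable {n h : Type} [Fintype n] [Fintype h] [DecidableEq n] [DecidableEq h]

/-- After doubling, the fibre with the symmetries `S` and `R` contains the two-dimensional fibre
with the symmetries `C` and `θ`. -/
def HasModelFibre (ε δ : ℂ) (S R : Matrix n n ℂ) (C θ : Matrix Bool Bool ℂ) : Prop :=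
  ∃ (X : Matrix (Bool × n) (Bool × n) ℂ) (Z : Matrix (Bool × n) Bool ℂ), X * X = 1 ∧
    Inflation δ (doubleK ε ⊗ₖ S) ((1 : Matrix Bool Bool ℂ) ⊗ₖ R) C θ X Z

theorem HasModelFibre.flips {s : Type} [Fintype s] [DecidableEq s] {ε δ δ' : ℂ} {S R : Matrix n n ℂ}
    {S' R' : Matrix s s ℂ} {C θ C' θ' : Matrix Bool Bool ℂ} {q : ℕ} (hε : star ε = ε)
    (hεε : ε * ε = 1) (h : HasModelFibre ε δ S R C θ) (h' : HasModelFibre ε δ' S' R' C' θ')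
    (hf : Flips δ C θ δ' C' θ' q) :
    ∃ (k : ℕ) (A : unitInterval → Matrix (Fin k × n) (Fin k × n) ℂ)
      (B : unitInterval → Matrix (Fin k × s) (Fin k × s) ℂ), Continuous A ∧ Continuous B ∧
      (∀ t, MatClass δ S R (A t)) ∧ (∀ t, MatClass δ' S' R' (B t)) ∧
      nul (acMat (A 0) (B 0)) = 0 ∧ nul (acMat (A 1) (B 1)) = q := by
  obtain ⟨X, Z, hX, hZ⟩ := h
  obtain ⟨X', Z', hX', hZ'⟩ := h'
  exact (hf.of_inflation hZ hX hZ' hX').of_double hε hεε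

/-- The symmetry `S² = δ` of the model fibre. -/
def modelC (δ : ℂ) : Matrix Bool Bool ℂ :=
  Matrix.of fun a b => if b = !a then (if a then δ else 1) else 0

/-- The chiral symmetry of the model fibre. -/
def modelR : Matrix Bool Bool ℂ := Matrix.diagonal fun a => if a then 1 else -1

variable {εn : ℤ} {ε δ : ℂ} {S R : Matrix n n ℂ}

/-- When $\varepsilon S^2=1$ the doubled symmetry is a real structure. One basis vector and its
image span a plane, in which a real basis makes the symmetry plain conjugation. -/
theorem hasModelFibre_real [Nonempty n] (hS : IsSymmetryOp εn S) (hεn : εn * εn = 1)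
    (hε : star ε = ε) (hεε : ε * ε = 1) (hs : ε * εn = 1) (hδ : δ = 1 ∨ δ = -1) :
    HasModelFibre ε δ S 0 1 0 := by
  obtain ⟨i₀⟩ := ‹Nonempty n›
  -- The row $(1,\imath)$ selects real and imaginary parts: $\overline{w_a}w_b$ plus its conjugate
  -- is $2\delta_{ab}$.
  set w : Bool → ℂ := fun b => if b then Complex.I else 1 with hw
  set A : Matrix n Bool ℂ := Matrix.vecMulVec (Pi.single i₀ 1) w with hA
  have hAA : Aᴴ * A = Matrix.vecMulVec (star w) w := by
    ext a b
    simp [hA, Matrix.mul_apply, Matrix.vecMulVec_apply, Pi.single_apply]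
  -- The matrix of the involution on the plane: it has to fix the row $w$ and to satisfy $\overline
  -- x=\delta x$.
  set x : Matrix Bool Bool ℂ := if δ = 1 then 1 else
    Matrix.of fun a b => if b = !a then (if a then -Complex.I else Complex.I) else 0 with hx
  have hxh : xᴴ = x := by
    rw [hx]
    split_ifs
    · simp
    · ext a b
      cases a <;> cases b <;> simp
  have hwx : Matrix.vecMul w x = w := by
    rw [hx]
    split_ifs
    · simp
    · ext a
      cases a <;> simp [Matrix.vecMul, dotProduct, hw]
  have hxs : x.map star = δ • x := by
    rcases hδ with rfl | rfl
    · simp [hx]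
    · have h1 : ¬ (-1 : ℂ) = 1 := by norm_num
      simp only [hx, h1, if_false]
      ext a b
      cases a <;> cases b <;> simp
  have hAx : A * x = A := by rw [hA, Matrix.vecMulVec_mul, hwx]
  have hδs : star δ = δ := by rcases hδ with rfl | rfl <;> simp
  have hδδ : δ * δ = 1 := by rcases hδ with rfl | rfl <;> simp
  refine exists_inflation (A := A) (x := x) (X := 1) (η := 1) (r := 1) hS hεn hε hεε hδs hδδ
    map_star_one (by simp) (by rw [hs]; simp) (by simp) (by simp) ?_ hxh ?_ ?_ (by simp) (by simp)
    (by simp) (by simp) (by simp) (by simp) (by simp)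
  · rw [hAA]
    ext a b
    cases a <;> cases b <;> simp [Matrix.vecMulVec_apply, hw] <;> norm_num
  · rw [hAx, Matrix.one_mul]
  · rw [hxs, Matrix.conjTranspose_one, Matrix.mul_one, Matrix.mul_smul, hAx, Matrix.one_mul]

theorem modelC_real (hδ : star δ = δ) : (modelC δ).map star = modelC δ := by
  ext a b
  cases a <;> cases b <;> simp [modelC]
  exact hδ

theorem modelC_isometry (hδ : star δ = δ) (hδδ : δ * δ = 1) : (modelC δ)ᴴ * modelC δ = 1 := by
  replace hδ : (starRingEnd ℂ) δ = δ := hδ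
  ext a b
  cases a <;> cases b <;> simp [modelC, Matrix.mul_apply, hδ, hδδ]

theorem modelC_mul_self : modelC δ * modelC δ = δ • (1 : Matrix Bool Bool ℂ) := by
  ext a b
  cases a <;> cases b <;> simp [modelC, Matrix.mul_apply]

/-- When $\varepsilon S^2=-1$ the doubled symmetry is quaternionic, and a basis vector with its
image spans a plane with symmetry of square $-1$. -/
theorem hasModelFibre_symplectic [Nonempty n] (hS : IsSymmetryOp εn S) (hεn : εn * εn = 1)
    (hε : star ε = ε) (hεε : ε * ε = 1) (hs : ε * εn = -1) :
    HasModelFibre ε (-1) S 0 (modelC (-1)) 0 := by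
  obtain ⟨i₀⟩ := ‹Nonempty n›
  set A : Matrix n Bool ℂ := Matrix.vecMulVec (Pi.single i₀ 1) 1 with hA
  have hAA : Aᴴ * A = Matrix.vecMulVec 1 1 := by
    ext a b
    simp [hA, Matrix.mul_apply, Matrix.vecMulVec_apply, Pi.single_apply]
  refine exists_inflation (A := A) (x := modelC 1) (X := 1) (η := 1) (r := 1) hS hεn hε hεε
    (by simp) (by simp) (modelC_real (by simp)) (modelC_isometry (by simp) (by simp))
    (by rw [hs]; exact modelC_mul_self) (by simp) (by simp) ?_ ?_ ?_ ?_ (by simp) (by simp)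
    (by simp) (by simp) (by simp) (by simp) (by simp)
  · rw [hAA]
    ext a b
    cases a <;> cases b <;> simp [Matrix.mul_apply, modelC] <;> norm_num
  · ext a b
    cases a <;> cases b <;> simp [modelC]
  · rw [Matrix.one_mul]
    ext a b
    cases b <;> simp [Matrix.mul_apply, hA, modelC]
  · ext a b
    cases b <;> simp [Matrix.mul_apply, hA, modelC]

theorem IsChiralFrame.orth {c : ℂ} {Vp Vm : Matrix n h ℂ} (hV : IsChiralFrame R c Vp Vm) :
    Vpᴴ * Vm = 0 := by
  have h1 : Vpᴴ * (Vp * Vpᴴ + Vm * Vmᴴ) * Vm = Vpᴴ * Vm := by rw [hV.complete, Matrix.mul_one]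
  rw [Matrix.mul_add, Matrix.add_mul, ← Matrix.mul_assoc, hV.isoP, Matrix.one_mul,
    Matrix.mul_assoc Vpᴴ, Matrix.mul_assoc Vm, hV.isoM, Matrix.mul_one] at h1
  exact add_eq_left.1 h1

/-- A chiral fibre contains a two-dimensional one, spanned by an eigenvector for each eigenvalue. -/
theorem hasModelFibre_chiral [Nonempty h] {c η r : ℂ} {Vp Vm : Matrix n h ℂ}
    {C : Matrix Bool Bool ℂ} (hV : IsChiralFrame R c Vp Vm) (hS : IsSymmetryOp εn S)
    (hεn : εn * εn = 1) (hε : star ε = ε) (hεε : ε * ε = 1) (hδ : star δ = δ) (hδδ : δ * δ = 1)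
    (hCr : C.map star = C) (hC : Cᴴ * C = 1) (hCC : C * C = (ε * εn) • (1 : Matrix Bool Bool ℂ))
    (hCx : δ • (modelC 1 * Cᴴ) = Cᴴ * modelC 1) (hRS : R * S = η • (S * R.map star))
    (hη : star η = η) (hθ : (η * star c) • (modelR * Cᴴ) = c • (Cᴴ * modelR)) (hRr : Rᴴ = r • R)
    (hcr : star c = r * c) : HasModelFibre ε δ S R C (c • modelR) := by
  obtain ⟨a₀⟩ := ‹Nonempty h›
  have ho := hV.orth
  have ho' : Vmᴴ * Vp = 0 := by
    rw [← Matrix.conjTranspose_conjTranspose (Vmᴴ * Vp), Matrix.conjTranspose_mul,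
      Matrix.conjTranspose_conjTranspose, ho, Matrix.conjTranspose_zero]
  -- This involution exchanges the two frames, so it anticommutes with $R$.
  set X : Matrix n n ℂ := Vp * Vmᴴ + Vm * Vpᴴ with hX
  have hXp : X * Vp = Vm := by
    rw [hX, Matrix.add_mul, Matrix.mul_assoc, Matrix.mul_assoc, ho', hV.isoP, Matrix.mul_zero,
      zero_add, Matrix.mul_one]
  have hXm : X * Vm = Vp := by
    rw [hX, Matrix.add_mul, Matrix.mul_assoc, Matrix.mul_assoc, ho, hV.isoM, Matrix.mul_zero,
      add_zero, Matrix.mul_one]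
  have hR : R = c • (Vp * Vpᴴ - Vm * Vmᴴ) := by
    rw [← Matrix.mul_one R, ← hV.complete, Matrix.mul_add, ← Matrix.mul_assoc, hV.eigP,
      ← Matrix.mul_assoc, hV.eigM, Matrix.smul_mul, Matrix.neg_mul, Matrix.smul_mul, smul_sub,
      sub_eq_add_neg]
  have hmR : modelRᴴ = modelR := by
    rw [modelR, Matrix.diagonal_conjTranspose]
    congr 1
    ext a
    cases a <;> simp
  set A : Matrix n Bool ℂ := Matrix.of fun i b => if b then Vp i a₀ else Vm i a₀ with hA
  have hcol : ∀ (M : Matrix n n ℂ) i b, (M * A) i b = if b then (M * Vp) i a₀ else (M * Vm) i a₀ := by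
    intro M i b
    cases b <;> simp [Matrix.mul_apply, hA]
  have hcc : ∀ V V' : Matrix n h ℂ, (Vᴴ * V') a₀ a₀ = ∑ i, star (V i a₀) * V' i a₀ := fun V V' => by
    simp [Matrix.mul_apply]
  have hAA : Aᴴ * A = 1 := by
    ext a b
    have e1 := (hcc Vp Vp).symm
    have e2 := (hcc Vm Vm).symm
    have e3 := (hcc Vp Vm).symm
    have e4 := (hcc Vm Vp).symm
    rw [hV.isoP, Matrix.one_apply_eq] at e1
    rw [hV.isoM, Matrix.one_apply_eq] at e2
    rw [ho, Matrix.zero_apply] at e3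
    rw [ho', Matrix.zero_apply] at e4
    cases a <;> cases b <;> simp only [Matrix.mul_apply, Matrix.conjTranspose_apply, hA, Matrix.of_apply,
      if_true, if_false, Bool.false_eq_true, e1, e2, e3, e4] <;> simp
  have hXA : X * A = A * modelC 1 := by
    ext i b
    rw [hcol, hXp, hXm]
    cases b <;> simp [Matrix.mul_apply, hA, modelC]
  refine exists_inflation (A := A) (x := modelC 1) (X := X) (η := η) (r := r) hS hεn hε hεε hδ hδδ
    hCr hC hCC ?_ ?_ ?_ ?_ hXA ?_ ?_ hRS hη ?_ ?_ hRr ?_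
  · rw [hX, Matrix.conjTranspose_add, Matrix.conjTranspose_mul, Matrix.conjTranspose_mul,
      Matrix.conjTranspose_conjTranspose, Matrix.conjTranspose_conjTranspose, add_comm]
  · conv_lhs => rhs; rw [hX]
    rw [Matrix.mul_add, ← Matrix.mul_assoc, ← Matrix.mul_assoc, hXp, hXm, add_comm, hV.complete]
  · have h1 : C * Cᴴ = 1 := mul_eq_one_comm.1 hC
    rw [hAA, map_star_one, Matrix.mul_one, h1, two_smul]
  · ext a b
    cases a <;> cases b <;> simp [modelC]
  · rw [modelC_real (by simp), ← Matrix.mul_assoc, hXA, Matrix.mul_assoc, ← Matrix.mul_smul, hCx,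
      Matrix.mul_assoc]
  · rw [hR, Matrix.smul_mul, Matrix.mul_smul, ← smul_neg]
    congr 1
    have h1 : Vpᴴ * X = Vmᴴ := by
      rw [hX, Matrix.mul_add, ← Matrix.mul_assoc, ← Matrix.mul_assoc, ho, hV.isoP, Matrix.zero_mul,
        add_zero, Matrix.one_mul]
    have h2 : Vmᴴ * X = Vpᴴ := by
      rw [hX, Matrix.mul_add, ← Matrix.mul_assoc, ← Matrix.mul_assoc, ho', hV.isoM, Matrix.zero_mul,
        zero_add, Matrix.one_mul]
    rw [Matrix.sub_mul, Matrix.mul_assoc, Matrix.mul_assoc, h1, h2, Matrix.mul_sub,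
      ← Matrix.mul_assoc, ← Matrix.mul_assoc, hXp, hXm, neg_sub]
  · ext i b
    rw [hcol, hV.eigP, hV.eigM]
    cases b <;> simp [Matrix.mul_apply, hA, modelR, Matrix.diagonal_apply, mul_comm]
  · rw [map_star_smul', Matrix.smul_mul, Matrix.mul_smul, smul_smul, ← hθ]
    congr 2
    rw [modelR, Matrix.diagonal_map (star_zero ℂ)]
    congr 1
    ext a
    cases a <;> simp
  · rw [Matrix.conjTranspose_smul, hmR, hcr, smul_smul]

/-- The symmetry maps the eigenvalue $c$ of $R$ to $\eta\overline c$. Here this is $c$, so each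
eigenspace is preserved and contributes a real line. -/
theorem hasModelFibre_chiral_real [Nonempty h] {c η r : ℂ} {Vp Vm : Matrix n h ℂ}
    (hV : IsChiralFrame R c Vp Vm) (hS : IsSymmetryOp εn S)
    (hεn : εn * εn = 1) (hε : star ε = ε) (hεε : ε * ε = 1) (hs : ε * εn = 1)
    (hRS : R * S = η • (S * R.map star)) (hη : star η = η) (hRr : Rᴴ = r • R)
    (hcr : star c = r * c) (hηc : η * star c = c) : HasModelFibre ε 1 S R 1 (c • modelR) :=
  hasModelFibre_chiral hV hS hεn hε hεε (star_one ℂ) (one_mul 1) map_star_one (by simp)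
    (by rw [hs]; simp) (by simp) hRS hη (by rw [hηc]; simp) hRr hcr

/-- Here $\eta\overline c=-c$: the symmetry exchanges the two eigenspaces of $R$ and is off-diagonal
in the model. -/
theorem hasModelFibre_chiral_swap [Nonempty h] {c η r : ℂ} {Vp Vm : Matrix n h ℂ}
    (hV : IsChiralFrame R c Vp Vm) (hS : IsSymmetryOp εn S)
    (hεn : εn * εn = 1) (hε : star ε = ε) (hεε : ε * ε = 1) (hδ : star δ = δ) (hδδ : δ * δ = 1)
    (hs : ε * εn = δ) (hRS : R * S = η • (S * R.map star)) (hη : star η = η) (hRr : Rᴴ = r • R)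
    (hcr : star c = r * c) (hηc : η * star c = -c) :
    HasModelFibre ε δ S R (modelC δ) (c • modelR) := by
  refine hasModelFibre_chiral hV hS hεn hε hεε hδ hδδ (modelC_real hδ) (modelC_isometry hδ hδδ)
    (by rw [hs, modelC_mul_self]) ?_ hRS hη ?_ hRr hcr
  · replace hδ : (starRingEnd ℂ) δ = δ := hδ
    ext a b
    cases a <;> cases b <;> simp [modelC, Matrix.mul_apply, hδδ, hδ]
  · rw [hηc]
    ext a b
    cases a <;> cases b <;> simp [modelC, modelR, Matrix.mul_apply, Matrix.diagonal_apply]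

end ModelFibres


open scoped Matrix Kronecker

/-! ### Monomial matrices and their nullities -/

section Monomial

variable {ι κ Y n s : Type} [Fintype ι] [Fintype κ] [DecidableEq ι] [DecidableEq κ] [Fintype Y]
  [Fintype n] [Fintype s] [DecidableEq Y] [DecidableEq n] [DecidableEq s]

omit [DecidableEq ι] [Fintype ι] [DecidableEq κ] in
theorem nul_add_rank (M : Matrix ι κ ℂ) : nul M + M.rank = Fintype.card κ := by
  have h := LinearMap.finrank_range_add_finrank_ker M.mulVecLin
  rw [Module.finrank_pi] at h
  rw [nul, Matrix.rank, add_comm, h]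

omit [Fintype ι] [DecidableEq ι] [DecidableEq κ] in
theorem nul_submatrix {ι' κ' : Type} [Fintype ι'] [Fintype κ'] [DecidableEq κ'] (M : Matrix ι κ ℂ)
    (e : ι' ≃ ι) (f : κ' ≃ κ) : nul (M.submatrix e f) = nul M := by
  have h1 := nul_add_rank M
  have h2 := nul_add_rank (M.submatrix e f)
  rw [Matrix.rank_submatrix, Fintype.card_congr f] at h2
  omega

omit [DecidableEq Y] in
-- Up to a permutation of the tensor factors the two reflections enter the anticommutator
-- symmetrically, so each model path serves two kinds of entries.
theorem acMat_swap (A : Matrix (Y × n) (Y × n) ℂ) (B : Matrix (Y × s) (Y × s) ℂ) :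
    acMat B A = (acMat A B).submatrix (swapEquiv Y n s) (swapEquiv Y n s) := by
  have h1 : ∀ (p q : Type) [DecidableEq p] [DecidableEq q] (M : Matrix (Y × q) (Y × q) ℂ),
      (M ⊗ₖ (1 : Matrix p p ℂ)) =
        (midMat p M).submatrix (swapEquiv Y p q) (swapEquiv Y p q) := by
    intro p q _ _ M
    ext ⟨⟨y, a⟩, b⟩ ⟨⟨y', a'⟩, b'⟩
    simp [midMat_apply, swapEquiv, Matrix.one_apply]
  have h2 : midMat s A = (A ⊗ₖ (1 : Matrix s s ℂ)).submatrix (swapEquiv Y n s) (swapEquiv Y n s) := by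
    rw [h1 s n A]
    rfl
  rw [acMat, acMat, h1 n s B, h2, Matrix.submatrix_mul_equiv, Matrix.submatrix_mul_equiv, add_comm]
  rfl

theorem Flips.swap {δ δ' : ℂ} {S R : Matrix n n ℂ} {S' R' : Matrix s s ℂ} {q : ℕ}
    (h : Flips δ S R δ' S' R' q) : Flips δ' S' R' δ S R q := by
  obtain ⟨Y, _, _, A, B, hA, hB, hcA, hcB, h0, h1⟩ := h
  refine ⟨Y, inferInstance, inferInstance, B, A, hB, hA, hcB, hcA, ?_, ?_⟩
  · rw [acMat_swap, nul_submatrix, h0]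
  · rw [acMat_swap, nul_submatrix, h1]

/-- The matrix with the entries `c p` at `(p, π p)`. -/
def mono (π : ι → ι) (c : ι → ℂ) : Matrix ι ι ℂ := Matrix.of fun p q => if q = π p then c p else 0

omit [Fintype ι] in
theorem mono_apply (π : ι → ι) (c : ι → ℂ) (p q : ι) : mono π c p q = if q = π p then c p else 0 := rfl

theorem mono_mul (π ρ : ι → ι) (c d : ι → ℂ) :
    mono π c * mono ρ d = mono (fun p => ρ (π p)) (fun p => c p * d (π p)) := by
  ext p q
  rw [Matrix.mul_apply, Finset.sum_eq_single (π p)]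
  · simp only [mono_apply, if_true, mul_ite, mul_zero]
  · intro b _ hb
    rw [mono_apply, if_neg hb, zero_mul]
  · exact fun hb => absurd (Finset.mem_univ _) hb

omit [Fintype ι] in
theorem mono_one : mono (fun p : ι => p) (fun _ => 1) = (1 : Matrix ι ι ℂ) := by
  ext p q
  rw [mono_apply, Matrix.one_apply]
  simp only [eq_comm]

omit [Fintype ι] in
theorem mono_congr {π ρ : ι → ι} {c d : ι → ℂ} (h : ∀ p, π p = ρ p) (h' : ∀ p, c p = d p) :
    mono π c = mono ρ d := by
  rw [funext h, funext h']

/-- A monomial matrix is a diagonal matrix with permuted columns. -/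
theorem nul_mono (π : ι ≃ ι) (c : ι → ℂ) (t : Finset ι) (ht : ∀ p, p ∈ t ↔ c p = 0) :
    nul (mono π c) = t.card := by
  have h1 : mono π c = (Matrix.diagonal c).submatrix id π.symm := by
    ext p q
    rw [mono_apply, Matrix.submatrix_apply, Matrix.diagonal_apply]
    simp only [id, ← π.symm_apply_eq, eq_comm]
  have h2 := nul_add_rank (Matrix.diagonal c)
  have h3 : nul (mono π c) = nul (Matrix.diagonal c) := by
    rw [h1]
    exact nul_submatrix _ (Equiv.refl ι) π.symm
  rw [Matrix.rank_diagonal, Fintype.card_subtype] at h2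
  have h4 := Finset.card_filter_add_card_filter_not (s := (Finset.univ : Finset ι)) (fun p => c p = 0)
  have h5 : t = Finset.univ.filter fun p => c p = 0 := by
    ext p
    simp [ht]
  rw [h3, h5]
  rw [Finset.card_univ] at h4
  simp only [ne_eq] at h2
  omega

theorem MatClass.of_mono {δ : ℂ} {γ : n → n} {σ θ : n → ℂ} {π : Y × n → Y × n} {c : Y × n → ℂ}
    (hπ : ∀ p, π (π p) = p) (hc : ∀ p, star (c (π p)) = c p) (hcc : ∀ p, c p * c (π p) = 1)
    (hγ : ∀ y a, ((π (y, a)).1, γ (π (y, a)).2) = π (y, γ a))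
    (hσ : ∀ y a, c (y, a) * σ (π (y, a)).2 = δ * (σ a * star (c (y, γ a))))
    (hθ : ∀ p, θ (π p).2 = -θ p.2) :
    MatClass δ (mono γ σ) (Matrix.diagonal θ) (mono π c) where
  herm := by
    ext p q
    rw [Matrix.conjTranspose_apply, mono_apply, mono_apply]
    by_cases h : q = π p
    · rw [h, hπ, if_pos rfl, if_pos rfl, hc]
    · rw [if_neg h, if_neg fun h' => h (by rw [h', hπ]), star_zero]
  sq := by
    rw [mono_mul, ← mono_one]
    exact mono_congr hπ hcc
  sym := by
    have h1 : (1 : Matrix Y Y ℂ) ⊗ₖ mono γ σ = mono (fun p : Y × n => (p.1, γ p.2)) fun p => σ p.2 := by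
      ext ⟨y, a⟩ ⟨y', a'⟩
      simp only [Matrix.kroneckerMap_apply, mono_apply, Matrix.one_apply, Prod.mk.injEq]
      by_cases h : y = y'
      · simp [h]
      · have h' : ¬ y' = y := fun e => h e.symm
        simp [h, h']
    have h2 : (mono π c).map star = mono π fun p => star (c p) := by
      ext p q
      simp only [Matrix.map_apply, mono_apply]
      split_ifs
      · rfl
      · exact star_zero ℂ
    have h3 : ∀ (ρ : Y × n → Y × n) (e : Y × n → ℂ), δ • mono ρ e = mono ρ fun p => δ * e p := by
      intro ρ e
      ext p q
      simp only [Matrix.smul_apply, mono_apply, smul_eq_mul, mul_ite, mul_zero]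
    rw [h1, h2, mono_mul, mono_mul, h3]
    exact mono_congr (fun p => hγ p.1 p.2) fun p => hσ p.1 p.2
  chiral := by
    have h1 : (1 : Matrix Y Y ℂ) ⊗ₖ Matrix.diagonal θ = Matrix.diagonal fun p : Y × n => θ p.2 := by
      rw [← Matrix.diagonal_one, Matrix.diagonal_kronecker_diagonal]
      simp only [one_mul]
    rw [h1]
    ext p q
    rw [Matrix.diagonal_mul, Matrix.neg_apply, Matrix.mul_diagonal, mono_apply]
    split_ifs with h
    · rw [h, hθ]
      ring
    · simp

/-- The hypotheses say that both products have the same underlying permutation. Their sum is then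
monomial again, and its kernel can be read off the coefficients. -/
theorem acMat_mono {π : Y × n → Y × n} {ρ : Y × s → Y × s} {c : Y × n → ℂ} {d : Y × s → ℂ}
    {τ : (Y × n) × s → (Y × n) × s}
    (h1 : ∀ y a b, (((ρ ((π (y, a)).1, b)).1, (π (y, a)).2), (ρ ((π (y, a)).1, b)).2) = τ ((y, a), b))
    (h2 : ∀ y a b, (π ((ρ (y, b)).1, a), (ρ (y, b)).2) = τ ((y, a), b)) :
    acMat (mono π c) (mono ρ d) = mono τ fun p => c p.1 * d ((π p.1).1, p.2) +
      d (p.1.1, p.2) * c ((ρ (p.1.1, p.2)).1, p.1.2) := by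
  have e1 : mono π c ⊗ₖ (1 : Matrix s s ℂ) = mono (fun p => (π p.1, p.2)) fun p => c p.1 := by
    ext ⟨p, b⟩ ⟨q, b'⟩
    simp only [Matrix.kroneckerMap_apply, mono_apply, Matrix.one_apply, Prod.mk.injEq]
    by_cases h : b = b'
    · simp [h]
    · have h' : ¬ b' = b := fun e => h e.symm
      simp [h, h']
  have e2 : midMat n (mono ρ d) = mono (fun p => (((ρ (p.1.1, p.2)).1, p.1.2), (ρ (p.1.1, p.2)).2))
      fun p => d (p.1.1, p.2) := by
    ext ⟨⟨y, a⟩, b⟩ ⟨⟨y', a'⟩, b'⟩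
    simp only [midMat_apply, mono_apply, Prod.ext_iff]
    by_cases h : a = a'
    · simp [h]
    · have h' : ¬ a' = a := fun e => h e.symm
      simp [h, h']
  rw [acMat, e1, e2, mono_mul, mono_mul]
  rw [mono_congr (ρ := τ) (fun p => h1 p.1.1 p.1.2 p.2) fun p => rfl,
    mono_congr (π := fun p => _) (ρ := τ) (fun p => h2 p.1.1 p.1.2 p.2) fun p => rfl]
  ext p q
  simp only [Matrix.add_apply, mono_apply]
  split_ifs <;> simp

omit [Fintype ι] [DecidableEq ι] in
theorem continuous_mono {τ : Type*} [TopologicalSpace τ] [DecidableEq ι] {π : ι → ι} {c : τ → ι → ℂ}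
    (hc : Continuous c) : Continuous fun t => mono π (c t) := by
  refine continuous_matrix fun p q => ?_
  simp only [mono_apply]
  split_ifs
  · exact (continuous_apply p).comp hc
  · exact continuous_const

end Monomial


open scoped Matrix Kronecker

/-! ### The model over the triangle -/

section Phases

/-- The angle `π t / 2`. -/
def quarterAngle (t : unitInterval) : ℝ := Real.pi / 2 * t

theorem continuous_quarterAngle : Continuous quarterAngle :=
  continuous_const.mul continuous_subtype_val

theorem quarterAngle_zero : quarterAngle 0 = 0 := by simp [quarterAngle]

theorem quarterAngle_one : quarterAngle 1 = Real.pi / 2 := by simp [quarterAngle]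

theorem smul_modelR (c : ℂ) : c • modelR = Matrix.diagonal fun a => if a then c else -c := by
  ext a b
  cases a <;> cases b <;> simp [modelR]

theorem modelC_eq_mono (δ : ℂ) : modelC δ = mono (fun a => !a) fun a => if a then δ else 1 := rfl

/-- The neighbours of a site of the triangle. -/
def triangleShift (a : Bool) (y : Fin 3) : Fin 3 := if a then y - 1 else y + 1

/-- The coefficients of a reflection over the triangle. -/
def triangleCoeff (u : ℂ) (p : Fin 3 × Bool) : ℂ := if p.2 then u ^ p.1.1 else star u ^ p.1.1

theorem matClass_triangle (c : ℂ) : MatClass 1 (1 : Matrix Bool Bool ℂ) (c • modelR)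
    (mono (fun p : Fin 3 × Bool => (triangleShift p.2 p.1, !p.2)) fun _ => 1) := by
  rw [← mono_one, smul_modelR]
  refine MatClass.of_mono (by decide) (by simp) (by simp) (by simp) (by simp) ?_
  rintro ⟨y, a⟩
  cases a <;> simp

theorem matClass_triangleCoeff {u δ : ℂ} (hu : star u * u = 1) (hδ : δ * δ = 1) (c : ℂ) :
    MatClass δ (modelC δ) (c • modelR)
      (mono (fun p : Fin 3 × Bool => (p.1, !p.2)) (triangleCoeff u)) := by
  have hu' : ∀ k : ℕ, star u ^ k * u ^ k = 1 := fun k => by rw [← mul_pow, hu, one_pow]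
  rw [modelC_eq_mono, smul_modelR]
  refine MatClass.of_mono (by simp) ?_ ?_ (by simp) ?_ ?_
  · rintro ⟨y, a⟩
    cases a <;> simp [triangleCoeff]
  · rintro ⟨y, a⟩
    have := hu' y.1
    cases a
    · simpa [triangleCoeff] using this
    · simpa [triangleCoeff, mul_comm] using this
  · intro y a
    cases a
    · simp [triangleCoeff, mul_comm]
    · simp [triangleCoeff, ← mul_assoc, hδ]
  · rintro ⟨y, a⟩
    cases a <;> simp

/-- The anticommutator of the reflections over the triangle is a monomial matrix. -/
theorem nul_acMat_triangle (u : ℂ) (t : Finset ((Fin 3 × Bool) × Bool))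
    (ht : ∀ p, p ∈ t ↔ triangleCoeff u (triangleShift p.1.2 p.1.1, p.2) +
      triangleCoeff u (p.1.1, p.2) = 0) :
    nul (acMat (mono (fun p : Fin 3 × Bool => (triangleShift p.2 p.1, !p.2)) fun _ => 1)
      (mono (fun p : Fin 3 × Bool => (p.1, !p.2)) (triangleCoeff u))) = t.card := by
  have hτ : Function.Involutive fun p : (Fin 3 × Bool) × Bool =>
    ((triangleShift p.1.2 p.1.1, !p.1.2), !p.2) := by
    unfold Function.Involutive
    decide
  rw [acMat_mono (τ := hτ.toPerm) (fun _ _ _ => rfl) fun _ _ _ => rfl]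
  refine nul_mono _ _ t fun p => ?_
  rw [ht, one_mul, mul_one]

/-- The sites $0,1,2$ of the triangle carry the phases $1,u,u^2$ or their conjugates, and the
coefficients of the anticommutator are sums of the phases at the ends of an edge. They are all $2$
for $u=1$. For $u=\imath$ only the edge between $0$ and $2$ cancels; with two orientations and two
states of the other fibre this gives a kernel of dimension four. -/
theorem flips_real_swap {δ : ℂ} (hδ : δ * δ = 1) (c c' : ℂ) :
    Flips 1 (1 : Matrix Bool Bool ℂ) (c • modelR) δ (modelC δ) (c' • modelR) 4 := by
  set u : unitInterval → ℂ := fun t => Complex.exp (quarterAngle t * Complex.I) with hu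
  have huu : ∀ t, star (u t) * u t = 1 := fun t => by
    have h1 : star (u t) = (starRingEnd ℂ) (u t) := rfl
    rw [h1, ← Complex.normSq_eq_conj_mul_self, Complex.normSq_eq_norm_sq, hu,
      Complex.norm_exp_ofReal_mul_I]
    simp
  have huc : Continuous u := by
    have := continuous_quarterAngle
    fun_prop
  refine ⟨Fin 3, inferInstance, inferInstance, _, fun t => mono _ (triangleCoeff (u t)),
    continuous_const, ?_, fun _ => matClass_triangle c,
    fun t => matClass_triangleCoeff (huu t) hδ c', ?_, ?_⟩
  · refine continuous_mono (continuous_pi fun p => ?_)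
    unfold triangleCoeff
    split_ifs
    · exact huc.pow _
    · exact huc.star.pow _
  · have h0 : u 0 = 1 := by simp [hu, quarterAngle_zero]
    beta_reduce
    rw [h0, nul_acMat_triangle 1 ∅, Finset.card_empty]
    intro p
    simp [triangleCoeff]
  · have h1 : u 1 = Complex.I := by
      simp [hu, quarterAngle_one]
    beta_reduce
    rw [h1, nul_acMat_triangle Complex.I
      (Finset.univ.filter fun p => p.1.1 = 0 ∧ p.1.2 = true ∨ p.1.1 = 2 ∧ p.1.2 = false)]
    · decide
    · rintro ⟨⟨y, a⟩, b⟩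
      fin_cases y <;> cases a <;> cases b <;>
        simp [triangleCoeff, triangleShift, Complex.ext_iff, pow_two]

end Phases

/-! ### The model with two real fibres -/

section DiagonalModel

variable {Y : Type} [Fintype Y] [DecidableEq Y]

/-- The reflection `m` at one point of the fibre `Bool`, and `1` at the other. -/
def halfRefl (m : Matrix Y Y ℂ) : Matrix (Y × Bool) (Y × Bool) ℂ :=
  Matrix.of fun p q => if q.2 = p.2 then (if p.2 then (1 : Matrix Y Y ℂ) else m) p.1 q.1 else 0

theorem matClass_halfRefl {m : Matrix Y Y ℂ} (hm : mᴴ = m) (hmm : m * m = 1) (hr : m.map star = m) :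
    MatClass 1 (1 : Matrix Bool Bool ℂ) 0 (halfRefl m) where
  herm := by
    ext ⟨y, a⟩ ⟨y', a'⟩
    have h1 := congrFun (congrFun hm y) y'
    have h2 := congrFun (congrFun (Matrix.conjTranspose_one (n := Y) (α := ℂ)) y) y'
    rw [Matrix.conjTranspose_apply] at h1 h2 ⊢
    cases a <;> cases a' <;> simp only [halfRefl, Matrix.of_apply, if_true, if_false,
      Bool.false_eq_true, Bool.true_eq_false, star_zero, h1, h2]
  sq := by
    ext ⟨y, a⟩ ⟨y', a'⟩
    have := congrFun (congrFun hmm y) y'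
    rw [Matrix.mul_apply] at this
    cases a <;> cases a' <;>
      simp [halfRefl, Matrix.mul_apply, Fintype.sum_prod_type, this, Matrix.one_apply]
  sym := by
    have : (halfRefl m).map star = halfRefl m := by
      ext ⟨y, a⟩ ⟨y', a'⟩
      have := congrFun (congrFun hr y) y'
      rw [Matrix.map_apply] at this
      cases a <;> cases a' <;> simp [halfRefl, Matrix.one_apply, apply_ite]
      exact this
    rw [this]
    simp
  chiral := by simp

omit [Fintype Y] in
theorem halfRefl_mono (ρ : Y → Y) (e : Y → ℂ) : halfRefl (mono ρ e) =
    mono (fun p => (if p.2 then p.1 else ρ p.1, p.2)) fun p => if p.2 then 1 else e p.1 := by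
  ext ⟨y, a⟩ ⟨y', a'⟩
  cases a <;> cases a' <;> simp [halfRefl, mono_apply, Matrix.one_apply]
  by_cases h : y = y'
  · simp [h]
  · have h' : ¬ y' = y := fun e => h e.symm
    simp [h, h']

/-- One reflection rotates from $\sigma_1$ to a diagonal one that anticommutes with $\sigma_1$,
while the other stays at $\sigma_1$. Wherever a fibre index selects the constant $1$ the
anticommutator stays invertible, so only one block, two-dimensional in the sites, degenerates. -/
theorem flips_real_real : Flips 1 (1 : Matrix Bool Bool ℂ) 0 1 (1 : Matrix Bool Bool ℂ) 0 2 := by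
  set m : ℝ → Matrix Bool Bool ℂ := fun x => Matrix.of fun a b =>
    if b = a then (if a then -(Real.sin x : ℂ) else Real.sin x) else Real.cos x with hm
  have hcs : ∀ x : ℝ, (Real.sin x : ℂ) * Real.sin x + Real.cos x * Real.cos x = 1 := fun x => by
    have := Real.sin_sq_add_cos_sq x
    rw [pow_two, pow_two] at this
    exact_mod_cast this
  have hs : ∀ x : ℝ, star (x : ℂ) = x := Complex.conj_ofReal
  have hc : ∀ x, MatClass 1 (1 : Matrix Bool Bool ℂ) 0 (halfRefl (m x)) := by
    intro x
    have h1 := hcs x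
    refine matClass_halfRefl ?_ ?_ ?_
    · ext a b
      rw [Matrix.conjTranspose_apply]
      cases a <;> cases b <;> simp only [hm, Matrix.of_apply] <;> simp [hs, -Complex.ofReal_cos, -Complex.ofReal_sin]
    · ext a b
      cases a <;> cases b <;> simp [hm, Matrix.mul_apply, -Complex.ofReal_cos, -Complex.ofReal_sin] <;>
        first
        | linear_combination h1
        | ring
    · ext a b
      rw [Matrix.map_apply]
      cases a <;> cases b <;> simp only [hm, Matrix.of_apply] <;> simp [hs, -Complex.ofReal_cos, -Complex.ofReal_sin]
  have e0 : m 0 = mono (fun y => !y) fun _ => 1 := by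
    ext a b
    cases a <;> cases b <;> simp [hm, mono_apply]
  have e1 : m (Real.pi / 2) = mono (fun y => y) fun y => if y then -1 else 1 := by
    ext a b
    cases a <;> cases b <;> simp [hm, mono_apply]
  have hτ : Function.Involutive fun p : (Bool × Bool) × Bool =>
    (((if p.2 then (if p.1.2 then p.1.1 else !p.1.1) else !(if p.1.2 then p.1.1 else !p.1.1)), p.1.2), p.2) := by
    unfold Function.Involutive
    decide
  have hτ' : Function.Involutive fun p : (Bool × Bool) × Bool =>
    (((if p.2 then p.1.1 else !p.1.1), p.1.2), p.2) := by
    unfold Function.Involutive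
    decide
  refine ⟨Bool, inferInstance, inferInstance, fun t => halfRefl (m (quarterAngle t)),
    fun _ => halfRefl (m 0), ?_, continuous_const, fun t => hc _, fun _ => hc _, ?_, ?_⟩
  · refine continuous_matrix fun p q => ?_
    have := continuous_quarterAngle
    have h1 : Continuous fun t => (Real.sin (quarterAngle t) : ℂ) :=
      Complex.continuous_ofReal.comp (Real.continuous_sin.comp this)
    have h2 : Continuous fun t => (Real.cos (quarterAngle t) : ℂ) :=
      Complex.continuous_ofReal.comp (Real.continuous_cos.comp this)
    obtain ⟨y, a⟩ := p
    obtain ⟨y', a'⟩ := q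
    cases a <;> cases a' <;> cases y <;> cases y' <;>
      simp only [halfRefl, hm, Matrix.of_apply, if_true, if_false, Bool.false_eq_true,
        Bool.true_eq_false] <;>
      first
      | exact continuous_const
      | exact h1
      | exact h1.neg
      | exact h2
  · beta_reduce
    rw [quarterAngle_zero, e0, halfRefl_mono, acMat_mono (τ := hτ.toPerm) (by simp only [Function.Involutive.coe_toPerm]; decide)
        (by simp only [Function.Involutive.coe_toPerm]; decide),
      nul_mono _ _ ∅, Finset.card_empty]
    rintro ⟨⟨y, a⟩, b⟩
    simp
  · beta_reduce
    rw [quarterAngle_one, e0, e1, halfRefl_mono, halfRefl_mono,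
      acMat_mono (τ := hτ'.toPerm) (by simp only [Function.Involutive.coe_toPerm]; decide)
        (by simp only [Function.Involutive.coe_toPerm]; decide),
      nul_mono _ _ (Finset.univ.filter fun p => p.1.2 = false ∧ p.2 = false)]
    · decide
    · rintro ⟨⟨y, a⟩, b⟩
      cases y <;> cases a <;> cases b <;> simp

end DiagonalModel


open scoped Matrix Kronecker

/-! ### Block reflections that confine the kernel to one block -/

section SiteBlocks

variable {Y n : Type} [Fintype Y] [Fintype n] [DecidableEq Y] [DecidableEq n]

/-- The operator `G false ⊕ G true`, with the summands distinguished by the sites. -/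
def siteBlock (G : Bool → Matrix (Y × n) (Y × n) ℂ) :
    Matrix ((Y × Bool) × n) ((Y × Bool) × n) ℂ :=
  Matrix.of fun p q => if q.1.2 = p.1.2 then G p.1.2 (p.1.1, p.2) (q.1.1, q.2) else 0

/-- The operator `T ⊗ 1` at one point of the fibre `Bool`, and `T ⊗ σ₁` at the other. -/
def siteFlip (T : Matrix Y Y ℂ) : Matrix ((Y × Bool) × Bool) ((Y × Bool) × Bool) ℂ :=
  Matrix.of fun p q => if q.2 = p.2 ∧ q.1.2 = (p.1.2 ^^ p.2) then T p.1.1 q.1.1 else 0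

theorem matClass_siteBlock {δ : ℂ} {S R : Matrix n n ℂ} {G : Bool → Matrix (Y × n) (Y × n) ℂ}
    (hG : ∀ a, MatClass δ S R (G a)) : MatClass δ S R (siteBlock G) := by
  have hmul : ∀ G G' : Bool → Matrix (Y × n) (Y × n) ℂ,
      siteBlock G * siteBlock G' = siteBlock fun a => G a * G' a := by
    intro G G'
    ext ⟨⟨y, a⟩, i⟩ ⟨⟨y', a'⟩, i'⟩
    cases a <;> cases a' <;>
      simp [siteBlock, Matrix.mul_apply, Fintype.sum_prod_type]
  have hone : ∀ M : Matrix n n ℂ, (1 : Matrix (Y × Bool) (Y × Bool) ℂ) ⊗ₖ M =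
      siteBlock fun _ => (1 : Matrix Y Y ℂ) ⊗ₖ M := by
    intro M
    ext ⟨⟨y, a⟩, i⟩ ⟨⟨y', a'⟩, i'⟩
    cases a <;> cases a' <;> simp [siteBlock, Matrix.one_apply]
  refine ⟨?_, ?_, ?_, ?_⟩
  · ext ⟨⟨y, a⟩, i⟩ ⟨⟨y', a'⟩, i'⟩
    have h1 := congrFun (congrFun (hG a).herm (y, i)) (y', i')
    rw [Matrix.conjTranspose_apply] at h1 ⊢
    cases a <;> cases a' <;> simp only [siteBlock, Matrix.of_apply, if_true, if_false,
      Bool.false_eq_true, Bool.true_eq_false, star_zero, h1]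
  · rw [hmul, funext fun a => (hG a).sq, ← Matrix.one_kronecker_one (m := Y) (n := n), ← hone,
      Matrix.one_kronecker_one]
  · have h1 : (siteBlock G).map star = siteBlock fun a => (G a).map star := by
      ext ⟨⟨y, a⟩, i⟩ ⟨⟨y', a'⟩, i'⟩
      cases a <;> cases a' <;> simp [siteBlock]
    rw [h1, hone, hmul, hmul, funext fun a => (hG a).sym]
    ext ⟨⟨y, a⟩, i⟩ ⟨⟨y', a'⟩, i'⟩
    cases a <;> cases a' <;> simp [siteBlock]
  · rw [hone, hmul, hmul, funext fun a => (hG a).chiral]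
    ext ⟨⟨y, a⟩, i⟩ ⟨⟨y', a'⟩, i'⟩
    cases a <;> cases a' <;> simp [siteBlock]

theorem matClass_siteFlip {T : Matrix Y Y ℂ} (hT : Tᴴ = T) (hTT : T * T = 1)
    (hTi : T.map star = -T) : MatClass (-1) (1 : Matrix Bool Bool ℂ) 0 (siteFlip T) where
  herm := by
    ext ⟨⟨y, a⟩, k⟩ ⟨⟨y', a'⟩, k'⟩
    have h1 := congrFun (congrFun hT y) y'
    rw [Matrix.conjTranspose_apply] at h1 ⊢
    cases a <;> cases a' <;> cases k <;> cases k' <;> simp only [siteFlip, Matrix.of_apply, if_true,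
      if_false, Bool.false_eq_true, Bool.true_eq_false, star_zero, h1, Bool.xor_true, Bool.xor_false,
      Bool.not_true, Bool.not_false, and_self, and_true, and_false]
  sq := by
    ext ⟨⟨y, a⟩, k⟩ ⟨⟨y', a'⟩, k'⟩
    have h1 := congrFun (congrFun hTT y) y'
    rw [Matrix.mul_apply] at h1
    cases a <;> cases a' <;> cases k <;> cases k' <;>
      simp [siteFlip, Matrix.mul_apply, Fintype.sum_prod_type, h1, Matrix.one_apply]
  sym := by
    have : (siteFlip T).map star = -siteFlip T := by
      ext ⟨⟨y, a⟩, k⟩ ⟨⟨y', a'⟩, k'⟩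
      have h1 := congrFun (congrFun hTi y) y'
      rw [Matrix.map_apply] at h1 ⊢
      cases a <;> cases a' <;> cases k <;> cases k' <;> simp only [siteFlip, Matrix.of_apply, if_true,
        if_false, Bool.false_eq_true, Bool.true_eq_false, star_zero, h1, Bool.xor_true,
        Bool.xor_false, Bool.not_true, Bool.not_false, and_self, and_true, and_false,
        Matrix.neg_apply, neg_zero]
    rw [this]
    simp
  chiral := by simp

omit [DecidableEq Y] in
-- The fibre state $k$ of the second reflection couples block $a$ to block $a\oplus k$: one state
-- sees the anticommutator of each block, the other a mixed expression.
theorem acMat_siteBlock_mulVec (G : Bool → Matrix (Y × n) (Y × n) ℂ) (T : Matrix Y Y ℂ)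
    (v : ((Y × Bool) × n) × Bool → ℂ) (y : Y) (a : Bool) (i : n) (k : Bool) :
    (acMat (siteBlock G) (siteFlip T) *ᵥ v) (((y, a), i), k) =
      ((G a * (T ⊗ₖ (1 : Matrix n n ℂ)) + (T ⊗ₖ (1 : Matrix n n ℂ)) * G (a ^^ k)) *ᵥ
        fun q => v (((q.1, a ^^ k), q.2), k)) (y, i) := by
  have h1 : ∀ (v : ((Y × Bool) × n) × Bool → ℂ) y a i k,
      (midMat n (siteFlip T) *ᵥ v) (((y, a), i), k) =
        ((T ⊗ₖ (1 : Matrix n n ℂ)) *ᵥ fun q => v (((q.1, a ^^ k), q.2), k)) (y, i) := by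
    intro v y a i k
    cases a <;> cases k <;> simp [Matrix.mulVec, dotProduct, midMat_apply, siteFlip,
      Fintype.sum_prod_type, Matrix.one_apply]
  have h2 : ∀ (v : ((Y × Bool) × n) × Bool → ℂ) y a i k,
      ((siteBlock G ⊗ₖ (1 : Matrix Bool Bool ℂ)) *ᵥ v) (((y, a), i), k) =
        (G a *ᵥ fun q => v (((q.1, a), q.2), k)) (y, i) := by
    intro v y a i k
    cases a <;> cases k <;> simp [Matrix.mulVec, dotProduct, siteBlock,
      Fintype.sum_prod_type]
  rw [acMat, Matrix.add_mulVec, Matrix.add_mulVec, ← Matrix.mulVec_mulVec, ← Matrix.mulVec_mulVec,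
    ← Matrix.mulVec_mulVec, ← Matrix.mulVec_mulVec, Pi.add_apply, Pi.add_apply, h1, h2]
  simp only [h1, h2]

theorem nul_eq_zero {ι : Type} [Fintype ι] {M : Matrix ι ι ℂ} (h : ∀ v, M *ᵥ v = 0 → v = 0) :
    nul M = 0 := by
  have h1 : LinearMap.ker M.mulVecLin = ⊥ := by
    rw [LinearMap.ker_eq_bot']
    exact h
  rw [nul, h1, finrank_bot]

theorem nul_acMat_siteBlock_zero {T : Matrix Y Y ℂ} (hTT : T * T = 1) :
    nul (acMat (siteBlock fun _ => T ⊗ₖ (1 : Matrix n n ℂ)) (siteFlip T)) = 0 := by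
  refine nul_eq_zero fun v hv => funext fun ⟨⟨⟨y, a⟩, i⟩, k⟩ => ?_
  have h := congrFun hv (((y, a ^^ k), i), k)
  rw [acMat_siteBlock_mulVec, mul_kronecker_one, hTT, Matrix.one_kronecker_one, ← two_smul ℂ,
    Matrix.smul_mulVec, Matrix.one_mulVec] at h
  simpa using h

/-- If the anticommutator `N` of `G` and `T` satisfies `N² = 2 N`, only the block of `N` contributes
to the kernel. -/
theorem nul_acMat_siteBlock {T : Matrix Y Y ℂ} (hTT : T * T = 1) {G N : Matrix (Y × n) (Y × n) ℂ}
    (hGG : G * G = 1)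
    (hN : G * (T ⊗ₖ (1 : Matrix n n ℂ)) + (T ⊗ₖ (1 : Matrix n n ℂ)) * G = N)
    (hNN : N * N = (2 : ℂ) • N) :
    nul (acMat (siteBlock fun a => if a then T ⊗ₖ (1 : Matrix n n ℂ) else G) (siteFlip T)) =
      nul N := by
  set X : Matrix (Y × n) (Y × n) ℂ := T ⊗ₖ (1 : Matrix n n ℂ) with hX
  have hXX : X * X = 1 := by rw [hX, mul_kronecker_one, hTT, Matrix.one_kronecker_one]
  set W : Matrix (((Y × Bool) × n) × Bool) (Y × n) ℂ := Matrix.of fun p q =>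
    if p.2 = false ∧ p.1.1.2 = false then (1 : Matrix (Y × n) (Y × n) ℂ) (p.1.1.1, p.1.2) q else 0
    with hW
  have hWv : ∀ u y a i k, (W *ᵥ u) (((y, a), i), k) =
      if k = false ∧ a = false then u (y, i) else 0 := by
    intro u y a i k
    cases a <;> cases k <;> simp [hW, Matrix.mulVec, dotProduct, Matrix.one_apply]
  have hWh : ∀ v q, (Wᴴ *ᵥ v) q = v (((q.1, false), q.2), false) := by
    rintro v ⟨y, i⟩
    simp [hW, Matrix.mulVec, dotProduct, Fintype.sum_prod_type, Matrix.one_apply, apply_ite]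
    rw [Finset.sum_eq_single y, Finset.sum_eq_single i]
    · simp
    · exact fun b _ hb => by simp [hb]
    · simp
    · exact fun b _ hb => by simp [hb]
    · simp
  refine nul_eq_of_intertwine (W := W) ?_ ?_ fun v hv => ?_
  · refine Matrix.ext_of_mulVec_single fun q => ?_
    rw [← Matrix.mulVec_mulVec, Matrix.one_mulVec]
    ext p
    rw [hWh, hWv, if_pos ⟨rfl, rfl⟩]
  · refine Matrix.ext_of_mulVec_single fun q => ?_
    rw [← Matrix.mulVec_mulVec, ← Matrix.mulVec_mulVec]
    ext ⟨⟨⟨y, a⟩, i⟩, k⟩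
    rw [acMat_siteBlock_mulVec, hWv]
    simp only [hWv]
    cases a <;> cases k <;> simp
    all_goals
      first
      | exact congrFun (congrFun hN (y, i)) q
      | exact congrFun (Matrix.mulVec_zero _) _
  · have key : ∀ a k, (fun q : Y × n => v (((q.1, a ^^ k), q.2), k)) = 0 ∨ (a = false ∧ k = false) := by
      intro a k
      have h : ((if a then X else G) * X + X * (if a ^^ k then X else G)) *ᵥ
          (fun q : Y × n => v (((q.1, a ^^ k), q.2), k)) = 0 := by
        ext ⟨y, i⟩
        rw [← acMat_siteBlock_mulVec (fun a => if a then X else G) T, hv]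
        rfl
      generalize (fun q : Y × n => v (((q.1, a ^^ k), q.2), k)) = u at h
      -- The mixed expressions reduce to $1+AB$, which is invertible: $(1+BA)(1+AB)=2+N$, and
      -- $N^2=2N$ gives $(4-N)(2+N)=8$.
      have inv : ∀ A B : Matrix (Y × n) (Y × n) ℂ, A * A = 1 → B * B = 1 → A * B + B * A = N →
          (1 + A * B) *ᵥ u = 0 → u = 0 := by
        intro A B hA hB hAB hu
        have h1 : (1 + B * A) * (1 + A * B) = (2 : ℂ) • 1 + N := by
          have h2 : B * A * (A * B) = 1 := by
            rw [Matrix.mul_assoc, ← Matrix.mul_assoc A, hA, Matrix.one_mul, hB]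
          rw [← hAB]
          simp only [Matrix.add_mul, Matrix.mul_add, Matrix.one_mul, Matrix.mul_one, h2]
          match_scalars <;> norm_num
        have h3 : ((4 : ℂ) • 1 - N) * ((1 + B * A) * (1 + A * B)) = (8 : ℂ) • 1 := by
          rw [h1]
          simp only [Matrix.sub_mul, Matrix.mul_add, Matrix.smul_mul, Matrix.mul_smul, Matrix.one_mul,
            Matrix.mul_one, hNN]
          match_scalars <;> norm_num
        have h4 := congrArg (fun w => (((4 : ℂ) • 1 - N) * (1 + B * A)) *ᵥ w) hu
        simp only [Matrix.mulVec_mulVec, Matrix.mulVec_zero] at h4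
        rw [Matrix.mul_assoc, h3, Matrix.smul_mulVec, Matrix.one_mulVec] at h4
        exact (smul_eq_zero.1 h4).resolve_left (by norm_num)
      cases a <;> cases k
      · exact Or.inr ⟨rfl, rfl⟩
      · left
        refine inv G X hGG hXX hN ?_
        simpa [hXX, add_comm] using h
      · left
        have h5 : (2 : ℂ) • u = 0 := by
          simpa [hXX, ← two_smul ℂ, Matrix.smul_mulVec] using h
        exact (smul_eq_zero.1 h5).resolve_left (by norm_num)
      · left
        refine inv X G hXX hGG (by rw [add_comm, hN]) ?_
        simpa [hXX] using h
    rw [← Matrix.mulVec_mulVec]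
    ext ⟨⟨⟨y, a⟩, i⟩, k⟩
    rw [hWv, hWh]
    rcases key (a ^^ k) k with h | h
    · have h6 := congrFun h (y, i)
      rw [Bool.xor_assoc, Bool.xor_self, Bool.xor_false] at h6
      rw [h6]
      split_ifs with h7
      · rw [← h6, h7.1, h7.2]
      · rfl
    · obtain ⟨h7, rfl⟩ := h
      rw [Bool.xor_false] at h7
      rw [if_pos ⟨rfl, h7⟩, h7]

end SiteBlocks


open scoped Matrix Kronecker

/-! ### The model with a symplectic and a real fibre -/

section SymplecticModel

/-- The second Pauli matrix, over the index set `Bool`. -/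
def boolPauli2 : Matrix Bool Bool ℂ :=
  Matrix.of fun a b => if b = !a then (if a then Complex.I else -Complex.I) else 0

theorem boolPauli2_conjTranspose : boolPauli2ᴴ = boolPauli2 := by
  ext a b
  cases a <;> cases b <;> simp [boolPauli2]

theorem boolPauli2_mul_self : boolPauli2 * boolPauli2 = 1 := by
  ext a b
  cases a <;> cases b <;> simp [boolPauli2, Matrix.mul_apply]

theorem boolPauli2_map_star : boolPauli2.map star = -boolPauli2 := by
  ext a b
  cases a <;> cases b <;> simp [boolPauli2]

theorem modelR_conjTranspose : modelRᴴ = modelR := by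
  ext a b
  cases a <;> cases b <;> simp [modelR]

theorem modelR_map_star : modelR.map star = modelR := by
  ext a b
  cases a <;> cases b <;> simp [modelR]

theorem modelR_mul_self : modelR * modelR = 1 := by
  ext a b
  cases a <;> cases b <;> simp [modelR, Matrix.mul_apply, Matrix.diagonal_apply]

/-- `σ₂ ⊗ 1` -/
def pathX : Matrix (Bool × Bool) (Bool × Bool) ℂ := boolPauli2 ⊗ₖ (1 : Matrix Bool Bool ℂ)

/-- `-1 ⊗ σ₃` -/
def pathZ : Matrix (Bool × Bool) (Bool × Bool) ℂ := (1 : Matrix Bool Bool ℂ) ⊗ₖ modelR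

/-- `σ₁ ⊗ σ₁ + σ₃ ⊗ σ₂` -/
def pathW : Matrix (Bool × Bool) (Bool × Bool) ℂ := modelC 1 ⊗ₖ modelC 1 - modelR ⊗ₖ boolPauli2

theorem pathX_mul_self : pathX * pathX = 1 := by
  rw [pathX, mul_kronecker_one, boolPauli2_mul_self, Matrix.one_kronecker_one]

theorem pathZ_mul_self : pathZ * pathZ = 1 := by
  rw [pathZ, one_kronecker_mul, modelR_mul_self, Matrix.one_kronecker_one]

theorem pathZ_mul_pathX : pathZ * pathX = pathX * pathZ := by
  rw [pathX, pathZ, ← Matrix.mul_kronecker_mul, ← Matrix.mul_kronecker_mul]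
  simp only [Matrix.one_mul, Matrix.mul_one]

theorem pathW_mul_pathX : pathW * pathX = -(pathX * pathW) := by
  have h1 : modelC 1 * boolPauli2 = -(boolPauli2 * modelC 1) := by
    ext a b
    cases a <;> cases b <;> simp [modelC, boolPauli2, Matrix.mul_apply]
  have h2 : modelR * boolPauli2 = -(boolPauli2 * modelR) := by
    ext a b
    cases a <;> cases b <;> simp [modelR, boolPauli2, Matrix.mul_apply, Matrix.diagonal_apply]
  rw [pathW, pathX, Matrix.sub_mul, Matrix.mul_sub]
  simp only [← Matrix.mul_kronecker_mul, Matrix.one_mul, Matrix.mul_one, h1, h2]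
  ext p q
  simp only [Matrix.sub_apply, Matrix.neg_apply, Matrix.kroneckerMap_apply]
  ring

theorem pathW_mul_pathZ : pathW * pathZ = -(pathZ * pathW) := by
  have h1 : modelC 1 * modelR = -(modelR * modelC 1) := by
    ext a b
    cases a <;> cases b <;> simp [modelC, modelR, Matrix.mul_apply, Matrix.diagonal_apply]
  have h2 : boolPauli2 * modelR = -(modelR * boolPauli2) := by
    ext a b
    cases a <;> cases b <;> simp [modelR, boolPauli2, Matrix.mul_apply, Matrix.diagonal_apply]
  rw [pathW, pathZ, Matrix.sub_mul, Matrix.mul_sub]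
  simp only [← Matrix.mul_kronecker_mul, Matrix.one_mul, Matrix.mul_one, h1, h2]
  ext p q
  simp only [Matrix.sub_apply, Matrix.neg_apply, Matrix.kroneckerMap_apply]
  ring

theorem pathW_mul_self : pathW * pathW = (2 : ℂ) • 1 - (2 : ℂ) • (pathX * pathZ) := by
  have h1 : modelC 1 * modelR = Complex.I • boolPauli2 := by
    ext a b
    cases a <;> cases b <;> simp [modelC, modelR, boolPauli2, Matrix.mul_apply, Matrix.diagonal_apply]
  have h2 : modelR * modelC 1 = (-Complex.I) • boolPauli2 := by
    ext a b
    cases a <;> cases b <;> simp [modelC, modelR, boolPauli2, Matrix.mul_apply, Matrix.diagonal_apply]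
  have h3 : modelC 1 * boolPauli2 = (-Complex.I) • modelR := by
    ext a b
    cases a <;> cases b <;> simp [modelC, modelR, boolPauli2, Matrix.mul_apply]
  have h4 : boolPauli2 * modelC 1 = Complex.I • modelR := by
    ext a b
    cases a <;> cases b <;> simp [modelC, modelR, boolPauli2, Matrix.mul_apply]
  rw [pathW, pathX, pathZ, Matrix.sub_mul, Matrix.mul_sub, Matrix.mul_sub]
  simp only [← Matrix.mul_kronecker_mul, Matrix.one_mul, Matrix.mul_one, h1, h2, h3, h4,
    modelC_mul_self, modelR_mul_self, boolPauli2_mul_self, one_smul, Matrix.one_kronecker_one,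
    Matrix.smul_kronecker, Matrix.kronecker_smul, smul_smul]
  match_scalars
  · norm_num
  · linear_combination (2 : ℂ) * Complex.I_sq

/-- A path of reflections from `σ₂ ⊗ 1`. -/
def symplecticPath (c s : ℝ) : Matrix (Bool × Bool) (Bool × Bool) ℂ :=
  (2⁻¹ : ℂ) • ((1 + c : ℂ) • pathX + (1 - c : ℂ) • pathZ + (s : ℂ) • pathW)

/-- $X$ and $Z$ are commuting involutions, $W$ anticommutes with both and $W^2=2-2XZ$. In the square
of the path the $XZ$ terms then cancel exactly on the circle $c^2+s^2=1$. -/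
theorem matClass_symplecticPath {c s : ℝ} (h : c * c + s * s = 1) :
    MatClass (-1) (modelC (-1)) 0 (symplecticPath c s) := by
  have hs : ∀ x : ℝ, star (x : ℂ) = x := Complex.conj_ofReal
  have h2 : star (2⁻¹ : ℂ) = 2⁻¹ := by simp
  have hC : modelC 1 * modelC (-1) = -(modelC (-1) * modelC 1) := by
    ext a b
    cases a <;> cases b <;> simp [modelC, Matrix.mul_apply]
  have hR : modelR * modelC (-1) = -(modelC (-1) * modelR) := by
    ext a b
    cases a <;> cases b <;> simp [modelC, modelR, Matrix.mul_apply, Matrix.diagonal_apply]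
  have hP : boolPauli2 * modelC (-1) = modelC (-1) * boolPauli2 := by
    ext a b
    cases a <;> cases b <;> simp [modelC, boolPauli2, Matrix.mul_apply]
  have hC1 : (modelC 1)ᴴ = modelC 1 := by
    ext a b
    cases a <;> cases b <;> simp [modelC]
  refine ⟨?_, ?_, ?_, by simp⟩
  · have hX : pathXᴴ = pathX := by
      rw [pathX, kronecker_one_conjTranspose, boolPauli2_conjTranspose]
    have hZ : pathZᴴ = pathZ := by
      rw [pathZ, one_kronecker_conjTranspose, modelR_conjTranspose]
    have hW : pathWᴴ = pathW := by
      rw [pathW, Matrix.conjTranspose_sub, Matrix.conjTranspose_kronecker,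
        Matrix.conjTranspose_kronecker, hC1, modelR_conjTranspose, boolPauli2_conjTranspose]
    simp only [symplecticPath, Matrix.conjTranspose_smul, Matrix.conjTranspose_add, hX, hZ, hW, h2,
      star_add, star_sub, star_one, hs]
  · have h' : (c : ℂ) * c + s * s = 1 := by exact_mod_cast h
    simp only [symplecticPath, Matrix.smul_mul, Matrix.mul_smul, Matrix.add_mul, Matrix.mul_add,
      pathX_mul_self, pathZ_mul_self, pathZ_mul_pathX, pathW_mul_pathX, pathW_mul_pathZ,
      pathW_mul_self]
    match_scalars
    · linear_combination (1 / 2 : ℂ) * h'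
    · linear_combination (-1 / 2 : ℂ) * h'
    · ring
    · ring
  · have hX : pathX.map star = -pathX := by
      rw [pathX, kronecker_map_star, boolPauli2_map_star, map_star_one]
      ext p q
      simp
    have hZ : pathZ.map star = pathZ := by
      rw [pathZ, one_kronecker_map_star, modelR_map_star]
    have hW : pathW.map star = modelC 1 ⊗ₖ modelC 1 + modelR ⊗ₖ boolPauli2 := by
      rw [pathW, Matrix.map_sub star star_sub, kronecker_map_star, kronecker_map_star,
        modelC_real (star_one ℂ), modelR_map_star, boolPauli2_map_star]
      ext p q
      simp
    simp only [symplecticPath, map_star_smul', Matrix.map_add star star_add, hX, hZ, hW, h2,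
      star_add, star_sub, star_one, hs]
    rw [pathX, pathZ, pathW]
    simp only [Matrix.smul_mul, Matrix.mul_smul, Matrix.add_mul, Matrix.mul_add, Matrix.sub_mul,
      Matrix.mul_neg, ← Matrix.mul_kronecker_mul, Matrix.one_mul, Matrix.mul_one, hC, hR, hP]
    ext p q
    simp only [Matrix.smul_apply, Matrix.add_apply, Matrix.neg_apply, Matrix.sub_apply,
      Matrix.kroneckerMap_apply, smul_eq_mul]
    ring

theorem symplecticPath_anticomm (c s : ℝ) : symplecticPath c s * pathX + pathX * symplecticPath c s =
    (1 + c : ℂ) • 1 + (1 - c : ℂ) • (pathX * pathZ) := by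
  simp only [symplecticPath, Matrix.smul_mul, Matrix.mul_smul, Matrix.add_mul, Matrix.mul_add,
    pathX_mul_self, pathZ_mul_pathX, pathW_mul_pathX]
  match_scalars <;> ring

theorem nul_one_add_pathX_mul_pathZ : nul (1 + pathX * pathZ) = 2 := by
  set a : ℂ := (((Real.sqrt 2)⁻¹ : ℝ) : ℂ) with ha
  have ha1 : (starRingEnd ℂ) a = a := Complex.conj_ofReal _
  have ha2 : a * a = 1 / 2 := by
    rw [ha, ← Complex.ofReal_mul, ← mul_inv, Real.mul_self_sqrt (by norm_num)]
    norm_num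
  -- Its columns are an orthonormal basis of the eigenspace of the involution $XZ$ for $-1$.
  set W : Matrix (Bool × Bool) Bool ℂ := Matrix.of fun p i =>
    if p.2 = i then (if p.1 then (if i then -Complex.I else Complex.I) * a else a) else 0 with hW
  have hXZ : pathX * pathZ = boolPauli2 ⊗ₖ modelR := by
    rw [pathX, pathZ, ← Matrix.mul_kronecker_mul, Matrix.one_mul, Matrix.mul_one]
  have h1 : Wᴴ * W = 1 := by
    ext i i'
    cases i <;> cases i' <;>
      simp [hW, Matrix.mul_apply, Fintype.sum_prod_type, ha1] <;>
      linear_combination (2 : ℂ) * ha2 - a * a * Complex.I_sq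
  have h2 : W * Wᴴ = (1 / 2 : ℂ) • (1 - pathX * pathZ) := by
    rw [hXZ]
    ext ⟨y, i⟩ ⟨y', i'⟩
    cases y <;> cases i <;> cases y' <;> cases i' <;>
      simp [hW, Matrix.mul_apply, ha1, ha2, boolPauli2, modelR] <;>
      first
      | linear_combination Complex.I * ha2
      | linear_combination -Complex.I * ha2
      | linear_combination ha2 - a * a * Complex.I_sq
  have h3 : (1 + pathX * pathZ) * W = 0 := by
    rw [hXZ]
    ext ⟨y, i⟩ k
    cases y <;> cases i <;> cases k <;>
      simp [hW, Matrix.mul_apply, Fintype.sum_prod_type, boolPauli2, modelR, Matrix.diagonal_apply,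
        Matrix.one_apply] <;>
      linear_combination a * Complex.I_sq
  rw [nul_eq_of_intertwine (N' := 0) h1 (by rw [h3, Matrix.mul_zero]) fun v hv => ?_]
  · rw [nul, Matrix.mulVecLin_zero, LinearMap.ker_zero, finrank_top]
    simp
  · rw [h2]
    rw [Matrix.add_mulVec, Matrix.one_mulVec] at hv
    rw [Matrix.smul_mulVec, Matrix.sub_mulVec, Matrix.one_mulVec, eq_neg_of_add_eq_zero_right hv,
      sub_neg_eq_add, ← two_smul ℂ, smul_smul]
    norm_num

/-- One block moves from $X$ to $\tfrac12(X+Z+W)$, the other rests at $X$. At the end the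
anticommutator of the moving block with $X$ is $N=1+XZ$, which satisfies $N^2=2N$ and has a kernel
of dimension two. All other blocks are invertible. -/
theorem flips_symplectic :
    Flips (-1) (modelC (-1)) 0 (-1) (1 : Matrix Bool Bool ℂ) 0 2 := by
  have hcs : ∀ x : ℝ, Real.cos x * Real.cos x + Real.sin x * Real.sin x = 1 := fun x => by
    have := Real.cos_sq_add_sin_sq x
    rwa [pow_two, pow_two] at this
  refine ⟨Bool × Bool, inferInstance, inferInstance, fun t => siteBlock fun a => if a then
      boolPauli2 ⊗ₖ (1 : Matrix Bool Bool ℂ) else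
      symplecticPath (Real.cos (quarterAngle t)) (Real.sin (quarterAngle t)),
    fun _ => siteFlip boolPauli2, ?_, continuous_const, fun t => matClass_siteBlock fun a => ?_,
    fun _ => matClass_siteFlip boolPauli2_conjTranspose boolPauli2_mul_self boolPauli2_map_star,
    ?_, ?_⟩
  · have h := continuous_quarterAngle
    have h1 : Continuous fun t => symplecticPath (Real.cos (quarterAngle t))
        (Real.sin (quarterAngle t)) := by
      unfold symplecticPath
      fun_prop
    refine continuous_matrix fun p q => ?_
    simp only [siteBlock, Matrix.of_apply]
    split_ifs
    · exact continuous_const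
    · exact h1.matrix_elem _ _
    · exact continuous_const
  · cases a
    · exact matClass_symplecticPath (hcs _)
    · have h1 := matClass_symplecticPath (c := 1) (s := 0) (by norm_num)
      have h2 : symplecticPath 1 0 = pathX := by
        rw [symplecticPath]
        match_scalars <;> norm_num
      rw [h2] at h1
      exact h1
  · have h2 : symplecticPath 1 0 = boolPauli2 ⊗ₖ (1 : Matrix Bool Bool ℂ) := by
      rw [symplecticPath, ← pathX]
      match_scalars <;> norm_num
    beta_reduce
    rw [quarterAngle_zero, Real.cos_zero, Real.sin_zero, h2]
    simp only [ite_self]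
    exact nul_acMat_siteBlock_zero boolPauli2_mul_self
  · beta_reduce
    rw [quarterAngle_one, Real.cos_pi_div_two, Real.sin_pi_div_two]
    have h1 := symplecticPath_anticomm 0 1
    have h2 : (1 + ((0 : ℝ) : ℂ)) • (1 : Matrix (Bool × Bool) (Bool × Bool) ℂ) +
        (1 - ((0 : ℝ) : ℂ)) • (pathX * pathZ) = 1 + pathX * pathZ := by simp
    rw [h2] at h1
    have h3 : pathX * pathZ * (pathX * pathZ) = 1 := by
      rw [Matrix.mul_assoc, ← Matrix.mul_assoc pathZ, pathZ_mul_pathX, Matrix.mul_assoc pathX,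
        pathZ_mul_self, Matrix.mul_one, pathX_mul_self]
    rw [nul_acMat_siteBlock boolPauli2_mul_self (matClass_symplecticPath (by norm_num)).sq h1,
      nul_one_add_pathX_mul_pathZ]
    rw [Matrix.add_mul, Matrix.mul_add, Matrix.mul_add, h3]
    simp only [Matrix.one_mul, Matrix.mul_one]
    match_scalars <;> norm_num

end SymplecticModel


open scoped Matrix Kronecker

/-! ### Parity flips for the sixteen exceptional entries -/

section ParityFlips

variable {n h m : Type} [Fintype n] [Fintype h] [Fintype m] [DecidableEq n] [DecidableEq h]
  [DecidableEq m] {j d : ℕ} {Str Sph : Matrix n n ℂ} {Vp Vm : Matrix n h ℂ}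
  {Wp Wm : Matrix (Spin d) m ℂ} {c ε δ δ' : ℂ} {C θ C' θ' : Matrix Bool Bool ℂ}

/-- The fibre of class `j` contains, after doubling, the two-dimensional fibre with the symmetries
`C` and `θ`. -/
def ClassFibre (ε : ℂ) (j : ℕ) (Str Sph : Matrix n n ℂ) (δ : ℂ) (C θ : Matrix Bool Bool ℂ) : Prop :=
  ∃ S R : Matrix n n ℂ, HasModelFibre ε δ S R C θ ∧ (Odd j → R = Str * Sph) ∧
    ∀ (k : ℕ) (G : Matrix (Fin k × n) (Fin k × n) ℂ), MatClass δ S R G → KClass j Str Sph (reflProj G)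

/-- The fibre of dimension `d` contains, after doubling, the two-dimensional fibre with the
symmetries `C` and `θ`. -/
def SpinFibre (ε : ℂ) (d : ℕ) (δ : ℂ) (C θ : Matrix Bool Bool ℂ) : Prop :=
  ∃ S R : Matrix (Spin d) (Spin d) ℂ, HasModelFibre ε δ S R C θ ∧ (Even d → R = diracOmega d) ∧
    ∀ (k : ℕ) (G : Matrix (Fin k × Spin d) (Fin k × Spin d) ℂ),
      MatClass δ S R G → KHClass d (reflProj G)

theorem continuous_reflProj {Y τ : Type} [Fintype Y] [DecidableEq Y] [TopologicalSpace τ]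
    {A : τ → Matrix (Y × n) (Y × n) ℂ} (hA : Continuous A) : Continuous fun t => reflProj (A t) := by
  refine continuous_opMat ?_
  fun_prop

/-- The factor between the nullity of the anticommutator and that of $T$ equals the dimension of the
kernel at the end of the model path, so $T$ ends with nullity one. -/
theorem hasFlip_of_fibres (hFS : IsFibreSymmetry j Str Sph) (hj : j < 8)
    (hV : Odd j → IsChiralFrame (Str * Sph) c Vp Vm)
    (hW : Even d → IsChiralFrame (diracOmega d) 1 Wp Wm) (hε : star ε = ε) (hεε : ε * ε = 1)
    (hP : ClassFibre ε j Str Sph δ C θ) (hE : SpinFibre ε d δ' C' θ')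
    (hf : Flips δ C θ δ' C' θ' (if Even d ∨ Odd j then 4 else 2)) :
    HasFlip j d Str Sph Vp Vm Wp Wm 1 := by
  obtain ⟨S, R, hP, hR, hK⟩ := hP
  obtain ⟨S', R', hE, hR', hH⟩ := hE
  obtain ⟨k, A, B, hAc, hBc, hA, hB, h0, h1⟩ := hP.flips hε hεε hE hf
  have key : ∀ t, (if Even d ∨ Odd j then 4 else 2) *
      nullity (pairingOp j d Vp Vm Wp Wm (reflProj (A t)) (reflProj (B t))) =
        nul (acMat (A t) (B t)) := by
    intro t
    by_cases hd : Even d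
    · rw [if_pos (Or.inl hd)]
      have hW' := hW hd
      rw [← hR' hd] at hW'
      exact nullity_even hd hW' (fun _ => one_ne_zero) (hA t) (hB t)
    · by_cases ho : Odd j
      · rw [if_pos (Or.inr ho)]
        have hV' := hV ho
        have hs := (odd_iff_trs_mul_phs hj).1 ho
        have hc : Nonempty h → c ≠ 0 := by
          rintro _ rfl
          have h2 := hV'.sq_eq (chiral_sq hFS (left_ne_zero_of_mul hs) (right_ne_zero_of_mul hs))
          rw [zero_mul] at h2
          exact hs (by exact_mod_cast h2.symm)
        rw [← hR ho] at hV'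
        exact nullity_odd_odd hd ho hV' hc (hA t) (hB t)
      · rw [if_neg (not_or.2 ⟨hd, ho⟩)]
        exact nullity_odd_even hd ho (hA t) (hB t)
  have hq : 0 < if Even d ∨ Odd j then 4 else 2 := by split_ifs <;> norm_num
  refine ⟨k, fun t => reflProj (A t), fun t => reflProj (B t), continuous_reflProj hAc,
    continuous_reflProj hBc, fun t => hK _ _ (hA t), fun t => hH _ _ (hB t), ?_, ?_⟩
  · have h2 := key 0
    rw [h0] at h2
    exact (Nat.mul_eq_zero.1 h2).resolve_left hq.ne'
  · have h2 := key 1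
    rw [h1] at h2
    rw [ind2, Nat.eq_of_mul_eq_mul_left hq (h2.trans (mul_one _).symm), Nat.cast_one]

theorem IsChiralFrame.nonempty {R : Matrix n n ℂ} (hV : IsChiralFrame R c Vp Vm) [Nonempty n] :
    Nonempty h := by
  by_contra hh
  rw [not_nonempty_iff] at hh
  obtain ⟨i⟩ := ‹Nonempty n›
  have h1 := congrFun (congrFun hV.complete i) i
  simp [Matrix.mul_apply] at h1

theorem star_intCast (a : ℤ) : star (a : ℂ) = a := by simp

theorem intCast_mul_self {a : ℤ} (ha : a * a = 1) : (a : ℂ) * a = 1 := by exact_mod_cast ha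

section Classes

variable (hFS : IsFibreSymmetry j Str Sph) (hj : j < 8)

include hFS hj

/-- Doubling with $\varepsilon=S_{tr}^2$ turns the symmetry into a real structure. -/
theorem classFibre_real [Nonempty n] (ht : trs j ≠ 0) (hp : phs j = 0) :
    ClassFibre (trs j) j Str Sph 1 1 0 := by
  have ho : ¬ Odd j := fun ho => (odd_iff_trs_mul_phs hj).1 ho (by rw [hp, mul_zero])
  have hs := trs_sq ht
  refine ⟨Str, 0, hasModelFibre_real (hFS.tr ht) hs (star_intCast _) (intCast_mul_self hs)
    (intCast_mul_self hs) (Or.inl rfl), fun h => absurd h ho, fun k G hG => ?_⟩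
  refine MatClass.kClass_even (R := 0) hFS hj ho ?_
  rwa [if_pos ht, if_pos ht]

/-- Doubling with $\varepsilon=-S_{ph}^2$ gives a symmetry of square $-1$. -/
theorem classFibre_symplectic [Nonempty n] (ht : trs j = 0) (hp : phs j ≠ 0) :
    ClassFibre (-phs j) j Str Sph (-1) (modelC (-1)) 0 := by
  have ho : ¬ Odd j := fun ho => (odd_iff_trs_mul_phs hj).1 ho (by rw [ht, zero_mul])
  have hs := phs_sq hp
  refine ⟨Sph, 0, hasModelFibre_symplectic (hFS.ph hp) hs (by simp)
    (by rw [neg_mul_neg, intCast_mul_self hs]) (by rw [neg_mul, intCast_mul_self hs]),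
    fun h => absurd h ho, fun k G hG => ?_⟩
  refine MatClass.kClass_even (R := 0) hFS hj ho ?_
  rwa [if_neg (not_not.2 ht), if_neg (not_not.2 ht)]

omit hj in
theorem chiral_comm (ht : trs j ≠ 0) (hp : phs j ≠ 0) :
    Str * Sph * Str = (1 : ℂ) • (Str * (Str * Sph).map star) := by
  rw [map_star_mul', (hFS.tr ht).real, (hFS.ph hp).real, one_smul, Matrix.mul_assoc,
    hFS.comm ht hp]

omit hj in
theorem chiral_conjTranspose (ht : trs j ≠ 0) (hp : phs j ≠ 0) :
    (Str * Sph)ᴴ = ((trs j * phs j : ℤ) : ℂ) • (Str * Sph) := by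
  have hadj : ∀ {a : ℤ} {S : Matrix n n ℂ}, IsSymmetryOp a S → a * a = 1 → Sᴴ = (a : ℂ) • S := by
    intro a S hS ha
    have h1 : Sᴴ * (S * S) = S := by rw [← Matrix.mul_assoc, hS.unitary, Matrix.one_mul]
    rw [hS.sq, Matrix.mul_smul, Matrix.mul_one] at h1
    conv_rhs => rw [← h1, smul_smul, intCast_mul_self ha, one_smul]
  rw [Matrix.conjTranspose_mul, hadj (hFS.tr ht) (trs_sq ht), hadj (hFS.ph hp) (phs_sq hp),
    Matrix.smul_mul, Matrix.mul_smul, smul_smul, hFS.comm ht hp, mul_comm, Int.cast_mul]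

/-- Equal signs make $R^2=1$ and $c$ real, so $S_{tr}\mathcal C$ preserves the eigenspaces of $R$.
Opposite signs make $c$ imaginary, so it exchanges them. -/
theorem classFibre_chiral [Nonempty n] (ho : Odd j) (hV : IsChiralFrame (Str * Sph) c Vp Vm) :
    (trs j = phs j → ClassFibre (trs j) j Str Sph 1 1 (c • modelR)) ∧
      (trs j = -phs j → ClassFibre (trs j) j Str Sph 1 (modelC 1) (c • modelR)) := by
  have hh := hV.nonempty
  have h0 := (odd_iff_trs_mul_phs hj).1 ho
  have ht := left_ne_zero_of_mul h0
  have hp := right_ne_zero_of_mul h0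
  have hs := trs_sq ht
  have hs' := phs_sq hp
  have hη : (trs j * phs j) * (trs j * phs j) = 1 := by rw [mul_mul_mul_comm, hs, hs', one_mul]
  have hc := star_eq_of_sq_real (one_or_neg_one_of_mul_self hη) (hV.sq_eq (chiral_sq hFS ht hp))
  refine ⟨fun he => ⟨Str, Str * Sph, hasModelFibre_chiral_real hV (hFS.tr ht) hs (star_intCast _)
    (intCast_mul_self hs) (intCast_mul_self hs) (chiral_comm hFS ht hp) (star_one ℂ)
    (chiral_conjTranspose hFS ht hp) hc ?_, fun _ => rfl, fun k G hG => hG.kClass_odd hFS hj ho⟩,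
    fun he => ⟨Str, Str * Sph, hasModelFibre_chiral_swap hV (hFS.tr ht) hs (star_intCast _)
    (intCast_mul_self hs) (star_one ℂ) (one_mul 1) (intCast_mul_self hs) (chiral_comm hFS ht hp)
    (star_one ℂ) (chiral_conjTranspose hFS ht hp) hc ?_, fun _ => rfl,
    fun k G hG => hG.kClass_odd hFS hj ho⟩⟩
  · rw [hc, he, hs']
    simp
  · rw [hc, he, neg_mul, hs']
    simp

end Classes

/-- For odd $d$ there is no grading, and the real model is available for both values of $\kappa$. -/
theorem spinFibre_real (hd : ¬ Even d) : SpinFibre (sigmaSign d) d (kappa d) 1 0 := by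
  have hs := sigmaSign_sq d
  refine ⟨diracSigma d, 0, hasModelFibre_real (isSymmetryOp_diracSigma d) hs (star_intCast _)
    (intCast_mul_self hs) (intCast_mul_self hs) ?_, fun h => absurd h hd, fun k G hG => ?_⟩
  · rcases neg_one_pow_eq_or ℤ (d / 2) with h | h <;> simp [kappa, h]
  · refine MatClass.khClass ?_
    rwa [if_neg hd]

theorem spinFibre_symplectic (hd : ¬ Even d) (hk : kappa d = -1) :
    SpinFibre (-sigmaSign d) d (-1) (modelC (-1)) 0 := by
  have hs := sigmaSign_sq d
  refine ⟨diracSigma d, 0, hasModelFibre_symplectic (isSymmetryOp_diracSigma d) hs (by simp)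
    (by rw [neg_mul_neg, intCast_mul_self hs]) (by rw [neg_mul, intCast_mul_self hs]),
    fun h => absurd h hd, fun k G hG => ?_⟩
  refine MatClass.khClass ?_
  rw [if_neg hd, hk]
  simpa using hG

theorem spinFibre_chiral (hd : Even d) (hW : IsChiralFrame (diracOmega d) 1 Wp Wm) :
    (kappa d = 1 → SpinFibre (sigmaSign d) d 1 1 ((1 : ℂ) • modelR)) ∧
      (kappa d = -1 → SpinFibre (-sigmaSign d) d (-1) (modelC (-1)) ((1 : ℂ) • modelR)) := by
  have hm := hW.nonempty
  have hs := sigmaSign_sq d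
  have hS := isSymmetryOp_diracSigma d
  have hκ : (kappa d : ℂ) * kappa d = 1 := by
    rw [kappa, ← Int.cast_mul, ← mul_pow]
    simp
  have hΩ : diracOmega d * diracSigma d =
      (kappa d : ℂ) • (diracSigma d * (diracOmega d).map star) := by
    have h1 := congrArg (fun M => M.map star) (diracOmega_mul_diracSigma d hd)
    simp only [map_star_mul', map_star_smul', map_star_map_star, star_intCast] at h1
    rwa [hS.real] at h1
  have hΩh : (diracOmega d)ᴴ = (1 : ℂ) • diracOmega d := by
    have h1 : diracOmega d * diracOmega d = 1 := by
      have h2 : diracOmega d * diracOmega d * (Wp * Wpᴴ + Wm * Wmᴴ) = Wp * Wpᴴ + Wm * Wmᴴ := by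
        have hp := hW.eigP
        have hm := hW.eigM
        rw [one_smul] at hp hm
        rw [Matrix.mul_add, ← Matrix.mul_assoc, ← Matrix.mul_assoc, Matrix.mul_assoc _ _ Wp,
          Matrix.mul_assoc _ _ Wm, hp, hm, hp, Matrix.mul_neg, hm, neg_neg]
      rwa [hW.complete, Matrix.mul_one] at h2
    rw [one_smul, ← Matrix.mul_one (diracOmega d)ᴴ, ← h1, ← Matrix.mul_assoc, diracOmega_unitary,
      Matrix.one_mul]
  have hK : ∀ (δ : ℤ), kappa d = δ → ∀ (k : ℕ) (G : Matrix (Fin k × Spin d) (Fin k × Spin d) ℂ),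
      MatClass (δ : ℂ) (diracSigma d) (diracOmega d) G → KHClass d (reflProj G) := by
    rintro δ rfl k G hG
    refine MatClass.khClass ?_
    rwa [if_pos hd]
  refine ⟨fun hk => ⟨diracSigma d, diracOmega d, hasModelFibre_chiral_real hW hS hs (star_intCast _)
    (intCast_mul_self hs) (intCast_mul_self hs) hΩ (star_intCast _) hΩh (by simp) (by simp [hk]),
    fun _ => rfl, fun k G hG => hK 1 hk k G (by simpa using hG)⟩,
    fun hk => ⟨diracSigma d, diracOmega d, hasModelFibre_chiral_swap hW hS hs (by simp)
    (by rw [neg_mul_neg, intCast_mul_self hs]) (by simp) (by simp)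
    (by rw [neg_mul, intCast_mul_self hs]) hΩ (star_intCast _) hΩh (by simp) (by simp [hk]),
    fun _ => rfl, fun k G hG => hK (-1) hk k G (by simpa using hG)⟩⟩

/-- The exceptional entries fall into eight kinds, by the parity of $d$ and the symmetries present.
For each kind a model of the class and a model of the dimension are paired. -/
theorem hasFlip_one [Nonempty n] (hFS : IsFibreSymmetry j Str Sph)
    (hV : Odd j → IsChiralFrame (Str * Sph) c Vp Vm)
    (hW : Even d → IsChiralFrame (diracOmega d) 1 Wp Wm) (hjd : IsFlip j d) :
    HasFlip j d Str Sph Vp Vm Wp Wm 1 := by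
  have hj : j < 8 := by
    simp only [IsFlip, List.mem_cons, Prod.mk.injEq, List.not_mem_nil, or_false] at hjd
    omega
  -- The condition $\varepsilon'=\varepsilon$ on the signs of the two doublings is what selects the
  -- entries $(j,d)$ that a pair of models reaches.
  have build : ∀ (ε ε' : ℤ) (δ δ' : ℂ) (C θ C' θ' : Matrix Bool Bool ℂ), ε * ε = 1 → ε' = ε →
      ClassFibre ε j Str Sph δ C θ → SpinFibre ε' d δ' C' θ' →
      Flips δ C θ δ' C' θ' (if Even d ∨ Odd j then 4 else 2) →
      HasFlip j d Str Sph Vp Vm Wp Wm 1 := by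
    rintro ε ε' δ δ' C θ C' θ' hεε rfl hP hE hf
    exact hasFlip_of_fibres hFS hj hV hW (star_intCast ε') (intCast_mul_self hεε) hP hE hf
  have hm1 : (-1 : ℂ) * -1 = 1 := by norm_num
  have evenReal : trs j ≠ 0 → phs j = 0 → Even d → kappa d = -1 → -sigmaSign d = trs j →
      HasFlip j d Str Sph Vp Vm Wp Wm 1 := fun ht hp hd hk hs => by
    refine build (trs j) (-sigmaSign d) 1 (-1) 1 0 (modelC (-1)) ((1 : ℂ) • modelR) (trs_sq ht) hs
      (classFibre_real hFS hj ht hp) ?_ ?_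
    · rw [Int.cast_neg]
      exact (spinFibre_chiral hd (hW hd)).2 hk
    · rw [if_pos (Or.inl hd), ← zero_smul ℂ modelR]
      exact flips_real_swap hm1 0 1
  have evenSymplectic : trs j = 0 → phs j ≠ 0 → Even d → kappa d = 1 → sigmaSign d = -phs j →
      HasFlip j d Str Sph Vp Vm Wp Wm 1 := fun ht hp hd hk hs => by
    refine build (-phs j) (sigmaSign d) (-1) 1 (modelC (-1)) 0 1 _
      (by rw [neg_mul_neg, phs_sq hp]) hs (by
        rw [Int.cast_neg]
        exact classFibre_symplectic hFS hj ht hp) ((spinFibre_chiral hd (hW hd)).1 hk) ?_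
    rw [if_pos (Or.inl hd), ← zero_smul ℂ modelR]
    exact (flips_real_swap hm1 1 0).swap
  have evenChiral : Odd j → trs j = phs j → Even d → kappa d = -1 → -sigmaSign d = trs j →
      HasFlip j d Str Sph Vp Vm Wp Wm 1 := fun ho hp hd hk hs => by
    refine build (trs j) (-sigmaSign d) 1 (-1) 1 (c • modelR) (modelC (-1)) ((1 : ℂ) • modelR)
      (trs_sq (left_ne_zero_of_mul ((odd_iff_trs_mul_phs hj).1 ho))) hs
      ((classFibre_chiral hFS hj ho (hV ho)).1 hp) ?_ ?_
    · rw [Int.cast_neg]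
      exact (spinFibre_chiral hd (hW hd)).2 hk
    · rw [if_pos (Or.inl hd)]
      exact flips_real_swap hm1 c 1
  have evenChiral' : Odd j → trs j = -phs j → Even d → kappa d = 1 → sigmaSign d = trs j →
      HasFlip j d Str Sph Vp Vm Wp Wm 1 := fun ho hp hd hk hs => by
    refine build (trs j) (sigmaSign d) 1 1 (modelC 1) _ 1 _
      (trs_sq (left_ne_zero_of_mul ((odd_iff_trs_mul_phs hj).1 ho))) hs
      ((classFibre_chiral hFS hj ho (hV ho)).2 hp) ((spinFibre_chiral hd (hW hd)).1 hk) ?_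
    rw [if_pos (Or.inl hd)]
    exact (flips_real_swap (one_mul 1) 1 c).swap
  have oddChiral : Odd j → trs j = phs j → ¬ Even d → kappa d = -1 → -sigmaSign d = trs j →
      HasFlip j d Str Sph Vp Vm Wp Wm 1 := fun ho hp hd hk hs => by
    refine build (trs j) (-sigmaSign d) 1 (-1) 1 (c • modelR) (modelC (-1)) 0
      (trs_sq (left_ne_zero_of_mul ((odd_iff_trs_mul_phs hj).1 ho))) hs
      ((classFibre_chiral hFS hj ho (hV ho)).1 hp) ?_ ?_
    · rw [Int.cast_neg]
      exact spinFibre_symplectic hd hk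
    · rw [if_pos (Or.inr ho), ← zero_smul ℂ modelR]
      exact flips_real_swap hm1 c 0
  have oddChiral' : Odd j → trs j = -phs j → ¬ Even d → kappa d = 1 → sigmaSign d = trs j →
      HasFlip j d Str Sph Vp Vm Wp Wm 1 := fun ho hp hd hk hs => by
    have hE := spinFibre_real hd
    rw [hk, Int.cast_one] at hE
    refine build (trs j) (sigmaSign d) 1 1 (modelC 1) _ 1 0
      (trs_sq (left_ne_zero_of_mul ((odd_iff_trs_mul_phs hj).1 ho))) hs
      ((classFibre_chiral hFS hj ho (hV ho)).2 hp) hE ?_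
    rw [if_pos (Or.inr ho), ← zero_smul ℂ modelR]
    exact (flips_real_swap (one_mul 1) 0 c).swap
  have oddReal : trs j ≠ 0 → phs j = 0 → ¬ Even d → kappa d = 1 → sigmaSign d = trs j →
      HasFlip j d Str Sph Vp Vm Wp Wm 1 := fun ht hp hd hk hs => by
    have ho : ¬ Odd j := fun ho => (odd_iff_trs_mul_phs hj).1 ho (by rw [hp, mul_zero])
    have hE := spinFibre_real hd
    rw [hk, Int.cast_one] at hE
    refine build (trs j) (sigmaSign d) 1 1 1 0 1 0 (trs_sq ht) hs
      (classFibre_real hFS hj ht hp) hE ?_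
    rw [if_neg (not_or.2 ⟨hd, ho⟩)]
    exact flips_real_real
  have oddSymplectic : trs j = 0 → phs j ≠ 0 → ¬ Even d → kappa d = -1 → sigmaSign d = -phs j →
      HasFlip j d Str Sph Vp Vm Wp Wm 1 := fun ht hp hd hk hs => by
    have ho : ¬ Odd j := fun ho => (odd_iff_trs_mul_phs hj).1 ho (by rw [ht, zero_mul])
    have hE := spinFibre_real hd
    rw [hk, Int.cast_neg, Int.cast_one] at hE
    refine build (-phs j) (sigmaSign d) (-1) (-1) (modelC (-1)) 0 1 0
      (by rw [neg_mul_neg, phs_sq hp]) hs (by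
        rw [Int.cast_neg]
        exact classFibre_symplectic hFS hj ht hp) hE ?_
    rw [if_neg (not_or.2 ⟨hd, ho⟩)]
    exact flips_symplectic
  simp only [IsFlip, List.mem_cons, Prod.mk.injEq, List.not_mem_nil, or_false] at hjd
  rcases hjd with ⟨rfl, rfl⟩ | ⟨rfl, rfl⟩ | ⟨rfl, rfl⟩ | ⟨rfl, rfl⟩ | ⟨rfl, rfl⟩ | ⟨rfl, rfl⟩ |
    ⟨rfl, rfl⟩ | ⟨rfl, rfl⟩ | ⟨rfl, rfl⟩ | ⟨rfl, rfl⟩ | ⟨rfl, rfl⟩ | ⟨rfl, rfl⟩ | ⟨rfl, rfl⟩ |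
    ⟨rfl, rfl⟩ | ⟨rfl, rfl⟩ | ⟨rfl, rfl⟩
  · exact evenReal (by decide) (by decide) (by decide) (by decide) (by decide)
  · exact evenSymplectic (by decide) (by decide) (by decide) (by decide) (by decide)
  · exact evenReal (by decide) (by decide) (by decide) (by decide) (by decide)
  · exact evenSymplectic (by decide) (by decide) (by decide) (by decide) (by decide)
  · exact oddChiral' (by decide) (by decide) (by decide) (by decide) (by decide)
  · exact oddChiral (by decide) (by decide) (by decide) (by decide) (by decide)
  · exact oddChiral' (by decide) (by decide) (by decide) (by decide) (by decide)
  · exact oddChiral (by decide) (by decide) (by decide) (by decide) (by decide)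
  · exact oddReal (by decide) (by decide) (by decide) (by decide) (by decide)
  · exact oddSymplectic (by decide) (by decide) (by decide) (by decide) (by decide)
  · exact oddReal (by decide) (by decide) (by decide) (by decide) (by decide)
  · exact oddSymplectic (by decide) (by decide) (by decide) (by decide) (by decide)
  · exact evenChiral (by decide) (by decide) (by decide) (by decide) (by decide)
  · exact evenChiral' (by decide) (by decide) (by decide) (by decide) (by decide)
  · exact evenChiral (by decide) (by decide) (by decide) (by decide) (by decide)
  · exact evenChiral' (by decide) (by decide) (by decide) (by decide) (by decide)

end ParityFlips

/-! ### Assembling the index theorems -/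

section PeriodicTable

variable {Y n h m : Type} [Fintype n] [Fintype h] [Fintype m] [DecidableEq n] [DecidableEq h]
  [DecidableEq m] {j d : ℕ} {Str Sph : Matrix n n ℂ} {Vp Vm : Matrix n h ℂ}
  {Wp Wm : Matrix (Spin d) m ℂ} {c : ℂ} {P : BOp (Y × n)} {E : BOp (Y × Spin d)}

theorem nullity_of_isEmpty {T : Σ ι : Type, BOp ι} [IsEmpty T.1] : nullity T = 0 := by
  have : T.2.ker = ⊥ := by
    rw [LinearMap.ker_eq_bot']
    exact fun v _ => lp.ext (funext fun i => isEmptyElim i)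
  rw [nullity, this, finrank_bot]

omit [DecidableEq m] in
-- The case $N=0$ is set apart because model fibres need a nonzero vector.
theorem nullity_pairingOp_of_isEmpty [IsEmpty n]
    (hV : Odd j → IsChiralFrame (Str * Sph) c Vp Vm) :
    nullity (pairingOp j d Vp Vm Wp Wm P E) = 0 := by
  by_cases hd : Even d
  · rw [pairingOp_even hd]
    have : IsEmpty ((Y × n) × m) := inferInstance
    exact nullity_of_isEmpty (T := ⟨_, _⟩)
  · by_cases ho : Odd j
    · have : IsEmpty h := by
        refine ⟨fun a => ?_⟩
        have h1 := congrFun (congrFun (hV ho).isoP a) a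
        simp [Matrix.mul_apply] at h1
      rw [pairingOp_odd_odd hd ho]
      have : IsEmpty ((Y × h) × Spin d) := inferInstance
      exact nullity_of_isEmpty (T := ⟨_, _⟩)
    · rw [pairingOp_odd_even hd ho]
      have : IsEmpty ((Y × n) × Spin d) := inferInstance
      exact nullity_of_isEmpty (T := ⟨_, _⟩)

/-- What the letter of an entry of the table means for the signs of the symmetries. -/
theorem hasLetter_of_signs (hFS : IsFibreSymmetry j Str Sph) (hP : KClass j Str Sph P)
    (hE : KHClass d E) {l : Letter} {ε a : ℤ} (hl : ∀ {Z s : Type} [Fintype s] [DecidableEq s]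
      (S : Matrix s s ℂ) (Q : BOp (Z × s)), IsSymmetryOp ε S → (a = 1 → twist S Q = Q) →
        (a = -1 → twist S Q = 1 - Q) → l.Holds S Q)
    (h : if Even d then (trs j ≠ 0 ∧ trs j = ε ∧ a = 1) ∨ (phs j ≠ 0 ∧ phs j = ε ∧ a = -1)
      else sigmaSign d = ε ∧ kappa d = a) : HasLetter j d Str Sph P E l := by
  rw [HasLetter]
  by_cases hd : Even d
  · rw [if_pos hd] at h ⊢
    rcases h with ⟨ht, rfl, rfl⟩ | ⟨hp, rfl, rfl⟩
    · exact Or.inl ⟨ht, hl Str P (hFS.tr ht) (fun _ => hP.tr ht) fun h => by norm_num at h⟩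
    · exact Or.inr ⟨hp, hl Sph P (hFS.ph hp) (fun h => by norm_num at h) fun _ => hP.ph hp⟩
  · rw [if_neg hd] at h ⊢
    obtain ⟨rfl, rfl⟩ := h
    exact hl _ E (isSymmetryOp_diracSigma d) hE.sigma_pos hE.sigma_neg

/-- The signs of the symmetry relation that a letter stands for. -/
def Letter.signs : Letter → ℤ × ℤ
  | .R => (1, 1)
  | .Q => (-1, 1)
  | .S => (-1, -1)
  | .O => (1, -1)

theorem Letter.holds_of_signs {Z s : Type} [Fintype s] [DecidableEq s] (l : Letter)
    (S : Matrix s s ℂ) (Q : BOp (Z × s)) (hS : IsSymmetryOp l.signs.1 S)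
    (h : l.signs.2 = 1 → twist S Q = Q) (h' : l.signs.2 = -1 → twist S Q = 1 - Q) :
    l.Holds S Q := by
  cases l
  · exact ⟨hS, h rfl⟩
  · exact ⟨hS, h rfl⟩
  · exact ⟨hS, h' rfl⟩
  · exact ⟨hS, h' rfl⟩

/-- The letters of the entries of the periodic table. -/
def letterSigns (j d : ℕ) : Entry → Prop
  | .even l | .two l =>
      if Even d then (trs j ≠ 0 ∧ trs j = l.signs.1 ∧ l.signs.2 = 1) ∨
        (phs j ≠ 0 ∧ phs j = l.signs.1 ∧ l.signs.2 = -1)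
      else sigmaSign d = l.signs.1 ∧ kappa d = l.signs.2
  | _ => True

theorem letterSigns_periodicTable (hj : j < 8) (hd : 1 ≤ d) (hd8 : d ≤ 8) :
    letterSigns j d (periodicTable j d) := by
  interval_cases j <;> interval_cases d <;>
    simp [periodicTable, letterSigns, Letter.signs, trs, phs, sigmaSign, kappa, Nat.even_iff]

theorem indexTheorem_of_signs (hFS : IsFibreSymmetry j Str Sph) (hj : j < 8)
    (hV : Odd j → IsChiralFrame (Str * Sph) c Vp Vm)
    (hW : Even d → IsChiralFrame (diracOmega d) 1 Wp Wm) (hP : KClass j Str Sph P)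
    (hE : KHClass d E) (hT : (pairingOp j d Vp Vm Wp Wm P E).2.IsFredholm) {e : Entry}
    (he : entrySigns j d e) (hl : letterSigns j d e) :
    IndexTheorem j d Str Sph Vp Vm Wp Wm P E e := by
  have hconst : ∀ (P' : unitInterval → BOp (Y × n)) (E' : unitInterval → BOp (Y × Spin d)),
      IsHomotopy j d Str Sph Vp Vm Wp Wm P' E' → P' 0 = P → E' 0 = E → ∀ t,
        ind (pairingOp j d Vp Vm Wp Wm (P' t) (E' t)) =
          ind (pairingOp j d Vp Vm Wp Wm P E) := by
    rintro P' E' hom rfl rfl t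
    exact hom.ind_const t
  have hzero : ClassSigns j d ZeroInd → ind (pairingOp j d Vp Vm Wp Wm P E) = 0 := fun h => by
    obtain ⟨_, _, _, _, h1, h2⟩ := exists_pairSym hj hFS hV hW hP hE h
    exact h2.ind_eq_zero h1
  have heven : ClassSigns j d EvenKer → Even (nullity (pairingOp j d Vp Vm Wp Wm P E)) ∧
      Even (ind (pairingOp j d Vp Vm Wp Wm P E)) := fun h => by
    obtain ⟨_, _, _, _, h1, h2⟩ := exists_pairSym hj hFS hV hW hP hE h
    exact h2.even_nullity h1
  cases e with
  | int => exact hconst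
  | even l =>
    exact ⟨hasLetter_of_signs hFS hP hE (l.holds_of_signs) hl, (heven he).2, hconst⟩
  | two l =>
    refine ⟨hasLetter_of_signs hFS hP hE (l.holds_of_signs) hl, hzero he.1, ?_⟩
    rintro P' E' hom rfl rfl t
    refine hom.ind2_const (fun t l hl hl1 => ?_) t
    -- The symmetries hold at every point of the homotopy, so the singular values in $(0,1)$ have
    -- even multiplicity throughout.
    obtain ⟨_, _, _, _, h1, h2⟩ := exists_pairSym hj hFS hV hW (hom.symP t) (hom.symE t) he.2
    exact h2.even_singMult h1 hl hl1
  | zero =>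
    refine zero_of_hasFlip hP hE hT (hzero he.1) ?_
    by_cases h : Even (nullity (pairingOp j d Vp Vm Wp Wm P E))
    · have h0 : ind2 (pairingOp j d Vp Vm Wp Wm P E) = 0 := (ZMod.natCast_eq_zero_iff_even).2 h
      rw [h0]
      exact hasFlip_zero
    · have h1 : ind2 (pairingOp j d Vp Vm Wp Wm P E) = 1 :=
        (ZMod.natCast_eq_one_iff_odd).2 (Nat.not_even_iff_odd.1 h)
      have hn : Nonempty n := by
        by_contra hn
        rw [not_nonempty_iff] at hn
        rw [nullity_pairingOp_of_isEmpty hV] at h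
        exact h Even.zero
      rw [h1]
      -- An odd kernel rules out the signs that force even kernels, so the entry is one of the
      -- exceptional ones.
      exact hasFlip_one hFS hV hW (he.2.resolve_left fun h' => h (heven h').1)

end PeriodicTable

end TopIns

end

theorem theorem2 (j d : ℕ) (hj : j < 8) (hd : 1 ≤ d) (hd8 : d ≤ 8) (N h m : ℕ)
    (Str Sph : Matrix (Fin N) (Fin N) ℂ) (hS : TopIns.IsFibreSymmetry j Str Sph)
    (c : ℂ) (Vp Vm : Matrix (Fin N) (Fin h) ℂ)
    (hV : Odd j → TopIns.IsChiralFrame (Str * Sph) c Vp Vm)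
    (Wp Wm : Matrix (TopIns.Spin d) (Fin m) ℂ)
    (hW : Even d → TopIns.IsChiralFrame (TopIns.diracOmega d) 1 Wp Wm)
    (H : TopIns.BOp ((Fin d → ℤ) × Fin N)) (μ : ℝ)
    (hH : TopIns.IsHamiltonian j Str Sph H μ)
    (hT : (TopIns.pairingOp j d Vp Vm Wp Wm
      (TopIns.fermiProj H μ) (TopIns.hardyProj d)).2.IsFredholm) :
    TopIns.KClass j Str Sph (TopIns.fermiProj H μ) ∧
    TopIns.KHClass d (TopIns.hardyProj d) ∧
    TopIns.IndexTheorem j d Str Sph Vp Vm Wp Wm (TopIns.fermiProj H μ) (TopIns.hardyProj d)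
      (TopIns.periodicTable j d) := by
  have hP := TopIns.kClass_fermiProj hS hH
  have hE := TopIns.khClass_hardyProj hd
  exact ⟨hP, hE, TopIns.indexTheorem_of_signs hS hj hV hW hP hE hT
    (TopIns.entrySigns_periodicTable hj hd hd8) (TopIns.letterSigns_periodicTable hj hd hd8)⟩
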